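/- **Setting.** Let $d\ge 1$, $\mathbb T^d=\mathbb R^d/(2\pi\mathbb Z^d)$, and let $s$ be a real number with $s>\max\{\lceil (d+5)/2\rceil+1,\;4\lceil d/2\rceil+1\}$. For $\sigma\in\mathbb R$, $H^\sigma=H^\sigma(\mathbb T^d)$ is the space of real distributions $f$ on $\mathbb T^d$ with $\|f\|_{H^\sigma}^2=\sum_{k\in\mathbb Z^d}(1+|k|^2)^\sigma|\hat f(k)|^2<\infty$. Let $\mathscr Q$ be the set of probability measures on $\mathbb T^d$ with density in $H^s$ (identified with the continuous density), and $\mathscr Q_R=\{m\in\mathscr Q:\|m-(2\pi)^{-d}\|_{H^s}\le R\}$. *Hamiltonian.* Let $T_0>0$ and let $\mathcal H:[0,T_0]\times\mathbb T^d\times\mathbb R^d\times[0,\infty)\to\mathbb R$, $(t,x,p,q)\mapsto\mathcal H(t,x,p,q)$, be measurable in $t$ and, for an integer $N$, of class $C^N$ in $(x,p,q)$, with all derivatives in $(x,p,q)$ of order at most $N$ bounded by $\tilde F(|p|+q)$ for some nondecreasing $\tilde F$. Assume this with $N=\lfloor s\rfloor+2$, i.e. for the derivatives of order at most $s+2$.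 *Final cost.* Let $G:\mathbb T^d\times\mathscr Q\to\mathbb R$ satisfy $G(\cdot,m)\in H^s$ for $m\in\mathscr Q$, and let every $G(x,\cdot)$ be Gâteaux differentiable on $H^s$: for $m\in\mathscr Q$ there is a continuous function $\frac{\delta G}{\delta m}(x,m)(\cdot)$ on $\mathbb T^d$ with $\int\frac{\delta G}{\delta m}(x,m)(y)\,dm(y)=0$ and $G(x,\tilde m)-G(x,m)-\int\frac{\delta G}{\delta m}(x,m)(y)\,d(\tilde m-m)(y)=o(\|\tilde m-m\|_{H^s})$ for $\tilde m\in\mathscr Q$. Write $\frac{\delta G}{\delta m}(x,m)\mu=\int\frac{\delta G}{\delta m}(x,m)(y)\mu(y)\,dy$ for smooth $\mu$. Assume that for every $R>0$ there are $\kappa,c>0$ such that for all $m,\tilde m\in\mathscr Q_R$ and all $\mu\in C^\infty(\mathbb T^d)$ $$\Big\|\tfrac{\delta G}{\delta m}(\cdot,m)\mu\Big\|_{H^\sigma}^2\le\kappa\|\mu\|_{H^{\sigma-1}}^2\quad\text{with }\sigma=s,\qquad(\mathrm P_\sigma)$$ $$\Big\|G(\cdot,\tilde m)-G(\cdot,m)-\tfrac{\delta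 G}{\delta m}(\cdot,m)(\tilde m-m)\Big\|_{H^s}\le c\|\tilde m-m\|_{H^s}^2 .$$ The operator $\mu\mapsto\frac{\delta G}{\delta m}(\cdot,m)\mu$ is extended by density to $H^{s-1}$, and to $H^{-s-1}$ when $(\mathrm P_{-s})$ also holds. *Mean field games system.* For $0\le t_0<T\le T_0$ and $m_0\in\mathscr Q$, a solution of the mean field games system on $[t_0,T]$ is a classical solution $(u,m)$, with $m\ge0$ and $m_T\in\mathscr Q$, of $$-\partial_tu-\Delta u+\mathcal H(t,x,\nabla u,m)=0,\quad \partial_tm-\Delta m-\nabla\cdot(mD_p\mathcal H(t,x,\nabla u,m))=0,\quad m(t_0)=m_0,\ u(T,x)=G(x,m_T).$$ *Linearized system.* With derivatives of $\mathcal H$ evaluated at $(t,x,\nabla u,m)$ and $\vartheta\in\{1,-1\}$, consider on $(t_0,T)\times\mathbb T^d$ $$\begin{cases}-\partial_tv-\Delta v+D_p\mathcal H\cdot\nabla v+\partial_q\mathcal H\,\mu=0,\\ \partial_t\mu-\Delta\mu-\nabla\cdot[\mu D_p\mathcal H+mD^2_{pp}\mathcal H\nabla v]+\vartheta\,\nabla\cdot[mD_p\partial_q\mathcal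 H\,\mu]=0,\\ \mu(t_0,\cdot)=\mu_0,\qquad v(T,x)=\frac{\delta G}{\delta m}(x,m_T)\mu_T.\end{cases}\qquad(\mathrm L)$$ (The linearization of the mean field games system is the case $\vartheta=-1$.) Solutions of (L) are understood in the sense of distributions, for the representatives that are continuous in time with values in distributions. **Theorem.** For all $R,M>0$ there is $T_*\in(0,T_0]$, depending only on $d,s,T_0,\mathcal H,G,R,M$, such that the following holds for all $0\le t_0<T<T_*$, all $m_0\in\mathscr Q_R$, every solution $(u,m)$ of the mean field games system on $[t_0,T]$ that is bounded by $M$ in the norms of $u\in L^\infty([t_0,T];H^s)\cap L^2([t_0,T];H^{s+1})$ and $m\in L^\infty([t_0,T];H^{s-1})\cap L^2([t_0,T];H^s)$, and each $\vartheta\in\{1,-1\}$. 1. For every $\mu_0\in H^{s-1}$ there is a unique pair $(v,\mu)\in L^\infty([t_0,T];H^s)\times L^\infty([t_0,T];H^{s-1})$ that solves (L). 2. Suppose that the hypothesis on $\mathcal H$ holds with $N=\lceil s\rceil+2$ (nothing new if $s$ is an integer). For every $\mu_0\in H^{-s-1}$ there is a distributional solution $(v,\mu)$ of (L) with $v\in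 L^\infty([t_0,T];H^{-s})\cap L^2([t_0,T];H^{1-s})$ and $\mu\in L^\infty([t_0,T];H^{-s-1})\cap L^2([t_0,T];H^{-s})$ (the $L^2$ bounds give a meaning to the products in (L)) and with $\mu_T\in H^{s-1}$ (which gives a meaning to the terminal condition). It is the only solution with these properties. If moreover $(\mathrm P_{-s})$ holds for every $R$, so that the terminal condition has a meaning for every $\mu_T\in H^{-s-1}$, then it is the only solution even without the requirement $\mu_T\in H^{s-1}$. -/

import Mathlib

open MeasureTheory Set
open scoped ENNReal NNReal ContDiff

noncomputable section

namespace MFG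

/-! ## The torus, Fourier coefficients and Sobolev spaces

Functions on the flat torus `ℝ^d / (2πℤ)^d` are `2π`-periodic functions on `ℝ^d`. Distributions of
finite Sobolev order are given by their Fourier coefficients, so that `f = ∑ k, c k * e^{i k·x}`. -/

/-- The space `ℝ^d`. -/
abbrev Pt (d : ℕ) := Fin d → ℝ

/-- Frequencies, i.e. elements of `ℤ^d`. -/
abbrev Freq (d : ℕ) := Fin d → ℤ

/-- Families of Fourier coefficients. -/
abbrev Coeffs (d : ℕ) := Freq d → ℂ

variable {d : ℕ}

/-- `f` is a function on the torus. -/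
def TorusPeriodic {F : Type*} (f : Pt d → F) : Prop :=
  ∀ (x : Pt d) (k : Freq d), f (fun i => x i + 2 * Real.pi * (k i : ℝ)) = f x

/-- The fundamental cell `[0, 2π]^d`. -/
def cell (d : ℕ) : Set (Pt d) := Icc (fun _ => 0) (fun _ => 2 * Real.pi)

/-- The character `x ↦ e^{i k·x}`. -/
def character (k : Freq d) (x : Pt d) : ℂ :=
  Complex.exp (Complex.I * ((∑ i, (k i : ℝ) * x i : ℝ) : ℂ))

/-- `f̂(k) = (2π)^{-d} ∫ e^{-i k·x} f(x) dx`. -/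
def fourier (f : Pt d → ℂ) : Coeffs d := fun k =>
  ((((2 * Real.pi) ^ d)⁻¹ : ℝ) : ℂ) * ∫ x in cell d, character (-k) x * f x

/-- Fourier coefficients of a real function. -/
def fourierR (f : Pt d → ℝ) : Coeffs d := fourier fun x => (f x : ℂ)

/-- `|k|²`. -/
def freqSq (k : Freq d) : ℝ := ∑ i, (k i : ℝ) ^ 2

/-- The squared Sobolev norm `‖f‖²_{H^σ} = ∑ k, (1 + |k|²)^σ |f̂(k)|²`, with value in `[0, ∞]`. -/
def sobSq (σ : ℝ) (c : Coeffs d) : ℝ≥0∞ :=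
  ∑' k, ENNReal.ofReal ((1 + freqSq k) ^ σ * ‖c k‖ ^ 2)

/-- The distribution with these Fourier coefficients is real. -/
def IsRealDist (c : Coeffs d) : Prop := ∀ k, c (-k) = (starRingEnd ℂ) (c k)

/-- The real Sobolev space `H^σ` of the torus, for every real order `σ`. -/
def MemSob (σ : ℝ) (c : Coeffs d) : Prop := IsRealDist c ∧ sobSq σ c < ⊤

/-- A real function on the torus that is integrable and belongs to `H^σ`. -/
def MemSobFun (σ : ℝ) (f : Pt d → ℝ) : Prop :=
  TorusPeriodic f ∧ IntegrableOn f (cell d) ∧ sobSq σ (fourierR f) < ⊤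

/-- Membership of a time-dependent distribution in `L^∞([t₀, T]; H^σ)`. -/
def MemLinfSob (σ t₀ T : ℝ) (c : ℝ → Coeffs d) : Prop :=
  (∀ t ∈ Icc t₀ T, IsRealDist (c t)) ∧
  (∀ k, AEStronglyMeasurable (fun t => c t k) (volume.restrict (Icc t₀ T))) ∧
  ∃ C : ℝ≥0, ∀ᵐ t ∂(volume.restrict (Icc t₀ T)), sobSq σ (c t) ≤ C

/-- Membership of a time-dependent distribution in `L²([t₀, T]; H^σ)`. -/
def MemL2Sob (σ t₀ T : ℝ) (c : ℝ → Coeffs d) : Prop :=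
  (∀ t ∈ Icc t₀ T, IsRealDist (c t)) ∧
  (∀ k, AEStronglyMeasurable (fun t => c t k) (volume.restrict (Icc t₀ T))) ∧
  ∫⁻ t in Icc t₀ T, sobSq σ (c t) < ⊤

/-- Smooth (complex) test functions on the torus. -/
def IsTest (φ : Pt d → ℂ) : Prop := ContDiff ℝ ∞ φ ∧ TorusPeriodic φ

/-- The duality pairing `⟨c, φ⟩`, equal to `∫ c(x) φ(x) dx` when `c` is a function. It is the
pairing of `H^{-σ}` with `H^σ` for every `σ`. -/
def pair (c : Coeffs d) (φ : Pt d → ℂ) : ℂ :=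
  ((((2 * Real.pi) ^ d : ℝ)) : ℂ) * ∑' k, c k * fourier φ (-k)

/-- The partial derivative `∂_i` of a distribution. -/
def distPartial (i : Fin d) (c : Coeffs d) : Coeffs d := fun k => Complex.I * (k i : ℂ) * c k

/-- The Laplacian of a distribution. -/
def distLaplacian (c : Coeffs d) : Coeffs d := fun k => -(freqSq k : ℂ) * c k

/-! ## Calculus for functions -/

/-- The partial derivative `∂_i f (x)`. -/
def pderiv {F : Type*} [NormedAddCommGroup F] [NormedSpace ℝ F]
    (i : Fin d) (f : Pt d → F) (x : Pt d) : F :=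
  fderiv ℝ f x (Pi.single i 1)

/-- The gradient of a function, as the vector of its partial derivatives. -/
def grad (f : Pt d → ℝ) (x : Pt d) : Pt d := fun i => pderiv i f x

/-- The Laplacian of a function. -/
def laplacian (f : Pt d → ℝ) (x : Pt d) : ℝ := ∑ i, pderiv i (fun y => pderiv i f y) x

/-! ## The Hamiltonian

`H t x p q` is defined for `q ≥ 0`, derivatives with respect to `q` at `q = 0` are one-sided. -/

/-- Hamiltonians `H(t, x, p, q)`. -/
abbrev Hamiltonian (d : ℕ) := ℝ → Pt d → Pt d → ℝ → ℝ

/-- `∂_{p_i} H`. -/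
def Hp (H : Hamiltonian d) (i : Fin d) : Hamiltonian d := fun t x p q =>
  pderiv i (fun p' => H t x p' q) p

/-- `∂_q H`. -/
def Hq (H : Hamiltonian d) : Hamiltonian d := fun t x p q =>
  derivWithin (fun q' => H t x p q') (Ici 0) q

/-- The domain of `(x, p, q)`. -/
def phaseDomain (d : ℕ) : Set (Pt d × Pt d × ℝ) := {z | 0 ≤ z.2.2}

/-- On `[0, T₀]` the Hamiltonian is measurable in `t`, periodic in `x`, of class `C^N` in
`(x, p, q)`, and its derivatives of order at most `N` are bounded by a nondecreasing function of
`|p| + q`. -/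
structure HamiltonianRegular (T₀ : ℝ) (N : ℕ) (H : Hamiltonian d) : Prop where
  measurable : ∀ (x p : Pt d) (q : ℝ), 0 ≤ q → Measurable fun t : Icc (0 : ℝ) T₀ => H t x p q
  periodic : ∀ t ∈ Icc 0 T₀, ∀ (p : Pt d) (q : ℝ), 0 ≤ q → TorusPeriodic fun x => H t x p q
  contDiff : ∀ t ∈ Icc 0 T₀,
    ContDiffOn ℝ N (fun z : Pt d × Pt d × ℝ => H t z.1 z.2.1 z.2.2) (phaseDomain d)
  bound : ∃ F : ℝ → ℝ, MonotoneOn F (Ici 0) ∧ ∀ n ≤ N, ∀ t ∈ Icc 0 T₀, ∀ z ∈ phaseDomain d,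
    ‖iteratedFDerivWithin ℝ n (fun z : Pt d × Pt d × ℝ => H t z.1 z.2.1 z.2.2)
      (phaseDomain d) z‖ ≤ F (‖z.2.1‖ + z.2.2)

/-! ## Probability densities and the final cost -/

/-- Probability measures with density in `H^s`, given by their continuous densities
(`s` is larger than `d / 2` throughout). -/
def densities (d : ℕ) (s : ℝ) : Set (Pt d → ℝ) :=
  {m | TorusPeriodic m ∧ Continuous m ∧ (∀ x, 0 ≤ m x) ∧ ∫ x in cell d, m x = 1 ∧
    sobSq s (fourierR m) < ⊤}

/-- The densities at `H^s`-distance at most `R` from the uniform density `(2π)^{-d}`. -/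
def densityBall (d : ℕ) (s R : ℝ) : Set (Pt d → ℝ) :=
  {m | m ∈ densities d s ∧
    sobSq s (fourierR fun x => m x - ((2 * Real.pi) ^ d)⁻¹) ≤ ENNReal.ofReal (R ^ 2)}

/-- `k` is the Gâteaux derivative `δV/δm (m)(·)` on `H^s` of the functional `V` on densities,
normalized by `∫ k dm = 0`. It is unique. -/
structure IsGateauxDeriv (s : ℝ) (V : (Pt d → ℝ) → ℝ) (m : Pt d → ℝ) (k : Pt d → ℝ) : Prop where
  continuous : Continuous k
  periodic : TorusPeriodic k
  normalized : ∫ y in cell d, k y * m y = 0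
  littleO : ∀ ε > 0, ∃ δ > 0, ∀ m' ∈ densities d s,
    sobSq s (fourierR fun x => m' x - m x) ≤ ENNReal.ofReal (δ ^ 2) →
    |V m' - V m - ∫ y in cell d, k y * (m' y - m y)| ≤
      ε * Real.sqrt (sobSq s (fourierR fun x => m' x - m x)).toReal

/-- Final costs `G(x, m)`. -/
abbrev FinalCost (d : ℕ) := Pt d → (Pt d → ℝ) → ℝ

/-- Kernels `δG/δm (x, m)(y)`. -/
abbrev CostKernel (d : ℕ) := Pt d → (Pt d → ℝ) → Pt d → ℝ

/-- The bound `‖δG/δm(·, m) μ‖²_{H^σ} ≤ κ ‖μ‖²_{H^{σ-1}}` for smooth `μ`, uniformly for `m` in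
each ball of densities. Here `(δG/δm(·, m) μ)(x) = ∫ δG/δm(x, m)(y) μ(y) dy`. -/
def PayoffBound (s σ : ℝ) (dG : CostKernel d) : Prop :=
  ∀ R > 0, ∃ κ : ℝ≥0, ∀ m ∈ densityBall d s R, ∀ μ : Pt d → ℝ,
    ContDiff ℝ ∞ μ → TorusPeriodic μ →
      MemSobFun σ (fun x => ∫ y in cell d, dG x m y * μ y) ∧
      sobSq σ (fourierR fun x => ∫ y in cell d, dG x m y * μ y) ≤
        κ * sobSq (σ - 1) (fourierR μ)

/-- `G` takes values in `H^s`, has the Gâteaux derivative `dG`, which gains one derivative in the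
scale of Sobolev spaces at order `s`, and the first order Taylor expansion of `G` in `H^s` has a
quadratic remainder. -/
structure FinalCostRegular (s : ℝ) (G : FinalCost d) (dG : CostKernel d) : Prop where
  memSob : ∀ m ∈ densities d s, MemSobFun s fun x => G x m
  gateaux : ∀ m ∈ densities d s, ∀ x, IsGateauxDeriv s (G x) m (dG x m)
  payoff : PayoffBound s s dG
  taylor : ∀ R > 0, ∃ C : ℝ≥0, ∀ m ∈ densityBall d s R, ∀ m' ∈ densityBall d s R,
    sobSq s (fourierR fun x =>
        G x m' - G x m - ∫ y in cell d, dG x m y * (m' y - m y)) ≤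
      C * sobSq s (fourierR fun x => m' x - m x) ^ 2

/-- The operator `μ ↦ ∫ k(·, y) μ(y) dy` on distributions `μ = ∑ j, c j e^{i j·y}`: the `j`-th
character is sent to the function `∫ k(·, y) e^{i j·y} dy`, and the operator is extended linearly. -/
def kernelAction (k : Pt d → Pt d → ℝ) (c : Coeffs d) : Coeffs d := fun n =>
  ∑' j, c j * fourier (fun x => ∫ y in cell d, (k x y : ℂ) * character j y) n

/-! ## The mean field games system -/

/-- `(u, m)` is a classical solution on `[t₀, T]` of
`-∂ₜu - Δu + H(t, x, ∇u, m) = 0`, `∂ₜm - Δm - div (m D_pH(t, x, ∇u, m)) = 0`,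
`m(t₀) = m₀`, `u(T, x) = G(x, m(T))`. -/
structure IsMFGSolution (s : ℝ) (H : Hamiltonian d) (G : FinalCost d) (t₀ T : ℝ)
    (m₀ : Pt d → ℝ) (u m : ℝ → Pt d → ℝ) : Prop where
  periodic_u : ∀ t ∈ Icc t₀ T, TorusPeriodic (u t)
  periodic_m : ∀ t ∈ Icc t₀ T, TorusPeriodic (m t)
  continuous_u : ContinuousOn (fun z : ℝ × Pt d => u z.1 z.2) (Icc t₀ T ×ˢ univ)
  continuous_m : ContinuousOn (fun z : ℝ × Pt d => m z.1 z.2) (Icc t₀ T ×ˢ univ)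
  nonneg_m : ∀ t ∈ Icc t₀ T, ∀ x, 0 ≤ m t x
  contDiff_u : ∀ t ∈ Ioo t₀ T, ContDiff ℝ 2 (u t)
  contDiff_m : ∀ t ∈ Ioo t₀ T, ContDiff ℝ 2 (m t)
  hamiltonJacobi : ∀ t ∈ Ioo t₀ T, ∀ x, HasDerivAt (fun τ => u τ x)
    (-laplacian (u t) x + H t x (grad (u t) x) (m t x)) t
  fokkerPlanck : ∀ t ∈ Ioo t₀ T, ∀ x, HasDerivAt (fun τ => m τ x)
    (laplacian (m t) x +
      ∑ i, pderiv i (fun y => m t y * Hp H i t y (grad (u t) y) (m t y)) x) t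
  initial : m t₀ = m₀
  terminal_mem : m T ∈ densities d s
  terminal : ∀ x, u T x = G x (m T)

/-- `u` is bounded by `M` in `L^∞([t₀, T]; H^s)` and in `L²([t₀, T]; H^{s+1})`, and `m` is bounded
by `M` in `L^∞([t₀, T]; H^{s-1})` and in `L²([t₀, T]; H^s)`. -/
structure MFGBound (s t₀ T M : ℝ) (u m : ℝ → Pt d → ℝ) : Prop where
  linf_u : ∀ᵐ t ∂(volume.restrict (Icc t₀ T)), sobSq s (fourierR (u t)) ≤ ENNReal.ofReal (M ^ 2)
  l2_u : ∫⁻ t in Icc t₀ T, sobSq (s + 1) (fourierR (u t)) ≤ ENNReal.ofReal (M ^ 2)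
  linf_m : ∀ᵐ t ∂(volume.restrict (Icc t₀ T)),
    sobSq (s - 1) (fourierR (m t)) ≤ ENNReal.ofReal (M ^ 2)
  l2_m : ∫⁻ t in Icc t₀ T, sobSq s (fourierR (m t)) ≤ ENNReal.ofReal (M ^ 2)

/-! ## The linearized system -/

section Linearized

variable (H : Hamiltonian d) (u m : ℝ → Pt d → ℝ)

/-- The coefficient `∂_{p_i} H(t, x, ∇u, m)`. -/
def coefP (i : Fin d) (t : ℝ) (x : Pt d) : ℝ := Hp H i t x (grad (u t) x) (m t x)

/-- The coefficient `∂_q H(t, x, ∇u, m)`. -/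
def coefQ (t : ℝ) (x : Pt d) : ℝ := Hq H t x (grad (u t) x) (m t x)

/-- The coefficient `m ∂_{p_i} ∂_{p_j} H(t, x, ∇u, m)`. -/
def coefPP (i j : Fin d) (t : ℝ) (x : Pt d) : ℝ :=
  m t x * Hp (Hp H j) i t x (grad (u t) x) (m t x)

/-- The coefficient `m ∂_{p_i} ∂_q H(t, x, ∇u, m)`. -/
def coefPQ (i : Fin d) (t : ℝ) (x : Pt d) : ℝ :=
  m t x * Hp (Hq H) i t x (grad (u t) x) (m t x)

/-- `⟨Δv - D_pH·∇v - ∂_qH μ, φ⟩`, where `⟨f c, φ⟩ = ⟨c, f φ⟩` for a function `f` and a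
distribution `c`. -/
def backwardRHS (v μ : ℝ → Coeffs d) (φ : Pt d → ℂ) (t : ℝ) : ℂ :=
  pair (distLaplacian (v t)) φ
    - ∑ i, pair (distPartial i (v t)) (fun x => (coefP H u m i t x : ℂ) * φ x)
    - pair (μ t) (fun x => (coefQ H u m t x : ℂ) * φ x)

/-- `⟨Δμ + div (μ D_pH + m D²_{pp}H ∇v) - ϑ div (m D_p∂_qH μ), φ⟩`, where
`⟨div F, φ⟩ = -∑ i, ⟨F_i, ∂_i φ⟩`. -/
def forwardRHS (ϑ : ℝ) (v μ : ℝ → Coeffs d) (φ : Pt d → ℂ) (t : ℝ) : ℂ :=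
  pair (distLaplacian (μ t)) φ
    - ∑ i, (pair (μ t) (fun x => (coefP H u m i t x : ℂ) * pderiv i φ x)
        + ∑ j, pair (distPartial j (v t)) (fun x => (coefPP H u m i j t x : ℂ) * pderiv i φ x))
    + (ϑ : ℂ) * ∑ i, pair (μ t) (fun x => (coefPQ H u m i t x : ℂ) * pderiv i φ x)

/-- `(v, μ)` solves, in the sense of distributions on `[t₀, T]`, the system
`-∂ₜv - Δv + D_pH·∇v + ∂_qH μ = 0`,
`∂ₜμ - Δμ - div (μ D_pH + m D²_{pp}H ∇v) + ϑ div (m D_p∂_qH μ) = 0`,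
`μ(t₀) = μ₀`, `v(T, x) = δG/δm(x, m(T)) μ(T)`,
with the derivatives of `H` taken at `(t, x, ∇u, m)`. The equations are tested with every smooth
function of `x` and integrated in time; `v` and `μ` are the representatives which are continuous
in time with values in distributions. -/
structure SolvesLinearized (dG : CostKernel d) (ϑ t₀ T : ℝ) (μ₀ : Coeffs d)
    (v μ : ℝ → Coeffs d) : Prop where
  backward : ∀ φ : Pt d → ℂ, IsTest φ →
    IntervalIntegrable (backwardRHS H u m v μ φ) volume t₀ T ∧
    ∀ t ∈ Icc t₀ T, pair (v t) φ =
      pair (kernelAction (fun x y => dG x (m T) y) (μ T)) φ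
        + ∫ τ in t..T, backwardRHS H u m v μ φ τ
  forward : ∀ φ : Pt d → ℂ, IsTest φ →
    IntervalIntegrable (forwardRHS H u m ϑ v μ φ) volume t₀ T ∧
    ∀ t ∈ Icc t₀ T, pair (μ t) φ =
      pair μ₀ φ + ∫ τ in t₀..t, forwardRHS H u m ϑ v μ φ τ

/-- Solutions of the linearized system in `L^∞ H^s × L^∞ H^{s-1}`. -/
def IsRegularSolution (dG : CostKernel d) (s ϑ t₀ T : ℝ) (μ₀ : Coeffs d)
    (v μ : ℝ → Coeffs d) : Prop :=
  MemLinfSob s t₀ T v ∧ MemLinfSob (s - 1) t₀ T μ ∧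
    SolvesLinearized H u m dG ϑ t₀ T μ₀ v μ

/-- Distributional solutions in `L^∞ H^{-s} × L^∞ H^{-s-1}`, with
`(v, μ) ∈ L² H^{1-s} × L² H^{-s}`, which gives a meaning to the products of `∇v` and `μ` with
coefficients in `L² H^s`. -/
def IsDistSolution (dG : CostKernel d) (s ϑ t₀ T : ℝ) (μ₀ : Coeffs d)
    (v μ : ℝ → Coeffs d) : Prop :=
  (MemLinfSob (-s) t₀ T v ∧ MemL2Sob (1 - s) t₀ T v) ∧
  (MemLinfSob (-s - 1) t₀ T μ ∧ MemL2Sob (-s) t₀ T μ) ∧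
    SolvesLinearized H u m dG ϑ t₀ T μ₀ v μ

end Linearized

end MFG

end

open MFG

noncomputable section

namespace MFG

variable {d : ℕ}

/-! The system is read as a pair of heat equations, backward for `v` and forward for `μ`, whose
sources are products of coefficients with `∇v` and `μ`. All estimates are made on Fourier
coefficients, with squared norms in `[0, ∞]`, in the space `L²([t₀, T]; H^{σ+1} × H^σ)` (`nrm`,
`en`). The heat semigroup turns a source in `L² H^σ` into a function that is bounded in `H^{σ+1}` at
every time. The forward equation contains a divergence, which spends this derivative, but `μ` is
measured one order below `v`, so the count closes. Thus the Duhamel operator maps `nrm` into a bound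
at every time (`CoefBound.en_duhamel_le`); integrating once more in time gives the factor `T - t₀`.
The terminal operator `Θ = δG/δm` gains one derivative, so the condition `v(T) = Θ μ(T)` can be
included, and for short times a Neumann series solves the problem (`CoefBound.isContraction_solOp`,
`IsContraction.exists_fixed`).

The estimate needed from the coefficients is `SmoothingBound`, for every `σ` in `[-s, s - 1]`. They
are functions of `(x, ∇u, m)`, bounded in time in `H^{s-1}` and square integrable in time in `H^s`.
For `0 ≤ σ ≤ s - 1` multiplication is bounded on `H^σ` at each time. For `-s ≤ σ ≤ 0` the product
splits (`conv_neg_pointwise`). One part uses only the Wiener norm of the coefficient, which is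
bounded in time. The other uses its `H^s` norm and is merely integrable in time, but its weighted
Fourier coefficients decay like `(1 + |k|²)^{-s/2}`, so no gain from the heat semigroup is needed
(`smoothingBound_of_nonpos`).

Sobolev bounds for the coefficients are Moser estimates on the closed half-space `q ≥ 0`. For smooth
curves and integer order they follow from the chain rule and tame products (`sobSq_comp_le_tame`).
For real order the curve is truncated in frequency at the scales `4^j`. A truncation can violate `q
≥ 0`; it is therefore shifted upward, and the value at the unshifted point is extrapolated by a
forward difference in `q` whose order is the number of available derivatives (`exists_approx_comp`,
`sobSq_comp_le`).

For `μ₀` in `H^{-s-1}` the terminal operator cannot be applied directly. First the system is solved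
with terminal value zero. This solution has a regular density at time `T`: almost every earlier time
supplies data half way up, and restarting there gains one derivative at a time
(`IsMild.sobSq_terminal_lt_top`). A regular solution with zero initial value then corrects the
terminal condition (`exists_coupled_of_distribution`). Uniqueness with `μ(T)` in `H^{s-1}` holds
because the difference of two solutions coincides with the regular solution that has the same
terminal value. If `(P_{-s})` holds, uniqueness is proved directly at order `-s`: high frequencies
of `μ(T)` are small because one derivative is spare, low frequencies are handled by `(P_s)` and the
shortness of the interval (`TerminalOp.lintegral_heatFlow_le`).

Weak and mild solutions agree, since testing with characters gives one scalar linear equation for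
each frequency (`SolvesLinearized.isMild`, `IsMild.solvesLinearized`). The length of the interval is
uniform because `m(T)` lies in a ball of `H^s` whose radius depends only on the data, by Duhamel's
formula for the Fokker–Planck equation (`exists_terminal_mem_densityBall`); this fixes the constants
of `Θ`. -/

/-! ## Weights and sums in `[0, ∞]` -/

/-- The weight `(1 + |k|²)^σ` with values in `[0, ∞]`. -/
def wt (σ : ℝ) (k : Freq d) : ℝ≥0∞ := ENNReal.ofReal ((1 + freqSq k) ^ σ)

lemma freqSq_nonneg (k : Freq d) : 0 ≤ freqSq k := Finset.sum_nonneg fun _ _ => sq_nonneg _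

lemma freqSq_neg (k : Freq d) : freqSq (-k) = freqSq k := by simp [freqSq]

lemma one_le_one_add_freqSq (k : Freq d) : 1 ≤ 1 + freqSq k := by
  linarith [freqSq_nonneg k]

lemma one_add_freqSq_pos (k : Freq d) : 0 < 1 + freqSq k := by
  linarith [freqSq_nonneg k]

lemma sq_le_freqSq (k : Freq d) (i : Fin d) : (k i : ℝ) ^ 2 ≤ freqSq k :=
  Finset.single_le_sum (f := fun i => (k i : ℝ) ^ 2) (fun _ _ => sq_nonneg _) (Finset.mem_univ i)

lemma freqSq_add_le (k l : Freq d) : freqSq (k + l) ≤ 2 * (freqSq k + freqSq l) := by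
  simp only [freqSq, ← Finset.sum_add_distrib, Finset.mul_sum]
  refine Finset.sum_le_sum fun i _ => ?_
  push_cast [Pi.add_apply]
  nlinarith [sq_nonneg ((k i : ℝ) - l i)]

lemma freqSq_sub_le (k l : Freq d) : freqSq (k - l) ≤ 2 * (freqSq k + freqSq l) := by
  simpa [sub_eq_add_neg, freqSq_neg] using freqSq_add_le k (-l)

lemma wt_pos (σ : ℝ) (k : Freq d) : 0 < wt σ k :=
  ENNReal.ofReal_pos.2 (Real.rpow_pos_of_pos (one_add_freqSq_pos k) _)

lemma wt_ne_zero (σ : ℝ) (k : Freq d) : wt σ k ≠ 0 := (wt_pos σ k).ne'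

lemma wt_ne_top (σ : ℝ) (k : Freq d) : wt σ k ≠ ⊤ := ENNReal.ofReal_ne_top

lemma wt_zero (k : Freq d) : wt 0 k = 1 := by simp [wt]

lemma wt_add (σ τ : ℝ) (k : Freq d) : wt (σ + τ) k = wt σ k * wt τ k := by
  rw [wt, wt, wt, Real.rpow_add (one_add_freqSq_pos k),
    ENNReal.ofReal_mul (Real.rpow_nonneg (one_add_freqSq_pos k).le _)]

lemma wt_half_sq (σ : ℝ) (k : Freq d) : wt (σ / 2) k ^ 2 = wt σ k := by
  rw [sq, ← wt_add, add_halves]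

lemma wt_neg_mul (σ : ℝ) (k : Freq d) : wt (-σ) k * wt σ k = 1 := by
  rw [← wt_add, neg_add_cancel, wt_zero]

lemma wt_mono {σ τ : ℝ} (h : σ ≤ τ) (k : Freq d) : wt σ k ≤ wt τ k :=
  ENNReal.ofReal_le_ofReal (Real.rpow_le_rpow_of_exponent_le (one_le_one_add_freqSq k) h)

lemma wt_neg_freq (σ : ℝ) (k : Freq d) : wt σ (-k) = wt σ k := by simp [wt, freqSq_neg]

/-- Cauchy–Schwarz with squares on both sides, so that it applies to squared norms in `[0, ∞]`
without roots and without integrability conditions. -/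
lemma lintegral_mul_sq_le {α : Type*} [MeasurableSpace α] {μ : Measure α} {f g : α → ℝ≥0∞}
    (hf : AEMeasurable f μ) (hg : AEMeasurable g μ) :
    (∫⁻ a, f a * g a ∂μ) ^ 2 ≤ (∫⁻ a, f a ^ 2 ∂μ) * ∫⁻ a, g a ^ 2 ∂μ := by
  have h := ENNReal.lintegral_mul_le_Lp_mul_Lq μ Real.HolderConjugate.two_two hf hg
  have h2 := ENNReal.pow_le_pow_left (n := 2) h
  refine h2.trans (le_of_eq ?_)
  rw [mul_pow, ← ENNReal.rpow_natCast, ← ENNReal.rpow_natCast, ← ENNReal.rpow_mul,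
    ← ENNReal.rpow_mul]
  norm_num

lemma tsum_mul_sq_le {ι : Type*} (f g : ι → ℝ≥0∞) :
    (∑' i, f i * g i) ^ 2 ≤ (∑' i, f i ^ 2) * ∑' i, g i ^ 2 := by
  let _ : MeasurableSpace ι := ⊤
  have h := lintegral_mul_sq_le (μ := Measure.count) (f := f) (g := g)
    measurable_from_top.aemeasurable measurable_from_top.aemeasurable
  simpa only [lintegral_count] using h

lemma ENNReal.add_sq_le (a b : ℝ≥0∞) : (a + b) ^ 2 ≤ 2 * a ^ 2 + 2 * b ^ 2 := by
  rcases eq_or_ne a ⊤ with rfl | ha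
  · simp
  rcases eq_or_ne b ⊤ with rfl | hb
  · simp
  lift a to ℝ≥0 using ha
  lift b to ℝ≥0 using hb
  norm_cast
  rw [← NNReal.coe_le_coe]
  push_cast
  nlinarith [sq_nonneg ((a : ℝ) - b)]

lemma ENNReal.sum_sq_le {ι : Type*} (s : Finset ι) (a : ι → ℝ≥0∞) :
    (∑ i ∈ s, a i) ^ 2 ≤ s.card * ∑ i ∈ s, a i ^ 2 := by
  have h := tsum_mul_sq_le (fun _ : s => 1) fun i : s => a i
  simp only [one_mul, one_pow, tsum_fintype] at h
  rw [Finset.sum_coe_sort s a, Finset.sum_coe_sort s fun i => a i ^ 2] at h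
  simpa using h

/-! ## Summability of the weights -/

/-- Tonelli, one coordinate at a time; it reduces lattice sums of product weights to dimension one.
-/
lemma tsum_prod_apply_eq_pow (n : ℕ) (g : ℤ → ℝ≥0∞) :
    ∑' k : Fin n → ℤ, ∏ i, g (k i) = (∑' j, g j) ^ n := by
  induction n with
  | zero => simp [tsum_fintype]
  | succ n ih =>
    rw [← (Fin.consEquiv fun _ : Fin (n + 1) => ℤ).tsum_eq, ENNReal.tsum_prod']
    simp only [Fin.consEquiv, Equiv.coe_fn_mk, Fin.prod_univ_succ, Fin.cons_zero, Fin.cons_succ,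
      ENNReal.tsum_mul_left, ih, ENNReal.tsum_mul_right, pow_succ, mul_comm]

lemma tsum_int_weight_lt_top {a : ℝ} (ha : 1 / 2 < a) :
    ∑' n : ℤ, ENNReal.ofReal ((1 + (n : ℝ) ^ 2) ^ (-a)) < ⊤ := by
  have hs : Summable fun n : ℤ => (1 + (n : ℝ) ^ 2) ^ (-a) := by
    have h0 : Summable fun n : ℤ => |(n : ℝ)| ^ (-(2 * a)) :=
      Real.summable_abs_int_rpow (by linarith)
    -- Away from zero the comparison is with `|n|^{-2a}`; the indicator takes care of `n = 0`.
    have h1 : Summable fun n : ℤ => |(n : ℝ)| ^ (-(2 * a)) + if n = 0 then (1 : ℝ) else 0 :=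
      h0.add (summable_of_hasFiniteSupport ((Set.finite_singleton (0 : ℤ)).subset (by
        intro n hn; by_contra h; simp_all)))
    refine Summable.of_nonneg_of_le (fun n => Real.rpow_nonneg (by positivity) _) (fun n => ?_) h1
    by_cases hn : n = 0
    · subst hn
      simp [Real.rpow_nonneg]
    · simp only [hn, if_false, add_zero]
      have hn' : 0 < |(n : ℝ)| := abs_pos.2 (by exact_mod_cast hn)
      have : |(n : ℝ)| ^ (-(2 * a)) = ((n : ℝ) ^ 2) ^ (-a) := by
        rw [← sq_abs, ← Real.rpow_natCast, ← Real.rpow_mul hn'.le]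
        norm_num
      rw [this]
      exact Real.rpow_le_rpow_of_nonpos (by positivity) (by linarith) (by linarith)
  rw [← ENNReal.ofReal_tsum_of_nonneg (fun n => Real.rpow_nonneg (by positivity) _) hs]
  exact ENNReal.ofReal_lt_top

/-- The sum of the weights of order `-r`. -/
def wtSum (d : ℕ) (r : ℝ) : ℝ≥0∞ := ∑' k : Freq d, wt (-r) k

/-- Since `∏ (1 + k_i²) ≤ (1 + |k|²)^d`, the weight of order `-r` lies below a product of
one-dimensional weights with exponent `r / d > 1 / 2`. -/
lemma wtSum_lt_top {r : ℝ} (hr : (d : ℝ) / 2 < r) : wtSum d r < ⊤ := by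
  rcases Nat.eq_zero_or_pos d with rfl | hd
  · simp [wtSum, tsum_fintype, (wt_ne_top _ _).lt_top]
  have hd' : (0 : ℝ) < d := by exact_mod_cast hd
  have ha : 1 / 2 < r / d := by rw [lt_div_iff₀ hd']; linarith
  have hr0 : 0 < r := by linarith [div_pos hd' (zero_lt_two' ℝ)]
  refine lt_of_le_of_lt ?_ (ENNReal.pow_lt_top (n := d) (tsum_int_weight_lt_top ha))
  rw [← tsum_prod_apply_eq_pow]
  refine ENNReal.tsum_le_tsum fun k => ?_
  rw [wt, ← ENNReal.ofReal_prod_of_nonneg fun i _ => Real.rpow_nonneg (by positivity) _]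
  refine ENNReal.ofReal_le_ofReal ?_
  rw [Real.finsetProd_rpow _ _ fun i _ => by positivity]
  have h1 : ∏ i, (1 + (k i : ℝ) ^ 2) ≤ (1 + freqSq k) ^ (d : ℝ) := by
    calc ∏ i, (1 + (k i : ℝ) ^ 2) ≤ ∏ _i : Fin d, (1 + freqSq k) :=
          Finset.prod_le_prod (fun i _ => by positivity)
            fun i _ => by linarith [sq_le_freqSq k i]
      _ = _ := by simp
  calc (1 + freqSq k) ^ (-r) = ((1 + freqSq k) ^ (d : ℝ)) ^ (-(r / d)) := by
        rw [← Real.rpow_mul (one_add_freqSq_pos k).le]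
        congr 1
        field_simp
    _ ≤ _ := Real.rpow_le_rpow_of_nonpos (Finset.prod_pos fun i _ => by positivity) h1
        (by have := div_pos hr0 hd'; linarith)

/-! ## Basic properties of the Sobolev norms -/

lemma sobSq_eq (σ : ℝ) (c : Coeffs d) : sobSq σ c = ∑' k, wt σ k * ‖c k‖ₑ ^ 2 := by
  refine tsum_congr fun k => ?_
  rw [ENNReal.ofReal_mul (Real.rpow_nonneg (one_add_freqSq_pos k).le _), wt,
    ENNReal.ofReal_pow (norm_nonneg _), ofReal_norm]

lemma sobSq_eq_sq (σ : ℝ) (c : Coeffs d) : sobSq σ c = ∑' k, (wt (σ / 2) k * ‖c k‖ₑ) ^ 2 := by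
  simp only [sobSq_eq, mul_pow, wt_half_sq]

lemma sobSq_mono {σ τ : ℝ} (h : σ ≤ τ) (c : Coeffs d) : sobSq σ c ≤ sobSq τ c := by
  rw [sobSq_eq, sobSq_eq]
  exact ENNReal.tsum_le_tsum fun k => mul_le_mul_left (wt_mono h k) _

lemma sobSq_le_of_enorm_le {σ : ℝ} {c e : Coeffs d} (h : ∀ k, ‖c k‖ₑ ≤ ‖e k‖ₑ) :
    sobSq σ c ≤ sobSq σ e := by
  rw [sobSq_eq, sobSq_eq]
  exact ENNReal.tsum_le_tsum fun k => by gcongr; exact h k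

lemma sobSq_add_le (σ : ℝ) (a b : Coeffs d) :
    sobSq σ (a + b) ≤ 2 * sobSq σ a + 2 * sobSq σ b := by
  rw [sobSq_eq, sobSq_eq, sobSq_eq, ← ENNReal.tsum_mul_left, ← ENNReal.tsum_mul_left,
    ← ENNReal.tsum_add]
  refine ENNReal.tsum_le_tsum fun k => ?_
  calc wt σ k * ‖a k + b k‖ₑ ^ 2 ≤ wt σ k * (2 * ‖a k‖ₑ ^ 2 + 2 * ‖b k‖ₑ ^ 2) := by
        gcongr
        exact (ENNReal.pow_le_pow_left (enorm_add_le _ _)).trans (ENNReal.add_sq_le _ _)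
    _ = _ := by ring

lemma sobSq_neg (σ : ℝ) (a : Coeffs d) : sobSq σ (-a) = sobSq σ a := by
  simp [sobSq_eq]

lemma sobSq_sub_le (σ : ℝ) (a b : Coeffs d) :
    sobSq σ (a - b) ≤ 2 * sobSq σ a + 2 * sobSq σ b := by
  simpa [sub_eq_add_neg, sobSq_neg] using sobSq_add_le σ a (-b)

lemma sobSq_zero (σ : ℝ) : sobSq σ (0 : Coeffs d) = 0 := by simp [sobSq_eq]

lemma sobSq_smul (σ : ℝ) (z : ℂ) (a : Coeffs d) : sobSq σ (z • a) = ‖z‖ₑ ^ 2 * sobSq σ a := by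
  rw [sobSq_eq, sobSq_eq, ← ENNReal.tsum_mul_left]
  refine tsum_congr fun k => ?_
  rw [Pi.smul_apply, smul_eq_mul, enorm_mul]
  ring

lemma sobSq_sum_le {ι : Type*} (σ : ℝ) (s : Finset ι) (a : ι → Coeffs d) :
    sobSq σ (∑ i ∈ s, a i) ≤ s.card * ∑ i ∈ s, sobSq σ (a i) := by
  simp only [sobSq_eq]
  rw [← Summable.tsum_finsetSum (fun _ _ => ENNReal.summable), ← ENNReal.tsum_mul_left]
  refine ENNReal.tsum_le_tsum fun k => ?_
  calc wt σ k * ‖(∑ i ∈ s, a i) k‖ₑ ^ 2 ≤ wt σ k * (s.card * ∑ i ∈ s, ‖a i k‖ₑ ^ 2) := by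
        gcongr
        rw [Finset.sum_apply]
        exact (ENNReal.pow_le_pow_left (enorm_sum_le _ _)).trans (ENNReal.sum_sq_le s _)
    _ = _ := by rw [← Finset.mul_sum]; ring

lemma wt_mul_enorm_sq_le (σ : ℝ) (c : Coeffs d) (k : Freq d) :
    wt σ k * ‖c k‖ₑ ^ 2 ≤ sobSq σ c := by
  rw [sobSq_eq]
  exact ENNReal.le_tsum (f := fun k => wt σ k * ‖c k‖ₑ ^ 2) k

lemma eq_zero_of_sobSq_eq_zero {σ : ℝ} {c : Coeffs d} (h : sobSq σ c = 0) : c = 0 := by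
  funext k
  have := wt_mul_enorm_sq_le σ c k
  simpa [h, wt_ne_zero] using this

/-- Fatou: every finite partial sum passes to the limit. Norm bounds on approximations thus survive
coefficientwise limits. -/
lemma sobSq_le_of_tendsto {ι : Type*} {l : Filter ι} [l.NeBot] {σ : ℝ} {c : ι → Coeffs d}
    {c₀ : Coeffs d} {B : ℝ≥0∞} (h : ∀ k, Filter.Tendsto (fun n => c n k) l (nhds (c₀ k)))
    (hB : ∀ᶠ n in l, sobSq σ (c n) ≤ B) : sobSq σ c₀ ≤ B := by
  rw [sobSq_eq, ENNReal.tsum_eq_iSup_sum]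
  refine iSup_le fun s => ?_
  have ht : Filter.Tendsto (fun n => ∑ k ∈ s, wt σ k * ‖c n k‖ₑ ^ 2) l
      (nhds (∑ k ∈ s, wt σ k * ‖c₀ k‖ₑ ^ 2)) := by
    refine tendsto_finsetSum _ fun k _ => ?_
    refine ENNReal.Tendsto.const_mul ?_ (Or.inr (wt_ne_top _ _))
    exact ENNReal.Tendsto.pow (h k).enorm
  refine le_of_tendsto ht (hB.mono fun n hn => le_trans ?_ hn)
  rw [sobSq_eq]
  exact ENNReal.sum_le_tsum s

/-! ## Weighted Wiener norms -/

/-- The weighted Wiener norm `∑ k, (1 + |k|²)^{τ/2} |c k|`. -/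
def wien (τ : ℝ) (c : Coeffs d) : ℝ≥0∞ := ∑' k, wt (τ / 2) k * ‖c k‖ₑ

/-- Cauchy–Schwarz against the weights of order `-r`. For `r > d / 2` this is the embedding of
`H^{τ+r}` in the weighted Wiener algebra, from which the supremum bounds come. -/
lemma wien_sq_le (τ r : ℝ) (c : Coeffs d) :
    wien τ c ^ 2 ≤ wtSum d r * sobSq (τ + r) c := by
  have h := tsum_mul_sq_le (fun k : Freq d => wt (-r / 2) k)
    fun k => wt ((τ + r) / 2) k * ‖c k‖ₑ
  simp only [wt_half_sq, ← sobSq_eq_sq] at h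
  refine le_trans (le_of_eq ?_) h
  rw [wien]
  congr 2 with k
  rw [← mul_assoc, ← wt_add]
  ring_nf

lemma wien_mono {σ τ : ℝ} (h : σ ≤ τ) (c : Coeffs d) : wien σ c ≤ wien τ c :=
  ENNReal.tsum_le_tsum fun k => mul_le_mul_left (wt_mono (by linarith) k) _

lemma wien_zero (c : Coeffs d) : wien 0 c = ∑' k, ‖c k‖ₑ := by simp [wien, wt_zero]

lemma wien_add_le (τ : ℝ) (a b : Coeffs d) : wien τ (a + b) ≤ wien τ a + wien τ b := by
  rw [wien, wien, wien, ← ENNReal.tsum_add]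
  refine ENNReal.tsum_le_tsum fun k => ?_
  rw [← mul_add]
  gcongr
  exact enorm_add_le _ _

/-! ## Convolutions -/

/-- Convolution of families of numbers in `[0, ∞]`. -/
def econv (f x : Freq d → ℝ≥0∞) (k : Freq d) : ℝ≥0∞ := ∑' l, f (k - l) * x l

lemma tsum_sub_right (f : Freq d → ℝ≥0∞) (l : Freq d) : ∑' k, f (k - l) = ∑' k, f k :=
  (Equiv.subRight l).tsum_eq f

lemma tsum_sub_left (f : Freq d → ℝ≥0∞) (k : Freq d) : ∑' l, f (k - l) = ∑' l, f l :=
  (Equiv.subLeft k).tsum_eq f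

lemma econv_comm (f x : Freq d → ℝ≥0∞) (k : Freq d) : econv f x k = econv x f k := by
  rw [econv, econv, ← tsum_sub_left (fun l => f (k - l) * x l) k]
  refine tsum_congr fun l => ?_
  rw [sub_sub_cancel, mul_comm]

/-- Cauchy–Schwarz with `f = f^{1/2} f^{1/2}` inside the convolution, then summation over `k`: `ℓ¹ *
ℓ² ⊆ ℓ²`. -/
lemma young (f x : Freq d → ℝ≥0∞) :
    ∑' k, econv f x k ^ 2 ≤ (∑' k, f k) ^ 2 * ∑' k, x k ^ 2 := by
  have h : ∀ k, econv f x k ^ 2 ≤ (∑' l, f l) * ∑' l, f (k - l) * x l ^ 2 := by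
    intro k
    have h1 := tsum_mul_sq_le (fun l => f (k - l) ^ (1 / 2 : ℝ))
      fun l => f (k - l) ^ (1 / 2 : ℝ) * x l
    have e : ∀ y : ℝ≥0∞, (y ^ (1 / 2 : ℝ)) ^ 2 = y := fun y => by
      rw [← ENNReal.rpow_natCast, ← ENNReal.rpow_mul]; norm_num
    simp only [mul_pow, e, ← mul_assoc, ← sq] at h1
    rwa [tsum_sub_left f k] at h1
  calc ∑' k, econv f x k ^ 2 ≤ ∑' k, (∑' l, f l) * ∑' l, f (k - l) * x l ^ 2 :=
        ENNReal.tsum_le_tsum h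
    _ = _ := by
        rw [ENNReal.tsum_mul_left, ENNReal.tsum_comm, sq, mul_assoc]
        congr 1
        simp only [ENNReal.tsum_mul_right, tsum_sub_right, ENNReal.tsum_mul_left]

/-- Convolution of families of Fourier coefficients. -/
def conv (f c : Coeffs d) : Coeffs d := fun k => ∑' l, f (k - l) * c l

lemma enorm_conv_le (f c : Coeffs d) (k : Freq d) :
    ‖conv f c k‖ₑ ≤ econv (fun l => ‖f l‖ₑ) (fun l => ‖c l‖ₑ) k := by
  refine enorm_tsum_le_tsum_enorm.trans (le_of_eq (tsum_congr fun l => ?_))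
  rw [enorm_mul]

/-- If `z ≤ y`, the first term dominates. If `y ≤ z`, write `z^t = z^r z^{t-r}` and replace `z` by
`y` in the factor with the nonpositive exponent. The second term moves the order `r` to `z` and
leaves a negative order on `y`; with `r > t` this is what makes sums over `y` converge. -/
lemma rpow_add_split {t r x y z : ℝ} (ht : 0 ≤ t) (htr : t ≤ r) (hx : 0 ≤ x) (hy : 0 < y)
    (hz : 0 < z) (h : x ≤ 2 * (y + z)) :
    x ^ t ≤ 4 ^ r * (y ^ t + z ^ r * y ^ (t - r)) := by
  have h4 : (4 : ℝ) ^ t ≤ 4 ^ r := Real.rpow_le_rpow_of_exponent_le (by norm_num) htr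
  have hyt := Real.rpow_nonneg hy.le t
  have hzt : 0 ≤ z ^ r * y ^ (t - r) := by positivity
  rcases le_total z y with hzy | hyz
  · calc x ^ t ≤ (4 * y) ^ t := Real.rpow_le_rpow hx (by linarith) ht
      _ = 4 ^ t * y ^ t := Real.mul_rpow (by norm_num) hy.le
      _ ≤ 4 ^ r * (y ^ t + z ^ r * y ^ (t - r)) := by gcongr; linarith
  · calc x ^ t ≤ (4 * z) ^ t := Real.rpow_le_rpow hx (by linarith) ht
      _ = 4 ^ t * z ^ t := Real.mul_rpow (by norm_num) hz.le
      _ ≤ 4 ^ r * (y ^ t + z ^ r * y ^ (t - r)) := by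
        gcongr
        calc z ^ t = z ^ r * z ^ (t - r) := by rw [← Real.rpow_add hz]; ring_nf
          _ ≤ z ^ r * y ^ (t - r) := by
            gcongr 1
            exact Real.rpow_le_rpow_of_nonpos hy hyz (by linarith)
          _ ≤ _ := by linarith

/-- The constant in the comparison of weights. -/
def splitC (r : ℝ) : ℝ≥0∞ := ENNReal.ofReal (2 ^ r)

lemma splitC_lt_top (r : ℝ) : splitC r < ⊤ := ENNReal.ofReal_lt_top

lemma wt_split {τ ρ : ℝ} (hτ : 0 ≤ τ) (hτρ : τ ≤ ρ) {a b c : Freq d}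
    (h : freqSq a ≤ 2 * (freqSq b + freqSq c)) :
    wt (τ / 2) a ≤ splitC ρ * (wt (τ / 2) b + wt (ρ / 2) c * wt ((τ - ρ) / 2) b) := by
  have e : (2 : ℝ) ^ ρ = 4 ^ (ρ / 2) := by
    rw [show (4 : ℝ) = 2 ^ (2 : ℝ) by norm_num, ← Real.rpow_mul (by norm_num)]
    ring_nf
  have hb := one_add_freqSq_pos b
  have hc := one_add_freqSq_pos c
  rw [splitC, e, wt, wt, wt, wt, ← ENNReal.ofReal_mul (by positivity),
    ← ENNReal.ofReal_add (by positivity) (by positivity), ← ENNReal.ofReal_mul (by positivity)]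
  refine ENNReal.ofReal_le_ofReal ?_
  rw [sub_div]
  exact rpow_add_split (by linarith) (by linarith) (one_add_freqSq_pos a).le hb hc
    (by nlinarith)

lemma freqSq_le_sub_add (k l : Freq d) : freqSq k ≤ 2 * (freqSq l + freqSq (k - l)) := by
  simpa using freqSq_add_le l (k - l)

lemma freqSq_le_add_sub (k l : Freq d) : freqSq l ≤ 2 * (freqSq k + freqSq (k - l)) := by
  simpa using freqSq_sub_le k (k - l)

/-- Products in Sobolev spaces of nonpositive order: a term with the Wiener norm of the
coefficient, and a smoother term. -/
lemma conv_neg_pointwise {σ ρ : ℝ} (hσ : σ ≤ 0) (hσρ : -ρ ≤ σ) (f c : Coeffs d) (k : Freq d) :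
    wt (σ / 2) k * ‖conv f c k‖ₑ ≤ splitC ρ *
      (econv (fun l => ‖f l‖ₑ) (fun l => wt (σ / 2) l * ‖c l‖ₑ) k
        + wt (-ρ / 2) k * econv (fun l => wt (ρ / 2) l * ‖f l‖ₑ)
          (fun l => wt (σ / 2) l * ‖c l‖ₑ) k) := by
  have hl : ∀ l, wt (σ / 2) k * (‖f (k - l)‖ₑ * ‖c l‖ₑ) ≤ splitC ρ *
      (‖f (k - l)‖ₑ * (wt (σ / 2) l * ‖c l‖ₑ)
        + wt (-ρ / 2) k * (wt (ρ / 2) (k - l) * ‖f (k - l)‖ₑ * (wt (σ / 2) l * ‖c l‖ₑ))) := by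
    intro l
    -- The weight at `k` has negative order, so the splitting is applied to the inverse weights:
    -- that of the frequency `l` of the distribution is divided between the output `k` and the
    -- frequency `k - l` of the coefficient.
    have h := wt_split (τ := -σ) (by linarith) (by linarith) (freqSq_le_add_sub k l)
    have e1 : wt (σ / 2) k * wt (-σ / 2) k = 1 := by
      rw [← wt_add, show σ / 2 + -σ / 2 = 0 by ring, wt_zero]
    have e2 : wt (σ / 2) l * wt (-σ / 2) l = 1 := by
      rw [← wt_add, show σ / 2 + -σ / 2 = 0 by ring, wt_zero]
    have e3 : wt (σ / 2) k * wt ((-σ - ρ) / 2) k = wt (-ρ / 2) k := by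
      rw [← wt_add]; ring_nf
    calc wt (σ / 2) k * (‖f (k - l)‖ₑ * ‖c l‖ₑ)
        = wt (-σ / 2) l * (wt (σ / 2) k * (‖f (k - l)‖ₑ * (wt (σ / 2) l * ‖c l‖ₑ))) := by
          rw [show wt (-σ / 2) l * (wt (σ / 2) k * (‖f (k - l)‖ₑ * (wt (σ / 2) l * ‖c l‖ₑ)))
            = (wt (σ / 2) l * wt (-σ / 2) l) * (wt (σ / 2) k * (‖f (k - l)‖ₑ * ‖c l‖ₑ)) by ring,
            e2, one_mul]
      _ ≤ (splitC ρ * (wt (-σ / 2) k + wt (ρ / 2) (k - l) * wt ((-σ - ρ) / 2) k)) *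
            (wt (σ / 2) k * (‖f (k - l)‖ₑ * (wt (σ / 2) l * ‖c l‖ₑ))) := by gcongr
      _ = splitC ρ * ((wt (σ / 2) k * wt (-σ / 2) k) * (‖f (k - l)‖ₑ * (wt (σ / 2) l * ‖c l‖ₑ))
            + (wt (σ / 2) k * wt ((-σ - ρ) / 2) k) *
              (wt (ρ / 2) (k - l) * ‖f (k - l)‖ₑ * (wt (σ / 2) l * ‖c l‖ₑ))) := by ring
      _ = _ := by rw [e1, e3, one_mul]
  calc wt (σ / 2) k * ‖conv f c k‖ₑ
      ≤ wt (σ / 2) k * econv (fun l => ‖f l‖ₑ) (fun l => ‖c l‖ₑ) k := by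
        gcongr; exact enorm_conv_le f c k
    _ = ∑' l, wt (σ / 2) k * (‖f (k - l)‖ₑ * ‖c l‖ₑ) := by rw [econv, ENNReal.tsum_mul_left]
    _ ≤ _ := ENNReal.tsum_le_tsum hl
    _ = _ := by
      rw [ENNReal.tsum_mul_left, ENNReal.tsum_add, ENNReal.tsum_mul_left]
      rfl

lemma econv_sq_le (f x : Freq d → ℝ≥0∞) (k : Freq d) :
    econv f x k ^ 2 ≤ (∑' l, f l ^ 2) * ∑' l, x l ^ 2 := by
  refine (tsum_mul_sq_le _ _).trans (le_of_eq ?_)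
  rw [tsum_sub_left (fun l => f l ^ 2) k]

/-- Products in Sobolev spaces of nonnegative order. -/
lemma sobSq_conv_le_of_nonneg {σ ρ : ℝ} (hσ : 0 ≤ σ) (hσρ : σ ≤ ρ) (f c : Coeffs d) :
    sobSq σ (conv f c) ≤
      2 * splitC ρ ^ 2 * (wien 0 f ^ 2 + wtSum d ρ * sobSq ρ f) * sobSq σ c := by
  set x : Freq d → ℝ≥0∞ := fun l => wt (σ / 2) l * ‖c l‖ₑ with hx
  set F : Freq d → ℝ≥0∞ := fun l => wt (ρ / 2) l * ‖f l‖ₑ with hF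
  have hk : ∀ k, wt (σ / 2) k * ‖conv f c k‖ₑ ≤ splitC ρ *
      (econv (fun l => ‖f l‖ₑ) x k + econv F (fun l => wt (-ρ / 2) l * x l) k) := by
    intro k
    have hl : ∀ l, wt (σ / 2) k * (‖f (k - l)‖ₑ * ‖c l‖ₑ) ≤ splitC ρ *
        (‖f (k - l)‖ₑ * x l + F (k - l) * (wt (-ρ / 2) l * x l)) := by
      intro l
      have h := wt_split hσ hσρ (freqSq_le_sub_add k l)
      have e3 : wt ((σ - ρ) / 2) l = wt (-ρ / 2) l * wt (σ / 2) l := by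
        rw [← wt_add]; ring_nf
      calc wt (σ / 2) k * (‖f (k - l)‖ₑ * ‖c l‖ₑ)
          ≤ splitC ρ * (wt (σ / 2) l + wt (ρ / 2) (k - l) * wt ((σ - ρ) / 2) l)
            * (‖f (k - l)‖ₑ * ‖c l‖ₑ) := by gcongr
        _ = _ := by rw [e3, hx, hF]; ring
    calc wt (σ / 2) k * ‖conv f c k‖ₑ
        ≤ wt (σ / 2) k * econv (fun l => ‖f l‖ₑ) (fun l => ‖c l‖ₑ) k := by
          gcongr; exact enorm_conv_le f c k
      _ = ∑' l, wt (σ / 2) k * (‖f (k - l)‖ₑ * ‖c l‖ₑ) := by rw [econv, ENNReal.tsum_mul_left]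
      _ ≤ _ := ENNReal.tsum_le_tsum hl
      _ = _ := by
        rw [ENNReal.tsum_mul_left, ENNReal.tsum_add]
        rfl
  -- In the second term `F` is only in `ℓ²`, so Young's inequality needs the other factor in `ℓ¹`.
  -- The weight of order `-ρ` makes it summable by Cauchy–Schwarz (`hcs`).
  simp only [econv_comm F] at hk
  have hy1 := young (fun l => ‖f l‖ₑ) x
  have hy2 := young (fun l => wt (-ρ / 2) l * x l) F
  have hcs := tsum_mul_sq_le (fun l : Freq d => wt (-ρ / 2) l) x
  simp only [wt_half_sq] at hcs
  rw [sobSq_eq_sq σ (conv f c)]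
  calc ∑' k, (wt (σ / 2) k * ‖conv f c k‖ₑ) ^ 2
      ≤ ∑' k, splitC ρ ^ 2 * (2 * econv (fun l => ‖f l‖ₑ) x k ^ 2
          + 2 * econv (fun l => wt (-ρ / 2) l * x l) F k ^ 2) := by
        refine ENNReal.tsum_le_tsum fun k => ?_
        refine (ENNReal.pow_le_pow_left (hk k)).trans ?_
        rw [mul_pow]
        gcongr
        exact ENNReal.add_sq_le _ _
    _ = splitC ρ ^ 2 * (2 * ∑' k, econv (fun l => ‖f l‖ₑ) x k ^ 2
          + 2 * ∑' k, econv (fun l => wt (-ρ / 2) l * x l) F k ^ 2) := by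
        rw [ENNReal.tsum_mul_left, ENNReal.tsum_add, ENNReal.tsum_mul_left, ENNReal.tsum_mul_left]
    _ ≤ splitC ρ ^ 2 * (2 * ((∑' l, ‖f l‖ₑ) ^ 2 * ∑' l, x l ^ 2)
          + 2 * (((∑' l : Freq d, wt (-ρ) l) * ∑' l, x l ^ 2) * ∑' l, F l ^ 2)) := by
        gcongr
        exact hy2.trans (by gcongr)
    _ = _ := by
        rw [hx, hF, ← sobSq_eq_sq, ← sobSq_eq_sq, wien_zero, wtSum]
        ring

/-- Peetre's inequality, from `1 + 2 (x + y) ≤ 4 (1 + x) (1 + y)`: weights of nonnegative order are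
submultiplicative up to a constant. -/
lemma peetre {τ : ℝ} {a b c : Freq d} (h : freqSq a ≤ 2 * (freqSq b + freqSq c)) (hτ : 0 ≤ τ) :
    wt (τ / 2) a ≤ splitC τ * (wt (τ / 2) b * wt (τ / 2) c) := by
  have hb := one_add_freqSq_pos b
  have hc := one_add_freqSq_pos c
  have ha := one_add_freqSq_pos a
  have e : (2 : ℝ) ^ τ = 4 ^ (τ / 2) := by
    rw [show (4 : ℝ) = 2 ^ (2 : ℝ) by norm_num, ← Real.rpow_mul (by norm_num)]
    ring_nf
  rw [splitC, e, wt, wt, wt, ← ENNReal.ofReal_mul (by positivity),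
    ← ENNReal.ofReal_mul (by positivity)]
  refine ENNReal.ofReal_le_ofReal ?_
  rw [← Real.mul_rpow hb.le hc.le, ← Real.mul_rpow (by norm_num) (by positivity)]
  refine Real.rpow_le_rpow ha.le ?_ (by linarith)
  nlinarith [mul_nonneg (freqSq_nonneg b) (freqSq_nonneg c), freqSq_nonneg b, freqSq_nonneg c]

/-- Products with a factor in a weighted Wiener algebra. -/
lemma sobSq_conv_le_wien {τ : ℝ} (hτ : 0 ≤ τ) (f c : Coeffs d) :
    sobSq τ (conv f c) ≤ splitC τ ^ 2 * wien τ f ^ 2 * sobSq τ c := by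
  set x : Freq d → ℝ≥0∞ := fun l => wt (τ / 2) l * ‖c l‖ₑ with hx
  set F : Freq d → ℝ≥0∞ := fun l => wt (τ / 2) l * ‖f l‖ₑ with hF
  have hk : ∀ k, wt (τ / 2) k * ‖conv f c k‖ₑ ≤ splitC τ * econv F x k := by
    intro k
    calc wt (τ / 2) k * ‖conv f c k‖ₑ
        ≤ wt (τ / 2) k * econv (fun l => ‖f l‖ₑ) (fun l => ‖c l‖ₑ) k := by
          gcongr; exact enorm_conv_le f c k
      _ = ∑' l, wt (τ / 2) k * (‖f (k - l)‖ₑ * ‖c l‖ₑ) := by rw [econv, ENNReal.tsum_mul_left]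
      _ ≤ ∑' l, splitC τ * (F (k - l) * x l) := by
          refine ENNReal.tsum_le_tsum fun l => ?_
          calc wt (τ / 2) k * (‖f (k - l)‖ₑ * ‖c l‖ₑ)
              ≤ splitC τ * (wt (τ / 2) l * wt (τ / 2) (k - l)) * (‖f (k - l)‖ₑ * ‖c l‖ₑ) := by
                gcongr
                exact peetre (freqSq_le_sub_add k l) hτ
            _ = _ := by rw [hx, hF]; ring
      _ = _ := by rw [ENNReal.tsum_mul_left]; rfl
  rw [sobSq_eq_sq τ (conv f c)]
  calc ∑' k, (wt (τ / 2) k * ‖conv f c k‖ₑ) ^ 2 ≤ ∑' k, splitC τ ^ 2 * econv F x k ^ 2 := by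
        refine ENNReal.tsum_le_tsum fun k => ?_
        rw [← mul_pow]
        exact ENNReal.pow_le_pow_left (hk k)
    _ ≤ splitC τ ^ 2 * ((∑' l, F l) ^ 2 * ∑' l, x l ^ 2) := by
        rw [ENNReal.tsum_mul_left]
        gcongr
        exact young F x
    _ = _ := by rw [hx, hF, ← sobSq_eq_sq, wien]; ring

/-- Products with a tame bound. -/
lemma sobSq_conv_le_tame {τ : ℝ} (hτ : 0 ≤ τ) (f c : Coeffs d) :
    sobSq τ (conv f c) ≤
      2 * splitC τ ^ 2 * (wien 0 f ^ 2 * sobSq τ c + sobSq τ f * wien 0 c ^ 2) := by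
  set x : Freq d → ℝ≥0∞ := fun l => wt (τ / 2) l * ‖c l‖ₑ with hx
  set F : Freq d → ℝ≥0∞ := fun l => wt (τ / 2) l * ‖f l‖ₑ with hF
  have hk : ∀ k, wt (τ / 2) k * ‖conv f c k‖ₑ ≤ splitC τ *
      (econv (fun l => ‖f l‖ₑ) x k + econv (fun l => ‖c l‖ₑ) F k) := by
    intro k
    have hl : ∀ l, wt (τ / 2) k * (‖f (k - l)‖ₑ * ‖c l‖ₑ) ≤ splitC τ *
        (‖f (k - l)‖ₑ * x l + F (k - l) * ‖c l‖ₑ) := by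
      intro l
      have h := wt_split hτ le_rfl (freqSq_le_sub_add k l)
      rw [sub_self, zero_div, wt_zero, mul_one] at h
      calc wt (τ / 2) k * (‖f (k - l)‖ₑ * ‖c l‖ₑ)
          ≤ splitC τ * (wt (τ / 2) l + wt (τ / 2) (k - l)) * (‖f (k - l)‖ₑ * ‖c l‖ₑ) := by
            gcongr
        _ = _ := by rw [hx, hF]; ring
    rw [econv_comm (fun l => ‖c l‖ₑ)]
    calc wt (τ / 2) k * ‖conv f c k‖ₑ
        ≤ wt (τ / 2) k * econv (fun l => ‖f l‖ₑ) (fun l => ‖c l‖ₑ) k := by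
          gcongr; exact enorm_conv_le f c k
      _ = ∑' l, wt (τ / 2) k * (‖f (k - l)‖ₑ * ‖c l‖ₑ) := by rw [econv, ENNReal.tsum_mul_left]
      _ ≤ _ := ENNReal.tsum_le_tsum hl
      _ = _ := by
        rw [ENNReal.tsum_mul_left, ENNReal.tsum_add]
        rfl
  have hy1 := young (fun l => ‖f l‖ₑ) x
  have hy2 := young (fun l => ‖c l‖ₑ) F
  rw [sobSq_eq_sq τ (conv f c)]
  calc ∑' k, (wt (τ / 2) k * ‖conv f c k‖ₑ) ^ 2
      ≤ ∑' k, splitC τ ^ 2 * (2 * econv (fun l => ‖f l‖ₑ) x k ^ 2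
          + 2 * econv (fun l => ‖c l‖ₑ) F k ^ 2) := by
        refine ENNReal.tsum_le_tsum fun k => ?_
        refine (ENNReal.pow_le_pow_left (hk k)).trans ?_
        rw [mul_pow]
        gcongr
        exact ENNReal.add_sq_le _ _
    _ = splitC τ ^ 2 * (2 * ∑' k, econv (fun l => ‖f l‖ₑ) x k ^ 2
          + 2 * ∑' k, econv (fun l => ‖c l‖ₑ) F k ^ 2) := by
        rw [ENNReal.tsum_mul_left, ENNReal.tsum_add, ENNReal.tsum_mul_left, ENNReal.tsum_mul_left]
    _ ≤ splitC τ ^ 2 * (2 * ((∑' l, ‖f l‖ₑ) ^ 2 * ∑' l, x l ^ 2)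
          + 2 * ((∑' l, ‖c l‖ₑ) ^ 2 * ∑' l, F l ^ 2)) := by
        gcongr
    _ = _ := by
        rw [hx, hF, ← sobSq_eq_sq, ← sobSq_eq_sq, wien_zero, wien_zero]
        ring

/-- The products `f (k - l) c l` are summable, with a bound that grows polynomially in `k`. -/
lemma econv_sq_le_wt {ρ : ℝ} (hρ : 0 ≤ ρ) (f c : Coeffs d) (k : Freq d) :
    econv (fun l => ‖f l‖ₑ) (fun l => ‖c l‖ₑ) k ^ 2 ≤
      splitC ρ ^ 2 * wt ρ k * (sobSq ρ f * sobSq (-ρ) c) := by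
  have hl : ∀ l, ‖f (k - l)‖ₑ * ‖c l‖ₑ ≤ splitC ρ * wt (ρ / 2) k *
      ((wt (ρ / 2) (k - l) * ‖f (k - l)‖ₑ) * (wt (-ρ / 2) l * ‖c l‖ₑ)) := by
    intro l
    have h := peetre (freqSq_le_add_sub k l) hρ
    have e2 : wt (ρ / 2) l * wt (-ρ / 2) l = 1 := by
      rw [← wt_add, show ρ / 2 + -ρ / 2 = 0 by ring, wt_zero]
    calc ‖f (k - l)‖ₑ * ‖c l‖ₑ = wt (ρ / 2) l * (‖f (k - l)‖ₑ * (wt (-ρ / 2) l * ‖c l‖ₑ)) := by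
          rw [show wt (ρ / 2) l * (‖f (k - l)‖ₑ * (wt (-ρ / 2) l * ‖c l‖ₑ))
            = (wt (ρ / 2) l * wt (-ρ / 2) l) * (‖f (k - l)‖ₑ * ‖c l‖ₑ) by ring, e2, one_mul]
      _ ≤ splitC ρ * (wt (ρ / 2) k * wt (ρ / 2) (k - l)) *
            (‖f (k - l)‖ₑ * (wt (-ρ / 2) l * ‖c l‖ₑ)) := by gcongr
      _ = _ := by ring
  calc econv (fun l => ‖f l‖ₑ) (fun l => ‖c l‖ₑ) k ^ 2
      ≤ (splitC ρ * wt (ρ / 2) k * econv (fun l => wt (ρ / 2) l * ‖f l‖ₑ)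
          (fun l => wt (-ρ / 2) l * ‖c l‖ₑ) k) ^ 2 := by
        refine ENNReal.pow_le_pow_left ?_
        rw [econv, econv, ← ENNReal.tsum_mul_left]
        exact ENNReal.tsum_le_tsum hl
    _ ≤ _ := by
        rw [mul_pow, mul_pow, wt_half_sq]
        gcongr
        refine (econv_sq_le _ _ k).trans (le_of_eq ?_)
        rw [← sobSq_eq_sq, ← sobSq_eq_sq]

lemma summable_of_tsum_enorm_lt_top {ι : Type*} {f : ι → ℂ} (h : ∑' i, ‖f i‖ₑ < ⊤) :
    Summable f := by
  refine Summable.of_enorm ?_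
  exact h.ne

/-- This gives a meaning to the product of an element of `H^ρ` and one of `H^{-ρ}`: each of its
Fourier coefficients is an absolutely convergent sum. -/
lemma summable_conv {ρ : ℝ} (hρ : 0 ≤ ρ) {f c : Coeffs d} (hf : sobSq ρ f < ⊤)
    (hc : sobSq (-ρ) c < ⊤) (k : Freq d) : Summable fun l => f (k - l) * c l := by
  refine summable_of_tsum_enorm_lt_top ?_
  simp only [enorm_mul]
  have h := econv_sq_le_wt hρ f c k
  have h2 : econv (fun l => ‖f l‖ₑ) (fun l => ‖c l‖ₑ) k ^ 2 < ⊤ :=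
    h.trans_lt (ENNReal.mul_lt_top (ENNReal.mul_lt_top (ENNReal.pow_lt_top (splitC_lt_top ρ))
      (wt_ne_top _ _).lt_top) (ENNReal.mul_lt_top hf hc))
  exact (ENNReal.pow_lt_top_iff.1 h2).resolve_right (by norm_num)

/-! ## Characters -/

/-- The phase `k · x`. -/
def phase (k : Freq d) (x : Pt d) : ℝ := ∑ i, (k i : ℝ) * x i

lemma character_eq (k : Freq d) (x : Pt d) :
    character k x = Complex.exp (Complex.I * (phase k x : ℂ)) := rfl

lemma norm_character (k : Freq d) (x : Pt d) : ‖character k x‖ = 1 := by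
  rw [character_eq, mul_comm, Complex.norm_exp_ofReal_mul_I]

lemma enorm_character (k : Freq d) (x : Pt d) : ‖character k x‖ₑ = 1 := by
  rw [← ofReal_norm, norm_character, ENNReal.ofReal_one]

lemma character_zero (x : Pt d) : character 0 x = 1 := by simp [character]

lemma character_add (k l : Freq d) (x : Pt d) :
    character (k + l) x = character k x * character l x := by
  rw [character_eq, character_eq, character_eq, ← Complex.exp_add, ← mul_add]
  congr 2
  simp only [phase, Pi.add_apply, Int.cast_add, add_mul, Finset.sum_add_distrib]
  push_cast
  rfl

lemma character_neg (k : Freq d) (x : Pt d) :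
    character (-k) x = (starRingEnd ℂ) (character k x) := by
  rw [character_eq, character_eq, ← Complex.exp_conj]
  simp [phase]

lemma contDiff_phase {n : WithTop ℕ∞} (k : Freq d) : ContDiff ℝ n (phase k) := by
  unfold phase; fun_prop

lemma contDiff_character {n : WithTop ℕ∞} (k : Freq d) : ContDiff ℝ n (character k) := by
  have h : ContDiff ℝ n fun x => Complex.exp (Complex.I * (phase k x : ℂ)) :=
    (contDiff_const.mul (Complex.ofRealCLM.contDiff.comp (contDiff_phase k))).cexp
  exact h

lemma continuous_character (k : Freq d) : Continuous (character k) :=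
  (contDiff_character (n := 0) k).continuous

lemma character_periodic (k : Freq d) : TorusPeriodic (character k) := by
  intro x l
  rw [character_eq, character_eq, Complex.exp_eq_exp_iff_exists_int]
  refine ⟨∑ i, k i * l i, ?_⟩
  simp only [phase, mul_add, Finset.sum_add_distrib]
  push_cast
  rw [mul_add, Finset.mul_sum Finset.univ (fun i => (k i : ℂ) * (2 * Real.pi * (l i : ℂ))),
    Finset.sum_mul]
  congr 1
  exact Finset.sum_congr rfl fun i _ => by ring

lemma isTest_character (k : Freq d) : IsTest (character k) :=
  ⟨contDiff_character k, character_periodic k⟩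

lemma phase_single (k : Freq d) (i : Fin d) : phase k (Pi.single i 1) = k i := by
  simp [phase, Pi.single_apply]

lemma hasFDerivAt_phase (k : Freq d) (x : Pt d) :
    ∃ L : Pt d →L[ℝ] ℝ, HasFDerivAt (phase k) L x ∧ ∀ y, L y = phase k y := by
  refine ⟨∑ i, (k i : ℝ) • ContinuousLinearMap.proj i, ?_, fun y => by
    simp [phase]⟩
  have h : phase k = fun x => (∑ i, (k i : ℝ) • (ContinuousLinearMap.proj i : Pt d →L[ℝ] ℝ)) x := by
    funext y; simp [phase]
  rw [h]
  exact ContinuousLinearMap.hasFDerivAt _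

lemma pderiv_character (i : Fin d) (k : Freq d) (x : Pt d) :
    pderiv i (character k) x = Complex.I * (k i : ℂ) * character k x := by
  obtain ⟨L, hL, hLy⟩ := hasFDerivAt_phase k x
  have h1 : HasFDerivAt (fun x => (phase k x : ℂ)) (Complex.ofRealCLM.comp L) x :=
    Complex.ofRealCLM.hasFDerivAt.comp x hL
  have h2 := (h1.const_mul Complex.I).cexp
  have h3 : HasFDerivAt (character k) _ x := h2
  rw [pderiv, h3.fderiv]
  simp only [smul_apply, ContinuousLinearMap.comp_apply, hLy, phase_single,
    smul_eq_mul, Complex.ofRealCLM_apply]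
  rw [character_eq]
  push_cast
  ring

/-! ## Periodic functions and the unit torus -/

/-- The volume of the torus, as a complex number. -/
lemma two_pi_pow_ne_zero (d : ℕ) : ((((2 * Real.pi) ^ d : ℝ)) : ℂ) ≠ 0 := by
  have : (0 : ℝ) < (2 * Real.pi) ^ d := by positivity
  exact_mod_cast this.ne'

lemma isCompact_cell (d : ℕ) : IsCompact (cell d) := isCompact_Icc

lemma volume_cell (d : ℕ) : volume (cell d) = ENNReal.ofReal ((2 * Real.pi) ^ d) := by
  rw [cell, Real.volume_Icc_pi]
  simp [ENNReal.ofReal_pow Real.two_pi_pos.le]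

lemma volume_cell_lt_top (d : ℕ) : volume (cell d) < ⊤ := by
  rw [volume_cell]; exact ENNReal.ofReal_lt_top

lemma integrableOn_cell_of_continuous {E : Type*} [NormedAddCommGroup E] {f : Pt d → E}
    (hf : Continuous f) : IntegrableOn f (cell d) :=
  hf.continuousOn.integrableOn_compact (isCompact_cell d)

open scoped Pointwise in
lemma smul_Ioc_ae_eq_cell (d : ℕ) :
    ((2 * Real.pi) • {x : Pt d | ∀ i, x i ∈ Ioc (0 : ℝ) (0 + 1)} : Set (Pt d))
      =ᵐ[volume] cell d := by
  have h : ((2 * Real.pi) • {x : Pt d | ∀ i, x i ∈ Ioc (0 : ℝ) (0 + 1)} : Set (Pt d))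
      = Set.univ.pi fun _ => Ioc 0 (2 * Real.pi) := by
    ext x
    rw [Set.mem_smul_set_iff_inv_smul_mem₀ Real.two_pi_pos.ne']
    simp only [Set.mem_ofPred_eq, Set.mem_pi, Set.mem_univ, true_implies, Pi.smul_apply,
      smul_eq_mul, zero_add, Set.mem_Ioc]
    refine forall_congr' fun i => and_congr ?_ ?_
    · exact mul_pos_iff_of_pos_left (inv_pos.2 Real.two_pi_pos)
    · rw [inv_mul_le_iff₀ Real.two_pi_pos, mul_one]
  rw [h]
  exact Measure.univ_pi_Ioc_ae_eq_Icc

section Torus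

attribute [local instance] instMeasureSpaceUnitAddCircle

local instance : IsProbabilityMeasure (volume : Measure UnitAddCircle) :=
  inferInstanceAs (IsProbabilityMeasure AddCircle.haarAddCircle)

open scoped Pointwise in
/-- Integrals over the unit torus as integrals over the cell. -/
lemma integral_unitAddTorus {E : Type*} [NormedAddCommGroup E] [NormedSpace ℝ E]
    (g : UnitAddTorus (Fin d) → E) (f : Pt d → E)
    (h : ∀ x : Pt d, g (fun i => (x i : UnitAddCircle)) = f ((2 * Real.pi) • x)) :
    ∫ y, g y = ((2 * Real.pi) ^ d)⁻¹ • ∫ x in cell d, f x := by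
  rw [UnitAddTorus.integral_preimage g fun _ => 0]
  simp only [h]
  rw [Measure.setIntegral_comp_smul volume f _ Real.two_pi_pos.ne',
    setIntegral_congr_set (smul_Ioc_ae_eq_cell d)]
  simp [abs_of_pos, Real.two_pi_pos]

lemma isOpenQuotientMap_torus (d : ℕ) :
    IsOpenQuotientMap fun (x : Pt d) (i : Fin d) => (x i : UnitAddCircle) :=
  IsOpenQuotientMap.piMap fun _ => QuotientAddGroup.isOpenQuotientMap_mk

/-- A continuous periodic function descends to the unit torus. -/
lemma exists_torus_lift {f : Pt d → ℂ} (hf : Continuous f) (hp : TorusPeriodic f) :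
    ∃ g : C(UnitAddTorus (Fin d), ℂ),
      ∀ x : Pt d, g (fun i => (x i : UnitAddCircle)) = f ((2 * Real.pi) • x) := by
  set π : Pt d → UnitAddTorus (Fin d) := fun x i => (x i : UnitAddCircle) with hπ
  have hq := isOpenQuotientMap_torus d
  have key : ∀ x y : Pt d, π x = π y → f ((2 * Real.pi) • x) = f ((2 * Real.pi) • y) := by
    intro x y hxy
    have : ∀ i, ∃ n : ℤ, n • (1 : ℝ) = x i - y i := fun i => by
      rw [← AddCircle.coe_eq_zero_iff, AddCircle.coe_sub, sub_eq_zero]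
      exact congrFun hxy i
    choose n hn using this
    rw [← hp ((2 * Real.pi) • y) n]
    congr 1
    funext i
    have := hn i
    simp only [zsmul_eq_mul, mul_one] at this
    simp only [Pi.smul_apply, smul_eq_mul, this]
    ring
  choose r hr using hq.surjective
  refine ⟨⟨fun y => f ((2 * Real.pi) • r y), ?_⟩, fun x => key _ _ (hr _)⟩
  rw [hq.isQuotientMap.continuous_iff]
  have : (fun y => f ((2 * Real.pi) • r y)) ∘ (fun (x : Pt d) (i : Fin d) => (x i : UnitAddCircle))
      = fun x => f ((2 * Real.pi) • x) := by
    funext x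
    exact key _ _ (hr _)
  rw [this]
  fun_prop

/-- The unit torus has period `1`, so its point `x` corresponds to `2π x` in the cell; this is the
origin of the dilations by `2π`. -/
lemma mFourier_coe (k : Freq d) (x : Pt d) :
    UnitAddTorus.mFourier k (fun i => (x i : UnitAddCircle)) = character k ((2 * Real.pi) • x) := by
  simp only [UnitAddTorus.mFourier, ContinuousMap.coe_mk, fourier_coe_apply]
  rw [← Complex.exp_sum, character_eq]
  congr 1
  simp only [phase, Pi.smul_apply, smul_eq_mul]
  push_cast
  rw [Finset.mul_sum]
  exact Finset.sum_congr rfl fun i _ => by ring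

lemma mFourierCoeff_eq_fourier {g : UnitAddTorus (Fin d) → ℂ} {f : Pt d → ℂ}
    (h : ∀ x : Pt d, g (fun i => (x i : UnitAddCircle)) = f ((2 * Real.pi) • x)) (k : Freq d) :
    UnitAddTorus.mFourierCoeff g k = fourier f k := by
  rw [UnitAddTorus.mFourierCoeff, integral_unitAddTorus _ (fun x => character (-k) x * f x),
    fourier, Complex.real_smul]
  intro x
  rw [h, mFourier_coe, smul_eq_mul]

/-- Fourier inversion for periodic functions with summable Fourier coefficients. -/
lemma hasSum_fourier {f : Pt d → ℂ} (hf : Continuous f) (hp : TorusPeriodic f)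
    (hs : ∑' k, ‖fourier f k‖ₑ < ⊤) (x : Pt d) :
    HasSum (fun k => fourier f k * character k x) (f x) := by
  obtain ⟨g, hg⟩ := exists_torus_lift hf hp
  have hc : UnitAddTorus.mFourierCoeff g = fourier f := funext (mFourierCoeff_eq_fourier hg)
  have h := UnitAddTorus.hasSum_mFourier_series_apply_of_summable (f := g)
    (by rw [hc]; exact summable_of_tsum_enorm_lt_top hs)
    (fun i => (((2 * Real.pi)⁻¹ • x) i : UnitAddCircle))
  rw [hg, hc] at h
  simp only [mFourier_coe, smul_inv_smul₀ Real.two_pi_pos.ne', smul_eq_mul] at h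
  exact h

/-- Parseval's identity for continuous periodic functions. -/
lemma hasSum_sq_fourier {f : Pt d → ℂ} (hf : Continuous f) (hp : TorusPeriodic f) :
    HasSum (fun k => ‖fourier f k‖ ^ 2) (((2 * Real.pi) ^ d)⁻¹ * ∫ x in cell d, ‖f x‖ ^ 2) := by
  obtain ⟨g, hg⟩ := exists_torus_lift hf hp
  have h := UnitAddTorus.hasSum_sq_mFourierCoeff (ContinuousMap.toLp 2 volume ℂ g)
  simp only [UnitAddTorus.mFourierCoeff_toLp, mFourierCoeff_eq_fourier hg] at h
  convert h using 1
  rw [← smul_eq_mul, ← integral_unitAddTorus (fun y => ‖g y‖ ^ 2) _ fun x => by rw [hg]]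
  refine integral_congr_ae ?_
  filter_upwards [ContinuousMap.coeFn_toLp (p := 2) (𝕜 := ℂ) volume g] with y hy
  rw [hy]

lemma sobSq_zero_eq {f : Pt d → ℂ} (hf : Continuous f) (hp : TorusPeriodic f) :
    sobSq 0 (fourier f) = ENNReal.ofReal (((2 * Real.pi) ^ d)⁻¹ * ∫ x in cell d, ‖f x‖ ^ 2) := by
  have h := hasSum_sq_fourier hf hp
  rw [sobSq_eq, ← h.tsum_eq, ENNReal.ofReal_tsum_of_nonneg (fun _ => sq_nonneg _) h.summable]
  refine tsum_congr fun k => ?_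
  rw [wt_zero, one_mul, ENNReal.ofReal_pow (norm_nonneg _), ofReal_norm]

end Torus

/-- Bessel's inequality with the supremum norm. -/
lemma sobSq_zero_le_of_bound {f : Pt d → ℂ} (hf : Continuous f) (hp : TorusPeriodic f) {B : ℝ}
    (hB : ∀ x, ‖f x‖ ≤ B) : sobSq 0 (fourier f) ≤ ENNReal.ofReal (B ^ 2) := by
  rw [sobSq_zero_eq hf hp]
  refine ENNReal.ofReal_le_ofReal ?_
  have hv : (0 : ℝ) < (2 * Real.pi) ^ d := by positivity
  rw [inv_mul_le_iff₀ hv]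
  calc ∫ x in cell d, ‖f x‖ ^ 2 ≤ ∫ _x in cell d, B ^ 2 := by
        refine setIntegral_mono (integrableOn_cell_of_continuous (by fun_prop))
          (integrableOn_cell_of_continuous continuous_const) fun x => ?_
        exact pow_le_pow_left₀ (norm_nonneg _) (hB x) 2
    _ = _ := by
        rw [setIntegral_const, Measure.real, volume_cell, ENNReal.toReal_ofReal hv.le, smul_eq_mul]

/-! ## Algebraic properties of Fourier coefficients -/

lemma integrableOn_character_mul {f : Pt d → ℂ} (hf : IntegrableOn f (cell d)) (k : Freq d) :
    IntegrableOn (fun x => character k x * f x) (cell d) := by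
  refine Integrable.bdd_mul (c := 1) hf (continuous_character k).aestronglyMeasurable ?_
  exact Filter.Eventually.of_forall fun x => (norm_character k x).le

lemma fourier_add {f g : Pt d → ℂ} (hf : IntegrableOn f (cell d)) (hg : IntegrableOn g (cell d)) :
    fourier (fun x => f x + g x) = fourier f + fourier g := by
  funext k
  simp only [fourier, Pi.add_apply, mul_add]
  rw [integral_add (integrableOn_character_mul hf _) (integrableOn_character_mul hg _), mul_add]

lemma fourier_const_mul (z : ℂ) (f : Pt d → ℂ) :
    fourier (fun x => z * f x) = z • fourier f := by
  funext k
  simp only [fourier, Pi.smul_apply, smul_eq_mul, mul_left_comm _ z]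
  rw [integral_const_mul]
  ring

lemma fourier_sub {f g : Pt d → ℂ} (hf : IntegrableOn f (cell d)) (hg : IntegrableOn g (cell d)) :
    fourier (fun x => f x - g x) = fourier f - fourier g := by
  funext k
  simp only [fourier, Pi.sub_apply, mul_sub]
  rw [integral_sub (integrableOn_character_mul hf _) (integrableOn_character_mul hg _), mul_sub]

lemma fourier_sum {ι : Type*} (s : Finset ι) {f : ι → Pt d → ℂ}
    (hf : ∀ i ∈ s, IntegrableOn (f i) (cell d)) :
    fourier (fun x => ∑ i ∈ s, f i x) = ∑ i ∈ s, fourier (f i) := by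
  funext k
  simp only [fourier, Finset.sum_apply, Finset.mul_sum]
  rw [integral_finsetSum s fun i hi => integrableOn_character_mul (hf i hi) _, Finset.mul_sum]

lemma norm_fourier_le_of_bound {f : Pt d → ℂ} {B : ℝ} (hB : ∀ x ∈ cell d, ‖f x‖ ≤ B)
    (k : Freq d) : ‖fourier f k‖ ≤ B := by
  have hv : (0 : ℝ) < (2 * Real.pi) ^ d := by positivity
  have h : ‖∫ x in cell d, character (-k) x * f x‖ ≤ B * (2 * Real.pi) ^ d := by
    have := norm_setIntegral_le_of_norm_le_const (volume_cell_lt_top d)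
      (f := fun x => character (-k) x * f x) (C := B)
      fun x hx => by rw [norm_mul, norm_character, one_mul]; exact hB x hx
    rwa [Measure.real, volume_cell, ENNReal.toReal_ofReal hv.le] at this
  rw [fourier, norm_mul, Complex.norm_real, Real.norm_of_nonneg (inv_nonneg.2 hv.le),
    inv_mul_le_iff₀ hv, mul_comm]
  exact h

lemma fourier_mul_character (f : Pt d → ℂ) (j k : Freq d) :
    fourier (fun x => f x * character j x) k = fourier f (k - j) := by
  simp only [fourier]
  congr 2
  funext x
  rw [neg_sub, sub_eq_neg_add, character_add]
  ring

/-- The coefficient at zero is a mean value. It already exhausts Parseval's identity, so all others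
vanish, and no exponential has to be integrated. -/
lemma fourier_one : fourier (fun _ : Pt d => (1 : ℂ)) = Pi.single 0 1 := by
  have h0 : fourier (fun _ : Pt d => (1 : ℂ)) 0 = 1 := by
    have hv : (0 : ℝ) < (2 * Real.pi) ^ d := by positivity
    simp only [fourier, neg_zero, character_zero, mul_one, setIntegral_const, Measure.real,
      volume_cell, ENNReal.toReal_ofReal hv.le, Complex.real_smul]
    rw [← Complex.ofReal_mul, inv_mul_cancel₀ hv.ne', Complex.ofReal_one]
  have hp : TorusPeriodic fun _ : Pt d => (1 : ℂ) := fun _ _ => rfl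
  have hs := hasSum_sq_fourier (continuous_const (y := (1 : ℂ))) hp
  have hv : (0 : ℝ) < (2 * Real.pi) ^ d := by positivity
  have h1 : ((2 * Real.pi) ^ d)⁻¹ * ∫ _x in cell d, ‖(1 : ℂ)‖ ^ 2 = 1 := by
    simp only [norm_one, one_pow, setIntegral_const, Measure.real, volume_cell,
      ENNReal.toReal_ofReal hv.le, smul_eq_mul, mul_one]
    exact inv_mul_cancel₀ hv.ne'
  rw [h1] at hs
  funext k
  by_cases hk : k = 0
  · subst hk; simpa using h0
  · rw [Pi.single_eq_of_ne hk]
    have h2 := sum_le_hasSum {0, k} (fun i _ => sq_nonneg _) hs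
    rw [Finset.sum_pair (Ne.symm hk), h0] at h2
    simp only [norm_one, one_pow] at h2
    have : ‖fourier (fun _ : Pt d => (1 : ℂ)) k‖ ^ 2 ≤ 0 := by linarith
    simpa using pow_eq_zero_iff (two_ne_zero) |>.1 (le_antisymm this (sq_nonneg _))

lemma fourier_character (j : Freq d) : fourier (character j) = Pi.single j 1 := by
  funext k
  have h := fourier_mul_character (fun _ => (1 : ℂ)) j k
  simp only [one_mul] at h
  rw [show fourier (character j) k = fourier (fun x => character j x) k from rfl, h, fourier_one]
  by_cases hk : k = j
  · subst hk; simp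
  · rw [Pi.single_eq_of_ne hk, Pi.single_eq_of_ne (sub_ne_zero.2 hk)]

/-- The Fourier coefficients of a product with an absolutely convergent Fourier series. -/
lemma fourier_mul_of_hasSum {f g : Pt d → ℂ} (hf : IntegrableOn f (cell d)) {c : Coeffs d}
    (hc : ∑' k, ‖c k‖ₑ < ⊤) (hg : ∀ x, HasSum (fun k => c k * character k x) (g x)) :
    fourier (fun x => f x * g x) = conv (fourier f) c := by
  funext k
  have hi : ∀ l : Freq d, IntegrableOn (fun x => character (-k) x * (f x * (c l * character l x)))
      (cell d) := fun l => by
    refine integrableOn_character_mul ?_ _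
    have := (integrableOn_character_mul hf l).const_mul (c l)
    refine this.congr (Filter.Eventually.of_forall fun x => ?_)
    ring
  have hsum : ∑' l : Freq d, ∫⁻ x in cell d, ‖character (-k) x * (f x * (c l * character l x))‖ₑ
      ≠ ⊤ := by
    have : ∀ l : Freq d, ∫⁻ x in cell d, ‖character (-k) x * (f x * (c l * character l x))‖ₑ
        = ‖c l‖ₑ * ∫⁻ x in cell d, ‖f x‖ₑ := fun l => by
      rw [← lintegral_const_mul' _ _ enorm_ne_top]
      refine lintegral_congr fun x => ?_
      simp only [enorm_mul, enorm_character]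
      ring
    simp only [this, ENNReal.tsum_mul_right]
    exact (ENNReal.mul_lt_top hc hf.2).ne
  have h := integral_tsum (μ := volume.restrict (cell d))
    (fun l => (hi l).aestronglyMeasurable) hsum
  have hpt : ∀ x, ∑' l, character (-k) x * (f x * (c l * character l x))
      = character (-k) x * (f x * g x) := fun x =>
    (((hg x).mul_left (f x)).mul_left (character (-k) x)).tsum_eq
  simp only [hpt] at h
  rw [fourier, h, ← tsum_mul_left, conv]
  refine tsum_congr fun l => ?_
  rw [← fourier_mul_character f l k, fourier, mul_assoc, ← integral_mul_const]
  congr 2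
  funext x
  ring

lemma fourier_of_hasSum {g : Pt d → ℂ} {c : Coeffs d} (hc : ∑' k, ‖c k‖ₑ < ⊤)
    (hg : ∀ x, HasSum (fun k => c k * character k x) (g x)) : fourier g = c := by
  have h := fourier_mul_of_hasSum (f := fun _ => (1 : ℂ))
    (integrableOn_cell_of_continuous continuous_const) hc hg
  simp only [one_mul] at h
  rw [h]
  funext k
  rw [conv, fourier_one, tsum_eq_single k]
  · simp
  · intro l hl
    rw [Pi.single_eq_of_ne (sub_ne_zero.2 (Ne.symm hl)), zero_mul]

lemma fourier_mul {f g : Pt d → ℂ} (hf : IntegrableOn f (cell d)) (hg : Continuous g)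
    (hgp : TorusPeriodic g) (hc : ∑' k, ‖fourier g k‖ₑ < ⊤) :
    fourier (fun x => f x * g x) = conv (fourier f) (fourier g) :=
  fourier_mul_of_hasSum hf hc (hasSum_fourier hg hgp hc)

/-! ## Fourier coefficients of derivatives -/

lemma TorusPeriodic.add_single {F : Type*} {f : Pt d → F} (hp : TorusPeriodic f) (x : Pt d)
    (i : Fin d) : f (x + Pi.single i (2 * Real.pi)) = f x := by
  rw [← hp x (Pi.single i 1)]
  congr 1
  funext j
  by_cases h : j = i
  · subst h; simp
  · simp [h]

lemma TorusPeriodic.fderiv {F : Type*} [NormedAddCommGroup F] [NormedSpace ℝ F] {f : Pt d → F}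
    (hp : TorusPeriodic f) : TorusPeriodic (fderiv ℝ f) := by
  intro x k
  have h : (fun y : Pt d => f (y + fun i => 2 * Real.pi * (k i : ℝ))) = f :=
    funext fun y => hp y k
  conv_rhs => rw [← h]
  rw [fderiv_comp_add_right]
  rfl

lemma TorusPeriodic.pderiv {F : Type*} [NormedAddCommGroup F] [NormedSpace ℝ F] {f : Pt d → F}
    (hp : TorusPeriodic f) (i : Fin d) : TorusPeriodic (pderiv i f) := fun x k => by
  simp only [MFG.pderiv]
  rw [hp.fderiv x k]

lemma _root_.ContDiff.pderiv {F : Type*} [NormedAddCommGroup F] [NormedSpace ℝ F]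
    {m n : WithTop ℕ∞} {f : Pt d → F} (hf : ContDiff ℝ n f) (h : m + 1 ≤ n) (i : Fin d) :
    ContDiff ℝ m (MFG.pderiv i f) :=
  (hf.fderiv_right h).clm_apply contDiff_const

lemma IsTest.pderiv {φ : Pt d → ℂ} (h : IsTest φ) (i : Fin d) : IsTest (pderiv i φ) :=
  ⟨h.1.pderiv (by simp) i, h.2.pderiv i⟩

/-- The divergence theorem on the cell, for the field whose only nonzero component is `f` in
direction `i`; by periodicity the two opposite faces cancel. -/
lemma integral_pderiv_eq_zero {f : Pt d → ℂ} (hf : ContDiff ℝ 1 f) (hp : TorusPeriodic f)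
    (i : Fin d) : ∫ x in cell d, pderiv i f x = 0 := by
  -- The divergence theorem is for dimension `n + 1`; the index `i : Fin d` shows that `d` is
  -- positive.
  obtain ⟨n, rfl⟩ : ∃ n, d = n + 1 := ⟨d - 1, by have := i.pos; omega⟩
  have hc : Continuous (pderiv i f) := (hf.pderiv (m := 0) (by simp) i).continuous
  have h := integral_divergence_of_hasFDerivAt_off_countable' (E := ℂ)
    (fun _ : Fin (n + 1) => (0 : ℝ)) (fun _ => 2 * Real.pi)
    (fun _ => Real.two_pi_pos.le) (fun j => if j = i then f else 0)
    (fun j x => if j = i then fderiv ℝ f x else 0) ∅ Set.countable_empty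
    (fun j => by
      by_cases hj : j = i
      · simp only [hj, if_true]; exact hf.continuous.continuousOn
      · simp only [hj, if_false]; exact continuous_zero.continuousOn)
    (fun x _ j => by
      by_cases hj : j = i
      · simp only [hj, if_true]
        exact (hf.differentiable one_ne_zero x).hasFDerivAt
      · simp only [hj, if_false]; exact hasFDerivAt_const (0 : ℂ) x)
    (by
      refine (integrableOn_cell_of_continuous hc).congr (Filter.Eventually.of_forall fun x => ?_)
      simp only [pderiv]
      rw [Finset.sum_eq_single i]
      · simp
      · intro j _ hj; simp [hj]
      · simp)
  have e : ∀ x, ∑ j, (if j = i then fderiv ℝ f x else 0) (Pi.single j 1) = pderiv i f x := by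
    intro x
    rw [Finset.sum_eq_single i]
    · simp [pderiv]
    · intro j _ hj; simp [hj]
    · simp
  simp only [e] at h
  rw [cell, h]
  refine Finset.sum_eq_zero fun j _ => ?_
  by_cases hj : j = i
  · subst hj
    simp only [if_true]
    rw [sub_eq_zero]
    congr 1
    funext x
    rw [← hp.add_single (j.insertNth 0 x) j]
    congr 1
    funext l
    refine Fin.succAboveCases j ?_ (fun l => ?_) l
    · simp
    · simp
  · simp [hj]

lemma pderiv_mul {f g : Pt d → ℂ} {x : Pt d} (hf : DifferentiableAt ℝ f x)
    (hg : DifferentiableAt ℝ g x) (i : Fin d) :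
    pderiv i (fun x => f x * g x) x = f x * pderiv i g x + pderiv i f x * g x := by
  rw [pderiv, fderiv_fun_mul hf hg]
  simp only [pderiv, add_apply, smul_apply, smul_eq_mul]
  ring

/-- Integration by parts: the derivative of the periodic function `e^{-ik·x} f` has integral zero.
-/
lemma fourier_pderiv {f : Pt d → ℂ} (hf : ContDiff ℝ 1 f) (hp : TorusPeriodic f) (i : Fin d) :
    fourier (pderiv i f) = distPartial i (fourier f) := by
  funext k
  have h := integral_pderiv_eq_zero (f := fun x => character (-k) x * f x)
    ((contDiff_character (-k)).mul hf) (fun x l => by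
      simp only [character_periodic (-k) x l, hp x l]) i
  have hd : ∀ x, pderiv i (fun x => character (-k) x * f x) x =
      character (-k) x * pderiv i f x - Complex.I * (k i : ℂ) * (character (-k) x * f x) := by
    intro x
    rw [pderiv_mul ((contDiff_character (n := 1) (-k)).differentiable one_ne_zero x)
      (hf.differentiable one_ne_zero x), pderiv_character]
    push_cast [Pi.neg_apply]
    ring
  have hc : Continuous (pderiv i f) := (hf.pderiv (m := 0) (by simp) i).continuous
  simp only [hd] at h
  rw [integral_sub (integrableOn_character_mul (integrableOn_cell_of_continuous hc) _)
    ((integrableOn_character_mul (integrableOn_cell_of_continuous hf.continuous) _).const_mul _),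
    integral_const_mul, sub_eq_zero] at h
  rw [fourier, h, distPartial, fourier]
  ring

/-- From `1 + |k|² = 1 + ∑ k_i²`. As this is an identity and not only an equivalence of norms,
induction on the order produces no constants. -/
lemma sobSq_add_one (σ : ℝ) (c : Coeffs d) :
    sobSq (σ + 1) c = sobSq σ c + ∑ i, sobSq σ (distPartial i c) := by
  simp only [sobSq_eq]
  rw [← Summable.tsum_finsetSum (fun _ _ => ENNReal.summable), ← ENNReal.tsum_add]
  refine tsum_congr fun k => ?_
  have h1 : wt 1 k = 1 + ∑ i, ‖((k i : ℤ) : ℂ)‖ₑ ^ 2 := by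
    rw [wt, Real.rpow_one, ENNReal.ofReal_add zero_le_one (freqSq_nonneg k), ENNReal.ofReal_one,
      freqSq, ENNReal.ofReal_sum_of_nonneg fun _ _ => sq_nonneg _]
    congr 1
    refine Finset.sum_congr rfl fun i _ => ?_
    rw [← ofReal_norm, ← ENNReal.ofReal_pow (norm_nonneg _), Complex.norm_intCast, sq_abs]
  have h2 : ∀ i, ‖distPartial i c k‖ₑ ^ 2 = ‖((k i : ℤ) : ℂ)‖ₑ ^ 2 * ‖c k‖ₑ ^ 2 := fun i => by
    rw [distPartial, enorm_mul, enorm_mul, mul_pow, mul_pow]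
    simp [← ofReal_norm]
  simp only [h2]
  rw [wt_add, h1, ← Finset.mul_sum, ← Finset.sum_mul]
  ring

lemma sobSq_distPartial_le (σ : ℝ) (c : Coeffs d) (i : Fin d) :
    sobSq σ (distPartial i c) ≤ sobSq (σ + 1) c := by
  rw [sobSq_add_one]
  exact (Finset.single_le_sum (f := fun i => sobSq σ (distPartial i c))
    (fun _ _ => bot_le) (Finset.mem_univ i)).trans le_add_self

lemma sobSq_fourier_test_nat (n : ℕ) : ∀ {φ : Pt d → ℂ}, IsTest φ →
    sobSq n (fourier φ) < ⊤ := by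
  induction n with
  | zero =>
    intro φ hφ
    rw [Nat.cast_zero, sobSq_zero_eq hφ.1.continuous hφ.2]
    exact ENNReal.ofReal_lt_top
  | succ n ih =>
    intro φ hφ
    rw [Nat.cast_succ, sobSq_add_one, ENNReal.add_lt_top]
    refine ⟨ih hφ, ENNReal.sum_lt_top.2 fun i _ => ?_⟩
    rw [← fourier_pderiv (hφ.1.of_le (by exact_mod_cast le_top)) hφ.2]
    exact ih (hφ.pderiv i)

lemma sobSq_fourier_test (σ : ℝ) {φ : Pt d → ℂ} (hφ : IsTest φ) : sobSq σ (fourier φ) < ⊤ := by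
  obtain ⟨n, hn⟩ := exists_nat_ge σ
  exact (sobSq_mono hn _).trans_lt (sobSq_fourier_test_nat n hφ)

lemma wien_lt_top_of_sobSq {τ r : ℝ} {c : Coeffs d} (hr : (d : ℝ) / 2 < r)
    (h : sobSq (τ + r) c < ⊤) : wien τ c < ⊤ := by
  have := (wien_sq_le τ r c).trans_lt (ENNReal.mul_lt_top (wtSum_lt_top hr) h)
  exact (ENNReal.pow_lt_top_iff.1 this).resolve_right (by norm_num)

lemma wien_fourier_test (τ : ℝ) {φ : Pt d → ℂ} (hφ : IsTest φ) : wien τ (fourier φ) < ⊤ :=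
  wien_lt_top_of_sobSq (r := d / 2 + 1) (by linarith) (sobSq_fourier_test _ hφ)

/-! ## Real functions -/

lemma isRealDist_fourierR (f : Pt d → ℝ) : IsRealDist (fourierR f) := by
  intro k
  simp only [fourierR, fourier, map_mul, Complex.conj_ofReal, ← integral_conj]
  congr 2
  funext x
  rw [← character_neg]

lemma integrableOn_ofReal {f : Pt d → ℝ} (hf : IntegrableOn f (cell d)) :
    IntegrableOn (fun x => (f x : ℂ)) (cell d) := hf.ofReal

lemma TorusPeriodic.ofReal {f : Pt d → ℝ} (hf : TorusPeriodic f) :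
    TorusPeriodic fun x => (f x : ℂ) := fun x k => by simp only [hf x k]

lemma fourierR_add {f g : Pt d → ℝ} (hf : IntegrableOn f (cell d)) (hg : IntegrableOn g (cell d)) :
    fourierR (fun x => f x + g x) = fourierR f + fourierR g := by
  simp only [fourierR, Complex.ofReal_add]
  exact fourier_add hf.ofReal hg.ofReal

lemma fourierR_sub {f g : Pt d → ℝ} (hf : IntegrableOn f (cell d)) (hg : IntegrableOn g (cell d)) :
    fourierR (fun x => f x - g x) = fourierR f - fourierR g := by
  simp only [fourierR, Complex.ofReal_sub]
  exact fourier_sub hf.ofReal hg.ofReal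

lemma fourierR_const_mul (a : ℝ) (f : Pt d → ℝ) :
    fourierR (fun x => a * f x) = (a : ℂ) • fourierR f := by
  simp only [fourierR, Complex.ofReal_mul]
  exact fourier_const_mul _ _

lemma fourierR_sum {ι : Type*} (s : Finset ι) {f : ι → Pt d → ℝ}
    (hf : ∀ i ∈ s, IntegrableOn (f i) (cell d)) :
    fourierR (fun x => ∑ i ∈ s, f i x) = ∑ i ∈ s, fourierR (f i) := by
  simp only [fourierR, Complex.ofReal_sum]
  exact fourier_sum s fun i hi => (hf i hi).ofReal

lemma fourierR_mul {f g : Pt d → ℝ} (hf : IntegrableOn f (cell d)) (hg : Continuous g)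
    (hgp : TorusPeriodic g) (hc : wien 0 (fourierR g) < ⊤) :
    fourierR (fun x => f x * g x) = conv (fourierR f) (fourierR g) := by
  rw [wien_zero] at hc
  have h := fourier_mul (integrableOn_ofReal hf) (Complex.continuous_ofReal.comp hg) hgp.ofReal hc
  simpa only [fourierR, Complex.ofReal_mul, Function.comp_def] using h

lemma pderiv_ofReal {f : Pt d → ℝ} {x : Pt d} (hf : DifferentiableAt ℝ f x) (i : Fin d) :
    pderiv i (fun x => (f x : ℂ)) x = ((pderiv i f x : ℝ) : ℂ) := by
  have h : HasFDerivAt (fun x => (f x : ℂ)) (Complex.ofRealCLM.comp (fderiv ℝ f x)) x :=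
    Complex.ofRealCLM.hasFDerivAt.comp x hf.hasFDerivAt
  rw [pderiv, h.fderiv]
  rfl

lemma fourierR_pderiv {f : Pt d → ℝ} (hf : ContDiff ℝ 1 f) (hp : TorusPeriodic f) (i : Fin d) :
    fourierR (pderiv i f) = distPartial i (fourierR f) := by
  have h := fourier_pderiv (f := fun x => (f x : ℂ)) (Complex.ofRealCLM.contDiff.comp hf)
    hp.ofReal i
  rw [fourierR, fourierR, ← h]
  congr 1
  funext x
  exact (pderiv_ofReal (hf.differentiable one_ne_zero x) i).symm

/-- Fourier inversion. No summability is needed, because otherwise the right side is infinite. -/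
lemma norm_le_wien {f : Pt d → ℝ} (hf : Continuous f) (hp : TorusPeriodic f) (x : Pt d) :
    ENNReal.ofReal |f x| ≤ wien 0 (fourierR f) := by
  by_cases h : wien 0 (fourierR f) < ⊤
  · rw [wien_zero] at h ⊢
    have hs := hasSum_fourier (Complex.continuous_ofReal.comp hf) hp.ofReal h x
    have h1 : ‖((f x : ℝ) : ℂ)‖ₑ ≤ ∑' k, ‖fourierR f k * character k x‖ₑ := by
      rw [show ((f x : ℝ) : ℂ) = ∑' k, fourierR f k * character k x from hs.tsum_eq.symm]
      exact enorm_tsum_le_tsum_enorm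
    simp only [enorm_mul, enorm_character, mul_one] at h1
    rwa [← ofReal_norm, Complex.norm_real, Real.norm_eq_abs] at h1
  · rw [not_lt_top_iff.1 h]; exact le_top

/-! ## The duality pairing with characters -/

lemma pair_character (c : Coeffs d) (k : Freq d) :
    pair c (character (-k)) = (((2 * Real.pi) ^ d : ℝ) : ℂ) * c k := by
  rw [pair, fourier_character]
  congr 1
  rw [tsum_eq_single k]
  · simp
  · intro l hl
    rw [Pi.single_eq_of_ne (fun h => hl (neg_injective h)), mul_zero]

/-! ## Functions on the phase space along curves -/

lemma conv_comm (f c : Coeffs d) : conv f c = conv c f := by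
  funext k
  rw [conv, conv, ← (Equiv.subLeft k).tsum_eq]
  refine tsum_congr fun l => ?_
  simp [mul_comm]

/-- The phase space of all `(x, p, q)`. -/
abbrev Phase (d : ℕ) := Pt d × Pt d × ℝ

lemma uniqueDiffOn_phaseDomain (d : ℕ) : UniqueDiffOn ℝ (phaseDomain d) := by
  have h : phaseDomain d = (univ : Set (Pt d)) ×ˢ ((univ : Set (Pt d)) ×ˢ Ici (0 : ℝ)) := by
    ext z; simp [phaseDomain]
  rw [h]
  exact uniqueDiffOn_univ.prod (uniqueDiffOn_univ.prod (uniqueDiffOn_Ici 0))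

/-- `F` is of class `C^n` on the phase space, periodic in `x`, and its derivatives of order at most
`n` are bounded by `B` on `K`. -/
structure PhaseReg (n : ℕ) (K : Set (Phase d)) (B : ℝ) (F : Phase d → ℝ) : Prop where
  contDiff : ContDiffOn ℝ n F (phaseDomain d)
  periodic : ∀ z ∈ phaseDomain d, ∀ k : Freq d,
    F (fun i => z.1 i + 2 * Real.pi * (k i : ℝ), z.2) = F z
  bound : ∀ m ≤ n, ∀ z ∈ K, ‖iteratedFDerivWithin ℝ m F (phaseDomain d) z‖ ≤ B

lemma PhaseReg.mono {n m : ℕ} {K K' : Set (Phase d)} {B : ℝ} {F : Phase d → ℝ}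
    (h : PhaseReg n K B F) (hm : m ≤ n) (hK : K' ⊆ K) : PhaseReg m K' B F :=
  ⟨h.contDiff.of_le (by exact_mod_cast hm), h.periodic,
    fun i hi z hz => h.bound i (hi.trans hm) z (hK hz)⟩

lemma PhaseReg.abs_le {n : ℕ} {K : Set (Phase d)} {B : ℝ} {F : Phase d → ℝ}
    (h : PhaseReg n K B F) {z : Phase d} (hz : z ∈ K) : |F z| ≤ B := by
  have := h.bound 0 (Nat.zero_le n) z hz
  rwa [norm_iteratedFDerivWithin_zero] at this

/-- The derivative in the direction `e`. -/
def dirDeriv (F : Phase d → ℝ) (e : Phase d) : Phase d → ℝ := fun z =>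
  fderivWithin ℝ F (phaseDomain d) z e

/-- Evaluation at the fixed vector `e` commutes with further differentiation, so the derivative of
order `n` of `dirDeriv F e` is that of order `n + 1` of `F` with one slot filled. -/
lemma norm_iteratedFDerivWithin_dirDeriv_le {n : ℕ} {F : Phase d → ℝ}
    (h : ContDiffOn ℝ (n + 1 : ℕ) F (phaseDomain d)) {e z : Phase d} (hz : z ∈ phaseDomain d) :
    ‖iteratedFDerivWithin ℝ n (dirDeriv F e) (phaseDomain d) z‖ ≤
      ‖iteratedFDerivWithin ℝ (n + 1) F (phaseDomain d) z‖ * ‖e‖ := by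
  have hu := uniqueDiffOn_phaseDomain d
  have hc : ContDiffOn ℝ n (fderivWithin ℝ F (phaseDomain d)) (phaseDomain d) :=
    h.fderivWithin hu (by norm_cast)
  rw [← norm_iteratedFDerivWithin_fderivWithin hu hz]
  refine ContinuousMultilinearMap.opNorm_le_bound (by positivity) fun m => ?_
  have := iteratedFDerivWithin_clm_apply_const_apply hu hc le_rfl hz (u := e) (m := m)
  rw [show iteratedFDerivWithin ℝ n (dirDeriv F e) (phaseDomain d) z m = _ from this]
  refine (ContinuousLinearMap.le_opNorm _ _).trans ?_
  rw [mul_right_comm]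
  gcongr
  exact ContinuousMultilinearMap.le_opNorm _ _

lemma mapsTo_shift_phaseDomain (k : Freq d) :
    MapsTo (fun z : Phase d => ((fun i => z.1 i + 2 * Real.pi * (k i : ℝ), z.2) : Phase d))
      (phaseDomain d) (phaseDomain d) := fun _ hz => hz

lemma hasFDerivAt_shift (k : Freq d) (z : Phase d) :
    HasFDerivAt (fun z : Phase d => ((fun i => z.1 i + 2 * Real.pi * (k i : ℝ), z.2) : Phase d))
      (ContinuousLinearMap.id ℝ (Phase d)) z := by
  have : (fun z : Phase d => ((fun i => z.1 i + 2 * Real.pi * (k i : ℝ), z.2) : Phase d))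
      = fun z => z + ((fun i => 2 * Real.pi * (k i : ℝ), 0) : Phase d) := by
    funext z
    ext <;> simp
  rw [this]
  exact (hasFDerivAt_id z).add_const _

lemma dirDeriv_periodic {F : Phase d → ℝ} (hF : ContDiffOn ℝ 1 F (phaseDomain d))
    (hp : ∀ z ∈ phaseDomain d, ∀ k : Freq d,
      F (fun i => z.1 i + 2 * Real.pi * (k i : ℝ), z.2) = F z) (e : Phase d) :
    ∀ z ∈ phaseDomain d, ∀ k : Freq d,
      dirDeriv F e (fun i => z.1 i + 2 * Real.pi * (k i : ℝ), z.2) = dirDeriv F e z := by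
  intro z hz k
  have hd := hF.differentiableOn one_ne_zero
  have h1 := (hd _ (mapsTo_shift_phaseDomain k hz)).hasFDerivWithinAt.comp z
    (hasFDerivAt_shift k z).hasFDerivWithinAt (mapsTo_shift_phaseDomain k)
  have h2 := h1.congr (f₁ := F) (fun y hy => (hp y hy k).symm) (hp z hz k).symm
  rw [dirDeriv, dirDeriv, h2.fderivWithin (uniqueDiffOn_phaseDomain d z hz)]
  rfl

lemma PhaseReg.dirDeriv {n : ℕ} {K : Set (Phase d)} {B : ℝ} {F : Phase d → ℝ}
    (h : PhaseReg (n + 1) K B F) (hK : K ⊆ phaseDomain d) {e : Phase d} (he : ‖e‖ ≤ 1) :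
    PhaseReg n K B (dirDeriv F e) where
  contDiff := (h.contDiff.fderivWithin (uniqueDiffOn_phaseDomain d) (by norm_cast)).clm_apply
    contDiffOn_const
  periodic := dirDeriv_periodic (h.contDiff.of_le (by norm_cast; omega)) h.periodic e
  bound m hm z hz := by
    refine (norm_iteratedFDerivWithin_dirDeriv_le
      (h.contDiff.of_le (by exact_mod_cast Nat.succ_le_succ hm)) (hK hz)).trans ?_
    have hb := h.bound (m + 1) (Nat.succ_le_succ hm) z hz
    calc _ ≤ B * 1 := by
          gcongr
          exact (norm_nonneg _).trans hb
      _ = B := mul_one B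

/-- The curve `x ↦ (x, p(x), q(x))`, where `p = w (some ·)` and `q = w none`. -/
def curve (w : Option (Fin d) → Pt d → ℝ) (x : Pt d) : Phase d :=
  (x, (fun j => w (some j) x), w none x)

/-- Coordinate directions of `(p, q)`. -/
def fiberDir (d : ℕ) : Option (Fin d) → Phase d
  | none => (0, 0, 1)
  | some j => (0, Pi.single j 1, 0)

/-- Coordinate directions of `x`. -/
def baseDir (i : Fin d) : Phase d := (Pi.single i 1, 0, 0)

lemma norm_single_one_le (i : Fin d) : ‖(Pi.single i 1 : Pt d)‖ ≤ 1 := by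
  rw [pi_norm_le_iff_of_nonneg zero_le_one]
  intro j
  by_cases h : j = i
  · subst h; simp
  · simp [h]

lemma norm_fiberDir_le (b : Option (Fin d)) : ‖fiberDir d b‖ ≤ 1 := by
  cases b with
  | none => simp [fiberDir, Prod.norm_def]
  | some j => simpa [fiberDir, Prod.norm_def] using norm_single_one_le j

lemma norm_baseDir_le (i : Fin d) : ‖baseDir i‖ ≤ 1 := by
  simpa [baseDir, Prod.norm_def] using norm_single_one_le i

lemma contDiff_curve {n : WithTop ℕ∞} {w : Option (Fin d) → Pt d → ℝ}
    (hw : ∀ b, ContDiff ℝ n (w b)) : ContDiff ℝ n (curve w) :=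
  contDiff_id.prodMk ((contDiff_pi.2 fun j => hw (some j)).prodMk (hw none))

lemma continuous_curve {w : Option (Fin d) → Pt d → ℝ}
    (hw : ∀ b, Continuous (w b)) : Continuous (curve w) :=
  continuous_id.prodMk ((continuous_pi fun j => hw (some j)).prodMk (hw none))

lemma continuous_comp_curve {n : ℕ} {K : Set (Phase d)} {B : ℝ} {F : Phase d → ℝ}
    (h : PhaseReg n K B F) {w : Option (Fin d) → Pt d → ℝ} (hw : ∀ b, Continuous (w b))
    (hΩ : ∀ x, curve w x ∈ phaseDomain d) : Continuous fun x => F (curve w x) :=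
  h.contDiff.continuousOn.comp_continuous (continuous_curve hw) hΩ

lemma periodic_comp_curve {n : ℕ} {K : Set (Phase d)} {B : ℝ} {F : Phase d → ℝ}
    (h : PhaseReg n K B F) {w : Option (Fin d) → Pt d → ℝ} (hw : ∀ b, TorusPeriodic (w b))
    (hΩ : ∀ x, curve w x ∈ phaseDomain d) : TorusPeriodic fun x => F (curve w x) := by
  intro x k
  have := h.periodic (curve w x) (hΩ x) k
  simp only [curve] at this ⊢
  rw [← this]
  simp only [hw _ x k]

/-- The chain rule holds with derivatives within the half-space, because the curve never leaves it.
The composition is therefore differentiable even where the curve touches `q = 0`. -/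
lemma pderiv_comp_curve {F : Phase d → ℝ} (hF : ContDiffOn ℝ 1 F (phaseDomain d))
    {w : Option (Fin d) → Pt d → ℝ} (hw : ∀ b, ContDiff ℝ 1 (w b))
    (hΩ : ∀ x, curve w x ∈ phaseDomain d) (i : Fin d) (x : Pt d) :
    pderiv i (fun x => F (curve w x)) x =
      dirDeriv F (baseDir i) (curve w x) +
        ∑ b, dirDeriv F (fiberDir d b) (curve w x) * pderiv i (w b) x := by
  have hd : ∀ b, HasFDerivAt (w b) (fderiv ℝ (w b) x) x := fun b =>
    ((hw b).differentiable one_ne_zero x).hasFDerivAt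
  have hγ : HasFDerivAt (curve w) ((ContinuousLinearMap.id ℝ (Pt d)).prod
      ((ContinuousLinearMap.pi fun j => fderiv ℝ (w (some j)) x).prod (fderiv ℝ (w none) x))) x :=
    (hasFDerivAt_id x).prodMk ((hasFDerivAt_pi.2 fun j => hd (some j)).prodMk (hd none))
  have hFd := (hF.differentiableOn one_ne_zero _ (hΩ x)).hasFDerivWithinAt
  have h := hFd.comp_hasFDerivAt x hγ (Filter.Eventually.of_forall hΩ)
  have h' : HasFDerivAt (fun x => F (curve w x)) _ x := h
  rw [pderiv, h'.fderiv]
  have hv : ((ContinuousLinearMap.id ℝ (Pt d)).prod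
      ((ContinuousLinearMap.pi fun j => fderiv ℝ (w (some j)) x).prod (fderiv ℝ (w none) x)))
      (Pi.single i 1) = baseDir i + ∑ b, pderiv i (w b) x • fiberDir d b := by
    rw [Fintype.sum_option]
    simp only [fiberDir, baseDir, ContinuousLinearMap.prod_apply, ContinuousLinearMap.id_apply,
      Prod.smul_mk, smul_zero]
    ext l
    · simp [Prod.fst_sum]
    · simp [Prod.fst_sum, Prod.snd_sum, Finset.sum_apply, Pi.single_apply, pderiv]
    · simp [Prod.snd_sum, pderiv]
  rw [ContinuousLinearMap.comp_apply, hv, map_add, map_sum]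
  simp only [map_smul, smul_eq_mul, dirDeriv]
  congr 1
  exact Finset.sum_congr rfl fun b _ => mul_comm _ _

/-! ### Compositions with smooth curves, integer orders -/

/-- A smooth periodic curve with values in `K`. -/
structure SmoothCurve (K : Set (Phase d)) (w : Option (Fin d) → Pt d → ℝ) : Prop where
  contDiff : ∀ b, ContDiff ℝ ∞ (w b)
  periodic : ∀ b, TorusPeriodic (w b)
  mem : ∀ x, curve w x ∈ K

lemma IsTest.ofReal {f : Pt d → ℝ} (hf : ContDiff ℝ ∞ f) (hp : TorusPeriodic f) :
    IsTest fun x => (f x : ℂ) := ⟨Complex.ofRealCLM.contDiff.comp hf, hp.ofReal⟩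

lemma wien_fourierR_lt_top (τ : ℝ) {f : Pt d → ℝ} (hf : ContDiff ℝ ∞ f) (hp : TorusPeriodic f) :
    wien τ (fourierR f) < ⊤ := wien_fourier_test τ (IsTest.ofReal hf hp)

/-- The Sobolev norm of order `n + 1` of a composition, in terms of products of order `n`. -/
lemma sobSq_succ_comp_le {n : ℕ} {K : Set (Phase d)} (hK : K ⊆ phaseDomain d) {B : ℝ}
    {F : Phase d → ℝ} (hF : PhaseReg (n + 1) K B F) {w : Option (Fin d) → Pt d → ℝ}
    (hw : SmoothCurve K w) :
    sobSq (n + 1 : ℕ) (fourierR fun x => F (curve w x)) ≤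
      sobSq n (fourierR fun x => F (curve w x)) +
      ∑ i, (2 * sobSq n (fourierR fun x => dirDeriv F (baseDir i) (curve w x)) +
        2 * ((d + 1 : ℕ) * ∑ b, sobSq n (conv (fourierR (pderiv i (w b)))
          (fourierR fun x => dirDeriv F (fiberDir d b) (curve w x))))) := by
  have hΩ : ∀ x, curve w x ∈ phaseDomain d := fun x => hK (hw.mem x)
  have hw1 : ∀ b, ContDiff ℝ 1 (w b) := fun b => (hw.contDiff b).of_le (by exact_mod_cast le_top)
  have hF1 : ContDiffOn ℝ 1 F (phaseDomain d) := hF.contDiff.of_le (by norm_cast; omega)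
  have hc1 : ContDiff ℝ 1 fun x => F (curve w x) := hF1.comp_contDiff (contDiff_curve hw1) hΩ
  have hcont : ∀ e : Phase d, ‖e‖ ≤ 1 → Continuous fun x => dirDeriv F e (curve w x) :=
    fun e he => continuous_comp_curve (hF.dirDeriv hK he) (fun b => (hw1 b).continuous) hΩ
  have hpc : ∀ b i, ContDiff ℝ ∞ (pderiv i (w b)) := fun b i => (hw.contDiff b).pderiv (by simp) i
  rw [Nat.cast_succ, sobSq_add_one]
  gcongr with i
  rw [← fourierR_pderiv hc1 (periodic_comp_curve hF hw.periodic hΩ)]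
  have hpd : pderiv i (fun x => F (curve w x)) = fun x => dirDeriv F (baseDir i) (curve w x) +
      ∑ b, dirDeriv F (fiberDir d b) (curve w x) * pderiv i (w b) x :=
    funext fun x => pderiv_comp_curve hF1 hw1 hΩ i x
  have hprod : ∀ b, Continuous fun x => dirDeriv F (fiberDir d b) (curve w x) * pderiv i (w b) x :=
    fun b => (hcont _ (norm_fiberDir_le b)).mul (hpc b i).continuous
  rw [hpd, fourierR_add (integrableOn_cell_of_continuous (hcont _ (norm_baseDir_le i)))
    (integrableOn_cell_of_continuous (continuous_finsetSum _ fun b _ => hprod b)),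
    fourierR_sum _ fun b _ => integrableOn_cell_of_continuous (hprod b)]
  refine (sobSq_add_le _ _ _).trans ?_
  gcongr
  refine (sobSq_sum_le _ _ _).trans ?_
  rw [Finset.card_univ, Fintype.card_option, Fintype.card_fin]
  gcongr with b
  rw [fourierR_mul (integrableOn_cell_of_continuous (hcont _ (norm_fiberDir_le b)))
    (hpc b i).continuous ((hw.periodic b).pderiv i)
    (wien_fourierR_lt_top 0 (hpc b i) ((hw.periodic b).pderiv i)), conv_comm]

lemma exists_nnreal_of_lt_top {C : ℝ≥0∞} (h : C < ⊤) : ∃ c : ℝ≥0, C = c :=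
  ⟨C.toNNReal, (ENNReal.coe_toNNReal h.ne).symm⟩

/-- Compositions are bounded in Sobolev spaces of integer order if the derivatives of the curve are
bounded in a Wiener algebra. -/
theorem sobSq_comp_le_of_wien (n : ℕ) (B : ℝ) (L : ℝ≥0) : ∃ C : ℝ≥0, ∀ K ⊆ phaseDomain d,
    ∀ F, PhaseReg n K B F → ∀ w, SmoothCurve K w →
    (∀ b i, wien n (fourierR (pderiv i (w b))) ≤ L) →
    sobSq n (fourierR fun x => F (curve w x)) ≤ C := by
  induction n with
  | zero =>
    refine ⟨(B ^ 2).toNNReal, fun K hK F hF w hw _ => ?_⟩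
    rw [Nat.cast_zero]
    have hΩ : ∀ x, curve w x ∈ phaseDomain d := fun x => hK (hw.mem x)
    refine sobSq_zero_le_of_bound (Complex.continuous_ofReal.comp
      (continuous_comp_curve hF (fun b => (hw.contDiff b).continuous) hΩ))
      (periodic_comp_curve hF hw.periodic hΩ).ofReal fun x => ?_
    rw [Function.comp_apply, Complex.norm_real]
    exact hF.abs_le (hw.mem x)
  | succ n ih =>
    obtain ⟨C, hC⟩ := ih
    -- The right side of `sobSq_succ_comp_le`, with `C` for each composition of order `n` and the
    -- Wiener norm `L` for the derivatives of the curve.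
    obtain ⟨C', hC'⟩ := exists_nnreal_of_lt_top (C := (C : ℝ≥0∞) + ∑ _i : Fin d, (2 * (C : ℝ≥0∞) +
        2 * ((d + 1 : ℕ) * ∑ _b : Option (Fin d), splitC n ^ 2 * (L : ℝ≥0∞) ^ 2 * (C : ℝ≥0∞)))) (by
      have h1 : splitC n ^ 2 * (L : ℝ≥0∞) ^ 2 * C < ⊤ :=
        ENNReal.mul_lt_top (ENNReal.mul_lt_top (ENNReal.pow_lt_top (splitC_lt_top _))
          (ENNReal.pow_lt_top ENNReal.coe_lt_top)) ENNReal.coe_lt_top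
      simp only [Finset.sum_const, nsmul_eq_mul]
      finiteness)
    refine ⟨C', fun K hK F hF w hw hL => ?_⟩
    have hLn : ∀ b i, wien n (fourierR (pderiv i (w b))) ≤ L := fun b i =>
      (wien_mono (by push_cast; linarith) _).trans (hL b i)
    have hd : ∀ e : Phase d, ‖e‖ ≤ 1 →
        sobSq n (fourierR fun x => dirDeriv F e (curve w x)) ≤ C := fun e he =>
      hC K hK _ (hF.dirDeriv hK he) w hw hLn
    rw [← hC']
    refine (sobSq_succ_comp_le hK hF hw).trans ?_
    gcongr with i _ b
    · exact hC K hK F (hF.mono n.le_succ subset_rfl) w hw hLn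
    · exact hd _ (norm_baseDir_le i)
    · refine (sobSq_conv_le_wien n.cast_nonneg _ _).trans ?_
      gcongr
      · exact hLn b i
      · exact hd _ (norm_fiberDir_le b)

/-- Tame bounds for compositions in Sobolev spaces of integer order. -/
theorem sobSq_comp_le_tame {r : ℕ} (hr : (d : ℝ) / 2 < r) (n : ℕ) (B : ℝ) (L : ℝ≥0) :
    ∃ C : ℝ≥0, ∀ K ⊆ phaseDomain d,
    ∀ F, PhaseReg n K B F → ∀ w, SmoothCurve K w →
    (∀ b i, wien r (fourierR (pderiv i (w b))) ≤ L) →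
    sobSq n (fourierR fun x => F (curve w x)) ≤ C * (1 + ∑ b, sobSq n (fourierR (w b))) := by
  induction n with
  | zero =>
    obtain ⟨C, hC⟩ := sobSq_comp_le_of_wien (d := d) 0 B L
    refine ⟨C, fun K hK F hF w hw hL => (hC K hK F hF w hw fun b i =>
      (wien_mono (by push_cast; positivity) _).trans (hL b i)).trans ?_⟩
    exact le_mul_of_one_le_right bot_le le_self_add
  | succ n ih =>
    -- Up to order `r` the Wiener bound on the curve suffices. Beyond it the tame product needs the
    -- Wiener norm of the derivative of `F` along the curve. It is controlled by the Sobolev norm of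
    -- order `r > d / 2`, which is already bounded by a constant (`hD`), so the estimate stays
    -- linear in the top norm.
    by_cases hn : n + 1 ≤ r
    · obtain ⟨C, hC⟩ := sobSq_comp_le_of_wien (d := d) (n + 1) B L
      refine ⟨C, fun K hK F hF w hw hL => (hC K hK F hF w hw fun b i =>
        (wien_mono (by exact_mod_cast hn) _).trans (hL b i)).trans ?_⟩
      exact le_mul_of_one_le_right bot_le le_self_add
    have hrn : r ≤ n := by omega
    obtain ⟨C, hC⟩ := ih
    obtain ⟨D, hD⟩ := sobSq_comp_le_of_wien (d := d) r B L
    have hS := wtSum_lt_top hr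
    have hsp := splitC_lt_top n
    obtain ⟨C', hC'⟩ := exists_nnreal_of_lt_top (C := (C : ℝ≥0∞) + ∑ _i : Fin d, (2 * (C : ℝ≥0∞) +
        2 * ((d + 1 : ℕ) * ∑ _b : Option (Fin d),
          2 * splitC n ^ 2 * ((L : ℝ≥0∞) ^ 2 * (C : ℝ≥0∞) + wtSum d r * (D : ℝ≥0∞))))) (by
      simp only [Finset.sum_const, nsmul_eq_mul]
      finiteness)
    refine ⟨C', fun K hK F hF w hw hL => ?_⟩
    set Z : ℝ≥0∞ := 1 + ∑ b, sobSq (n + 1 : ℕ) (fourierR (w b)) with hZ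
    have hZn : 1 + ∑ b, sobSq n (fourierR (w b)) ≤ Z := by
      rw [hZ]
      gcongr with b
      exact sobSq_mono (by push_cast; linarith) _
    have hd : ∀ e : Phase d, ‖e‖ ≤ 1 →
        sobSq n (fourierR fun x => dirDeriv F e (curve w x)) ≤ C * Z := fun e he =>
      (hC K hK _ (hF.dirDeriv hK he) w hw hL).trans (by gcongr)
    rw [← hC']
    refine (sobSq_succ_comp_le hK hF hw).trans ?_
    have hfin : ((C : ℝ≥0∞) + ∑ _i : Fin d, (2 * (C : ℝ≥0∞) + 2 * ((d + 1 : ℕ) *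
          ∑ _b : Option (Fin d),
          2 * splitC n ^ 2 * ((L : ℝ≥0∞) ^ 2 * (C : ℝ≥0∞) + wtSum d r * (D : ℝ≥0∞))))) * Z =
        C * Z + ∑ _i : Fin d, (2 * (C * Z) + 2 * ((d + 1 : ℕ) * ∑ _b : Option (Fin d),
          2 * splitC n ^ 2 * ((L : ℝ≥0∞) ^ 2 * (C * Z) + Z * (wtSum d r * D)))) := by
      simp only [Finset.sum_const, nsmul_eq_mul]
      ring
    rw [hfin]
    gcongr with i _ b
    · exact (hC K hK F (hF.mono n.le_succ subset_rfl) w hw hL).trans (by gcongr)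
    · exact hd _ (norm_baseDir_le i)
    · refine (sobSq_conv_le_tame n.cast_nonneg _ _).trans ?_
      gcongr
      · exact (wien_mono (by positivity) _).trans (hL b i)
      · exact hd _ (norm_fiberDir_le b)
      · rw [fourierR_pderiv ((hw.contDiff b).of_le (by exact_mod_cast le_top)) (hw.periodic b)]
        refine (sobSq_distPartial_le _ _ i).trans ?_
        refine le_trans ?_ le_add_self
        push_cast
        exact Finset.single_le_sum (f := fun b => sobSq (n + 1) (fourierR (w b)))
          (fun _ _ => bot_le) (Finset.mem_univ b)
      · refine (wien_sq_le 0 r _).trans ?_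
        gcongr
        rw [zero_add]
        exact hD K hK _ ((hF.dirDeriv hK (norm_fiberDir_le b)).mono hrn subset_rfl) w hw hL

/-! ## Truncated Fourier series -/

lemma finite_freqSq_le (d : ℕ) (a : ℝ) : {k : Freq d | freqSq k ≤ a}.Finite := by
  refine (Set.Finite.pi' fun _ : Fin d => Set.finite_Icc (-⌈a⌉) ⌈a⌉).subset fun k hk i => ?_
  have h1 : (k i : ℝ) ^ 2 ≤ a := (sq_le_freqSq k i).trans hk
  have h2 : (k i) ^ 2 ≤ ⌈a⌉ := by exact_mod_cast h1.trans (Int.le_ceil a)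
  have h3 := Int.le_self_sq (k i)
  have h4 := Int.le_self_sq (-k i)
  rw [neg_sq] at h4
  exact Set.mem_Icc.2 ⟨by linarith, by linarith⟩

/-- The low frequency part of a distribution. -/
def trunc (a : ℝ) (c : Coeffs d) : Coeffs d := fun k => if freqSq k ≤ a then c k else 0

/-- The trigonometric polynomial with the low frequencies of a distribution. -/
def trigPoly (a : ℝ) (c : Coeffs d) (x : Pt d) : ℝ :=
  (∑ k ∈ (finite_freqSq_le d a).toFinset, c k * character k x).re

lemma enorm_trunc_le (a : ℝ) (c : Coeffs d) (k : Freq d) : ‖trunc a c k‖ₑ ≤ ‖c k‖ₑ := by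
  unfold trunc
  split_ifs <;> simp

lemma sobSq_trunc_le (σ a : ℝ) (c : Coeffs d) : sobSq σ (trunc a c) ≤ sobSq σ c :=
  sobSq_le_of_enorm_le (enorm_trunc_le a c)

lemma wien_trunc_le (τ a : ℝ) (c : Coeffs d) : wien τ (trunc a c) ≤ wien τ c :=
  ENNReal.tsum_le_tsum fun k => by gcongr; exact enorm_trunc_le a c k

lemma tsum_enorm_trunc_lt_top (a : ℝ) (c : Coeffs d) : ∑' k, ‖trunc a c k‖ₑ < ⊤ := by
  rw [tsum_eq_sum (s := (finite_freqSq_le d a).toFinset)]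
  · exact ENNReal.sum_lt_top.2 fun _ _ => enorm_lt_top
  · intro k hk
    have : ¬ freqSq k ≤ a := by simpa using hk
    simp [trunc, this]

/-- The set of frequencies is symmetric, so for a real distribution the sum equals its conjugate and
the real part in `trigPoly` loses nothing. -/
lemma hasSum_trigPoly {c : Coeffs d} (hc : IsRealDist c) (a : ℝ) (x : Pt d) :
    HasSum (fun k => trunc a c k * character k x) (trigPoly a c x : ℂ) := by
  have h1 : ∑ k ∈ (finite_freqSq_le d a).toFinset, c k * character k x =
      ((trigPoly a c x : ℝ) : ℂ) := by
    refine (Complex.conj_eq_iff_re.1 ?_).symm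
    rw [map_sum]
    refine Finset.sum_nbij' (fun k => -k) (fun k => -k) ?_ ?_ ?_ ?_ ?_
    · intro k hk; simpa [freqSq_neg] using hk
    · intro k hk; simpa [freqSq_neg] using hk
    · intro k _; simp
    · intro k _; simp
    · intro k _
      rw [map_mul, ← hc, ← character_neg]
  rw [← h1]
  have h2 : ∑ k ∈ (finite_freqSq_le d a).toFinset, c k * character k x =
      ∑ k ∈ (finite_freqSq_le d a).toFinset, trunc a c k * character k x := by
    refine Finset.sum_congr rfl fun k hk => ?_
    have : freqSq k ≤ a := by simpa using hk
    simp [trunc, this]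
  rw [h2]
  refine hasSum_sum_of_ne_finset_zero fun k hk => ?_
  have : ¬ freqSq k ≤ a := by simpa using hk
  simp [trunc, this]

lemma fourierR_trigPoly {c : Coeffs d} (hc : IsRealDist c) (a : ℝ) :
    fourierR (trigPoly a c) = trunc a c :=
  fourier_of_hasSum (tsum_enorm_trunc_lt_top a c) (hasSum_trigPoly hc a)

lemma contDiff_trigPoly (a : ℝ) (c : Coeffs d) : ContDiff ℝ ∞ (trigPoly a c) :=
  Complex.reCLM.contDiff.comp (ContDiff.sum fun k _ => contDiff_const.mul (contDiff_character k))

lemma trigPoly_periodic (a : ℝ) (c : Coeffs d) : TorusPeriodic (trigPoly a c) := fun x l => by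
  simp only [trigPoly, character_periodic _ x l]

/-- Only frequencies with `|k|² > a` remain; on these the weight of order two yields the factor `1 /
a`, and the Wiener norm bounds the supremum. -/
lemma abs_sub_trigPoly_le {w : Pt d → ℝ} (hw : Continuous w) (hp : TorusPeriodic w) {L : ℝ≥0}
    (hL : wien 2 (fourierR w) ≤ L) {a : ℝ} (ha : 0 < a) (x : Pt d) :
    |w x - trigPoly a (fourierR w) x| ≤ L / a := by
  have hT := contDiff_trigPoly a (fourierR w)
  have h := norm_le_wien (f := fun x => w x - trigPoly a (fourierR w) x) (hw.sub hT.continuous)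
    (fun x k => by simp only [hp x k, trigPoly_periodic a _ x k]) x
  rw [fourierR_sub (integrableOn_cell_of_continuous hw)
    (integrableOn_cell_of_continuous hT.continuous),
    fourierR_trigPoly (isRealDist_fourierR w)] at h
  have h2 : wien 0 (fourierR w - trunc a (fourierR w)) ≤ ENNReal.ofReal a⁻¹ * L := by
    refine le_trans ?_ (mul_le_mul_right hL _)
    rw [wien_zero, wien, ← ENNReal.tsum_mul_left]
    refine ENNReal.tsum_le_tsum fun k => ?_
    simp only [Pi.sub_apply, trunc]
    split_ifs with hk
    · simp
    · rw [sub_zero, ← mul_assoc]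
      refine le_mul_of_one_le_left bot_le ?_
      rw [wt, ← ENNReal.ofReal_mul (by positivity), ENNReal.one_le_ofReal]
      norm_num
      rw [← div_eq_inv_mul, one_le_div ha]
      linarith
  have h3 := h.trans h2
  rw [← ENNReal.ofReal_coe_nnreal, ← ENNReal.ofReal_mul (by positivity),
    ENNReal.ofReal_le_ofReal_iff (by positivity)] at h3
  rwa [div_eq_inv_mul]

/-! ## Finite differences -/

/-- The part of the phase space with `|p| + q ≤ r`. -/
def phaseBall (d : ℕ) (r : ℝ) : Set (Phase d) := {z | z ∈ phaseDomain d ∧ ‖z.2.1‖ + z.2.2 ≤ r}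

lemma phaseBall_subset (d : ℕ) (r : ℝ) : phaseBall d r ⊆ phaseDomain d := fun _ h => h.1

lemma convex_phaseBall (d : ℕ) (r : ℝ) : Convex ℝ (phaseBall d r) := by
  intro z hz y hy a b ha hb hab
  constructor
  · have h1 : 0 ≤ z.2.2 := hz.1
    have h2 : 0 ≤ y.2.2 := hy.1
    change 0 ≤ a * z.2.2 + b * y.2.2
    positivity
  · have h1 := hz.2
    have h2 := hy.2
    have h3 : ‖a • z.2.1 + b • y.2.1‖ ≤ a * ‖z.2.1‖ + b * ‖y.2.1‖ := by
      refine (norm_add_le _ _).trans (le_of_eq ?_)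
      rw [norm_smul, norm_smul, Real.norm_of_nonneg ha, Real.norm_of_nonneg hb]
    change ‖a • z.2.1 + b • y.2.1‖ + (a * z.2.2 + b * y.2.2) ≤ r
    have h4 := mul_le_mul_of_nonneg_left h1 ha
    have h5 := mul_le_mul_of_nonneg_left h2 hb
    have h6 : a * r + b * r = r := by rw [← add_mul, hab, one_mul]
    linarith

lemma hasDerivWithinAt_ray {F : Phase d → ℝ} (hF : ContDiffOn ℝ 1 F (phaseDomain d)) {z : Phase d}
    (hz : z ∈ phaseDomain d) {t : ℝ} (ht : 0 ≤ t) (s : Set ℝ) (hs : s ⊆ Ici 0) :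
    HasDerivWithinAt (fun t => F (z + t • fiberDir d none))
      (dirDeriv F (fiberDir d none) (z + t • fiberDir d none)) s t := by
  have hm : ∀ t : ℝ, 0 ≤ t → z + t • fiberDir d none ∈ phaseDomain d := fun t ht => by
    have h1 : 0 ≤ z.2.2 := hz
    change 0 ≤ z.2.2 + t * 1
    linarith
  have hline : HasDerivWithinAt (fun t : ℝ => z + t • fiberDir d none) (fiberDir d none) s t := by
    simpa using ((hasDerivWithinAt_id t s).smul_const (fiberDir d none)).const_add z
  have := (hF.differentiableOn one_ne_zero _ (hm t ht)).hasFDerivWithinAt.comp_hasDerivWithinAt t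
    hline (fun t ht => hm t (hs ht))
  exact this

/-- Each difference of step `δ` costs one derivative in `q` and gives one factor `δ`, by the mean
value inequality. Forward differences use only points with larger `q`, so they are available on the
boundary `q = 0` as well. -/
lemma abs_fwdDiff_le {K : Set (Phase d)} (hK : K ⊆ phaseDomain d) {B δ : ℝ} (hδ : 0 ≤ δ) (n : ℕ) :
    ∀ {F : Phase d → ℝ}, PhaseReg n K B F → ∀ z : Phase d,
      (∀ t : ℝ, 0 ≤ t → t ≤ n * δ → z + t • fiberDir d none ∈ K) →
      |(fwdDiff (δ • fiberDir d none))^[n] F z| ≤ B * δ ^ n := by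
  induction n with
  | zero =>
    intro F hF z hz
    have := hF.abs_le (hz 0 le_rfl (by simp))
    simpa using this
  | succ n ih =>
    intro F hF z hz
    set Q := fiberDir d none with hQ
    have hF1 : ContDiffOn ℝ 1 F (phaseDomain d) := hF.contDiff.of_le (by norm_cast; omega)
    have hz0 : z ∈ phaseDomain d := by
      have := hK (hz 0 le_rfl (by positivity))
      simpa using this
    -- The iterated difference is a finite combination of translates, so it commutes with the
    -- derivative in `q`.
    have hd : ∀ t ∈ Icc 0 δ, HasDerivWithinAt (fun t => (fwdDiff (δ • Q))^[n] F (z + t • Q))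
        ((fwdDiff (δ • Q))^[n] (dirDeriv F Q) (z + t • Q)) (Icc 0 δ) t := by
      intro t ht
      simp only [fwdDiff_iter_eq_sum_shift]
      refine HasDerivWithinAt.fun_sum fun k _ => HasDerivWithinAt.fun_const_smul _ ?_
      have hzk : z + k • δ • Q ∈ phaseDomain d := by
        have h1 : 0 ≤ z.2.2 := hz0
        rw [← Nat.cast_smul_eq_nsmul ℝ, smul_smul]
        change 0 ≤ z.2.2 + (k * δ) * 1
        positivity
      have h := hasDerivWithinAt_ray hF1 hzk ht.1 (Icc 0 δ) fun s hs => hs.1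
      simpa only [add_right_comm z] using h
    have hb : ∀ t ∈ Icc 0 δ, ‖(fwdDiff (δ • Q))^[n] (dirDeriv F Q) (z + t • Q)‖ ≤ B * δ ^ n := by
      intro t ht
      refine ih (hF.dirDeriv hK (norm_fiberDir_le none)) _ fun s hs0 hs => ?_
      rw [add_assoc, ← add_smul]
      refine hz _ (by linarith [ht.1]) ?_
      push_cast
      linarith [ht.2]
    have h := (convex_Icc 0 δ).norm_image_sub_le_of_norm_hasDerivWithin_le hd hb
      (left_mem_Icc.2 hδ) (right_mem_Icc.2 hδ)
    rw [Function.iterate_succ_apply', fwdDiff]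
    simpa [abs_of_nonneg hδ, pow_succ, mul_assoc] using h

/-- The mean value inequality, for which the set where the derivatives are bounded has to be convex
(`convex_phaseBall`). -/
lemma PhaseReg.lipschitz {n : ℕ} {r B : ℝ} {F : Phase d → ℝ}
    (h : PhaseReg (n + 1) (phaseBall d r) B F) {y z : Phase d} (hy : y ∈ phaseBall d r)
    (hz : z ∈ phaseBall d r) : |F y - F z| ≤ B * ‖y - z‖ := by
  have hd := h.contDiff.differentiableOn (by norm_cast)
  refine (convex_phaseBall d r).norm_image_sub_le_of_norm_hasFDerivWithin_le (𝕜 := ℝ)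
    (f' := fderivWithin ℝ F (phaseDomain d)) (fun x hx => ?_) (fun x hx => ?_) hz hy
  · exact (hd x hx.1).hasFDerivWithinAt.mono (phaseBall_subset d r)
  · rw [← norm_iteratedFDerivWithin_one F (uniqueDiffOn_phaseDomain d x hx.1)]
    exact h.bound 1 (by omega) x hx

/-! ## Sobolev norms by approximation -/

/-- The powers of four. -/
def four (s : ℝ) : ℝ≥0∞ := ENNReal.ofReal (4 ^ s)

lemma four_lt_top (s : ℝ) : four s < ⊤ := ENNReal.ofReal_lt_top

lemma four_pow (s : ℝ) (j : ℕ) : four s ^ j = ENNReal.ofReal (((4 : ℝ) ^ j) ^ s) := by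
  rw [four, ← ENNReal.ofReal_pow (by positivity), ← Real.rpow_natCast, ← Real.rpow_mul (by norm_num),
    mul_comm, Real.rpow_mul (by norm_num), Real.rpow_natCast]

lemma four_add (s t : ℝ) : four (s + t) = four s * four t := by
  rw [four, four, four, ← ENNReal.ofReal_mul (by positivity), Real.rpow_add (by norm_num)]

lemma tsum_four_lt_top {s : ℝ} (hs : s < 0) : ∑' j : ℕ, four s ^ j < ⊤ := by
  rw [ENNReal.tsum_geometric, ENNReal.inv_lt_top, tsub_pos_iff_lt, four,
    ENNReal.ofReal_lt_one]
  exact Real.rpow_lt_one_of_one_lt_of_neg (by norm_num) hs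

/-- The powers with `4^j < |k|²` form a geometric sum that is dominated by its last term, of size at
most `(1 + |k|²)^σ`. The constant is finite for `σ > 0`. -/
lemma tsum_four_low_le {σ : ℝ} (hσ : 0 ≤ σ) (k : Freq d) :
    ∑' j : ℕ, (if freqSq k ≤ (4 : ℝ) ^ j then 0 else four σ ^ j) ≤
      (∑' j : ℕ, four (-σ) ^ j) * wt σ k := by
  obtain ⟨J, hJ1, hJ2⟩ := exists_nat_pow_near (one_le_one_add_freqSq k) (y := (4 : ℝ)) (by norm_num)
  have hinv : ∀ i j : ℕ, four σ ^ (i + j) * four (-σ) ^ i = four σ ^ j := fun i j => by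
    rw [pow_add, mul_right_comm, ← mul_pow, ← four_add, add_neg_cancel]
    simp [four]
  calc ∑' j : ℕ, (if freqSq k ≤ (4 : ℝ) ^ j then 0 else four σ ^ j)
      = ∑ j ∈ Finset.range (J + 1), (if freqSq k ≤ (4 : ℝ) ^ j then 0 else four σ ^ j) := by
        refine tsum_eq_sum fun j hj => if_pos ?_
        have : J + 1 ≤ j := by simpa using hj
        have h2 : (4 : ℝ) ^ (J + 1) ≤ 4 ^ j := pow_le_pow_right₀ (by norm_num) this
        linarith
    _ ≤ ∑ j ∈ Finset.range (J + 1), four σ ^ j := by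
        gcongr with j
        split_ifs
        · exact bot_le
        · exact le_rfl
    _ = ∑ j ∈ Finset.range (J + 1), four (-σ) ^ j * four σ ^ J := by
        rw [← Finset.sum_range_reflect]
        refine Finset.sum_congr rfl fun j hj => ?_
        have : j ≤ J := by have := Finset.mem_range.1 hj; omega
        rw [← hinv j (J + 1 - 1 - j), mul_comm]
        congr 2
        omega
    _ ≤ (∑' j : ℕ, four (-σ) ^ j) * wt σ k := by
        rw [← Finset.sum_mul]
        gcongr
        · exact ENNReal.sum_le_tsum _
        · rw [four_pow, wt]
          exact ENNReal.ofReal_le_ofReal (Real.rpow_le_rpow (by positivity) hJ1 hσ)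

/-- Here the sum starts near the `j` with `4^j ≈ 1 + |k|²` and decays from there. The factor
`4^{-s}` pays for comparing the starting index with `1 + |k|²`. -/
lemma tsum_four_high_le {s : ℝ} (hs : s ≤ 0) (k : Freq d) :
    ∑' j : ℕ, (if freqSq k ≤ (4 : ℝ) ^ j then four s ^ j else 0) ≤
      (∑' j : ℕ, four s ^ j) * four (-s) * wt s k := by
  obtain ⟨J, hJ1, hJ2⟩ := exists_nat_pow_near (one_le_one_add_freqSq k) (y := (4 : ℝ)) (by norm_num)
  have hJ : four s ^ J ≤ four (-s) * wt s k := by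
    rw [four_pow, four, wt, ← ENNReal.ofReal_mul (by positivity)]
    refine ENNReal.ofReal_le_ofReal ?_
    rw [Real.rpow_neg (by norm_num), ← Real.inv_rpow (by norm_num),
      ← Real.mul_rpow (by norm_num) (one_add_freqSq_pos k).le]
    refine Real.rpow_le_rpow_of_nonpos ?_ ?_ hs
    · have := one_add_freqSq_pos k; positivity
    · rw [pow_succ] at hJ2; linarith
  rw [← (Summable.sum_add_tsum_nat_add' (k := J) ENNReal.summable)]
  rw [Finset.sum_eq_zero fun j hj => ?_, zero_add]
  · rw [mul_assoc, ← ENNReal.tsum_mul_right]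
    refine ENNReal.tsum_le_tsum fun j => ?_
    split_ifs
    · rw [pow_add]; gcongr
    · exact bot_le
  · refine if_neg fun h => ?_
    have hj' : j + 1 ≤ J := Finset.mem_range.1 hj
    have h2 : (4 : ℝ) ^ (j + 1) ≤ 4 ^ J := pow_le_pow_right₀ (by norm_num) hj'
    have h3 : (1 : ℝ) ≤ 4 ^ j := one_le_pow₀ (by norm_num)
    rw [pow_succ] at h2
    linarith

/-- A bound of a Sobolev norm by approximations in stronger and weaker norms. -/
lemma sobSq_le_of_approx {σ : ℝ} (hσ : 0 ≤ σ) (n : ℝ) (hn : 0 ≤ n) (f : Coeffs d)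
    (g : ℕ → Coeffs d) :
    sobSq σ f ≤ 2 * four σ *
      ((∑' j, four σ ^ j * sobSq 0 (f - g j)) + ∑' j, four (σ - n) ^ j * sobSq n (g j)) := by
  have hk : ∀ k, wt σ k * ‖f k‖ₑ ^ 2 ≤ 2 * four σ * ∑' j, (four σ ^ j * ‖(f - g j) k‖ₑ ^ 2 +
      four (σ - n) ^ j * (wt n k * ‖g j k‖ₑ ^ 2)) := by
    intro k
    -- At the frequency `k` only the approximation with `4^J ≈ 1 + |k|²` is used; the sum over all
    -- `j` dominates this term.
    obtain ⟨J, hJ1, hJ2⟩ :=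
      exists_nat_pow_near (one_le_one_add_freqSq k) (y := (4 : ℝ)) (by norm_num)
    refine le_trans ?_ (mul_le_mul_right (ENNReal.le_tsum J) _)
    have h1 : wt σ k ≤ four σ * four σ ^ J := by
      rw [← pow_succ', four_pow, wt]
      exact ENNReal.ofReal_le_ofReal (Real.rpow_le_rpow (one_add_freqSq_pos k).le hJ2.le hσ)
    have h2 : 1 ≤ four (-n) ^ J * wt n k := by
      rw [four_pow, wt, ← ENNReal.ofReal_mul (by positivity), ENNReal.one_le_ofReal,
        Real.rpow_neg (by positivity), ← div_eq_inv_mul, one_le_div (by positivity)]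
      exact Real.rpow_le_rpow (by positivity) hJ1 hn
    have h3 : ‖f k‖ₑ ^ 2 ≤ 2 * ‖(f - g J) k‖ₑ ^ 2 + 2 * ‖g J k‖ₑ ^ 2 := by
      have : f k = (f - g J) k + g J k := by simp
      rw [this]
      exact (ENNReal.pow_le_pow_left (enorm_add_le _ _)).trans (by
        simpa using ENNReal.add_sq_le _ _)
    calc wt σ k * ‖f k‖ₑ ^ 2
        ≤ (four σ * four σ ^ J) * (2 * ‖(f - g J) k‖ₑ ^ 2 +
            2 * (four (-n) ^ J * wt n k * ‖g J k‖ₑ ^ 2)) := by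
          gcongr
          refine h3.trans ?_
          gcongr
          exact le_mul_of_one_le_left bot_le h2
      _ = _ := by
          rw [sub_eq_add_neg σ, four_add, mul_pow]
          ring
  rw [sobSq_eq]
  refine (ENNReal.tsum_le_tsum hk).trans (le_of_eq ?_)
  rw [ENNReal.tsum_mul_left, ENNReal.tsum_comm]
  congr 1
  rw [← ENNReal.tsum_add]
  refine tsum_congr fun j => ?_
  rw [ENNReal.tsum_add, ENNReal.tsum_mul_left, ENNReal.tsum_mul_left, sobSq_eq, sobSq_eq]
  simp only [wt_zero, one_mul]

/-! ## Compositions in Sobolev spaces of real order -/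

/-- The trigonometric polynomial approximation of a curve, with a shift of `q` by `a`. -/
def shiftedTrig (w : Option (Fin d) → Pt d → ℝ) (j : ℕ) (a : ℝ) (b : Option (Fin d))
    (x : Pt d) : ℝ :=
  trigPoly (4 ^ j) (fourierR (w b)) x + if b = none then a else 0

/-- A continuous periodic curve with `q ≥ 0` that is bounded by `L` in a Wiener algebra. -/
structure WienerCurve (τ : ℝ) (L : ℝ≥0) (w : Option (Fin d) → Pt d → ℝ) : Prop where
  continuous : ∀ b, Continuous (w b)
  periodic : ∀ b, TorusPeriodic (w b)
  nonneg : ∀ x, 0 ≤ w none x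
  wien_le : ∀ b, wien τ (fourierR (w b)) ≤ L

lemma WienerCurve.abs_le {τ : ℝ} (hτ : 0 ≤ τ) {L : ℝ≥0} {w : Option (Fin d) → Pt d → ℝ}
    (h : WienerCurve τ L w) (b : Option (Fin d)) (x : Pt d) : |w b x| ≤ L := by
  have h1 := (norm_le_wien (h.continuous b) (h.periodic b) x).trans
    ((wien_mono hτ _).trans (h.wien_le b))
  rw [← ENNReal.ofReal_coe_nnreal] at h1
  exact (ENNReal.ofReal_le_ofReal_iff L.2).1 h1

lemma abs_trigPoly_le {f : Pt d → ℝ} {L : ℝ≥0}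
    (h : wien 0 (fourierR f) ≤ L) (a : ℝ) (x : Pt d) : |trigPoly a (fourierR f) x| ≤ L := by
  have h1 := (norm_le_wien (contDiff_trigPoly a (fourierR f)).continuous
    (trigPoly_periodic a (fourierR f)) x)
  rw [fourierR_trigPoly (isRealDist_fourierR f)] at h1
  have h2 := (h1.trans (wien_trunc_le _ _ _)).trans h
  rw [← ENNReal.ofReal_coe_nnreal] at h2
  exact (ENNReal.ofReal_le_ofReal_iff L.2).1 h2

lemma WienerCurve.abs_sub_le {τ : ℝ} (hτ : 2 ≤ τ) {L : ℝ≥0} {w : Option (Fin d) → Pt d → ℝ}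
    (h : WienerCurve τ L w) (j : ℕ) (b : Option (Fin d)) (x : Pt d) :
    |w b x - trigPoly (4 ^ j) (fourierR (w b)) x| ≤ L / 4 ^ j :=
  abs_sub_trigPoly_le (h.continuous b) (h.periodic b) ((wien_mono hτ _).trans (h.wien_le b))
    (by positivity) x

lemma mem_phaseBall_curve {w : Option (Fin d) → Pt d → ℝ} {r₁ r₂ : ℝ} {x : Pt d} (hr : 0 ≤ r₁)
    (h1 : ∀ j, |w (some j) x| ≤ r₁) (h2 : 0 ≤ w none x) (h3 : w none x ≤ r₂) :
    curve w x ∈ phaseBall d (r₁ + r₂) := by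
  refine ⟨h2, add_le_add ?_ h3⟩
  exact (pi_norm_le_iff_of_nonneg hr).2 h1

lemma contDiff_shiftedTrig (w : Option (Fin d) → Pt d → ℝ) (j : ℕ) (a : ℝ) (b : Option (Fin d)) :
    ContDiff ℝ ∞ (shiftedTrig w j a b) := (contDiff_trigPoly _ _).add contDiff_const

lemma shiftedTrig_periodic (w : Option (Fin d) → Pt d → ℝ) (j : ℕ) (a : ℝ)
    (b : Option (Fin d)) : TorusPeriodic (shiftedTrig w j a b) := fun x k => by
  simp only [shiftedTrig, trigPoly_periodic _ _ x k]

/-- The truncation of a nonnegative `q` can be negative, but by no more than `L / 4^j`. A shift by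
at least this amount (`1 ≤ i`) returns the curve to the half-space, and `i ≤ n` keeps it in a fixed
ball: `L` for `p` and `(n + 1) L` for `q`. -/
lemma smoothCurve_shiftedTrig {τ : ℝ} (hτ : 2 ≤ τ) {L : ℝ≥0} {w : Option (Fin d) → Pt d → ℝ}
    (h : WienerCurve τ L w) {n : ℕ} (j : ℕ) {i : ℕ} (hi : 1 ≤ i) (hin : i ≤ n) :
    SmoothCurve (phaseBall d ((n + 2) * L)) (shiftedTrig w j (i * (L / 4 ^ j))) := by
  have h4 : (1 : ℝ) ≤ 4 ^ j := one_le_pow₀ (by norm_num)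
  have hδ0 : (0 : ℝ) ≤ L / 4 ^ j := by positivity
  have hδ1 : (L : ℝ) / 4 ^ j ≤ L := div_le_self L.2 h4
  have hi' : (1 : ℝ) ≤ i := by exact_mod_cast hi
  have hin' : (i : ℝ) ≤ n := by exact_mod_cast hin
  refine ⟨contDiff_shiftedTrig _ _ _, shiftedTrig_periodic _ _ _, fun x => ?_⟩
  rw [show ((n : ℝ) + 2) * L = L + (n + 1) * L by ring]
  have hw0 : ∀ b, wien 0 (fourierR (w b)) ≤ L := fun b =>
    (wien_mono (by linarith) _).trans (h.wien_le b)
  refine mem_phaseBall_curve L.2 (fun l => ?_) ?_ ?_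
  · simpa [shiftedTrig] using abs_trigPoly_le (hw0 (some l)) (4 ^ j) x
  · have h1 := (abs_le.1 (h.abs_sub_le hτ j none x)).2
    have h2 := h.nonneg x
    simp only [shiftedTrig, if_true]
    nlinarith
  · have h1 := (abs_le.1 (abs_trigPoly_le (hw0 none) (4 ^ j) x)).2
    simp only [shiftedTrig, if_true]
    have : (i : ℝ) * (L / 4 ^ j) ≤ n * L := by gcongr
    linarith

lemma fourierR_const (a : ℝ) : fourierR (fun _ : Pt d => a) = (a : ℂ) • Pi.single 0 1 := by
  have := fourier_const_mul (d := d) (a : ℂ) fun _ => 1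
  simp only [mul_one, fourier_one] at this
  exact this

lemma sobSq_single_zero (σ : ℝ) : sobSq σ (Pi.single 0 1 : Coeffs d) = 1 := by
  rw [sobSq_eq, tsum_eq_single 0]
  · simp [wt, freqSq]
  · intro k hk; simp [Pi.single_eq_of_ne hk]

lemma sobSq_fourierR_const (σ a : ℝ) :
    sobSq σ (fourierR fun _ : Pt d => a) = ENNReal.ofReal (a ^ 2) := by
  rw [fourierR_const, sobSq_smul, sobSq_single_zero, mul_one, ← ofReal_norm,
    ← ENNReal.ofReal_pow (norm_nonneg _), Complex.norm_real, Real.norm_eq_abs, sq_abs]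

lemma sobSq_shiftedTrig_le (σ : ℝ) (w : Option (Fin d) → Pt d → ℝ) (j : ℕ) (a : ℝ)
    (b : Option (Fin d)) : sobSq σ (fourierR (shiftedTrig w j a b)) ≤
      2 * sobSq σ (trunc (4 ^ j) (fourierR (w b))) + 2 * ENNReal.ofReal (a ^ 2) := by
  have h : fourierR (shiftedTrig w j a b) = trunc (4 ^ j) (fourierR (w b)) +
      fourierR fun _ : Pt d => if b = none then a else 0 := by
    rw [← fourierR_trigPoly (isRealDist_fourierR (w b))]
    exact fourierR_add (integrableOn_cell_of_continuous (contDiff_trigPoly _ _).continuous)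
      (integrableOn_cell_of_continuous continuous_const)
  rw [h]
  refine (sobSq_add_le _ _ _).trans ?_
  gcongr
  rw [sobSq_fourierR_const]
  split_ifs
  · exact le_rfl
  · simp

lemma wien_distPartial_le (τ : ℝ) (c : Coeffs d) (i : Fin d) :
    wien τ (distPartial i c) ≤ wien (τ + 1) c := by
  refine ENNReal.tsum_le_tsum fun k => ?_
  rw [show (τ + 1) / 2 = τ / 2 + 1 / 2 by ring, wt_add, mul_assoc]
  gcongr
  rw [distPartial, enorm_mul, enorm_mul]
  gcongr
  rw [← ofReal_norm, ← ofReal_norm, Complex.norm_I, ENNReal.ofReal_one, one_mul, wt,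
    Complex.norm_intCast]
  refine ENNReal.ofReal_le_ofReal ?_
  rw [← Real.sqrt_eq_rpow]
  refine Real.le_sqrt_of_sq_le ?_
  rw [sq_abs]
  linarith [sq_le_freqSq k i]

lemma wien_pderiv_shiftedTrig_le {τ : ℝ} {L : ℝ≥0} {w : Option (Fin d) → Pt d → ℝ}
    (h : WienerCurve (τ + 1) L w) (j : ℕ) (a : ℝ) (b : Option (Fin d)) (i : Fin d) :
    wien τ (fourierR (pderiv i (shiftedTrig w j a b))) ≤ L := by
  have e : pderiv i (shiftedTrig w j a b) = pderiv i (trigPoly (4 ^ j) (fourierR (w b))) := by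
    funext x
    simp only [pderiv]
    congr 1
    exact fderiv_add_const _
  rw [e, fourierR_pderiv ((contDiff_trigPoly _ _).of_le (by exact_mod_cast le_top))
    (trigPoly_periodic _ _), fourierR_trigPoly (isRealDist_fourierR _)]
  exact (wien_distPartial_le _ _ _).trans ((wien_trunc_le _ _ _).trans (h.wien_le b))

/-- A pointwise inequality turned into one between `L²` norms, by Parseval's identity and
Cauchy–Schwarz for the `card β + 1` summands. -/
lemma sobSq_zero_le_of_abs_le {β : Type*} [Fintype β] {g : Pt d → ℝ} {h : β → Pt d → ℝ}
    (hg : Continuous g) (hgp : TorusPeriodic g) (hh : ∀ b, Continuous (h b))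
    (hhp : ∀ b, TorusPeriodic (h b)) {C a : ℝ}
    (hle : ∀ x, |g x| ≤ C * (a + ∑ b, |h b x|)) :
    sobSq 0 (fourierR g) ≤ ENNReal.ofReal (C ^ 2 * (Fintype.card β + 1)) *
      (ENNReal.ofReal (a ^ 2) + ∑ b, sobSq 0 (fourierR (h b))) := by
  have hv : (0 : ℝ) < (2 * Real.pi) ^ d := by positivity
  have key : ∀ x, ‖((g x : ℝ) : ℂ)‖ ^ 2 ≤
      C ^ 2 * (Fintype.card β + 1) * (a ^ 2 + ∑ b, ‖((h b x : ℝ) : ℂ)‖ ^ 2) := by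
    intro x
    have h1 := sq_sum_le_card_mul_sum_sq (s := (Finset.univ : Finset (Option β)))
      (f := fun o => o.elim a fun b => |h b x|)
    simp only [Fintype.sum_option, Option.elim_none, Option.elim_some, Finset.card_univ,
      Fintype.card_option] at h1
    push_cast at h1
    simp only [Complex.norm_real, Real.norm_eq_abs]
    calc |g x| ^ 2 ≤ (C * (a + ∑ b, |h b x|)) ^ 2 := pow_le_pow_left₀ (abs_nonneg _) (hle x) 2
      _ = C ^ 2 * (a + ∑ b, |h b x|) ^ 2 := by ring
      _ ≤ C ^ 2 * ((Fintype.card β + 1) * (a ^ 2 + ∑ b, |h b x| ^ 2)) := by gcongr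
      _ = _ := by ring
  have hi : ∀ b, IntegrableOn (fun x => ‖((h b x : ℝ) : ℂ)‖ ^ 2) (cell d) := fun b =>
    integrableOn_cell_of_continuous (((Complex.continuous_ofReal.comp (hh b)).norm).pow 2)
  have hint : ∫ x in cell d, ‖((g x : ℝ) : ℂ)‖ ^ 2 ≤ C ^ 2 * (Fintype.card β + 1) *
      (a ^ 2 * (2 * Real.pi) ^ d + ∑ b, ∫ x in cell d, ‖((h b x : ℝ) : ℂ)‖ ^ 2) := by
    calc _ ≤ ∫ x in cell d,
          C ^ 2 * (Fintype.card β + 1) * (a ^ 2 + ∑ b, ‖((h b x : ℝ) : ℂ)‖ ^ 2) := by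
          refine setIntegral_mono (integrableOn_cell_of_continuous
            (((Complex.continuous_ofReal.comp hg).norm).pow 2)) ?_ key
          exact ((integrableOn_cell_of_continuous continuous_const).add
            (integrable_finsetSum _ fun b _ => hi b)).const_mul _
      _ = _ := by
          rw [integral_const_mul, integral_add (integrableOn_cell_of_continuous continuous_const)
            (integrable_finsetSum _ fun b _ => hi b), integral_finsetSum _ fun b _ => hi b,
            setIntegral_const, Measure.real, volume_cell, ENNReal.toReal_ofReal hv.le, smul_eq_mul,
            mul_comm _ (a ^ 2)]
  simp only [fourierR]
  have hz : ∀ b, sobSq 0 (fourier fun x => (h b x : ℂ)) =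
      ENNReal.ofReal (((2 * Real.pi) ^ d)⁻¹ * ∫ x in cell d, ‖((h b x : ℝ) : ℂ)‖ ^ 2) := fun b =>
    sobSq_zero_eq (Complex.continuous_ofReal.comp (hh b)) (hhp b).ofReal
  have hnn : ∀ b, 0 ≤ ∫ x in cell d, ‖((h b x : ℝ) : ℂ)‖ ^ 2 := fun b =>
    integral_nonneg fun x => sq_nonneg _
  have hgz : sobSq 0 (fourier fun x => (g x : ℂ)) =
      ENNReal.ofReal (((2 * Real.pi) ^ d)⁻¹ * ∫ x in cell d, ‖((g x : ℝ) : ℂ)‖ ^ 2) :=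
    sobSq_zero_eq (Complex.continuous_ofReal.comp hg) hgp.ofReal
  rw [hgz]
  simp only [hz]
  rw [← ENNReal.ofReal_sum_of_nonneg fun b _ => mul_nonneg (inv_nonneg.2 hv.le) (hnn b),
    ← ENNReal.ofReal_add (sq_nonneg _)
      (Finset.sum_nonneg fun b _ => mul_nonneg (inv_nonneg.2 hv.le) (hnn b)),
    ← ENNReal.ofReal_mul (by positivity)]
  refine ENNReal.ofReal_le_ofReal ?_
  rw [inv_mul_le_iff₀ hv, ← Finset.mul_sum]
  refine hint.trans (le_of_eq ?_)
  field_simp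

/-! ### Extrapolation from shifted truncations -/

/-- Approximation of a composition by compositions with smooth curves. -/
lemma exists_approx_comp {r : ℕ} (hr : (d : ℝ) / 2 < r) (hr1 : 1 ≤ r) (n : ℕ) (L : ℝ≥0) (B : ℝ) :
    ∃ C : ℝ≥0, ∀ F, PhaseReg (n + 1) (phaseBall d ((n + 1 + 2 : ℕ) * L)) B F → ∀ w,
    WienerCurve (r + 1) L w → ∃ A : ℕ → Pt d → ℝ,
      (∀ j, Continuous (A j)) ∧ (∀ j, TorusPeriodic (A j)) ∧
      (∀ j x, |F (curve w x) - A j x| ≤ C * (((4 : ℝ) ^ (n + 1))⁻¹ ^ j +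
        ∑ b, |w b x - trigPoly (4 ^ j) (fourierR (w b)) x|)) ∧
      ∀ j, sobSq (n + 1 : ℕ) (fourierR (A j)) ≤
        C * (1 + ∑ b, sobSq (n + 1 : ℕ) (trunc (4 ^ j) (fourierR (w b)))) := by
  obtain ⟨D, hD⟩ := sobSq_comp_le_tame hr (n + 1) B L
  set N := n + 1 with hN
  -- The weights of the extrapolation `F(z) ≈ ∑ a_i F(z + i δ Q)` over `1 ≤ i ≤ N`, which is exact
  -- up to the `N`-th forward difference.
  set a : ℕ → ℝ := fun i => (-1) ^ (i + 1) * (N.choose i) with ha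
  have ha_le : ∀ i, |a i| ≤ 2 ^ N := fun i => by
    rw [ha]
    simp only [abs_mul, abs_pow, abs_neg, abs_one, one_pow, one_mul, Nat.abs_cast]
    exact_mod_cast Nat.choose_le_two_pow N i
  set E : ℝ≥0∞ := N * ∑ _i ∈ Finset.range N, ENNReal.ofReal ((2 ^ N) ^ 2) *
    (D * (1 + ∑ _b : Option (Fin d), (2 + 2 * ENNReal.ofReal ((N * L) ^ 2)))) with hE
  have hEtop : E < ⊤ := by
    rw [hE]
    simp only [Finset.sum_const, nsmul_eq_mul]
    finiteness
  obtain ⟨E', hE'⟩ := exists_nnreal_of_lt_top hEtop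
  set C₁ : ℝ := |B| * L ^ N + N * (2 ^ N * |B|) with hC₁
  have hC₁0 : 0 ≤ C₁ := by positivity
  refine ⟨C₁.toNNReal + E', fun F hF w hw => ?_⟩
  have hr2 : (2 : ℝ) ≤ r + 1 := by
    have : (1 : ℝ) ≤ r := by exact_mod_cast hr1
    linarith
  set δ : ℕ → ℝ := fun j => L / 4 ^ j with hδ
  have hδ0 : ∀ j, 0 ≤ δ j := fun j => by rw [hδ]; positivity
  have hδL : ∀ j, δ j ≤ L := fun j => div_le_self L.2 (one_le_pow₀ (by norm_num))
  have hsm : ∀ j i, i < N → SmoothCurve (phaseBall d ((N + 2 : ℕ) * L))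
      (shiftedTrig w j ((i + 1 : ℕ) * δ j)) := fun j i hi => by
    have := smoothCurve_shiftedTrig hr2 hw (n := N) j (i := i + 1) (by omega) (by omega)
    push_cast at this ⊢
    exact this
  have hcont : ∀ j i, i < N → Continuous fun x => F (curve (shiftedTrig w j ((i + 1 : ℕ) * δ j)) x) :=
    fun j i hi => continuous_comp_curve hF (fun b => (contDiff_shiftedTrig _ _ _ b).continuous)
      fun x => phaseBall_subset _ _ ((hsm j i hi).mem x)
  -- `F` is not evaluated at the truncated curve, which may leave `q ≥ 0`, but at its shifts by `δ,
  -- …, N δ`, combined so as to extrapolate back to the unshifted point. The extrapolation costs a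
  -- term of order `δ^N`, and replacing the curve by its truncation costs a Lipschitz constant.
  refine ⟨fun j x => ∑ i ∈ Finset.range N, a (i + 1) *
    F (curve (shiftedTrig w j ((i + 1 : ℕ) * δ j)) x), fun j => ?_, fun j => ?_, fun j x => ?_,
    fun j => ?_⟩
  · exact continuous_finsetSum _ fun i hi =>
      continuous_const.mul (hcont j i (Finset.mem_range.1 hi))
  · intro x k
    refine Finset.sum_congr rfl fun i hi => ?_
    congr 1
    exact periodic_comp_curve hF (shiftedTrig_periodic _ _ _)
      (fun x => phaseBall_subset _ _ ((hsm j i (Finset.mem_range.1 hi)).mem x)) x k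
  · set z := curve w x with hz
    set Q := fiberDir d none with hQ
    have hmem : ∀ t : ℝ, 0 ≤ t → t ≤ N * δ j → z + t • Q ∈ phaseBall d ((N + 2 : ℕ) * L) := by
      intro t ht0 ht
      have e : z + t • Q = curve (fun b x => w b x + if b = none then t else 0) x := by
        rw [hz, hQ]
        simp only [curve, fiberDir]
        ext <;> simp
      rw [e, show (((N + 2 : ℕ) : ℝ)) * L = L + (N + 1) * L by push_cast; ring]
      refine mem_phaseBall_curve L.2 (fun l => ?_) ?_ ?_
      · simpa using hw.abs_le (by linarith) (some l) x
      · have := hw.nonneg x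
        simp only [if_true]; linarith
      · have h1 := (abs_le.1 (hw.abs_le (by linarith) none x)).2
        simp only [if_true]
        have : N * δ j ≤ N * L := by gcongr; exact hδL j
        linarith
    have hfd := abs_fwdDiff_le (phaseBall_subset d _) (hδ0 j) N hF z hmem
    -- The term `i = 0` in the expansion of the `N`-th difference is `F z`; up to sign, the other
    -- terms are the extrapolation sum.
    have hexp : F z - ∑ i ∈ Finset.range N, a (i + 1) * F (z + (i + 1) • δ j • Q) =
        (-1) ^ N * (fwdDiff (δ j • Q))^[N] F z := by
      have h0 := fwdDiff_iter_eq_sum_shift (δ j • Q) F N z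
      rw [Finset.sum_range_succ' _ N] at h0
      have e0 : (-1 : ℝ) ^ N * (((-1) ^ (N - 0) * (N.choose 0 : ℤ)) • F (z + 0 • δ j • Q)) =
          F z := by
        have : (-1 : ℝ) ^ N * (-1) ^ N = 1 := by rw [← mul_pow]; simp
        rw [zsmul_eq_mul]
        push_cast
        simp only [Nat.sub_zero, Nat.choose_zero_right, Nat.cast_one, mul_one, zero_smul, add_zero]
        rw [← mul_assoc, this, one_mul]
      rw [h0, mul_add, Finset.mul_sum, e0, sub_eq_add_neg, ← Finset.sum_neg_distrib, add_comm]
      congr 1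
      refine Finset.sum_congr rfl fun i hi => ?_
      have hi' : i < N := Finset.mem_range.1 hi
      have e : (-1 : ℝ) ^ N * (-1) ^ (N - (i + 1)) = (-1) ^ (i + 1) := by
        obtain ⟨K, hK⟩ : ∃ K, N = K + (i + 1) := ⟨N - (i + 1), by omega⟩
        rw [hK, Nat.add_sub_cancel, pow_add, mul_right_comm, ← pow_add, ← two_mul, pow_mul]
        simp
      rw [ha, zsmul_eq_mul]
      push_cast
      rw [pow_succ _ (i + 1), ← e]
      ring
    have hterm : ∀ i ∈ Finset.range N, |a (i + 1) * F (z + (i + 1) • δ j • Q) - a (i + 1) *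
        F (curve (shiftedTrig w j ((i + 1 : ℕ) * δ j)) x)| ≤
        2 ^ N * |B| * ∑ b, |w b x - trigPoly (4 ^ j) (fourierR (w b)) x| := by
      intro i hi
      have hi' : i < N := Finset.mem_range.1 hi
      have hm : z + (i + 1) • δ j • Q ∈ phaseBall d ((N + 2 : ℕ) * L) := by
        rw [← Nat.cast_smul_eq_nsmul ℝ, smul_smul]
        refine hmem _ (mul_nonneg (by positivity) (hδ0 j)) ?_
        exact mul_le_mul_of_nonneg_right (by exact_mod_cast hi') (hδ0 j)
      rw [← mul_sub, abs_mul]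
      have hl := hF.lipschitz hm ((hsm j i hi').mem x)
      have hnorm : ‖z + (i + 1) • δ j • Q - curve (shiftedTrig w j ((i + 1 : ℕ) * δ j)) x‖ ≤
          ∑ b, |w b x - trigPoly (4 ^ j) (fourierR (w b)) x| := by
        have e : z + (i + 1) • δ j • Q - curve (shiftedTrig w j ((i + 1 : ℕ) * δ j)) x =
            ((0, (fun l => w (some l) x - trigPoly (4 ^ j) (fourierR (w (some l))) x),
              w none x - trigPoly (4 ^ j) (fourierR (w none)) x) : Phase d) := by
          rw [hz, hQ, ← Nat.cast_smul_eq_nsmul ℝ, smul_smul]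
          simp only [curve, fiberDir, shiftedTrig]
          ext
          · simp
          · simp
          · simp
        have hb : ∀ b, |w b x - trigPoly (4 ^ j) (fourierR (w b)) x| ≤
            ∑ b, |w b x - trigPoly (4 ^ j) (fourierR (w b)) x| := fun b =>
          Finset.single_le_sum (f := fun b => |w b x - trigPoly (4 ^ j) (fourierR (w b)) x|)
            (fun _ _ => abs_nonneg _) (Finset.mem_univ b)
        have hs0 : 0 ≤ ∑ b, |w b x - trigPoly (4 ^ j) (fourierR (w b)) x| :=
          Finset.sum_nonneg fun _ _ => abs_nonneg _
        rw [e, Prod.norm_def, Prod.norm_def]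
        refine max_le (by simpa using hs0) (max_le ?_ (hb none))
        exact (pi_norm_le_iff_of_nonneg hs0).2 fun l => hb (some l)
      calc |a (i + 1)| * |_| ≤ 2 ^ N * (|B| * ∑ b, |w b x - trigPoly (4 ^ j) (fourierR (w b)) x|) := by
            gcongr
            · exact ha_le _
            · refine hl.trans ?_
              gcongr
              exact le_abs_self B
        _ = _ := by ring
    have hdecomp : F z - ∑ i ∈ Finset.range N, a (i + 1) *
        F (curve (shiftedTrig w j ((i + 1 : ℕ) * δ j)) x) =
        (-1) ^ N * (fwdDiff (δ j • Q))^[N] F z + ∑ i ∈ Finset.range N,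
          (a (i + 1) * F (z + (i + 1) • δ j • Q) - a (i + 1) *
            F (curve (shiftedTrig w j ((i + 1 : ℕ) * δ j)) x)) := by
      rw [← hexp, Finset.sum_sub_distrib]
      ring
    rw [hdecomp]
    have hpow : δ j ^ N = L ^ N * ((4 : ℝ) ^ N)⁻¹ ^ j := by
      rw [hδ]
      simp only [div_eq_mul_inv, mul_pow, inv_pow, ← pow_mul, mul_comm]
    have hS0 : 0 ≤ ∑ b, |w b x - trigPoly (4 ^ j) (fourierR (w b)) x| :=
      Finset.sum_nonneg fun _ _ => abs_nonneg _
    have hp0 : (0 : ℝ) ≤ ((4 : ℝ) ^ N)⁻¹ ^ j := by positivity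
    calc _ ≤ |(-1) ^ N * (fwdDiff (δ j • Q))^[N] F z| + ∑ i ∈ Finset.range N,
          2 ^ N * |B| * ∑ b, |w b x - trigPoly (4 ^ j) (fourierR (w b)) x| := by
          refine (abs_add_le _ _).trans (add_le_add le_rfl ?_)
          exact (Finset.abs_sum_le_sum_abs _ _).trans (Finset.sum_le_sum hterm)
      _ ≤ |B| * (L ^ N * ((4 : ℝ) ^ N)⁻¹ ^ j) +
          N * (2 ^ N * |B| * ∑ b, |w b x - trigPoly (4 ^ j) (fourierR (w b)) x|) := by
          rw [Finset.sum_const, Finset.card_range, nsmul_eq_mul, abs_mul, abs_pow, abs_neg, abs_one,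
            one_pow, one_mul, ← hpow]
          gcongr
          refine hfd.trans ?_
          have := pow_nonneg (hδ0 j) N
          gcongr
          exact le_abs_self B
      _ ≤ C₁ * (((4 : ℝ) ^ N)⁻¹ ^ j + ∑ b, |w b x - trigPoly (4 ^ j) (fourierR (w b)) x|) := by
          rw [hC₁]
          have h1 : 0 ≤ |B| * (L : ℝ) ^ N := by positivity
          have h2 : 0 ≤ (N : ℝ) * (2 ^ N * |B|) := by positivity
          nlinarith [mul_nonneg h1 hS0, mul_nonneg h2 hp0]
      _ ≤ _ := by
          gcongr
          rw [NNReal.coe_add, Real.coe_toNNReal _ hC₁0]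
          linarith [E'.2]
  · have hi : ∀ i ∈ Finset.range N, IntegrableOn (fun x => a (i + 1) *
        F (curve (shiftedTrig w j ((i + 1 : ℕ) * δ j)) x)) (cell d) := fun i hi =>
      integrableOn_cell_of_continuous
        (continuous_const.mul (hcont j i (Finset.mem_range.1 hi)))
    rw [fourierR_sum _ hi]
    refine (sobSq_sum_le _ _ _).trans ?_
    set Z : ℝ≥0∞ := 1 + ∑ b, sobSq N (trunc (4 ^ j) (fourierR (w b))) with hZ
    have hZb : ∀ b, sobSq N (trunc (4 ^ j) (fourierR (w b))) ≤ Z := fun b =>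
      (Finset.single_le_sum (f := fun b => sobSq N (trunc (4 ^ j) (fourierR (w b))))
        (fun _ _ => bot_le) (Finset.mem_univ b)).trans le_add_self
    have hZ1 : 1 ≤ Z := le_self_add
    have hle : ∀ i ∈ Finset.range N, sobSq N (fourierR fun x => a (i + 1) *
        F (curve (shiftedTrig w j ((i + 1 : ℕ) * δ j)) x)) ≤ ENNReal.ofReal ((2 ^ N) ^ 2) *
        (D * (1 + ∑ _b : Option (Fin d), (2 + 2 * ENNReal.ofReal ((N * L) ^ 2)))) * Z := by
      intro i hi
      have hi' : i < N := Finset.mem_range.1 hi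
      rw [fourierR_const_mul, sobSq_smul, mul_assoc]
      gcongr
      · rw [← ofReal_norm, ← ENNReal.ofReal_pow (norm_nonneg _), Complex.norm_real,
          Real.norm_eq_abs]
        exact ENNReal.ofReal_le_ofReal (pow_le_pow_left₀ (abs_nonneg _) (ha_le _) 2)
      · refine (hD _ (phaseBall_subset d _) F hF _ (hsm j i hi')
          fun b i => wien_pderiv_shiftedTrig_le hw j _ b i).trans ?_
        rw [mul_assoc]
        gcongr
        rw [add_mul, one_mul, Finset.sum_mul]
        gcongr with b
        refine (sobSq_shiftedTrig_le _ _ _ _ _).trans ?_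
        rw [add_mul]
        refine add_le_add (mul_le_mul_right (hZb b) _) ?_
        refine le_trans (mul_le_mul_right (ENNReal.ofReal_le_ofReal ?_) _)
          (le_mul_of_one_le_right bot_le hZ1)
        refine pow_le_pow_left₀ (mul_nonneg (by positivity) (hδ0 j)) ?_ 2
        exact mul_le_mul (by exact_mod_cast hi') (hδL j) (hδ0 j) (by positivity)
    calc _ ≤ (N : ℝ≥0∞) * ∑ _i ∈ Finset.range N, ENNReal.ofReal ((2 ^ N) ^ 2) *
          (D * (1 + ∑ _b : Option (Fin d), (2 + 2 * ENNReal.ofReal ((N * L) ^ 2)))) * Z := by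
          rw [Finset.card_range]
          gcongr with i hi
          exact hle i hi
      _ = E * Z := by rw [← Finset.sum_mul, ← mul_assoc, hE]
      _ ≤ _ := by
          rw [hE']
          gcongr
          exact le_add_self

lemma sobSq_zero_sub_trunc_eq (a : ℝ) (c : Coeffs d) :
    sobSq 0 (c - trunc a c) = ∑' k, if freqSq k ≤ a then 0 else ‖c k‖ₑ ^ 2 := by
  rw [sobSq_eq]
  refine tsum_congr fun k => ?_
  rw [wt_zero, one_mul, Pi.sub_apply, trunc]
  split_ifs <;> simp

/-- Together with `tsum_high_le`, the two halves of the description of `H^σ` by truncations: the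
`L²` errors weighted by `4^{σj}`, and the `H^n` norms of the truncations weighted by `4^{(σ-n)j}`.
-/
lemma tsum_low_le {σ : ℝ} (hσ : 0 ≤ σ) (c : Coeffs d) :
    ∑' j : ℕ, four σ ^ j * sobSq 0 (c - trunc (4 ^ j) c) ≤
      (∑' j : ℕ, four (-σ) ^ j) * sobSq σ c := by
  simp only [sobSq_zero_sub_trunc_eq]
  calc _ = ∑' j : ℕ, ∑' k, (if freqSq k ≤ (4 : ℝ) ^ j then 0 else four σ ^ j) * ‖c k‖ₑ ^ 2 := by
        refine tsum_congr fun j => ?_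
        rw [← ENNReal.tsum_mul_left]
        refine tsum_congr fun k => ?_
        split_ifs <;> simp
    _ = ∑' k, (∑' j : ℕ, if freqSq k ≤ (4 : ℝ) ^ j then 0 else four σ ^ j) * ‖c k‖ₑ ^ 2 := by
        rw [ENNReal.tsum_comm]
        exact tsum_congr fun k => ENNReal.tsum_mul_right
    _ ≤ ∑' k, (∑' j : ℕ, four (-σ) ^ j) * wt σ k * ‖c k‖ₑ ^ 2 :=
        ENNReal.tsum_le_tsum fun k => by gcongr; exact tsum_four_low_le hσ k
    _ = _ := by
        rw [sobSq_eq, ← ENNReal.tsum_mul_left]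
        exact tsum_congr fun k => mul_assoc _ _ _

lemma tsum_high_le {σ n : ℝ} (h : σ ≤ n) (c : Coeffs d) :
    ∑' j : ℕ, four (σ - n) ^ j * sobSq n (trunc (4 ^ j) c) ≤
      (∑' j : ℕ, four (σ - n) ^ j) * four (n - σ) * sobSq σ c := by
  calc _ = ∑' j : ℕ, ∑' k, (if freqSq k ≤ (4 : ℝ) ^ j then four (σ - n) ^ j else 0) *
          (wt n k * ‖c k‖ₑ ^ 2) := by
        refine tsum_congr fun j => ?_
        rw [sobSq_eq, ← ENNReal.tsum_mul_left]
        refine tsum_congr fun k => ?_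
        rw [trunc]
        split_ifs <;> simp
    _ = ∑' k, (∑' j : ℕ, if freqSq k ≤ (4 : ℝ) ^ j then four (σ - n) ^ j else 0) *
          (wt n k * ‖c k‖ₑ ^ 2) := by
        rw [ENNReal.tsum_comm]
        exact tsum_congr fun k => ENNReal.tsum_mul_right
    _ ≤ ∑' k, (∑' j : ℕ, four (σ - n) ^ j) * four (-(σ - n)) * wt (σ - n) k *
          (wt n k * ‖c k‖ₑ ^ 2) :=
        ENNReal.tsum_le_tsum fun k => by
          gcongr; exact tsum_four_high_le (by linarith) k
    _ = _ := by
        rw [sobSq_eq, ← ENNReal.tsum_mul_left, neg_sub]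
        refine tsum_congr fun k => ?_
        rw [show wt σ k = wt (σ - n) k * wt n k by rw [← wt_add, sub_add_cancel]]
        ring

lemma continuous_trigPoly_sub {f : Pt d → ℝ} (hf : Continuous f) (a : ℝ) :
    Continuous fun x => f x - trigPoly a (fourierR f) x :=
  hf.sub (contDiff_trigPoly a _).continuous

lemma fourierR_sub_trigPoly {f : Pt d → ℝ} (hf : Continuous f) (a : ℝ) :
    fourierR (fun x => f x - trigPoly a (fourierR f) x) = fourierR f - trunc a (fourierR f) := by
  rw [fourierR_sub (integrableOn_cell_of_continuous hf)
    (integrableOn_cell_of_continuous (contDiff_trigPoly a _).continuous),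
    fourierR_trigPoly (isRealDist_fourierR f)]

lemma tendsto_fourierR_of_abs_sub_le {g : ℕ → Pt d → ℝ} {f : Pt d → ℝ} (hf : Continuous f)
    (hg : ∀ j, Continuous (g j)) {e : ℕ → ℝ} (he : Filter.Tendsto e Filter.atTop (nhds 0))
    (h : ∀ j x, |f x - g j x| ≤ e j) (k : Freq d) :
    Filter.Tendsto (fun j => fourierR (g j) k) Filter.atTop (nhds (fourierR f k)) := by
  rw [tendsto_iff_norm_sub_tendsto_zero]
  refine squeeze_zero (fun _ => norm_nonneg _) (fun j => ?_) he
  have h1 := congrFun (fourierR_sub (integrableOn_cell_of_continuous hf)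
    (integrableOn_cell_of_continuous (hg j))) k
  rw [norm_sub_rev, ← Pi.sub_apply, ← h1]
  refine norm_fourier_le_of_bound (fun x _ => ?_) k
  rw [Complex.norm_real]
  exact h j x

/-- Composition with functions of class `C^⌈σ⌉` is bounded in the Sobolev space of order `σ`. -/
theorem sobSq_comp_le {r : ℕ} (hr : (d : ℝ) / 2 < r) (hr1 : 1 ≤ r) (n : ℕ) {σ : ℝ} (hσ0 : 0 < σ)
    (hσ : σ ≤ n + 1) (L : ℝ≥0) (B : ℝ) :
    ∃ C : ℝ≥0, ∀ F, PhaseReg (n + 1) (phaseBall d ((n + 1 + 2 : ℕ) * L)) B F → ∀ w,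
    WienerCurve (r + 1) L w → sobSq σ (fourierR fun x => F (curve w x)) ≤
      C * (1 + ∑ b, sobSq σ (fourierR (w b))) := by
  obtain ⟨C, hC⟩ := exists_approx_comp hr hr1 n L B
  have hr2 : (2 : ℝ) ≤ r + 1 := by
    have : (1 : ℝ) ≤ r := by exact_mod_cast hr1
    linarith
  have hmem : ∀ w, WienerCurve (r + 1) L w → ∀ x,
      curve w x ∈ phaseBall d ((n + 1 + 2 : ℕ) * L) := fun w hw x => by
    rw [show (((n + 1 + 2 : ℕ) : ℝ)) * L = L + (n + 2) * L by push_cast; ring]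
    refine mem_phaseBall_curve L.2 (fun l => hw.abs_le (by linarith) _ x) (hw.nonneg x) ?_
    have h1 := (abs_le.1 (hw.abs_le (by linarith) none x)).2
    nlinarith [mul_nonneg (Nat.cast_nonneg (α := ℝ) n) L.2, L.2]
  have hcF : ∀ F, PhaseReg (n + 1) (phaseBall d ((n + 1 + 2 : ℕ) * L)) B F → ∀ w,
      WienerCurve (r + 1) L w → Continuous fun x => F (curve w x) := fun F hF w hw =>
    continuous_comp_curve hF hw.continuous fun x => phaseBall_subset _ _ (hmem w hw x)
  have hpF : ∀ F, PhaseReg (n + 1) (phaseBall d ((n + 1 + 2 : ℕ) * L)) B F → ∀ w,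
      WienerCurve (r + 1) L w → TorusPeriodic fun x => F (curve w x) := fun F hF w hw =>
    periodic_comp_curve hF hw.periodic fun x => phaseBall_subset _ _ (hmem w hw x)
  -- At the endpoint `σ = n + 1` the ratio `4^{σ-n-1}` is one and the geometric sum diverges; there
  -- the approximations are bounded in `H^σ` itself and converge uniformly, so the bound passes to
  -- the limit. Below the endpoint the errors at all scales are summed.
  rcases eq_or_lt_of_le hσ with rfl | hlt
  · refine ⟨C, fun F hF w hw => ?_⟩
    obtain ⟨A, hA1, hA2, hA3, hA4⟩ := hC F hF w hw
    have hlim : Filter.Tendsto (fun j : ℕ => C * (((4 : ℝ) ^ (n + 1))⁻¹ ^ j +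
        ∑ _b : Option (Fin d), (L : ℝ) / 4 ^ j)) Filter.atTop (nhds 0) := by
      have h1 : Filter.Tendsto (fun j : ℕ => ((4 : ℝ) ^ (n + 1))⁻¹ ^ j) Filter.atTop (nhds 0) :=
        tendsto_pow_atTop_nhds_zero_of_lt_one (by positivity)
          (inv_lt_one_of_one_lt₀ (one_lt_pow₀ (by norm_num) (by omega)))
      have h2 : Filter.Tendsto (fun j : ℕ => (L : ℝ) / 4 ^ j) Filter.atTop (nhds 0) := by
        have := (tendsto_pow_atTop_nhds_zero_of_lt_one (r := ((4 : ℝ))⁻¹) (by positivity)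
          (by norm_num)).const_mul (L : ℝ)
        simpa [div_eq_mul_inv] using this
      simpa using (h1.add (tendsto_finsetSum Finset.univ
        fun (_ : Option (Fin d)) _ => h2)).const_mul (C : ℝ)
    refine sobSq_le_of_tendsto (tendsto_fourierR_of_abs_sub_le (hcF F hF w hw) hA1 hlim
      fun j x => (hA3 j x).trans ?_) (Filter.Eventually.of_forall fun j => (?_ : _ ≤ _))
    · gcongr with b
      exact hw.abs_sub_le hr2 j b x
    · have := hA4 j
      push_cast at this
      refine this.trans ?_
      gcongr with b
      exact sobSq_trunc_le _ _ _
  · set N : ℝ := n + 1 with hN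
    set S₁ := ∑' j : ℕ, four (-σ) ^ j with hS₁
    set S₂ := ∑' j : ℕ, four (σ - N) ^ j with hS₂
    set S₃ := ∑' j : ℕ, four (σ - 2 * N) ^ j with hS₃
    have hS₁t : S₁ < ⊤ := tsum_four_lt_top (by linarith)
    have hS₂t : S₂ < ⊤ := tsum_four_lt_top (by linarith)
    have hS₃t : S₃ < ⊤ := tsum_four_lt_top (by linarith)
    set E₁ : ℝ≥0∞ := ENNReal.ofReal ((C : ℝ) ^ 2 * (Fintype.card (Option (Fin d)) + 1)) with hE₁
    have hKt : 2 * four σ * (E₁ * (S₃ + S₁) + C * (S₂ + S₂ * four (N - σ))) < ⊤ := by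
      have := four_lt_top σ
      have := four_lt_top (N - σ)
      finiteness
    obtain ⟨K, hK⟩ := exists_nnreal_of_lt_top hKt
    refine ⟨K, fun F hF w hw => ?_⟩
    obtain ⟨A, hA1, hA2, hA3, hA4⟩ := hC F hF w hw
    set Z : ℝ≥0∞ := 1 + ∑ b, sobSq σ (fourierR (w b)) with hZ
    have hlow : ∑' j : ℕ, four σ ^ j * sobSq 0 ((fourierR fun x => F (curve w x)) -
        fourierR (A j)) ≤ E₁ * (S₃ + S₁) * Z := by
      have h1 : ∀ j, sobSq 0 ((fourierR fun x => F (curve w x)) - fourierR (A j)) ≤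
          E₁ * (four (-2 * N) ^ j + ∑ b, sobSq 0 (fourierR (w b) - trunc (4 ^ j) (fourierR (w b)))) := by
        intro j
        rw [← fourierR_sub (integrableOn_cell_of_continuous (hcF F hF w hw))
          (integrableOn_cell_of_continuous (hA1 j))]
        have h2 := sobSq_zero_le_of_abs_le (g := fun x => F (curve w x) - A j x)
          (h := fun b x => w b x - trigPoly (4 ^ j) (fourierR (w b)) x)
          ((hcF F hF w hw).sub (hA1 j))
          (fun x k => by simp only [hpF F hF w hw x k, hA2 j x k])
          (fun b => continuous_trigPoly_sub (hw.continuous b) _)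
          (fun b x k => by simp only [hw.periodic b x k, trigPoly_periodic _ _ x k])
          (hA3 j)
        refine h2.trans ?_
        rw [← hE₁]
        gcongr with b
        · rw [four_pow]
          refine ENNReal.ofReal_le_ofReal (le_of_eq ?_)
          rw [Real.rpow_mul (by positivity), hN, show ((n : ℝ) + 1) = ((n + 1 : ℕ) : ℝ) by push_cast; ring,
            Real.rpow_natCast, Real.rpow_neg (by positivity), Real.rpow_two]
          simp only [inv_pow, ← pow_mul]
          congr 2
          ring
        · rw [fourierR_sub_trigPoly (hw.continuous b)]
      calc _ ≤ ∑' j : ℕ, four σ ^ j * (E₁ * (four (-2 * N) ^ j +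
            ∑ b, sobSq 0 (fourierR (w b) - trunc (4 ^ j) (fourierR (w b))))) :=
            ENNReal.tsum_le_tsum fun j => by gcongr; exact h1 j
        _ = E₁ * (S₃ + ∑ b, ∑' j : ℕ, four σ ^ j *
              sobSq 0 (fourierR (w b) - trunc (4 ^ j) (fourierR (w b)))) := by
            rw [← Summable.tsum_finsetSum fun b _ => ENNReal.summable, hS₃, ← ENNReal.tsum_add,
              ← ENNReal.tsum_mul_left]
            refine tsum_congr fun j => ?_
            rw [← Finset.mul_sum, show σ - 2 * N = σ + -2 * N by ring, four_add, mul_pow]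
            ring
        _ ≤ E₁ * (S₃ * Z + ∑ b, S₁ * sobSq σ (fourierR (w b))) := by
            gcongr with b
            · exact le_mul_of_one_le_right bot_le le_self_add
            · exact tsum_low_le hσ0.le _
        _ ≤ E₁ * (S₃ * Z + S₁ * Z) := by
            rw [← Finset.mul_sum]
            gcongr
            exact le_add_self
        _ = _ := by ring
    have hhigh : ∑' j : ℕ, four (σ - N) ^ j * sobSq N (fourierR (A j)) ≤
        C * (S₂ + S₂ * four (N - σ)) * Z := by
      calc _ ≤ ∑' j : ℕ, four (σ - N) ^ j * (C * (1 + ∑ b, sobSq N (trunc (4 ^ j) (fourierR (w b))))) :=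
            ENNReal.tsum_le_tsum fun j => by
              have := hA4 j
              push_cast at this
              gcongr
        _ = C * (S₂ + ∑ b, ∑' j : ℕ, four (σ - N) ^ j * sobSq N (trunc (4 ^ j) (fourierR (w b)))) := by
            rw [← Summable.tsum_finsetSum fun b _ => ENNReal.summable, hS₂, ← ENNReal.tsum_add,
              ← ENNReal.tsum_mul_left]
            refine tsum_congr fun j => ?_
            rw [← Finset.mul_sum]
            ring
        _ ≤ C * (S₂ * Z + ∑ b, S₂ * four (N - σ) * sobSq σ (fourierR (w b))) := by
            gcongr with b
            · exact le_mul_of_one_le_right bot_le le_self_add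
            · exact tsum_high_le hlt.le _
        _ ≤ C * (S₂ * Z + S₂ * four (N - σ) * Z) := by
            rw [← Finset.mul_sum]
            gcongr
            exact le_add_self
        _ = _ := by ring
    calc _ ≤ 2 * four σ * (E₁ * (S₃ + S₁) * Z + C * (S₂ + S₂ * four (N - σ)) * Z) := by
          refine (sobSq_le_of_approx hσ0.le N (by positivity) _ fun j => fourierR (A j)).trans ?_
          gcongr
      _ = K * Z := by rw [← hK]; ring

/-! ## Hamiltonians -/

/-- The Hamiltonian at a fixed time, as a function on the phase space. -/
def frozen (H : Hamiltonian d) (t : ℝ) (z : Phase d) : ℝ := H t z.1 z.2.1 z.2.2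

/-- The coefficients are defined by derivatives in one variable at a time, whereas the composition
estimates use derivatives within the half-space in all variables; on the half-space they agree. The
next lemma is the same for `q`, one-sided at zero. -/
lemma frozen_Hp_eq {H : Hamiltonian d} {t : ℝ} (hF : ContDiffOn ℝ 1 (frozen H t) (phaseDomain d))
    (i : Fin d) {z : Phase d} (hz : z ∈ phaseDomain d) :
    frozen (Hp H i) t z = dirDeriv (frozen H t) (fiberDir d (some i)) z := by
  have hd := (hF.differentiableOn one_ne_zero z hz).hasFDerivWithinAt
  have hline : HasFDerivAt (fun p : Pt d => ((z.1, p, z.2.2) : Phase d))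
      ((0 : Pt d →L[ℝ] Pt d).prod ((ContinuousLinearMap.id ℝ (Pt d)).prod 0)) z.2.1 :=
    (hasFDerivAt_const z.1 _).prodMk ((hasFDerivAt_id _).prodMk (hasFDerivAt_const z.2.2 _))
  have h := hd.comp_hasFDerivAt z.2.1 hline (Filter.Eventually.of_forall fun p => hz)
  have h' : HasFDerivAt (fun p : Pt d => H t z.1 p z.2.2) _ z.2.1 := h
  simp only [frozen, Hp, pderiv]
  rw [h'.fderiv]
  rfl

lemma frozen_Hq_eq {H : Hamiltonian d} {t : ℝ} (hF : ContDiffOn ℝ 1 (frozen H t) (phaseDomain d))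
    {z : Phase d} (hz : z ∈ phaseDomain d) :
    frozen (Hq H) t z = dirDeriv (frozen H t) (fiberDir d none) z := by
  have hd := (hF.differentiableOn one_ne_zero z hz).hasFDerivWithinAt
  have hline : HasDerivWithinAt (fun q : ℝ => ((z.1, z.2.1, q) : Phase d)) (fiberDir d none)
      (Ici 0) z.2.2 :=
    (hasDerivWithinAt_const _ _ z.1).prodMk
      ((hasDerivWithinAt_const _ _ z.2.1).prodMk (hasDerivWithinAt_id _ _))
  have h := hd.comp_hasDerivWithinAt z.2.2 hline (fun q hq => hq)
  have h' : HasDerivWithinAt (fun q : ℝ => H t z.1 z.2.1 q) _ (Ici 0) z.2.2 := h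
  simp only [frozen, Hq]
  rw [h'.derivWithin (uniqueDiffOn_Ici 0 _ hz)]
  rfl

lemma HamiltonianRegular.mono {T₀ : ℝ} {n N : ℕ} {H : Hamiltonian d}
    (h : HamiltonianRegular T₀ N H) (hn : n ≤ N) : HamiltonianRegular T₀ n H where
  measurable := h.measurable
  periodic := h.periodic
  contDiff t ht := (h.contDiff t ht).of_le (by exact_mod_cast hn)
  bound := h.bound.imp fun _ hF => ⟨hF.1, fun m hm => hF.2 m (hm.trans hn)⟩

lemma HamiltonianRegular.contDiff_bound_of_dirDeriv {T₀ : ℝ} {n : ℕ} {H K : Hamiltonian d}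
    (h : HamiltonianRegular T₀ (n + 1) H) {e : Phase d} (he : ‖e‖ ≤ 1)
    (hK : ∀ t ∈ Icc 0 T₀, ∀ z ∈ phaseDomain d, frozen K t z = dirDeriv (frozen H t) e z) :
    (∀ t ∈ Icc 0 T₀, ContDiffOn ℝ n (frozen K t) (phaseDomain d)) ∧
    ∃ F : ℝ → ℝ, MonotoneOn F (Ici 0) ∧ ∀ m ≤ n, ∀ t ∈ Icc 0 T₀, ∀ z ∈ phaseDomain d,
      ‖iteratedFDerivWithin ℝ m (frozen K t) (phaseDomain d) z‖ ≤ F (‖z.2.1‖ + z.2.2) := by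
  have hu := uniqueDiffOn_phaseDomain d
  refine ⟨fun t ht => ?_, ?_⟩
  · have h1 : ContDiffOn ℝ n (dirDeriv (frozen H t) e) (phaseDomain d) :=
      ((h.contDiff t ht).fderivWithin hu (by norm_cast)).clm_apply contDiffOn_const
    exact h1.congr fun z hz => hK t ht z hz
  · obtain ⟨F, hF1, hF2⟩ := h.bound
    refine ⟨F, hF1, fun m hm t ht z hz => ?_⟩
    rw [iteratedFDerivWithin_congr (fun z hz => hK t ht z hz) hz]
    refine (norm_iteratedFDerivWithin_dirDeriv_le
      ((h.contDiff t ht).of_le (by exact_mod_cast Nat.succ_le_succ hm)) hz).trans ?_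
    exact (mul_le_of_le_one_right (norm_nonneg _) he).trans
      (hF2 (m + 1) (Nat.succ_le_succ hm) t ht z hz)

/-- Derivatives as limits of countably many difference quotients: this is how measurability passes
to the derivatives of `H` and to `∇u`. The steps are positive, so `q = 0` is no exception. -/
lemma tendsto_slope_nat {f : ℝ → ℝ} {f' x : ℝ} (h : HasDerivWithinAt f f' (Ici x) x) :
    Filter.Tendsto (fun n : ℕ => ((n : ℝ) + 1) * (f (x + 1 / ((n : ℝ) + 1)) - f x)) Filter.atTop
      (nhds f') := by
  have h1 := (hasDerivWithinAt_iff_tendsto_slope' self_notMem_Ioi).1 (h.mono Ioi_subset_Ici_self)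
  have h2 : Filter.Tendsto (fun n : ℕ => x + 1 / ((n : ℝ) + 1)) Filter.atTop
      (nhdsWithin x (Ioi x)) := by
    refine tendsto_nhdsWithin_iff.2 ⟨?_, Filter.Eventually.of_forall fun n => ?_⟩
    · simpa using tendsto_one_div_add_atTop_nhds_zero_nat.const_add x
    · have : (0 : ℝ) < 1 / ((n : ℝ) + 1) := by positivity
      exact lt_add_of_pos_right x this
  refine (h1.comp h2).congr fun n => ?_
  simp [slope_def_field]
  ring

lemma HamiltonianRegular.Hp {T₀ : ℝ} {n : ℕ} {H : Hamiltonian d}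
    (h : HamiltonianRegular T₀ (n + 1) H) (i : Fin d) : HamiltonianRegular T₀ n (Hp H i) := by
  have h1 : ∀ t ∈ Icc 0 T₀, ContDiffOn ℝ 1 (frozen H t) (phaseDomain d) := fun t ht =>
    (h.contDiff t ht).of_le (by norm_cast; omega)
  obtain ⟨hc, hb⟩ := h.contDiff_bound_of_dirDeriv (norm_fiberDir_le (some i)) (K := MFG.Hp H i)
    fun t ht z hz => frozen_Hp_eq (h1 t ht) i hz
  refine ⟨fun x p q hq => ?_, fun t ht p q hq x k => ?_, hc, hb⟩
  · refine measurable_of_tendsto_metrizable (f := fun (n : ℕ) (t : Icc (0 : ℝ) T₀) =>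
      ((n : ℝ) + 1) * (H t x (p + (1 / ((n : ℝ) + 1)) • Pi.single i 1) q - H t x p q))
      (fun n => ((h.measurable _ _ _ hq).sub (h.measurable _ _ _ hq)).const_mul _)
      (tendsto_pi_nhds.2 fun t => ?_)
    have hd := ((h1 t t.2).differentiableOn one_ne_zero ((x, p, q) : Phase d) hq).hasFDerivWithinAt
    have hline : HasFDerivAt (fun p : Pt d => ((x, p, q) : Phase d))
        ((0 : Pt d →L[ℝ] Pt d).prod ((ContinuousLinearMap.id ℝ (Pt d)).prod 0)) p :=
      (hasFDerivAt_const x _).prodMk ((hasFDerivAt_id _).prodMk (hasFDerivAt_const q _))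
    have h2 := hd.comp_hasFDerivAt p hline (Filter.Eventually.of_forall fun p => hq)
    have h3 : HasFDerivAt (fun p : Pt d => H t x p q) (fderiv ℝ (fun p : Pt d => H t x p q) p) p :=
      h2.differentiableAt.hasFDerivAt
    have h4 : HasDerivAt (fun a : ℝ => p + a • (Pi.single i 1 : Pt d)) (Pi.single i 1) 0 := by
      simpa using ((hasDerivAt_id (0 : ℝ)).smul_const (Pi.single i 1 : Pt d)).const_add p
    have h3' : HasFDerivAt (fun p : Pt d => H t x p q) (fderiv ℝ (fun p : Pt d => H t x p q) p)
        (p + (0 : ℝ) • (Pi.single i 1 : Pt d)) := by simpa using h3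
    have h5 := (h3'.comp_hasDerivAt (0 : ℝ) h4).hasDerivWithinAt (s := Ici 0)
    simpa [MFG.Hp, MFG.pderiv] using tendsto_slope_nat h5
  · simp only [MFG.Hp]
    congr 2
    funext p'
    exact h.periodic t ht p' q hq x k

lemma HamiltonianRegular.Hq {T₀ : ℝ} {n : ℕ} {H : Hamiltonian d}
    (h : HamiltonianRegular T₀ (n + 1) H) : HamiltonianRegular T₀ n (Hq H) := by
  have h1 : ∀ t ∈ Icc 0 T₀, ContDiffOn ℝ 1 (frozen H t) (phaseDomain d) := fun t ht =>
    (h.contDiff t ht).of_le (by norm_cast; omega)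
  obtain ⟨hc, hb⟩ := h.contDiff_bound_of_dirDeriv (norm_fiberDir_le none) (K := MFG.Hq H)
    fun t ht z hz => frozen_Hq_eq (h1 t ht) hz
  refine ⟨fun x p q hq => ?_, fun t ht p q hq x k => ?_, hc, hb⟩
  · refine measurable_of_tendsto_metrizable (f := fun (n : ℕ) (t : Icc (0 : ℝ) T₀) =>
      ((n : ℝ) + 1) * (H t x p (q + 1 / ((n : ℝ) + 1)) - H t x p q))
      (fun n => ((h.measurable _ _ _ (by positivity)).sub (h.measurable _ _ _ hq)).const_mul _)
      (tendsto_pi_nhds.2 fun t => ?_)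
    have hd := ((h1 t t.2).differentiableOn one_ne_zero ((x, p, q) : Phase d) hq).hasFDerivWithinAt
    have hline : HasDerivWithinAt (fun q : ℝ => ((x, p, q) : Phase d)) (fiberDir d none)
        (Ici 0) q :=
      (hasDerivWithinAt_const _ _ x).prodMk
        ((hasDerivWithinAt_const _ _ p).prodMk (hasDerivWithinAt_id _ _))
    have h2 := hd.comp_hasDerivWithinAt q hline (fun q hq => hq)
    have h3 : HasDerivWithinAt (fun q : ℝ => H t x p q)
        (derivWithin (fun q : ℝ => H t x p q) (Ici 0) q) (Ici 0) q :=
      h2.differentiableWithinAt.hasDerivWithinAt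
    exact tendsto_slope_nat (h3.mono (Ici_subset_Ici.2 hq))
  · simp only [MFG.Hq]
    refine derivWithin_congr (fun q' hq' => h.periodic t ht p q' hq' x k)
      (h.periodic t ht p q hq x k)

lemma HamiltonianRegular.exists_phaseReg {T₀ : ℝ} {n : ℕ} {H : Hamiltonian d}
    (h : HamiltonianRegular T₀ n H) (r : ℝ) :
    ∃ B : ℝ, ∀ t ∈ Icc 0 T₀, PhaseReg n (phaseBall d r) B (frozen H t) := by
  obtain ⟨F, hF1, hF2⟩ := h.bound
  refine ⟨F r, fun t ht => ⟨h.contDiff t ht, fun z hz k => h.periodic t ht z.2.1 z.2.2 hz z.1 k,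
    fun m hm z hz => (hF2 m hm t ht z hz.1).trans ?_⟩⟩
  have h0 : 0 ≤ ‖z.2.1‖ + z.2.2 := add_nonneg (norm_nonneg _) hz.1
  exact hF1 h0 (h0.trans hz.2) hz.2

/-! ## Measurability in time -/

/-- `f` is measurable in `(t, x)` for `t` in the open time interval. -/
def JointMeas (t₀ T : ℝ) {E : Type*} [MeasurableSpace E] (f : ℝ → Pt d → E) : Prop :=
  ∃ g : ℝ × Pt d → E, Measurable g ∧ ∀ t ∈ Ioo t₀ T, ∀ x, g (t, x) = f t x

lemma continuous_projIcc_comp {t₀ T : ℝ} (hT : t₀ ≤ T) {f : ℝ → Pt d → ℝ}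
    (hf : ContinuousOn (fun z : ℝ × Pt d => f z.1 z.2) (Icc t₀ T ×ˢ univ)) :
    Continuous fun z : ℝ × Pt d => f (projIcc t₀ T hT z.1) z.2 :=
  hf.comp_continuous (f := fun z : ℝ × Pt d => ((projIcc t₀ T hT z.1 : ℝ), z.2))
    ((continuous_subtype_val.comp ((continuous_projIcc (h := hT)).comp continuous_fst)).prodMk
      continuous_snd) fun z => ⟨Subtype.coe_prop (projIcc t₀ T hT z.1), mem_univ _⟩

lemma JointMeas.of_continuousOn {t₀ T : ℝ} (hT : t₀ ≤ T) {f : ℝ → Pt d → ℝ}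
    (hf : ContinuousOn (fun z : ℝ × Pt d => f z.1 z.2) (Icc t₀ T ×ˢ univ)) :
    JointMeas t₀ T f := by
  refine ⟨_, (continuous_projIcc_comp hT hf).measurable, fun t ht x => ?_⟩
  · simp only
    rw [projIcc_of_mem hT (Ioo_subset_Icc_self ht)]

lemma JointMeas.mul {t₀ T : ℝ} {f g : ℝ → Pt d → ℝ} (hf : JointMeas t₀ T f)
    (hg : JointMeas t₀ T g) : JointMeas t₀ T fun t x => f t x * g t x := by
  obtain ⟨F, hF, hF'⟩ := hf
  obtain ⟨G, hG, hG'⟩ := hg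
  exact ⟨fun z => F z * G z, hF.mul hG, fun t ht x => by simp only [hF' t ht x, hG' t ht x]⟩

/-- Limits of difference quotients of a jointly continuous function. Joint continuity of `∇u` is not
part of `IsMFGSolution`, so it is measurability that is propagated. -/
lemma JointMeas.pderiv {t₀ T : ℝ} (hT : t₀ ≤ T) {f : ℝ → Pt d → ℝ}
    (hf : ContinuousOn (fun z : ℝ × Pt d => f z.1 z.2) (Icc t₀ T ×ˢ univ))
    (hd : ∀ t ∈ Ioo t₀ T, Differentiable ℝ (f t)) (i : Fin d) :
    JointMeas t₀ T fun t => pderiv i (f t) := by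
  have hc := continuous_projIcc_comp hT hf
  have hm : MeasurableSet {z : ℝ × Pt d | z.1 ∈ Ioo t₀ T} := measurable_fst measurableSet_Ioo
  refine ⟨fun z => {z : ℝ × Pt d | z.1 ∈ Ioo t₀ T}.indicator
    (fun z => MFG.pderiv i (f z.1) z.2) z, ?_, fun t ht x =>
    indicator_of_mem (s := {z : ℝ × Pt d | z.1 ∈ Ioo t₀ T}) (a := (t, x)) ht _⟩
  refine measurable_of_tendsto_metrizable (f := fun (n : ℕ) (z : ℝ × Pt d) =>
    {z : ℝ × Pt d | z.1 ∈ Ioo t₀ T}.indicator (fun z => ((n : ℝ) + 1) *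
      (f (projIcc t₀ T hT z.1) (z.2 + (1 / ((n : ℝ) + 1)) • Pi.single i 1) -
        f (projIcc t₀ T hT z.1) z.2)) z) (fun n => ?_) (tendsto_pi_nhds.2 fun z => ?_)
  · refine Measurable.indicator ?_ hm
    refine Continuous.measurable (continuous_const.mul (Continuous.sub ?_ hc))
    exact hc.comp (continuous_fst.prodMk (continuous_snd.add continuous_const))
  · by_cases hz : z.1 ∈ Ioo t₀ T
    · simp only [indicator_of_mem (s := {z : ℝ × Pt d | z.1 ∈ Ioo t₀ T}) hz]
      rw [projIcc_of_mem hT (Ioo_subset_Icc_self hz)]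
      have h4 : HasDerivAt (fun a : ℝ => z.2 + a • (Pi.single i 1 : Pt d)) (Pi.single i 1) 0 := by
        simpa using ((hasDerivAt_id (0 : ℝ)).smul_const (Pi.single i 1 : Pt d)).const_add z.2
      have h3' : HasFDerivAt (f z.1) (fderiv ℝ (f z.1) z.2)
          (z.2 + (0 : ℝ) • (Pi.single i 1 : Pt d)) := by
        simpa using (hd z.1 hz z.2).hasFDerivAt
      have h5 := (h3'.comp_hasDerivAt (0 : ℝ) h4).hasDerivWithinAt (s := Ici 0)
      simpa [MFG.pderiv] using tendsto_slope_nat h5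
    · simp only [indicator_of_notMem (s := {z : ℝ × Pt d | z.1 ∈ Ioo t₀ T}) hz]
      exact tendsto_const_nhds

/-- `H` is a Carathéodory function, continuous in `(x, p, q)` and measurable in `t`, hence jointly
measurable. Before this applies, `t` is clamped to `[0, T₀]` and `q` to `[0, ∞)`, since nothing is
known about `H` elsewhere. -/
lemma JointMeas.hamiltonian {T₀ t₀ T : ℝ} (h₀ : 0 ≤ t₀) (hT : T ≤ T₀) {n : ℕ}
    {H : Hamiltonian d} (h : HamiltonianRegular T₀ n H) {p : ℝ → Pt d → Pt d} {q : ℝ → Pt d → ℝ}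
    (hp : ∀ i, JointMeas t₀ T fun t x => p t x i) (hq : JointMeas t₀ T q)
    (hq0 : ∀ t ∈ Ioo t₀ T, ∀ x, 0 ≤ q t x) :
    JointMeas t₀ T fun t x => H t x (p t x) (q t x) := by
  by_cases hne : (Ioo t₀ T).Nonempty
  swap
  · rw [not_nonempty_iff_eq_empty] at hne
    exact ⟨0, measurable_const, fun t ht => by rw [hne] at ht; exact ht.elim⟩
  have hT₀ : 0 ≤ T₀ := by
    obtain ⟨t, ht⟩ := hne
    linarith [ht.1, ht.2]
  choose P hP hP' using hp
  obtain ⟨Q, hQ, hQ'⟩ := hq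
  set Ψ : Phase d → ℝ → ℝ := fun z t => H (projIcc 0 T₀ hT₀ t) z.1 z.2.1 (max z.2.2 0) with hΨ
  have hΨm : StronglyMeasurable (Function.uncurry Ψ) := by
    refine stronglyMeasurable_uncurry_of_continuous_of_stronglyMeasurable (fun t => ?_) fun z => ?_
    · have hc := (h.contDiff (projIcc 0 T₀ hT₀ t) (Subtype.coe_prop _)).continuousOn
      exact hc.comp_continuous (f := fun z : Phase d => ((z.1, z.2.1, max z.2.2 0) : Phase d))
        (by fun_prop) fun z => le_max_right z.2.2 0
    · exact ((h.measurable z.1 z.2.1 (max z.2.2 0) (le_max_right _ _)).comp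
        continuous_projIcc.measurable).stronglyMeasurable
  refine ⟨fun z => Ψ (z.2, (fun i => P i z), Q z) z.1, ?_, fun t ht x => ?_⟩
  · refine hΨm.measurable.comp (f := fun z : ℝ × Pt d =>
      (((z.2, (fun i => P i z), Q z) : Phase d), z.1)) ?_
    exact (measurable_snd.prodMk ((measurable_pi_lambda _ hP).prodMk hQ)).prodMk measurable_fst
  · simp only [hΨ, hP' _ t ht x, hQ' t ht x]
    rw [projIcc_of_mem hT₀ ⟨h₀.trans ht.1.le, ht.2.le.trans hT⟩, max_eq_left (hq0 t ht x)]

lemma JointMeas.fourierR {t₀ T : ℝ} {f : ℝ → Pt d → ℝ} (hf : JointMeas t₀ T f) (k : Freq d) :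
    AEStronglyMeasurable (fun t => fourierR (f t) k) (volume.restrict (Icc t₀ T)) := by
  obtain ⟨F, hF, hF'⟩ := hf
  rw [← restrict_Ioo_eq_restrict_Icc]
  refine AEStronglyMeasurable.congr (f := fun t => MFG.fourierR (fun x => F (t, x)) k) ?_ ?_
  · refine StronglyMeasurable.aestronglyMeasurable ?_
    unfold MFG.fourierR MFG.fourier
    refine stronglyMeasurable_const.mul ?_
    refine StronglyMeasurable.integral_prod_right' (f := fun z : ℝ × Pt d =>
      character (-k) z.2 * (F (z.1, z.2) : ℂ)) ?_
    have h1 : Measurable fun z : ℝ × Pt d => character (-k) z.2 :=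
      (continuous_character (-k)).measurable.comp measurable_snd
    have h2 : Measurable fun z : ℝ × Pt d => (F z : ℂ) := Complex.measurable_ofReal.comp hF
    exact (h1.mul h2).stronglyMeasurable
  · refine (ae_restrict_iff' measurableSet_Ioo).2 (Filter.Eventually.of_forall fun t ht => ?_)
    have : (fun x => F (t, x)) = f t := funext fun x => hF' t ht x
    simp only [this]

/-! ## The coefficients of the linearized system -/

/-- The curve `x ↦ (∇u(x), m(x))`. -/
def stateCurve (u m : Pt d → ℝ) : Option (Fin d) → Pt d → ℝ
  | none => m
  | some j => pderiv j u

/-- Regularity and bounds of a solution of the mean field games system at a fixed time. -/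
structure Slice (s M : ℝ) (u m : Pt d → ℝ) : Prop where
  contDiff_u : ContDiff ℝ 2 u
  contDiff_m : ContDiff ℝ 2 m
  periodic_u : TorusPeriodic u
  periodic_m : TorusPeriodic m
  nonneg : ∀ x, 0 ≤ m x
  bound_u : sobSq s (fourierR u) ≤ ENNReal.ofReal (M ^ 2)
  bound_m : sobSq (s - 1) (fourierR m) ≤ ENNReal.ofReal (M ^ 2)

lemma Slice.fourierR_some {s M : ℝ} {u m : Pt d → ℝ} (h : Slice s M u m) (j : Fin d) :
    fourierR (stateCurve u m (some j)) = distPartial j (fourierR u) :=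
  fourierR_pderiv (h.contDiff_u.of_le (by norm_num)) h.periodic_u j

lemma Slice.continuous {s M : ℝ} {u m : Pt d → ℝ} (h : Slice s M u m) (b : Option (Fin d)) :
    Continuous (stateCurve u m b) := by
  cases b with
  | none => exact h.contDiff_m.continuous
  | some j => exact (h.contDiff_u.pderiv (m := 1) (by norm_num) j).continuous

lemma Slice.periodic {s M : ℝ} {u m : Pt d → ℝ} (h : Slice s M u m) (b : Option (Fin d)) :
    TorusPeriodic (stateCurve u m b) := by
  cases b with
  | none => exact h.periodic_m
  | some j => exact h.periodic_u.pderiv j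

lemma Slice.sobSq_le {s M : ℝ} {u m : Pt d → ℝ} (h : Slice s M u m) (b : Option (Fin d)) :
    sobSq (s - 1) (fourierR (stateCurve u m b)) ≤ ENNReal.ofReal (M ^ 2) := by
  cases b with
  | none => exact h.bound_m
  | some j =>
    rw [h.fourierR_some]
    refine (sobSq_distPartial_le _ _ _).trans ?_
    rw [sub_add_cancel]
    exact h.bound_u

/-- The order of the Wiener algebra that is used for the coefficients. -/
def wienerOrder (d : ℕ) : ℕ := d / 2 + 1

lemma lt_wienerOrder (d : ℕ) : (d : ℝ) / 2 < wienerOrder d := by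
  have : d < 2 * (d / 2 + 1) := by omega
  have h : (d : ℝ) < 2 * ((d / 2 + 1 : ℕ) : ℝ) := by exact_mod_cast this
  rw [wienerOrder]
  linarith

lemma one_le_wienerOrder (d : ℕ) : 1 ≤ wienerOrder d := Nat.le_add_left 1 _

/-- The orders `s` for which the state belongs to the Wiener algebra. -/
def Admissible (d : ℕ) (s : ℝ) : Prop := (wienerOrder d : ℝ) + 2 + d / 2 < s

lemma Admissible.three_lt {s : ℝ} (h : Admissible d s) : 3 < s := by
  have h1 : (1 : ℝ) ≤ wienerOrder d := by exact_mod_cast one_le_wienerOrder d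
  have h2 : (0 : ℝ) ≤ (d : ℝ) / 2 := by positivity
  unfold Admissible at h
  linarith

lemma Admissible.half_lt {s : ℝ} (h : Admissible d s) : (d : ℝ) / 2 < s - 3 := by
  have h1 : (1 : ℝ) ≤ wienerOrder d := by exact_mod_cast one_le_wienerOrder d
  unfold Admissible at h
  linarith

/-- `∇u` and `m` have order `s - 1`, and `Admissible` leaves more than `d / 2` between this and
`wienerOrder d + 1`. -/
lemma exists_wienerCurve {s : ℝ} (hs : Admissible d s) (M : ℝ) :
    ∃ L : ℝ≥0, ∀ u m : Pt d → ℝ, Slice s M u m →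
      WienerCurve (wienerOrder d + 1) L (stateCurve u m) := by
  have hlt : (d : ℝ) / 2 < s - 2 - wienerOrder d := by unfold Admissible at hs; linarith
  obtain ⟨X, hX⟩ := exists_nnreal_of_lt_top
    (ENNReal.mul_lt_top (wtSum_lt_top hlt) (ENNReal.ofReal_lt_top (r := M ^ 2)))
  -- The bound `1 + X` avoids a square root: the square of the norm is at most `X ≤ (1 + X)²`.
  refine ⟨1 + X, fun u m h => ⟨h.continuous, h.periodic, h.nonneg, fun b => ?_⟩⟩
  have h1 := wien_sq_le (wienerOrder d + 1 : ℝ) (s - 2 - wienerOrder d) (fourierR (stateCurve u m b))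
  rw [show (wienerOrder d : ℝ) + 1 + (s - 2 - wienerOrder d) = s - 1 by ring] at h1
  have h2 : wien (wienerOrder d + 1 : ℝ) (fourierR (stateCurve u m b)) ^ 2 ≤ (X : ℝ≥0∞) := by
    rw [← hX]
    exact h1.trans (by gcongr; exact h.sobSq_le b)
  rw [← ENNReal.pow_le_pow_left_iff (two_ne_zero)]
  refine h2.trans ?_
  push_cast
  calc (X : ℝ≥0∞) ≤ (1 + X) * 1 := by rw [mul_one]; exact le_add_self
    _ ≤ (1 + X) * (1 + X) := by gcongr; exact le_self_add
    _ = _ := (sq _).symm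

/-- Functions `x ↦ Φ(t, x, ∇u(x), m(x))`. -/
def along (Φ : Hamiltonian d) (t : ℝ) (u m : Pt d → ℝ) (x : Pt d) : ℝ :=
  Φ t x (grad u x) (m x)

lemma along_eq (Φ : Hamiltonian d) (t : ℝ) (u m : Pt d → ℝ) :
    along Φ t u m = fun x => frozen Φ t (curve (stateCurve u m) x) := rfl

lemma Slice.continuous_along {T₀ s M : ℝ} {n : ℕ} {Φ : Hamiltonian d}
    (hΦ : HamiltonianRegular T₀ n Φ) {t : ℝ} (ht : t ∈ Icc 0 T₀) {u m : Pt d → ℝ}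
    (h : Slice s M u m) : Continuous (along Φ t u m) := by
  rw [along_eq]
  exact (hΦ.contDiff t ht).continuousOn.comp_continuous (continuous_curve h.continuous) h.nonneg

lemma Slice.periodic_along {T₀ s M : ℝ} {n : ℕ} {Φ : Hamiltonian d}
    (hΦ : HamiltonianRegular T₀ n Φ) {t : ℝ} (ht : t ∈ Icc 0 T₀) {u m : Pt d → ℝ}
    (h : Slice s M u m) : TorusPeriodic (along Φ t u m) := by
  intro x k
  have h1 : grad u (fun i => x i + 2 * Real.pi * (k i : ℝ)) = grad u x :=
    funext fun j => h.periodic_u.pderiv j x k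
  rw [along, h1, h.periodic_m x k]
  exact hΦ.periodic t ht _ _ (h.nonneg x) x k

/-- The composition theorem along the state curve. The bound is affine in the squared norms of top
order, which for `σ = s` are only integrable in time, and its constant depends on the bounds in
`Slice` alone. -/
lemma exists_sobSq_along_le {s : ℝ} (hs : Admissible d s) (M : ℝ) {T₀ : ℝ} {n : ℕ}
    {Φ : Hamiltonian d} (hΦ : HamiltonianRegular T₀ (n + 1) Φ) {σ : ℝ} (hσ0 : 0 < σ)
    (hσ : σ ≤ n + 1) : ∃ C : ℝ≥0, ∀ t ∈ Icc 0 T₀, ∀ u m : Pt d → ℝ, Slice s M u m →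
      sobSq σ (fourierR (along Φ t u m)) ≤
        C * (1 + (sobSq (σ + 1) (fourierR u) + sobSq σ (fourierR m))) := by
  obtain ⟨L, hL⟩ := exists_wienerCurve hs M
  obtain ⟨B, hB⟩ := hΦ.exists_phaseReg ((n + 1 + 2 : ℕ) * L)
  obtain ⟨C, hC⟩ := sobSq_comp_le (lt_wienerOrder d) (one_le_wienerOrder d) n hσ0 hσ L B
  refine ⟨C, fun t ht u m h => (hC _ (hB t ht) _ (hL u m h)).trans ?_⟩
  gcongr
  rw [Fintype.sum_option, add_comm, sobSq_add_one]
  refine add_le_add (le_trans (le_of_eq ?_) le_add_self) le_rfl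
  exact Finset.sum_congr rfl fun j _ => by rw [h.fourierR_some]

lemma Slice.bound_sum {s M : ℝ} {u m : Pt d → ℝ} (h : Slice s M u m) {σ : ℝ} (hσ : σ ≤ s - 1) :
    1 + (sobSq (σ + 1) (fourierR u) + sobSq σ (fourierR m)) ≤
      1 + (ENNReal.ofReal (M ^ 2) + ENNReal.ofReal (M ^ 2)) := by
  gcongr
  · exact (sobSq_mono (by linarith) _).trans h.bound_u
  · exact (sobSq_mono (by linarith) _).trans h.bound_m

/-- In the tame product bound the Wiener norms of both factors are controlled at order `s - 1`, so
each term contains just one norm of order `σ` and the result is again affine. -/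
lemma exists_sobSq_mul_along_le {s : ℝ} (hs : Admissible d s) (M : ℝ) {T₀ : ℝ} {n : ℕ}
    {Φ : Hamiltonian d} (hΦ : HamiltonianRegular T₀ (n + 1) Φ) {σ : ℝ} (hσ0 : s - 1 ≤ σ)
    (hσ : σ ≤ n + 1) : ∃ C : ℝ≥0, ∀ t ∈ Icc 0 T₀, ∀ u m : Pt d → ℝ, Slice s M u m →
      sobSq σ (fourierR fun x => m x * along Φ t u m x) ≤
        C * (1 + (sobSq (σ + 1) (fourierR u) + sobSq σ (fourierR m))) := by
  have h3 := hs.three_lt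
  obtain ⟨C₁, hC₁⟩ := exists_sobSq_along_le hs M hΦ (σ := s - 1) (by linarith) (by linarith)
  obtain ⟨C₂, hC₂⟩ := exists_sobSq_along_le hs M hΦ (σ := σ) (by linarith) hσ
  have hw : wtSum d (s - 1) < ⊤ := wtSum_lt_top (by linarith [hs.half_lt])
  have hsp := splitC_lt_top σ
  set Y : ℝ≥0∞ := 1 + (ENNReal.ofReal (M ^ 2) + ENNReal.ofReal (M ^ 2)) with hY
  obtain ⟨C, hC⟩ := exists_nnreal_of_lt_top (C := 2 * splitC σ ^ 2 * (wtSum d (s - 1) *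
    ((C₁ : ℝ≥0∞) * Y) + (C₂ : ℝ≥0∞) * (wtSum d (s - 1) * ENNReal.ofReal (M ^ 2)))) (by finiteness)
  refine ⟨C, fun t ht u m h => ?_⟩
  set Z : ℝ≥0∞ := 1 + (sobSq (σ + 1) (fourierR u) + sobSq σ (fourierR m)) with hZ
  have hwm : wien 0 (fourierR m) ^ 2 ≤ wtSum d (s - 1) * ENNReal.ofReal (M ^ 2) := by
    refine (wien_sq_le 0 (s - 1) _).trans ?_
    rw [zero_add]
    gcongr
    exact h.bound_m
  have hwΦ : wien 0 (fourierR (along Φ t u m)) ^ 2 ≤ wtSum d (s - 1) * (C₁ * Y) := by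
    refine (wien_sq_le 0 (s - 1) _).trans ?_
    rw [zero_add]
    gcongr
    refine (hC₁ t ht u m h).trans ?_
    gcongr
    exact h.bound_sum le_rfl
  have hmt : wien 0 (fourierR m) < ⊤ :=
    (ENNReal.pow_lt_top_iff.1 (hwm.trans_lt (by finiteness))).resolve_right (by norm_num)
  have he : (fun x => m x * along Φ t u m x) = fun x => along Φ t u m x * m x :=
    funext fun x => mul_comm _ _
  rw [he, fourierR_mul (integrableOn_cell_of_continuous (h.continuous_along hΦ ht))
    h.contDiff_m.continuous h.periodic_m hmt]
  refine (sobSq_conv_le_tame (by linarith) _ _).trans ?_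
  calc _ ≤ 2 * splitC σ ^ 2 * (wtSum d (s - 1) * (C₁ * Y) * Z +
        C₂ * Z * (wtSum d (s - 1) * ENNReal.ofReal (M ^ 2))) := by
        gcongr
        · exact le_add_self.trans le_add_self
        · exact hC₂ t ht u m h
    _ = C * Z := by rw [← hC]; ring

/-- The Fourier coefficients of the coefficients of the linearized system: the row `none` belongs
to the backward equation, the row `some i` to the `i`-th component of the flux in the forward
equation, the column `none` to `μ`, and the column `some j` to `∂_j v`. -/
def linCoef (H : Hamiltonian d) (u m : ℝ → Pt d → ℝ) (ϑ : ℝ) :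
    Option (Fin d) → Option (Fin d) → ℝ → Coeffs d
  | none, none => fun t => fourierR (coefQ H u m t)
  | none, some i => fun t => fourierR (coefP H u m i t)
  | some i, none => fun t =>
      fourierR (coefP H u m i t) + ((-ϑ : ℝ) : ℂ) • fourierR (coefPQ H u m i t)
  | some i, some j => fun t => fourierR (coefPP H u m i j t)

/-- The estimates depend on the sign `ϑ` only through `|ϑ| = 1`. -/
lemma sobSq_add_smul_le {σ ϑ : ℝ} (hϑ : ϑ = 1 ∨ ϑ = -1) (a b : Coeffs d) :
    sobSq σ (a + ((-ϑ : ℝ) : ℂ) • b) ≤ 2 * sobSq σ a + 2 * sobSq σ b := by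
  refine (sobSq_add_le _ _ _).trans ?_
  rw [sobSq_smul]
  rcases hϑ with rfl | rfl <;> simp

/-- Uniform bounds of finitely many families of coefficients give a bound of the matrix. -/
lemma exists_sobSq_linCoef_le {s : ℝ} (hs : Admissible d s) (M : ℝ) {T₀ : ℝ} {n : ℕ}
    {H : Hamiltonian d} (hH : HamiltonianRegular T₀ (n + 1 + 2) H) {σ : ℝ} (hσ0 : s - 1 ≤ σ)
    (hσ : σ ≤ n + 1) : ∃ C : ℝ≥0, ∀ t ∈ Icc 0 T₀, ∀ u m : ℝ → Pt d → ℝ, Slice s M (u t) (m t) →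
      ∀ ϑ : ℝ, ϑ = 1 ∨ ϑ = -1 → ∀ o b, sobSq σ (linCoef H u m ϑ o b t) ≤
        C * (1 + (sobSq (σ + 1) (fourierR (u t)) + sobSq σ (fourierR (m t)))) := by
  have h3 := hs.three_lt
  have hP := fun i => exists_sobSq_along_le hs M ((hH.Hp i).mono (Nat.le_succ (n + 1)))
    (σ := σ) (by linarith) hσ
  have hQ := exists_sobSq_along_le hs M (hH.Hq.mono (Nat.le_succ (n + 1)))
    (σ := σ) (by linarith) hσ
  have hPP := fun i j => exists_sobSq_mul_along_le hs M ((hH.Hp j).Hp i) hσ0 hσ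
  have hPQ := fun i => exists_sobSq_mul_along_le hs M (hH.Hq.Hp i) hσ0 hσ
  choose cP hcP using hP
  obtain ⟨cQ, hcQ⟩ := hQ
  choose cPP hcPP using hPP
  choose cPQ hcPQ using hPQ
  refine ⟨cQ + ∑ i, cP i + ∑ i, (2 * cP i + 2 * cPQ i) + ∑ i, ∑ j, cPP i j,
    fun t ht u m h ϑ hϑ o b => ?_⟩
  set Z : ℝ≥0∞ := 1 + (sobSq (σ + 1) (fourierR (u t)) + sobSq σ (fourierR (m t))) with hZ
  have hs1 : ∀ (f : Fin d → ℝ≥0) i, f i ≤ ∑ i, f i := fun f i =>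
    Finset.single_le_sum (f := f) (fun _ _ => bot_le) (Finset.mem_univ i)
  match o, b with
  | none, none =>
    refine (hcQ t ht _ _ h).trans (mul_le_mul_left (ENNReal.coe_le_coe.2 ?_) _)
    rw [add_assoc, add_assoc]
    exact le_self_add
  | none, some i =>
    refine (hcP i t ht _ _ h).trans (mul_le_mul_left (ENNReal.coe_le_coe.2 ?_) _)
    exact (hs1 cP i).trans (le_add_self.trans (le_self_add.trans le_self_add))
  | some i, none =>
    refine (sobSq_add_smul_le hϑ _ _).trans ?_
    calc _ ≤ 2 * (cP i * Z) + 2 * (cPQ i * Z) := by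
          gcongr
          · exact hcP i t ht _ _ h
          · exact hcPQ i t ht _ _ h
      _ = ((2 * cP i + 2 * cPQ i : ℝ≥0) : ℝ≥0∞) * Z := by push_cast; ring
      _ ≤ _ := by
          refine mul_le_mul_left (ENNReal.coe_le_coe.2 ?_) _
          exact (hs1 (fun i => 2 * cP i + 2 * cPQ i) i).trans (le_add_self.trans le_self_add)
  | some i, some j =>
    refine (hcPP i j t ht _ _ h).trans (mul_le_mul_left (ENNReal.coe_le_coe.2 ?_) _)
    exact (hs1 (cPP i) j).trans ((hs1 (fun i => ∑ j, cPP i j) i).trans le_add_self)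

lemma MFGBound.ae_slice {s t₀ T M : ℝ} {H : Hamiltonian d} {G : FinalCost d} {m₀ : Pt d → ℝ}
    {u m : ℝ → Pt d → ℝ} (hb : MFGBound s t₀ T M u m) (hsol : IsMFGSolution s H G t₀ T m₀ u m) :
    ∀ᵐ t ∂(volume.restrict (Icc t₀ T)), t ∈ Ioo t₀ T ∧ Slice s M (u t) (m t) := by
  have h1 : ∀ᵐ t ∂(volume.restrict (Icc t₀ T)), t ∈ Ioo t₀ T := by
    rw [← restrict_Ioo_eq_restrict_Icc]
    exact ae_restrict_mem measurableSet_Ioo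
  filter_upwards [h1, hb.linf_u, hb.linf_m] with t ht h2 h3
  have ht' := Ioo_subset_Icc_self ht
  exact ⟨ht, hsol.contDiff_u t ht, hsol.contDiff_m t ht, hsol.periodic_u t ht',
    hsol.periodic_m t ht', hsol.nonneg_m t ht', h2, h3⟩

section

variable {s t₀ T T₀ : ℝ} {H : Hamiltonian d} {G : FinalCost d} {m₀ : Pt d → ℝ}
  {u m : ℝ → Pt d → ℝ}

lemma IsMFGSolution.jointMeas_m (hT : t₀ ≤ T) (h : IsMFGSolution s H G t₀ T m₀ u m) :
    JointMeas t₀ T m := JointMeas.of_continuousOn hT h.continuous_m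

lemma IsMFGSolution.jointMeas_along (h₀ : 0 ≤ t₀) (hT : t₀ ≤ T) (hTT : T ≤ T₀)
    (h : IsMFGSolution s H G t₀ T m₀ u m) {n : ℕ} {Φ : Hamiltonian d}
    (hΦ : HamiltonianRegular T₀ n Φ) : JointMeas t₀ T fun t => along Φ t (u t) (m t) :=
  JointMeas.hamiltonian h₀ hTT hΦ
    (fun i => JointMeas.pderiv hT h.continuous_u
      (fun t ht => (h.contDiff_u t ht).differentiable (by norm_num)) i)
    (h.jointMeas_m hT) fun t ht x => h.nonneg_m t (Ioo_subset_Icc_self ht) x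

lemma IsMFGSolution.aestronglyMeasurable_linCoef (h₀ : 0 ≤ t₀) (hT : t₀ ≤ T) (hTT : T ≤ T₀)
    (h : IsMFGSolution s H G t₀ T m₀ u m) {n : ℕ} (hH : HamiltonianRegular T₀ (n + 2) H) (ϑ : ℝ)
    (o b : Option (Fin d)) (k : Freq d) :
    AEStronglyMeasurable (fun t => linCoef H u m ϑ o b t k) (volume.restrict (Icc t₀ T)) := by
  have hP := fun i => (h.jointMeas_along h₀ hT hTT (hH.Hp i)).fourierR k
  match o, b with
  | none, none => exact (h.jointMeas_along h₀ hT hTT hH.Hq).fourierR k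
  | none, some i => exact hP i
  | some i, none =>
    exact (hP i).add (AEStronglyMeasurable.const_smul
      (((h.jointMeas_m hT).mul (h.jointMeas_along h₀ hT hTT (hH.Hq.Hp i))).fourierR k) _)
  | some i, some j =>
    exact ((h.jointMeas_m hT).mul (h.jointMeas_along h₀ hT hTT ((hH.Hp j).Hp i))).fourierR k

lemma isRealDist_linCoef (H : Hamiltonian d) (u m : ℝ → Pt d → ℝ) (ϑ : ℝ)
    (o b : Option (Fin d)) (t : ℝ) : IsRealDist (linCoef H u m ϑ o b t) := by
  match o, b with
  | none, none => exact isRealDist_fourierR _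
  | none, some i => exact isRealDist_fourierR _
  | some i, none =>
    intro k
    simp only [linCoef, Pi.add_apply, Pi.smul_apply, smul_eq_mul, map_add, map_mul,
      Complex.conj_ofReal]
    rw [isRealDist_fourierR _ k, isRealDist_fourierR _ k]
  | some i, some j => exact isRealDist_fourierR _

end

/-! ## Estimates for the heat semigroup -/

/-- The multiplier `e^{-|k|² |t - τ|}` of the heat semigroup. -/
def heat (k : Freq d) (t τ : ℝ) : ℝ≥0∞ := ENNReal.ofReal (Real.exp (-(freqSq k * |t - τ|)))

lemma heat_le_one (k : Freq d) (t τ : ℝ) : heat k t τ ≤ 1 := by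
  rw [heat, ENNReal.ofReal_le_one, Real.exp_le_one_iff]
  have := mul_nonneg (freqSq_nonneg k) (abs_nonneg (t - τ))
  linarith

lemma measurable_heat (k : Freq d) (t : ℝ) : Measurable (heat k t) := by
  unfold heat
  fun_prop

lemma lintegral_exp_neg_abs_le {a : ℝ} (ha : 0 < a) (t : ℝ) :
    ∫⁻ τ, ENNReal.ofReal (Real.exp (-(a * |t - τ|))) ≤ ENNReal.ofReal (2 / a) := by
  have h1 : ∫⁻ τ in Iic t, ENNReal.ofReal (Real.exp (-(a * |t - τ|))) = ENNReal.ofReal (1 / a) := by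
    have e : ∀ τ ∈ Iic t, ENNReal.ofReal (Real.exp (-(a * |t - τ|))) =
        ENNReal.ofReal (Real.exp (-(a * t))) * ENNReal.ofReal (Real.exp (a * τ)) := by
      intro τ hτ
      rw [← ENNReal.ofReal_mul (Real.exp_pos _).le, ← Real.exp_add,
        abs_of_nonneg (sub_nonneg.2 hτ)]
      congr 2
      ring
    rw [setLIntegral_congr_fun measurableSet_Iic e, lintegral_const_mul _ (by fun_prop),
      ← ofReal_integral_eq_lintegral_ofReal (integrableOn_exp_mul_Iic ha t)
        (Filter.Eventually.of_forall fun τ => (Real.exp_pos _).le), integral_exp_mul_Iic ha,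
      ← ENNReal.ofReal_mul (Real.exp_pos _).le, ← mul_div_assoc, ← Real.exp_add]
    simp
  have h2 : ∫⁻ τ in Ioi t, ENNReal.ofReal (Real.exp (-(a * |t - τ|))) = ENNReal.ofReal (1 / a) := by
    have e : ∀ τ ∈ Ioi t, ENNReal.ofReal (Real.exp (-(a * |t - τ|))) =
        ENNReal.ofReal (Real.exp (a * t)) * ENNReal.ofReal (Real.exp (-a * τ)) := by
      intro τ hτ
      rw [← ENNReal.ofReal_mul (Real.exp_pos _).le, ← Real.exp_add,
        abs_of_nonpos (sub_nonpos.2 (le_of_lt hτ))]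
      congr 2
      ring
    rw [setLIntegral_congr_fun measurableSet_Ioi e, lintegral_const_mul _ (by fun_prop),
      ← ofReal_integral_eq_lintegral_ofReal (integrableOn_exp_mul_Ioi (neg_lt_zero.2 ha) t)
        (Filter.Eventually.of_forall fun τ => (Real.exp_pos _).le),
      integral_exp_mul_Ioi (neg_lt_zero.2 ha),
      ← ENNReal.ofReal_mul (Real.exp_pos _).le, neg_div_neg_eq, ← mul_div_assoc, ← Real.exp_add]
    simp
  rw [← lintegral_add_compl _ (measurableSet_Iic (a := t)), compl_Iic, h1, h2,
    ← ENNReal.ofReal_add (by positivity) (by positivity)]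
  refine ENNReal.ofReal_le_ofReal (le_of_eq ?_)
  ring

/-- `∫ e^{-2|k|²|t-τ|} dτ ≤ 1 / |k|²`, while the summand `1` of the weight is paid for by the length
of the interval. This is the gain of one derivative by the heat semigroup in `L²` of time. -/
lemma wt_one_mul_lintegral_heat_sq_le (k : Freq d) (t t₀ T : ℝ) :
    wt 1 k * ∫⁻ τ in Icc t₀ T, heat k t τ ^ 2 ≤ ENNReal.ofReal (T - t₀) + 1 := by
  have h1 : ∫⁻ τ in Icc t₀ T, heat k t τ ^ 2 ≤ ENNReal.ofReal (T - t₀) := by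
    calc _ ≤ ∫⁻ _τ in Icc t₀ T, 1 := lintegral_mono fun τ => pow_le_one' (heat_le_one k t τ) 2
      _ = _ := by rw [setLIntegral_one, Real.volume_Icc]
  rw [wt, Real.rpow_one, ENNReal.ofReal_add zero_le_one (freqSq_nonneg k), add_mul,
    ENNReal.ofReal_one, one_mul]
  refine add_le_add h1 ?_
  rcases eq_or_lt_of_le (freqSq_nonneg k) with h0 | h0
  · rw [← h0]; simp
  have h2 : ∫⁻ τ in Icc t₀ T, heat k t τ ^ 2 ≤ ENNReal.ofReal (1 / freqSq k) := by
    have e : ∀ τ, heat k t τ ^ 2 = ENNReal.ofReal (Real.exp (-(2 * freqSq k * |t - τ|))) := by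
      intro τ
      rw [heat, ← ENNReal.ofReal_pow (Real.exp_pos _).le, ← Real.exp_nat_mul]
      congr 2
      push_cast
      ring
    simp only [e]
    refine (setLIntegral_le_lintegral _ _).trans
      ((lintegral_exp_neg_abs_le (by positivity) t).trans (le_of_eq ?_))
    congr 1
    field_simp
  calc _ ≤ ENNReal.ofReal (freqSq k) * ENNReal.ofReal (1 / freqSq k) := by gcongr
    _ = 1 := by
      rw [← ENNReal.ofReal_mul h0.le, mul_one_div_cancel h0.ne', ENNReal.ofReal_one]

/-- Square integrable sources gain one derivative. -/
lemma duhamel_sq_le {g : Freq d → ℝ → ℝ≥0∞} {t₀ T : ℝ}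
    (hg : ∀ k, AEMeasurable (g k) (volume.restrict (Icc t₀ T))) (t : ℝ) :
    ∑' k, wt 1 k * (∫⁻ τ in Icc t₀ T, heat k t τ * g k τ) ^ 2 ≤
      (ENNReal.ofReal (T - t₀) + 1) * ∫⁻ τ in Icc t₀ T, ∑' k, g k τ ^ 2 := by
  rw [lintegral_tsum fun k => (hg k).pow_const 2, ← ENNReal.tsum_mul_left]
  refine ENNReal.tsum_le_tsum fun k => ?_
  calc _ ≤ wt 1 k * ((∫⁻ τ in Icc t₀ T, heat k t τ ^ 2) * ∫⁻ τ in Icc t₀ T, g k τ ^ 2) := by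
        gcongr
        exact lintegral_mul_sq_le (measurable_heat k t).aemeasurable (hg k)
    _ ≤ _ := by
        rw [← mul_assoc]
        gcongr
        exact wt_one_mul_lintegral_heat_sq_le k t t₀ T

/-- Sources that are integrable in time. -/
lemma duhamel_le {ρ : ℝ} (β : ℝ → ℝ≥0∞) (t₀ T t : ℝ) :
    ∑' k : Freq d, wt 1 k * (∫⁻ τ in Icc t₀ T, heat k t τ * (wt (-ρ / 2) k * β τ)) ^ 2 ≤
      wtSum d (ρ - 1) * (∫⁻ τ in Icc t₀ T, β τ) ^ 2 := by
  rw [wtSum, ← ENNReal.tsum_mul_right]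
  refine ENNReal.tsum_le_tsum fun k => ?_
  calc _ ≤ wt 1 k * (wt (-ρ / 2) k * ∫⁻ τ in Icc t₀ T, β τ) ^ 2 := by
        gcongr
        rw [← lintegral_const_mul' _ _ (wt_ne_top _ _)]
        refine lintegral_mono fun τ => ?_
        exact mul_le_of_le_one_left bot_le (heat_le_one k t τ)
    _ = wt 1 k * wt (-ρ) k * (∫⁻ τ in Icc t₀ T, β τ) ^ 2 := by rw [mul_pow, wt_half_sq, mul_assoc]
    _ = _ := by rw [← wt_add]; ring_nf

/-- The families of coefficients are measurable in time. -/
def MeasTime (t₀ T : ℝ) (c : ℝ → Coeffs d) : Prop :=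
  ∀ k, AEStronglyMeasurable (fun t => c t k) (volume.restrict (Icc t₀ T))

/-- Multiplication by `f` satisfies the parabolic smoothing estimate on `H^σ`. -/
def SmoothingBound (t₀ T σ : ℝ) (K : ℝ≥0∞) (f : ℝ → Coeffs d) : Prop :=
  ∀ c : ℝ → Coeffs d, MeasTime t₀ T c → ∫⁻ τ in Icc t₀ T, sobSq σ (c τ) < ⊤ → ∀ t,
    ∑' k, wt (σ + 1) k * (∫⁻ τ in Icc t₀ T, heat k t τ * ‖conv (f τ) (c τ) k‖ₑ) ^ 2 ≤
      K * ∫⁻ τ in Icc t₀ T, sobSq σ (c τ)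

lemma aemeasurable_sobSq {t₀ T : ℝ} {c : ℝ → Coeffs d} (h : MeasTime t₀ T c) (σ : ℝ) :
    AEMeasurable (fun t => sobSq σ (c t)) (volume.restrict (Icc t₀ T)) := by
  simp only [sobSq_eq]
  exact AEMeasurable.tsum fun k => ((h k).enorm.pow_const 2).const_mul _

lemma aemeasurable_econv {t₀ T : ℝ} {f c : ℝ → Freq d → ℝ≥0∞}
    (hf : ∀ k, AEMeasurable (fun t => f t k) (volume.restrict (Icc t₀ T)))
    (hc : ∀ k, AEMeasurable (fun t => c t k) (volume.restrict (Icc t₀ T))) (k : Freq d) :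
    AEMeasurable (fun t => econv (f t) (c t) k) (volume.restrict (Icc t₀ T)) :=
  AEMeasurable.tsum fun l => (hf (k - l)).mul (hc l)

/-- The Fourier coefficients of a product are limits of finite sums, which converge at almost every
time. -/
lemma MeasTime.conv {t₀ T ρ : ℝ} (hρ : 0 ≤ ρ) {f c : ℝ → Coeffs d} (hf : MeasTime t₀ T f)
    (hc : MeasTime t₀ T c) (hf' : ∀ᵐ t ∂(volume.restrict (Icc t₀ T)), sobSq ρ (f t) < ⊤)
    (hc' : ∀ᵐ t ∂(volume.restrict (Icc t₀ T)), sobSq (-ρ) (c t) < ⊤) :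
    MeasTime t₀ T fun t => conv (f t) (c t) := by
  intro k
  refine aestronglyMeasurable_of_tendsto_ae Filter.atTop
    (f := fun (s : Finset (Freq d)) t => ∑ l ∈ s, f t (k - l) * c t l)
    (fun s => Finset.aestronglyMeasurable_fun_sum s fun l _ => (hf (k - l)).mul (hc l)) ?_
  filter_upwards [hf', hc'] with t h1 h2
  exact (summable_conv hρ h1 h2 k).hasSum

/-- At each time, multiplication by a function in `H^ρ` is bounded on `H^σ` (when `wtSum d ρ` is
finite); the gain of a derivative is then that of the heat semigroup for sources in `L²`. -/
lemma smoothingBound_of_nonneg {t₀ T σ ρ : ℝ} (hσ : 0 ≤ σ) (hσρ : σ ≤ ρ) {f : ℝ → Coeffs d}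
    {Λ : ℝ≥0∞} (hf : MeasTime t₀ T f) (hΛ : Λ ≠ ⊤)
    (hfb : ∀ᵐ t ∂(volume.restrict (Icc t₀ T)), sobSq ρ (f t) ≤ Λ) :
    SmoothingBound t₀ T σ ((ENNReal.ofReal (T - t₀) + 1) *
      (2 * splitC ρ ^ 2 * (wtSum d ρ * Λ + wtSum d ρ * Λ))) f := by
  intro c hc hfin t
  have hcf : ∀ᵐ τ ∂(volume.restrict (Icc t₀ T)), sobSq σ (c τ) < ⊤ :=
    ae_lt_top' (aemeasurable_sobSq hc σ) hfin.ne
  have hm : MeasTime t₀ T fun τ => conv (f τ) (c τ) := by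
    refine hf.conv (hσ.trans hσρ) hc ?_ ?_
    · filter_upwards [hfb] with τ hτ using hτ.trans_lt hΛ.lt_top
    · filter_upwards [hcf] with τ hτ using (sobSq_mono (by linarith) _).trans_lt hτ
  have h1 := duhamel_sq_le (g := fun k τ => wt (σ / 2) k * ‖conv (f τ) (c τ) k‖ₑ)
    (fun k => (hm k).enorm.const_mul _) t
  calc _ = ∑' k, wt 1 k * (∫⁻ τ in Icc t₀ T,
        heat k t τ * (wt (σ / 2) k * ‖conv (f τ) (c τ) k‖ₑ)) ^ 2 := by
        refine tsum_congr fun k => ?_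
        simp only [mul_left_comm (heat k t _) (wt (σ / 2) k)]
        rw [lintegral_const_mul' _ _ (wt_ne_top _ _), mul_pow, wt_half_sq, ← mul_assoc, ← wt_add,
          add_comm]
    _ ≤ _ := h1
    _ ≤ (ENNReal.ofReal (T - t₀) + 1) * ∫⁻ τ in Icc t₀ T,
          (2 * splitC ρ ^ 2 * (wtSum d ρ * Λ + wtSum d ρ * Λ)) * sobSq σ (c τ) := by
        refine mul_le_mul_right (lintegral_mono_ae ?_) _
        filter_upwards [hfb] with τ hτ
        rw [← sobSq_eq_sq]
        refine (sobSq_conv_le_of_nonneg hσ hσρ _ _).trans ?_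
        gcongr
        refine (wien_sq_le 0 ρ _).trans ?_
        rw [zero_add]
        gcongr
    _ = _ := by
        rw [lintegral_const_mul'' _ (aemeasurable_sobSq hc σ), ← mul_assoc]

/-- The coefficient is bounded in the Wiener algebra, but in `H^ρ` it is only square integrable in
time. By `conv_neg_pointwise`, the part with the Wiener norm is a source in `L² H^σ` and is smoothed
by the heat semigroup. The other part is a product of two square integrable functions of time, hence
only integrable, and has no parabolic gain; instead its weighted Fourier coefficients decay like `(1
+ |k|²)^{-ρ/2}`, which suffices if `ρ - 1 > d / 2`. -/
lemma smoothingBound_of_nonpos {t₀ T σ ρ : ℝ} (hσ : σ ≤ 0) (hσρ : -ρ ≤ σ) {f : ℝ → Coeffs d}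
    {W Λ : ℝ≥0∞} (hf : MeasTime t₀ T f)
    (hW : ∀ᵐ t ∂(volume.restrict (Icc t₀ T)), wien 0 (f t) ^ 2 ≤ W)
    (hΛ : ∫⁻ t in Icc t₀ T, sobSq ρ (f t) ≤ Λ) :
    SmoothingBound t₀ T σ (splitC ρ ^ 2 * (2 * (ENNReal.ofReal (T - t₀) + 1) * W +
      2 * (wtSum d (ρ - 1) * Λ))) f := by
  intro c hc _ t
  set x : ℝ → Freq d → ℝ≥0∞ := fun τ l => wt (σ / 2) l * ‖c τ l‖ₑ with hx
  set F : ℝ → Freq d → ℝ≥0∞ := fun τ l => wt (ρ / 2) l * ‖f τ l‖ₑ with hF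
  have hxm : ∀ k, AEMeasurable (fun τ => x τ k) (volume.restrict (Icc t₀ T)) := fun k =>
    (hc k).enorm.const_mul _
  -- By Cauchy–Schwarz in frequency, `β` bounds the convolution uniformly in `k`; by Cauchy–Schwarz
  -- in time, it is integrable.
  set β : ℝ → ℝ≥0∞ := fun τ => sobSq ρ (f τ) ^ (1 / 2 : ℝ) * sobSq σ (c τ) ^ (1 / 2 : ℝ) with hβ
  have hsq : ∀ y : ℝ≥0∞, (y ^ (1 / 2 : ℝ)) ^ 2 = y := fun y => by
    rw [← ENNReal.rpow_natCast, ← ENNReal.rpow_mul]; norm_num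
  have hsx : ∀ τ, ∑' k, x τ k ^ 2 = sobSq σ (c τ) := fun τ => (sobSq_eq_sq _ _).symm
  have hsF : ∀ τ, ∑' k, F τ k ^ 2 = sobSq ρ (f τ) := fun τ => (sobSq_eq_sq _ _).symm
  have hβF : ∀ τ k, econv (F τ) (x τ) k ≤ β τ := fun τ k => by
    rw [← ENNReal.pow_le_pow_left_iff two_ne_zero, hβ]
    simp only [mul_pow, hsq]
    rw [← hsx, ← hsF]
    exact econv_sq_le _ _ _
  have hE : ∀ k, AEMeasurable (fun τ => econv (fun l => ‖f τ l‖ₑ) (x τ) k)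
      (volume.restrict (Icc t₀ T)) := fun k => aemeasurable_econv (fun l => (hf l).enorm) hxm k
  have hint : ∀ k, wt (σ / 2) k * ∫⁻ τ in Icc t₀ T, heat k t τ * ‖conv (f τ) (c τ) k‖ₑ ≤
      splitC ρ * ((∫⁻ τ in Icc t₀ T, heat k t τ * econv (fun l => ‖f τ l‖ₑ) (x τ) k) +
        ∫⁻ τ in Icc t₀ T, heat k t τ * (wt (-ρ / 2) k * β τ)) := by
    intro k
    have hm : AEMeasurable (fun τ => heat k t τ * econv (fun l => ‖f τ l‖ₑ) (x τ) k)
        (volume.restrict (Icc t₀ T)) := (measurable_heat k t).aemeasurable.mul (hE k)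
    rw [← lintegral_const_mul' _ _ (wt_ne_top _ _), ← lintegral_add_left' hm,
      ← lintegral_const_mul' _ _ (splitC_lt_top ρ).ne]
    refine lintegral_mono fun τ => ?_
    calc wt (σ / 2) k * (heat k t τ * ‖conv (f τ) (c τ) k‖ₑ)
        = heat k t τ * (wt (σ / 2) k * ‖conv (f τ) (c τ) k‖ₑ) := by ring
      _ ≤ heat k t τ * (splitC ρ * (econv (fun l => ‖f τ l‖ₑ) (x τ) k +
          wt (-ρ / 2) k * econv (F τ) (x τ) k)) :=
          mul_le_mul_right (conv_neg_pointwise hσ hσρ _ _ _) _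
      _ ≤ heat k t τ * (splitC ρ * (econv (fun l => ‖f τ l‖ₑ) (x τ) k +
          wt (-ρ / 2) k * β τ)) := by
          gcongr
          exact hβF τ k
      _ = _ := by ring
  calc _ = ∑' k, wt 1 k * (wt (σ / 2) k *
        ∫⁻ τ in Icc t₀ T, heat k t τ * ‖conv (f τ) (c τ) k‖ₑ) ^ 2 := by
        refine tsum_congr fun k => ?_
        rw [mul_pow, wt_half_sq, ← mul_assoc, ← wt_add, add_comm]
    _ ≤ ∑' k, splitC ρ ^ 2 * (2 * (wt 1 k * (∫⁻ τ in Icc t₀ T, heat k t τ *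
          econv (fun l => ‖f τ l‖ₑ) (x τ) k) ^ 2) +
        2 * (wt 1 k * (∫⁻ τ in Icc t₀ T, heat k t τ * (wt (-ρ / 2) k * β τ)) ^ 2)) := by
        refine ENNReal.tsum_le_tsum fun k => ?_
        refine (mul_le_mul_right (ENNReal.pow_le_pow_left (hint k)) _).trans ?_
        rw [mul_pow]
        refine (mul_le_mul_right (mul_le_mul_right (ENNReal.add_sq_le _ _) _) _).trans
          (le_of_eq ?_)
        ring
    _ ≤ splitC ρ ^ 2 * (2 * ((ENNReal.ofReal (T - t₀) + 1) *
          ∫⁻ τ in Icc t₀ T, ∑' k, econv (fun l => ‖f τ l‖ₑ) (x τ) k ^ 2) +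
        2 * (wtSum d (ρ - 1) * (∫⁻ τ in Icc t₀ T, β τ) ^ 2)) := by
        rw [ENNReal.tsum_mul_left, ENNReal.tsum_add, ENNReal.tsum_mul_left, ENNReal.tsum_mul_left]
        gcongr
        · exact duhamel_sq_le hE t
        · exact duhamel_le β t₀ T t
    _ ≤ splitC ρ ^ 2 * (2 * ((ENNReal.ofReal (T - t₀) + 1) *
          (W * ∫⁻ τ in Icc t₀ T, sobSq σ (c τ))) +
        2 * (wtSum d (ρ - 1) * (Λ * ∫⁻ τ in Icc t₀ T, sobSq σ (c τ)))) := by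
        gcongr
        · rw [← lintegral_const_mul'' _ (aemeasurable_sobSq hc σ)]
          refine lintegral_mono_ae ?_
          filter_upwards [hW] with τ hτ
          refine (young _ _).trans ?_
          rw [hsx, ← wien_zero]
          gcongr
        · refine (lintegral_mul_sq_le ((aemeasurable_sobSq hf ρ).pow_const _)
            ((aemeasurable_sobSq hc σ).pow_const _)).trans ?_
          simp only [hsq]
          gcongr
    _ = _ := by ring

/-! ## The Duhamel operator of the linearized system -/

/-- Pairs `(v, μ)` of distributions. -/
abbrev State (d : ℕ) := Coeffs d × Coeffs d

/-- The components of `(∇v, μ)`. -/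
def stateComp (z : State d) : Option (Fin d) → Coeffs d
  | none => z.2
  | some j => distPartial j z.1

/-- The squared norm of `H^{σ+1} × H^σ`. -/
def en (σ : ℝ) (z : State d) : ℝ≥0∞ := sobSq (σ + 1) z.1 + sobSq σ z.2

/-- The squared norm of `L²([t₀, T]; H^{σ+1} × H^σ)`. -/
def nrm (σ t₀ T : ℝ) (Z : ℝ → State d) : ℝ≥0∞ := ∫⁻ t in Icc t₀ T, en σ (Z t)

lemma sum_sobSq_stateComp_le (σ : ℝ) (z : State d) : ∑ b, sobSq σ (stateComp z b) ≤ en σ z := by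
  rw [Fintype.sum_option, add_comm, en, sobSq_add_one]
  exact add_le_add le_add_self le_rfl

lemma sobSq_stateComp_le (σ : ℝ) (z : State d) (b : Option (Fin d)) :
    sobSq σ (stateComp z b) ≤ en σ z :=
  (Finset.single_le_sum (f := fun b => sobSq σ (stateComp z b))
    (fun _ _ => bot_le) (Finset.mem_univ b)).trans (sum_sobSq_stateComp_le σ z)

lemma en_add_le (σ : ℝ) (z y : State d) : en σ (z + y) ≤ 2 * en σ z + 2 * en σ y := by
  refine (add_le_add (sobSq_add_le _ _ _) (sobSq_add_le _ _ _)).trans (le_of_eq ?_)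
  simp only [en]
  ring

lemma en_mono {σ τ : ℝ} (h : σ ≤ τ) (z : State d) : en σ z ≤ en τ z :=
  add_le_add (sobSq_mono (by linarith) _) (sobSq_mono h _)

lemma eq_zero_of_en_eq_zero {σ : ℝ} {z : State d} (h : en σ z = 0) : z = 0 := by
  obtain ⟨h1, h2⟩ := add_eq_zero.1 h
  exact Prod.ext (eq_zero_of_sobSq_eq_zero h1) (eq_zero_of_sobSq_eq_zero h2)

lemma distPartial_add (i : Fin d) (a b : Coeffs d) :
    distPartial i (a + b) = distPartial i a + distPartial i b := by
  funext k; simp only [distPartial, Pi.add_apply]; ring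

lemma stateComp_add (z y : State d) (b : Option (Fin d)) :
    stateComp (z + y) b = stateComp z b + stateComp y b := by
  cases b with
  | none => rfl
  | some j => exact distPartial_add _ _ _

lemma enorm_intCast_sq_le (k : Freq d) (i : Fin d) : ‖((k i : ℤ) : ℂ)‖ₑ ^ 2 ≤ wt 1 k := by
  rw [← ofReal_norm, ← ENNReal.ofReal_pow (norm_nonneg _), wt, Real.rpow_one, Complex.norm_intCast,
    sq_abs]
  exact ENNReal.ofReal_le_ofReal (by linarith [sq_le_freqSq k i])

/-- Measurable real families in `L²([t₀, T]; H^{σ+1} × H^σ)`. -/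
structure Adm (σ t₀ T : ℝ) (Z : ℝ → State d) : Prop where
  real₁ : ∀ t ∈ Icc t₀ T, IsRealDist (Z t).1
  real₂ : ∀ t ∈ Icc t₀ T, IsRealDist (Z t).2
  meas₁ : MeasTime t₀ T fun t => (Z t).1
  meas₂ : MeasTime t₀ T fun t => (Z t).2
  fin : nrm σ t₀ T Z < ⊤

lemma IsRealDist.add {a b : Coeffs d} (ha : IsRealDist a) (hb : IsRealDist b) :
    IsRealDist (a + b) := fun k => by simp [ha k, hb k]

lemma IsRealDist.neg {a : Coeffs d} (ha : IsRealDist a) : IsRealDist (-a) := fun k => by simp [ha k]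

lemma IsRealDist.sum {ι : Type*} {s : Finset ι} {a : ι → Coeffs d}
    (ha : ∀ i ∈ s, IsRealDist (a i)) : IsRealDist (∑ i ∈ s, a i) := fun k => by
  simp only [Finset.sum_apply, map_sum]
  exact Finset.sum_congr rfl fun i hi => ha i hi k

lemma IsRealDist.distPartial {a : Coeffs d} (ha : IsRealDist a) (i : Fin d) :
    IsRealDist (distPartial i a) := fun k => by
  simp [MFG.distPartial, ha k]

lemma IsRealDist.conv {f c : Coeffs d} (hf : IsRealDist f) (hc : IsRealDist c) :
    IsRealDist (conv f c) := fun k => by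
  rw [MFG.conv, MFG.conv, Complex.conj_tsum, ← (Equiv.neg (Freq d)).tsum_eq]
  refine tsum_congr fun l => ?_
  rw [map_mul, ← hf, ← hc, Equiv.neg_apply]
  congr 2
  abel

lemma IsRealDist.stateComp {z : State d} (h1 : IsRealDist z.1) (h2 : IsRealDist z.2)
    (b : Option (Fin d)) : IsRealDist (stateComp z b) := by
  cases b with
  | none => exact h2
  | some j => exact h1.distPartial j

lemma MeasTime.distPartial {t₀ T : ℝ} {c : ℝ → Coeffs d} (h : MeasTime t₀ T c) (i : Fin d) :
    MeasTime t₀ T fun t => distPartial i (c t) := fun k => (h k).const_mul _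

lemma MeasTime.sum {ι : Type*} {s : Finset ι} {t₀ T : ℝ} {c : ι → ℝ → Coeffs d}
    (h : ∀ i ∈ s, MeasTime t₀ T (c i)) : MeasTime t₀ T fun t => ∑ i ∈ s, c i t := fun k => by
  simp only [Finset.sum_apply]
  exact Finset.aestronglyMeasurable_fun_sum s fun i hi => h i hi k

lemma MeasTime.add {t₀ T : ℝ} {a b : ℝ → Coeffs d} (ha : MeasTime t₀ T a)
    (hb : MeasTime t₀ T b) : MeasTime t₀ T fun t => a t + b t := fun k => (ha k).add (hb k)

lemma MeasTime.neg {t₀ T : ℝ} {a : ℝ → Coeffs d} (ha : MeasTime t₀ T a) :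
    MeasTime t₀ T fun t => -a t := fun k => (ha k).neg

section

variable {σ ρ t₀ T : ℝ} {K : ℝ≥0∞} {A : Option (Fin d) → Option (Fin d) → ℝ → Coeffs d}
  {Z Y : ℝ → State d}

lemma Adm.meas_stateComp (h : Adm σ t₀ T Z) (b : Option (Fin d)) :
    MeasTime t₀ T fun t => stateComp (Z t) b := by
  cases b with
  | none => exact h.meas₂
  | some j => exact h.meas₁.distPartial j

lemma Adm.aemeasurable_en (h : Adm σ t₀ T Z) :
    AEMeasurable (fun t => en σ (Z t)) (volume.restrict (Icc t₀ T)) :=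
  (aemeasurable_sobSq h.meas₁ _).add (aemeasurable_sobSq h.meas₂ _)

lemma nrm_add_le (h : Adm σ t₀ T Z) (Y : ℝ → State d) :
    nrm σ t₀ T (Z + Y) ≤ 2 * nrm σ t₀ T Z + 2 * nrm σ t₀ T Y := by
  rw [nrm, nrm, nrm, ← lintegral_const_mul' _ _ (by norm_num), ← lintegral_const_mul' _ _ (by norm_num),
    ← lintegral_add_left' (h.aemeasurable_en.const_mul _)]
  exact lintegral_mono fun t => en_add_le _ _ _

lemma Adm.add (h : Adm σ t₀ T Z) (h' : Adm σ t₀ T Y) : Adm σ t₀ T (Z + Y) where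
  real₁ t ht := (h.real₁ t ht).add (h'.real₁ t ht)
  real₂ t ht := (h.real₂ t ht).add (h'.real₂ t ht)
  meas₁ := h.meas₁.add h'.meas₁
  meas₂ := h.meas₂.add h'.meas₂
  fin := (nrm_add_le h Y).trans_lt (by have := h.fin; have := h'.fin; finiteness)

lemma en_neg (σ : ℝ) (z : State d) : en σ (-z) = en σ z := by
  simp only [en, Prod.fst_neg, Prod.snd_neg, sobSq_neg]

lemma Adm.neg (h : Adm σ t₀ T Z) : Adm σ t₀ T (-Z) where
  real₁ t ht := (h.real₁ t ht).neg
  real₂ t ht := (h.real₂ t ht).neg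
  meas₁ := h.meas₁.neg
  meas₂ := h.meas₂.neg
  fin := by
    have h1 := h.fin
    simp only [nrm, Pi.neg_apply, en_neg] at h1 ⊢
    exact h1

lemma Adm.sub (h : Adm σ t₀ T Z) (h' : Adm σ t₀ T Y) : Adm σ t₀ T (Z - Y) := by
  rw [sub_eq_add_neg]
  exact h.add h'.neg

lemma Adm.mono {σ' : ℝ} (h : Adm σ t₀ T Z) (hσ : σ' ≤ σ) : Adm σ' t₀ T Z :=
  ⟨h.real₁, h.real₂, h.meas₁, h.meas₂, (lintegral_mono fun _ => en_mono hσ _).trans_lt h.fin⟩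

lemma Adm.ae_en_lt_top (h : Adm σ t₀ T Z) :
    ∀ᵐ t ∂(volume.restrict (Icc t₀ T)), en σ (Z t) < ⊤ := ae_lt_top' h.aemeasurable_en h.fin.ne

/-- Bounds for the coefficients of a linear system which are sufficient for its solution in
`H^{σ+1} × H^σ`. -/
structure CoefBound (t₀ T σ ρ : ℝ) (K : ℝ≥0∞)
    (A : Option (Fin d) → Option (Fin d) → ℝ → Coeffs d) : Prop where
  nonneg : 0 ≤ ρ
  neg_le : -ρ ≤ σ
  real : ∀ o b t, IsRealDist (A o b t)
  meas : ∀ o b, MeasTime t₀ T (A o b)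
  fin : ∀ o b, ∀ᵐ t ∂(volume.restrict (Icc t₀ T)), sobSq ρ (A o b t) < ⊤
  smoothing : ∀ o b, SmoothingBound t₀ T σ K (A o b)

/-- The sources of the linear system. -/
def source (A : Option (Fin d) → Option (Fin d) → ℝ → Coeffs d) (Z : ℝ → State d)
    (o : Option (Fin d)) (t : ℝ) : Coeffs d := ∑ b, conv (A o b t) (stateComp (Z t) b)

/-- The divergence of the flux. -/
def flux (A : Option (Fin d) → Option (Fin d) → ℝ → Coeffs d) (Z : ℝ → State d)
    (t : ℝ) : Coeffs d := ∑ i, distPartial i (source A Z (some i) t)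

lemma conv_add {ρ : ℝ} (hρ : 0 ≤ ρ) {f a b : Coeffs d} (hf : sobSq ρ f < ⊤)
    (ha : sobSq (-ρ) a < ⊤) (hb : sobSq (-ρ) b < ⊤) : conv f (a + b) = conv f a + conv f b := by
  funext k
  rw [Pi.add_apply, conv, conv, conv,
    ← (summable_conv hρ hf ha k).tsum_add (summable_conv hρ hf hb k)]
  exact tsum_congr fun l => by rw [Pi.add_apply, mul_add]

lemma CoefBound.ae_fin (hA : CoefBound t₀ T σ ρ K A) (h : Adm σ t₀ T Z) :
    ∀ᵐ t ∂(volume.restrict (Icc t₀ T)), ∀ b, sobSq (-ρ) (stateComp (Z t) b) < ⊤ := by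
  filter_upwards [h.ae_en_lt_top] with t ht b
  exact ((sobSq_mono hA.neg_le _).trans (sobSq_stateComp_le σ (Z t) b)).trans_lt ht

lemma CoefBound.meas_conv (hA : CoefBound t₀ T σ ρ K A) (h : Adm σ t₀ T Z)
    (o b : Option (Fin d)) : MeasTime t₀ T fun t => conv (A o b t) (stateComp (Z t) b) :=
  (hA.meas o b).conv hA.nonneg (h.meas_stateComp b) (hA.fin o b)
    ((hA.ae_fin h).mono fun _ ht => ht b)

lemma CoefBound.meas_source (hA : CoefBound t₀ T σ ρ K A) (h : Adm σ t₀ T Z)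
    (o : Option (Fin d)) : MeasTime t₀ T (source A Z o) :=
  MeasTime.sum fun b _ => hA.meas_conv h o b

/-- Additivity needs convergent products, hence holds only at almost every time; the integrals in
Duhamel's formula do not see the exceptional times. -/
lemma CoefBound.source_add (hA : CoefBound t₀ T σ ρ K A) (h : Adm σ t₀ T Z) (h' : Adm σ t₀ T Y) :
    ∀ᵐ t ∂(volume.restrict (Icc t₀ T)), ∀ o, source A (Z + Y) o t = source A Z o t + source A Y o t := by
  have hf : ∀ᵐ t ∂(volume.restrict (Icc t₀ T)), ∀ o b, sobSq ρ (A o b t) < ⊤ :=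
    ae_all_iff.2 fun o => ae_all_iff.2 fun b => hA.fin o b
  filter_upwards [hA.ae_fin h, hA.ae_fin h', hf] with t h1 h2 h3 o
  rw [source, source, source, ← Finset.sum_add_distrib]
  refine Finset.sum_congr rfl fun b _ => ?_
  rw [Pi.add_apply, stateComp_add, conv_add hA.nonneg (h3 o b) (h1 b) (h2 b)]

lemma CoefBound.flux_add (hA : CoefBound t₀ T σ ρ K A) (h : Adm σ t₀ T Z) (h' : Adm σ t₀ T Y) :
    ∀ᵐ t ∂(volume.restrict (Icc t₀ T)), flux A (Z + Y) t = flux A Z t + flux A Y t := by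
  filter_upwards [hA.source_add h h'] with t ht
  rw [flux, flux, flux, ← Finset.sum_add_distrib]
  exact Finset.sum_congr rfl fun i _ => by rw [ht, distPartial_add]

lemma CoefBound.real_source (hA : CoefBound t₀ T σ ρ K A) (h : Adm σ t₀ T Z) {t : ℝ}
    (ht : t ∈ Icc t₀ T) (o : Option (Fin d)) : IsRealDist (source A Z o t) :=
  IsRealDist.sum fun b _ => (hA.real o b t).conv (IsRealDist.stateComp (h.real₁ t ht) (h.real₂ t ht) b)

lemma CoefBound.real_flux (hA : CoefBound t₀ T σ ρ K A) (h : Adm σ t₀ T Z) {t : ℝ}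
    (ht : t ∈ Icc t₀ T) : IsRealDist (flux A Z t) :=
  IsRealDist.sum fun i _ => (hA.real_source h ht (some i)).distPartial i

lemma CoefBound.smoothing_source (hA : CoefBound t₀ T σ ρ K A) (h : Adm σ t₀ T Z)
    (o : Option (Fin d)) (t : ℝ) :
    ∑' k, wt (σ + 1) k * (∫⁻ τ in Icc t₀ T, heat k t τ * ‖source A Z o τ k‖ₑ) ^ 2 ≤
      (d + 1 : ℕ) * K * nrm σ t₀ T Z := by
  have hb : ∀ b, ∫⁻ τ in Icc t₀ T, sobSq σ (stateComp (Z τ) b) < ⊤ := fun b =>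
    (lintegral_mono fun τ => sobSq_stateComp_le σ (Z τ) b).trans_lt h.fin
  have hk : ∀ k, (∫⁻ τ in Icc t₀ T, heat k t τ * ‖source A Z o τ k‖ₑ) ^ 2 ≤
      (d + 1 : ℕ) * ∑ b, (∫⁻ τ in Icc t₀ T,
        heat k t τ * ‖conv (A o b τ) (stateComp (Z τ) b) k‖ₑ) ^ 2 := by
    intro k
    have h1 : ∫⁻ τ in Icc t₀ T, heat k t τ * ‖source A Z o τ k‖ₑ ≤
        ∑ b, ∫⁻ τ in Icc t₀ T, heat k t τ * ‖conv (A o b τ) (stateComp (Z τ) b) k‖ₑ := by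
      have hm : ∀ b, AEMeasurable
          (fun τ => heat k t τ * ‖conv (A o b τ) (stateComp (Z τ) b) k‖ₑ)
          (volume.restrict (Icc t₀ T)) := fun b =>
        (measurable_heat k t).aemeasurable.mul (hA.meas_conv h o b k).enorm
      rw [← lintegral_finsetSum' _ fun b _ => hm b]
      refine lintegral_mono fun τ => ?_
      rw [← Finset.mul_sum]
      gcongr
      rw [source, Finset.sum_apply]
      exact enorm_sum_le _ _
    refine (ENNReal.pow_le_pow_left h1).trans ((ENNReal.sum_sq_le _ _).trans (le_of_eq ?_))
    rw [Finset.card_univ, Fintype.card_option, Fintype.card_fin]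
  calc _ ≤ ∑' k, (d + 1 : ℕ) * ∑ b, wt (σ + 1) k * (∫⁻ τ in Icc t₀ T,
          heat k t τ * ‖conv (A o b τ) (stateComp (Z τ) b) k‖ₑ) ^ 2 := by
        refine ENNReal.tsum_le_tsum fun k => ?_
        rw [← Finset.mul_sum, mul_left_comm]
        gcongr
        exact hk k
    _ = (d + 1 : ℕ) * ∑ b, ∑' k, wt (σ + 1) k * (∫⁻ τ in Icc t₀ T,
          heat k t τ * ‖conv (A o b τ) (stateComp (Z τ) b) k‖ₑ) ^ 2 := by
        rw [ENNReal.tsum_mul_left, Summable.tsum_finsetSum fun _ _ => ENNReal.summable]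
    _ ≤ (d + 1 : ℕ) * ∑ b, K * ∫⁻ τ in Icc t₀ T, sobSq σ (stateComp (Z τ) b) := by
        gcongr with b
        exact hA.smoothing o b _ (h.meas_stateComp b) (hb b) t
    _ ≤ (d + 1 : ℕ) * (K * nrm σ t₀ T Z) := by
        rw [← Finset.mul_sum]
        gcongr
        rw [← lintegral_finsetSum' _ fun b _ => aemeasurable_sobSq (h.meas_stateComp b) σ]
        exact lintegral_mono fun τ => sum_sobSq_stateComp_le σ (Z τ)
    _ = _ := (mul_assoc _ _ _).symm

/-- The smoothing estimate at a single frequency: on a bounded interval the heat multiplier has a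
positive lower bound and can be removed. -/
lemma CoefBound.integrable_source (hA : CoefBound t₀ T σ ρ K A) (hK : K ≠ ⊤) (h : Adm σ t₀ T Z)
    (o : Option (Fin d)) (k : Freq d) :
    IntegrableOn (fun τ => source A Z o τ k) (Icc t₀ T) := by
  refine ⟨hA.meas_source h o k, ?_⟩
  have h1 := (ENNReal.le_tsum k).trans (hA.smoothing_source h o t₀)
  have h2 : wt (σ + 1) k * (∫⁻ τ in Icc t₀ T, heat k t₀ τ * ‖source A Z o τ k‖ₑ) ^ 2 < ⊤ := by
    refine h1.trans_lt ?_
    have := h.fin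
    finiteness
  have h3 : ∫⁻ τ in Icc t₀ T, heat k t₀ τ * ‖source A Z o τ k‖ₑ ≠ ⊤ := by
    intro htop
    rw [htop] at h2
    simp [ENNReal.mul_top, wt_ne_zero] at h2
  set c : ℝ≥0∞ := ENNReal.ofReal (Real.exp (-(freqSq k * (T - t₀)))) with hc
  have hc0 : c ≠ 0 := (ENNReal.ofReal_pos.2 (Real.exp_pos _)).ne'
  have h4 : c * ∫⁻ τ in Icc t₀ T, ‖source A Z o τ k‖ₑ < ⊤ := by
    refine lt_of_le_of_lt ?_ h3.lt_top
    rw [← lintegral_const_mul' _ _ ENNReal.ofReal_ne_top]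
    refine setLIntegral_mono' measurableSet_Icc fun τ hτ => ?_
    gcongr
    refine ENNReal.ofReal_le_ofReal (Real.exp_le_exp.2 (neg_le_neg ?_))
    refine mul_le_mul_of_nonneg_left ?_ (freqSq_nonneg k)
    rw [abs_sub_comm, abs_of_nonneg (sub_nonneg.2 hτ.1)]
    linarith [hτ.2]
  exact (ENNReal.mul_lt_top_iff.1 h4).elim (fun h => h.2)
    (fun h => h.elim (fun h => absurd h hc0) fun h => by rw [HasFiniteIntegral, h]; exact ENNReal.zero_lt_top)

lemma CoefBound.integrable_flux (hA : CoefBound t₀ T σ ρ K A) (hK : K ≠ ⊤) (h : Adm σ t₀ T Z)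
    (k : Freq d) : IntegrableOn (fun τ => flux A Z τ k) (Icc t₀ T) := by
  simp only [flux, Finset.sum_apply, distPartial]
  exact integrable_finsetSum _ fun i _ => (hA.integrable_source hK h (some i) k).const_mul _

end

/-! ### The heat flow and the Duhamel integrals -/

/-- The real multiplier `e^{-|k|² (t - τ)}`. -/
def heatR (k : Freq d) (t τ : ℝ) : ℂ := ((Real.exp (-(freqSq k * (t - τ))) : ℝ) : ℂ)

lemma enorm_heatR (k : Freq d) {t τ : ℝ} (h : τ ≤ t) : ‖heatR k t τ‖ₑ = heat k t τ := by
  rw [← ofReal_norm, heatR, Complex.norm_real, Real.norm_of_nonneg (Real.exp_pos _).le, heat,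
    abs_of_nonneg (sub_nonneg.2 h)]

lemma heat_symm (k : Freq d) (t τ : ℝ) : heat k t τ = heat k τ t := by
  rw [heat, heat, abs_sub_comm]

lemma heatR_eq (k : Freq d) (t τ : ℝ) :
    heatR k t τ = heatR k t 0 * heatR k 0 τ := by
  rw [heatR, heatR, heatR, ← Complex.ofReal_mul, ← Real.exp_add]
  congr 2
  ring

lemma heatR_neg (k : Freq d) (t τ : ℝ) : heatR (-k) t τ = heatR k t τ := by
  rw [heatR, heatR, freqSq_neg]

lemma continuous_heatR (k : Freq d) : Continuous fun z : ℝ × ℝ => heatR k z.1 z.2 := by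
  unfold heatR
  fun_prop

/-- The heat semigroup. -/
def heatFlow (t : ℝ) (c : Coeffs d) : Coeffs d := fun k => heatR k t 0 * c k

lemma IsRealDist.heatFlow {c : Coeffs d} (h : IsRealDist c) (t : ℝ) : IsRealDist (heatFlow t c) :=
  fun k => by
    simp only [MFG.heatFlow, map_mul, h k, heatR_neg]
    rw [heatR, Complex.conj_ofReal]

lemma sobSq_heatFlow_le (σ : ℝ) {t : ℝ} (ht : 0 ≤ t) (c : Coeffs d) :
    sobSq σ (heatFlow t c) ≤ sobSq σ c :=
  sobSq_le_of_enorm_le fun k => by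
    rw [heatFlow, enorm_mul, enorm_heatR k ht]
    exact mul_le_of_le_one_left bot_le (heat_le_one k t 0)

lemma heatFlow_add (t : ℝ) (a b : Coeffs d) : heatFlow t (a + b) = heatFlow t a + heatFlow t b := by
  funext k; simp only [heatFlow, Pi.add_apply, mul_add]

lemma heatFlow_zero (t : ℝ) : heatFlow t (0 : Coeffs d) = 0 := by
  funext k; simp [heatFlow]

lemma measTime_heatFlow (t₀ T a b : ℝ) (c : Coeffs d) :
    MeasTime t₀ T fun t => heatFlow (a * t + b) c := fun k => by
  refine Continuous.aestronglyMeasurable ?_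
  refine Continuous.mul ?_ continuous_const
  exact (continuous_heatR k).comp
    (f := fun t : ℝ => ((a * t + b, 0) : ℝ × ℝ)) (by fun_prop)

/-- The gain of one derivative in `L²` for the heat semigroup, at the initial or terminal time. -/
lemma lintegral_sobSq_heatFlow_le (σ t₀ T t : ℝ) (c : Coeffs d) :
    ∫⁻ τ in Icc t₀ T, sobSq (σ + 1) (heatFlow |t - τ| c) ≤
      (ENNReal.ofReal (T - t₀) + 1) * sobSq σ c := by
  have hm : ∀ k, Measurable fun τ => wt (σ + 1) k * ‖heatFlow |t - τ| c k‖ₑ ^ 2 := fun k => by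
    have : Continuous fun τ : ℝ => heatFlow |t - τ| c k :=
      Continuous.mul ((continuous_heatR k).comp
        (f := fun τ : ℝ => ((|t - τ|, 0) : ℝ × ℝ)) (by fun_prop)) continuous_const
    exact (this.measurable.enorm.pow_const 2).const_mul _
  simp only [sobSq_eq]
  rw [lintegral_tsum fun k => (hm k).aemeasurable, ← ENNReal.tsum_mul_left]
  refine ENNReal.tsum_le_tsum fun k => ?_
  have e : ∀ τ, wt (σ + 1) k * ‖heatFlow |t - τ| c k‖ₑ ^ 2 =
      (wt (σ + 1) k * ‖c k‖ₑ ^ 2) * heat k t τ ^ 2 := fun τ => by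
    rw [heatFlow, enorm_mul, enorm_heatR k (abs_nonneg _), mul_pow, heat, heat, sub_zero, abs_abs]
    ring
  simp only [e]
  rw [lintegral_const_mul _ ((measurable_heat k t).pow_const 2), wt_add]
  calc _ = wt 1 k * (∫⁻ τ in Icc t₀ T, heat k t τ ^ 2) * (wt σ k * ‖c k‖ₑ ^ 2) := by ring
    _ ≤ _ := by gcongr; exact wt_one_mul_lintegral_heat_sq_le k t t₀ T

/-- The backward Duhamel integral. -/
def duhB (T : ℝ) (S : ℝ → Coeffs d) (t : ℝ) : Coeffs d := fun k =>
  -∫ τ in t..T, heatR k τ t * S τ k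

/-- The forward Duhamel integral. -/
def duhF (t₀ : ℝ) (S : ℝ → Coeffs d) (t : ℝ) : Coeffs d := fun k =>
  ∫ τ in t₀..t, heatR k t τ * S τ k

section

variable {σ ρ t₀ T : ℝ} {K : ℝ≥0∞} {A : Option (Fin d) → Option (Fin d) → ℝ → Coeffs d}
  {Z Y : ℝ → State d} {S S' : ℝ → Coeffs d}

lemma intervalIntegrable_heatR_mul (t : ℝ) {k : Freq d}
    (h : IntegrableOn (fun τ => S τ k) (Icc t₀ T)) {a b : ℝ} (ha : a ∈ Icc t₀ T)
    (hb : b ∈ Icc t₀ T) :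
    IntervalIntegrable (fun τ => heatR k t τ * S τ k) volume a b ∧
    IntervalIntegrable (fun τ => heatR k τ t * S τ k) volume a b := by
  have h1 : IntervalIntegrable (fun τ => S τ k) volume a b := by
    refine (h.mono_set ?_).intervalIntegrable
    exact (convex_Icc t₀ T).ordConnected.uIcc_subset ha hb
  constructor
  · exact h1.continuousOn_mul ((continuous_heatR k).comp
      (f := fun τ : ℝ => ((t, τ) : ℝ × ℝ)) (by fun_prop)).continuousOn
  · exact h1.continuousOn_mul ((continuous_heatR k).comp
      (f := fun τ : ℝ => ((τ, t) : ℝ × ℝ)) (by fun_prop)).continuousOn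

lemma enorm_duhB_le {t : ℝ} (ht : t ∈ Icc t₀ T) (k : Freq d) :
    ‖duhB T S t k‖ₑ ≤ ∫⁻ τ in Icc t₀ T, heat k t τ * ‖S τ k‖ₑ := by
  rw [duhB, enorm_neg, intervalIntegral.integral_of_le ht.2]
  refine (enorm_integral_le_lintegral_enorm _).trans ?_
  refine le_trans ?_ (lintegral_mono_set (fun τ hτ => ⟨ht.1.trans hτ.1.le, hτ.2⟩ :
    Ioc t T ⊆ Icc t₀ T))
  refine setLIntegral_mono' measurableSet_Ioc fun τ hτ => ?_
  rw [enorm_mul, enorm_heatR k hτ.1.le, heat_symm]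

lemma enorm_duhF_le {t : ℝ} (ht : t ∈ Icc t₀ T) (k : Freq d) :
    ‖duhF t₀ S t k‖ₑ ≤ ∫⁻ τ in Icc t₀ T, heat k t τ * ‖S τ k‖ₑ := by
  rw [duhF, intervalIntegral.integral_of_le ht.1]
  refine (enorm_integral_le_lintegral_enorm _).trans ?_
  refine le_trans ?_ (lintegral_mono_set (fun τ hτ => ⟨hτ.1.le, hτ.2.trans ht.2⟩ :
    Ioc t₀ t ⊆ Icc t₀ T))
  refine setLIntegral_mono' measurableSet_Ioc fun τ hτ => ?_
  rw [enorm_mul, enorm_heatR k hτ.2]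

/-- The dependence of the heat multiplier on `t` splits off as a factor (`heatR_eq`). What remains
is a primitive of an integrable function, so every coefficient is even continuous in time. -/
lemma measTime_duhB (hT : t₀ ≤ T) (h : ∀ k, IntegrableOn (fun τ => S τ k) (Icc t₀ T)) :
    MeasTime t₀ T (duhB T S) := by
  intro k
  have hT' : T ∈ Icc t₀ T := right_mem_Icc.2 hT
  have h1 := (intervalIntegrable_heatR_mul 0 (h k) (left_mem_Icc.2 hT) hT').2
  have h2 := intervalIntegral.continuousOn_primitive_interval' h1 (a := T) right_mem_uIcc
  rw [uIcc_of_le hT] at h2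
  refine ContinuousOn.aestronglyMeasurable ?_ measurableSet_Icc
  refine ((((continuous_heatR k).comp (f := fun t : ℝ => ((0, t) : ℝ × ℝ))
    (by fun_prop)).continuousOn (s := Icc t₀ T)).mul h2).congr fun t _ => ?_
  simp only [duhB, Pi.mul_apply, Function.comp_apply]
  rw [intervalIntegral.integral_symm, neg_neg, ← intervalIntegral.integral_const_mul]
  refine intervalIntegral.integral_congr fun τ _ => ?_
  rw [heatR_eq k τ t]
  ring

lemma measTime_duhF (hT : t₀ ≤ T) (h : ∀ k, IntegrableOn (fun τ => S τ k) (Icc t₀ T)) :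
    MeasTime t₀ T (duhF t₀ S) := by
  intro k
  have hT' : T ∈ Icc t₀ T := right_mem_Icc.2 hT
  have h1 := (intervalIntegrable_heatR_mul 0 (h k) (left_mem_Icc.2 hT) hT').1
  have h2 := intervalIntegral.continuousOn_primitive_interval' h1 (a := t₀) left_mem_uIcc
  rw [uIcc_of_le hT] at h2
  refine ContinuousOn.aestronglyMeasurable ?_ measurableSet_Icc
  refine ((((continuous_heatR k).comp (f := fun t : ℝ => ((t, 0) : ℝ × ℝ))
    (by fun_prop)).continuousOn (s := Icc t₀ T)).mul h2).congr fun t _ => ?_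
  simp only [duhF, Pi.mul_apply, Function.comp_apply]
  rw [← intervalIntegral.integral_const_mul]
  refine intervalIntegral.integral_congr fun τ _ => ?_
  rw [heatR_eq k t τ]
  ring

lemma conj_heatR (k : Freq d) (t τ : ℝ) : (starRingEnd ℂ) (heatR k t τ) = heatR k t τ := by
  rw [heatR, Complex.conj_ofReal]

lemma isRealDist_duhB (hS : ∀ t ∈ Icc t₀ T, IsRealDist (S t)) {t : ℝ} (ht : t ∈ Icc t₀ T) :
    IsRealDist (duhB T S t) := by
  intro k
  rw [duhB, duhB, map_neg, intervalIntegral.integral_of_le ht.2, intervalIntegral.integral_of_le ht.2,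
    ← integral_conj]
  congr 1
  refine setIntegral_congr_fun measurableSet_Ioc fun τ hτ => ?_
  rw [map_mul, conj_heatR, hS τ ⟨ht.1.trans hτ.1.le, hτ.2⟩, heatR_neg]

lemma isRealDist_duhF (hS : ∀ t ∈ Icc t₀ T, IsRealDist (S t)) {t : ℝ} (ht : t ∈ Icc t₀ T) :
    IsRealDist (duhF t₀ S t) := by
  intro k
  rw [duhF, duhF, intervalIntegral.integral_of_le ht.1, intervalIntegral.integral_of_le ht.1,
    ← integral_conj]
  refine setIntegral_congr_fun measurableSet_Ioc fun τ hτ => ?_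
  rw [map_mul, conj_heatR, hS τ ⟨hτ.1.le, hτ.2.trans ht.2⟩, heatR_neg]

lemma integral_congr_Icc {f g : ℝ → ℂ} (h : ∀ᵐ t ∂(volume.restrict (Icc t₀ T)), f t = g t)
    {a b : ℝ} (ha : a ∈ Icc t₀ T) (hb : b ∈ Icc t₀ T) :
    ∫ τ in a..b, f τ = ∫ τ in a..b, g τ := by
  refine intervalIntegral.integral_congr_ae ?_
  filter_upwards [(ae_restrict_iff' measurableSet_Icc).1 h] with t ht h'
  exact ht ((convex_Icc t₀ T).ordConnected.uIcc_subset ha hb (uIoc_subset_uIcc h'))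

lemma duhB_add {t : ℝ} (ht : t ∈ Icc t₀ T) {S'' : ℝ → Coeffs d}
    (h : ∀ k, IntegrableOn (fun τ => S τ k) (Icc t₀ T))
    (h' : ∀ k, IntegrableOn (fun τ => S' τ k) (Icc t₀ T))
    (he : ∀ᵐ τ ∂(volume.restrict (Icc t₀ T)), S'' τ = S τ + S' τ) :
    duhB T S'' t = duhB T S t + duhB T S' t := by
  have hT : T ∈ Icc t₀ T := ⟨ht.1.trans ht.2, le_rfl⟩
  funext k
  rw [Pi.add_apply, duhB, duhB, duhB, ← neg_add, ← intervalIntegral.integral_add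
    (intervalIntegrable_heatR_mul t (h k) ht hT).2 (intervalIntegrable_heatR_mul t (h' k) ht hT).2]
  congr 1
  refine integral_congr_Icc ?_ ht hT
  filter_upwards [he] with τ hτ
  rw [hτ, Pi.add_apply, mul_add]

lemma duhF_add {t : ℝ} (ht : t ∈ Icc t₀ T) {S'' : ℝ → Coeffs d}
    (h : ∀ k, IntegrableOn (fun τ => S τ k) (Icc t₀ T))
    (h' : ∀ k, IntegrableOn (fun τ => S' τ k) (Icc t₀ T))
    (he : ∀ᵐ τ ∂(volume.restrict (Icc t₀ T)), S'' τ = S τ + S' τ) :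
    duhF t₀ S'' t = duhF t₀ S t + duhF t₀ S' t := by
  have hT : t₀ ∈ Icc t₀ T := ⟨le_rfl, ht.1.trans ht.2⟩
  funext k
  rw [Pi.add_apply, duhF, duhF, duhF, ← intervalIntegral.integral_add
    (intervalIntegrable_heatR_mul t (h k) hT ht).1 (intervalIntegrable_heatR_mul t (h' k) hT ht).1]
  refine integral_congr_Icc ?_ hT ht
  filter_upwards [he] with τ hτ
  rw [hτ, Pi.add_apply, mul_add]

/-- The Duhamel operator of the linear system. -/
def duhamel (A : Option (Fin d) → Option (Fin d) → ℝ → Coeffs d) (t₀ T : ℝ) (Z : ℝ → State d)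
    (t : ℝ) : State d := (duhB T (source A Z none) t, duhF t₀ (flux A Z) t)

lemma CoefBound.duhamel_add (hA : CoefBound t₀ T σ ρ K A) (hK : K ≠ ⊤) (h : Adm σ t₀ T Z)
    (h' : Adm σ t₀ T Y) {t : ℝ} (ht : t ∈ Icc t₀ T) :
    duhamel A t₀ T (Z + Y) t = duhamel A t₀ T Z t + duhamel A t₀ T Y t := by
  refine Prod.ext ?_ ?_
  · exact duhB_add ht (hA.integrable_source hK h none) (hA.integrable_source hK h' none)
      ((hA.source_add h h').mono fun _ ht => ht none)
  · exact duhF_add ht (hA.integrable_flux hK h) (hA.integrable_flux hK h') (hA.flux_add h h')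

/-- The constant in the estimate of the Duhamel operator. -/
def duhamelC (d : ℕ) (K : ℝ≥0∞) : ℝ≥0∞ := (1 + d * d) * ((d + 1 : ℕ) * K)

lemma duhamelC_lt_top {K : ℝ≥0∞} (hK : K ≠ ⊤) : duhamelC d K < ⊤ := by
  unfold duhamelC
  finiteness

lemma CoefBound.sobSq_duhB_le (hA : CoefBound t₀ T σ ρ K A) (h : Adm σ t₀ T Z) {t : ℝ}
    (ht : t ∈ Icc t₀ T) :
    sobSq (σ + 1) (duhB T (source A Z none) t) ≤ (d + 1 : ℕ) * K * nrm σ t₀ T Z := by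
  refine le_trans ?_ (hA.smoothing_source h none t)
  rw [sobSq_eq]
  gcongr with k
  exact enorm_duhB_le ht k

/-- The divergence spends the derivative gained by the heat semigroup: `k_i² ≤ 1 + |k|²` turns the
order `σ` of the flux divergence into `σ + 1` for the sources. -/
lemma CoefBound.sobSq_duhF_le (hA : CoefBound t₀ T σ ρ K A) (h : Adm σ t₀ T Z) {t : ℝ}
    (ht : t ∈ Icc t₀ T) :
    sobSq σ (duhF t₀ (flux A Z) t) ≤ d * d * ((d + 1 : ℕ) * K * nrm σ t₀ T Z) := by
  have hk : ∀ k, wt σ k * ‖duhF t₀ (flux A Z) t k‖ₑ ^ 2 ≤ d * ∑ i, wt (σ + 1) k *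
      (∫⁻ τ in Icc t₀ T, heat k t τ * ‖source A Z (some i) τ k‖ₑ) ^ 2 := by
    intro k
    have hm : ∀ i, AEMeasurable (fun τ => heat k t τ * ‖source A Z (some i) τ k‖ₑ)
        (volume.restrict (Icc t₀ T)) := fun i =>
      (measurable_heat k t).aemeasurable.mul (hA.meas_source h (some i) k).enorm
    have h1 : ‖duhF t₀ (flux A Z) t k‖ₑ ≤ ∑ i, ‖((k i : ℤ) : ℂ)‖ₑ *
        ∫⁻ τ in Icc t₀ T, heat k t τ * ‖source A Z (some i) τ k‖ₑ := by
      refine (enorm_duhF_le ht k).trans ?_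
      simp only [← lintegral_const_mul' _ _ enorm_ne_top]
      rw [← lintegral_finsetSum' _ fun i _ => (hm i).const_mul _]
      refine lintegral_mono fun τ => ?_
      simp only [mul_left_comm _ (heat k t τ)]
      rw [← Finset.mul_sum]
      gcongr
      rw [flux, Finset.sum_apply]
      refine (enorm_sum_le _ _).trans (le_of_eq (Finset.sum_congr rfl fun i _ => ?_))
      rw [distPartial, enorm_mul, enorm_mul]
      simp [← ofReal_norm]
    refine (mul_le_mul_right ((ENNReal.pow_le_pow_left h1).trans (ENNReal.sum_sq_le _ _)) _).trans ?_
    rw [Finset.card_univ, Fintype.card_fin, mul_left_comm, Finset.mul_sum]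
    refine mul_le_mul_right (Finset.sum_le_sum fun i _ => ?_) _
    rw [mul_pow, ← mul_assoc, wt_add]
    gcongr
    exact enorm_intCast_sq_le k i
  rw [sobSq_eq]
  calc _ ≤ ∑' k, d * ∑ i, wt (σ + 1) k *
      (∫⁻ τ in Icc t₀ T, heat k t τ * ‖source A Z (some i) τ k‖ₑ) ^ 2 := ENNReal.tsum_le_tsum hk
    _ = d * ∑ i, ∑' k, wt (σ + 1) k *
      (∫⁻ τ in Icc t₀ T, heat k t τ * ‖source A Z (some i) τ k‖ₑ) ^ 2 := by
        rw [ENNReal.tsum_mul_left, Summable.tsum_finsetSum fun _ _ => ENNReal.summable]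
    _ ≤ d * ∑ _i : Fin d, (d + 1 : ℕ) * K * nrm σ t₀ T Z := by
        gcongr with i
        exact hA.smoothing_source h (some i) t
    _ = _ := by
        rw [Finset.sum_const, Finset.card_univ, Fintype.card_fin, nsmul_eq_mul]
        ring

/-- A bound at every time by an integral over time. Integrated once more, it produces the factor `T
- t₀` that makes the operator contract. -/
lemma CoefBound.en_duhamel_le (hA : CoefBound t₀ T σ ρ K A) (h : Adm σ t₀ T Z) {t : ℝ}
    (ht : t ∈ Icc t₀ T) : en σ (duhamel A t₀ T Z t) ≤ duhamelC d K * nrm σ t₀ T Z := by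
  refine (add_le_add (hA.sobSq_duhB_le h ht) (hA.sobSq_duhF_le h ht)).trans (le_of_eq ?_)
  unfold duhamelC
  ring

lemma nrm_le_of_en_le {B : ℝ≥0∞} (h : ∀ t ∈ Icc t₀ T, en σ (Z t) ≤ B) :
    nrm σ t₀ T Z ≤ ENNReal.ofReal (T - t₀) * B := by
  calc _ ≤ ∫⁻ _t in Icc t₀ T, B := setLIntegral_mono' measurableSet_Icc h
    _ = _ := by rw [setLIntegral_const, Real.volume_Icc, mul_comm]

lemma CoefBound.adm_duhamel (hA : CoefBound t₀ T σ ρ K A) (hK : K ≠ ⊤) (hT : t₀ ≤ T)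
    (h : Adm σ t₀ T Z) : Adm σ t₀ T (duhamel A t₀ T Z) where
  real₁ _ ht := isRealDist_duhB (fun _ ht => hA.real_source h ht none) ht
  real₂ _ ht := isRealDist_duhF (fun _ ht => hA.real_flux h ht) ht
  meas₁ := measTime_duhB hT (hA.integrable_source hK h none)
  meas₂ := measTime_duhF hT (hA.integrable_flux hK h)
  fin := (nrm_le_of_en_le fun _ ht => hA.en_duhamel_le h ht).trans_lt (by
    have := h.fin
    have := duhamelC_lt_top (d := d) hK
    finiteness)

end

/-! ## Contractions -/

lemma tsum_geometric_sq_le : ∑' n : ℕ, ((2 : ℝ≥0∞)⁻¹ ^ n) ^ 2 ≤ 2 := by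
  refine le_trans (ENNReal.tsum_le_tsum fun n => ?_) ENNReal.tsum_geometric_two.le
  rw [sq]
  have h : (2 : ℝ≥0∞)⁻¹ ≤ 1 := by norm_num
  exact mul_le_of_le_one_left bot_le (pow_le_one₀ bot_le h)

/-- Cauchy–Schwarz with the weights `2^{-n}`. With squared norms the triangle inequality for series
loses `4^n`, which a decay with ratio `1 / 16` absorbs. -/
lemma enorm_tsum_sq_le (a : ℕ → ℂ) : ‖∑' n, a n‖ₑ ^ 2 ≤ 2 * ∑' n, 4 ^ n * ‖a n‖ₑ ^ 2 := by
  have h2 : ∀ n : ℕ, (2 : ℝ≥0∞)⁻¹ ^ n * (2 ^ n * ‖a n‖ₑ) = ‖a n‖ₑ := fun n => by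
    rw [← mul_assoc, ← mul_pow, ENNReal.inv_mul_cancel two_ne_zero (by norm_num), one_pow, one_mul]
  calc ‖∑' n, a n‖ₑ ^ 2 ≤ (∑' n : ℕ, (2 : ℝ≥0∞)⁻¹ ^ n * (2 ^ n * ‖a n‖ₑ)) ^ 2 := by
        simp only [h2]
        exact ENNReal.pow_le_pow_left enorm_tsum_le_tsum_enorm
    _ ≤ _ := tsum_mul_sq_le _ _
    _ ≤ 2 * ∑' n : ℕ, (2 ^ n * ‖a n‖ₑ) ^ 2 := by gcongr; exact tsum_geometric_sq_le
    _ = _ := by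
        congr 1
        refine tsum_congr fun n => ?_
        rw [mul_pow, ← pow_mul, mul_comm n 2, pow_mul]
        norm_num

lemma sobSq_tsum_le (σ : ℝ) (c : ℕ → Coeffs d) :
    sobSq σ (fun k => ∑' n, c n k) ≤ 2 * ∑' n, 4 ^ n * sobSq σ (c n) := by
  calc _ ≤ ∑' k, wt σ k * (2 * ∑' n, 4 ^ n * ‖c n k‖ₑ ^ 2) := by
        rw [sobSq_eq]
        gcongr with k
        exact enorm_tsum_sq_le _
    _ = 2 * ∑' k, ∑' n, 4 ^ n * (wt σ k * ‖c n k‖ₑ ^ 2) := by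
        rw [← ENNReal.tsum_mul_left]
        refine tsum_congr fun k => ?_
        rw [mul_left_comm, ← ENNReal.tsum_mul_left]
        congr 1
        exact tsum_congr fun n => mul_left_comm _ _ _
    _ = _ := by
        rw [ENNReal.tsum_comm]
        congr 1
        refine tsum_congr fun n => ?_
        rw [ENNReal.tsum_mul_left, sobSq_eq]

/-- A divergent sum would be zero by convention, so convergence has to be known before the
coefficients in `sumState` mean anything. -/
lemma summable_coeff {σ : ℝ} {c : ℕ → Coeffs d} (h : ∑' n, 4 ^ n * sobSq σ (c n) < ⊤)
    (k : Freq d) : Summable fun n => c n k := by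
  refine summable_of_tsum_enorm_lt_top ?_
  have h1 : ∑' n : ℕ, (2 ^ n * ‖c n k‖ₑ) ^ 2 < ⊤ := by
    have h2 : wt σ k * ∑' n : ℕ, (2 ^ n * ‖c n k‖ₑ) ^ 2 < ⊤ := by
      refine lt_of_le_of_lt ?_ h
      rw [← ENNReal.tsum_mul_left]
      refine ENNReal.tsum_le_tsum fun n => ?_
      rw [mul_pow, ← pow_mul, mul_comm n 2, pow_mul, mul_left_comm, sobSq_eq,
        show (2 : ℝ≥0∞) ^ 2 = 4 by norm_num]
      gcongr
      exact ENNReal.le_tsum (f := fun k => wt σ k * ‖c n k‖ₑ ^ 2) k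
    exact (ENNReal.mul_lt_top_iff.1 h2).elim (fun h => h.2)
      (fun h => h.elim (fun h => absurd h (wt_ne_zero _ _)) fun h => by rw [h]; exact ENNReal.zero_lt_top)
  have h3 := tsum_mul_sq_le (fun n : ℕ => (2 : ℝ≥0∞)⁻¹ ^ n) fun n => 2 ^ n * ‖c n k‖ₑ
  have h4 : ∀ n : ℕ, (2 : ℝ≥0∞)⁻¹ ^ n * (2 ^ n * ‖c n k‖ₑ) = ‖c n k‖ₑ := fun n => by
    rw [← mul_assoc, ← mul_pow, ENNReal.inv_mul_cancel two_ne_zero (by norm_num), one_pow, one_mul]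
  simp only [h4] at h3
  have h6 : (∑' n, ‖c n k‖ₑ) ^ 2 < ⊤ :=
    h3.trans_lt (ENNReal.mul_lt_top (tsum_geometric_sq_le.trans_lt (by norm_num)) h1)
  exact (ENNReal.pow_lt_top_iff.1 h6).resolve_right (by norm_num)

/-- Additive operators on time-dependent pairs which contract for short times. -/
structure IsContraction (σ t₀ T : ℝ) (K : ℝ≥0∞) (L : (ℝ → State d) → ℝ → State d) : Prop where
  adm : ∀ Z, Adm σ t₀ T Z → Adm σ t₀ T (L Z)
  en_le : ∀ Z, Adm σ t₀ T Z → ∀ t ∈ Icc t₀ T, en σ (L Z t) ≤ K * nrm σ t₀ T Z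
  add : ∀ Z Y, Adm σ t₀ T Z → Adm σ t₀ T Y → ∀ t ∈ Icc t₀ T, L (Z + Y) t = L Z t + L Y t
  lt_top : K < ⊤
  small : ENNReal.ofReal (T - t₀) * K ≤ 16⁻¹

section

variable {σ t₀ T : ℝ} {K : ℝ≥0∞} {L : (ℝ → State d) → ℝ → State d}

/-- The sum of a series of pairs. -/
def sumState (e : ℕ → ℝ → State d) (t : ℝ) : State d :=
  (fun k => ∑' n, (e n t).1 k, fun k => ∑' n, (e n t).2 k)

lemma en_sumState_le (σ : ℝ) (e : ℕ → ℝ → State d) (t : ℝ) :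
    en σ (sumState e t) ≤ 2 * ∑' n, 4 ^ n * en σ (e n t) := by
  refine (add_le_add (sobSq_tsum_le _ fun n => (e n t).1)
    (sobSq_tsum_le _ fun n => (e n t).2)).trans (le_of_eq ?_)
  rw [← mul_add, ← ENNReal.tsum_add]
  simp only [en, mul_add]

/-- Since `4 / 16 ≤ 1 / 2`, a geometric series remains after the loss of `4^n`; `N` is the start of
a tail. -/
lemma tsum_geometric_bound {D : ℝ≥0∞} (N : ℕ) (e : ℕ → ℝ≥0∞)
    (h : ∀ n, e n ≤ 16⁻¹ ^ n * D) : ∑' n, 4 ^ n * e (n + N) ≤ 2 * (16⁻¹ ^ N * D) := by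
  have h16 : ∀ n : ℕ, (4 : ℝ≥0∞) ^ n * 16⁻¹ ^ n ≤ 2⁻¹ ^ n := fun n => by
    rw [← mul_pow]
    refine pow_le_pow_left₀ bot_le ?_ n
    rw [show (16 : ℝ≥0∞) = 4 * 4 by norm_num, ENNReal.mul_inv (by norm_num) (by norm_num),
      ← mul_assoc, ENNReal.mul_inv_cancel (by norm_num) (by norm_num), one_mul]
    exact ENNReal.inv_le_inv.2 (by norm_num)
  calc _ ≤ ∑' n : ℕ, 2⁻¹ ^ n * (16⁻¹ ^ N * D) := by
        refine ENNReal.tsum_le_tsum fun n => ?_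
        calc 4 ^ n * e (n + N) ≤ 4 ^ n * (16⁻¹ ^ (n + N) * D) := by gcongr; exact h _
          _ = 4 ^ n * 16⁻¹ ^ n * (16⁻¹ ^ N * D) := by rw [pow_add]; ring
          _ ≤ _ := by gcongr; exact h16 n
    _ = _ := by rw [ENNReal.tsum_mul_right, ENNReal.tsum_geometric_two]

lemma adm_sumState {e : ℕ → ℝ → State d} {D : ℝ≥0∞} (hD : D < ⊤)
    (he : ∀ n, Adm σ t₀ T (e n)) (h : ∀ n, ∀ t ∈ Icc t₀ T, en σ (e n t) ≤ 16⁻¹ ^ n * D) :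
    Adm σ t₀ T (sumState e) := by
  have hs : ∀ t ∈ Icc t₀ T, ∑' n, 4 ^ n * en σ (e n t) < ⊤ := fun t ht => by
    refine (tsum_geometric_bound 0 (fun n => en σ (e n t)) fun n => h n t ht).trans_lt ?_
    finiteness
  have hs1 : ∀ t ∈ Icc t₀ T, ∀ k, Summable fun n => (e n t).1 k := fun t ht k =>
    summable_coeff (σ := σ + 1) (c := fun n => (e n t).1)
      ((ENNReal.tsum_le_tsum fun n => by gcongr; exact le_self_add).trans_lt (hs t ht)) k
  have hs2 : ∀ t ∈ Icc t₀ T, ∀ k, Summable fun n => (e n t).2 k := fun t ht k =>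
    summable_coeff (σ := σ) (c := fun n => (e n t).2)
      ((ENNReal.tsum_le_tsum fun n => by gcongr; exact le_add_self).trans_lt (hs t ht)) k
  refine ⟨fun t ht k => ?_, fun t ht k => ?_, fun k => ?_, fun k => ?_, ?_⟩
  · simp only [sumState, Complex.conj_tsum]
    exact tsum_congr fun n => (he n).real₁ t ht k
  · simp only [sumState, Complex.conj_tsum]
    exact tsum_congr fun n => (he n).real₂ t ht k
  · refine aestronglyMeasurable_of_tendsto_ae Filter.atTop
      (f := fun (s : Finset ℕ) t => ∑ n ∈ s, (e n t).1 k)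
      (fun s => Finset.aestronglyMeasurable_fun_sum s fun n _ => (he n).meas₁ k) ?_
    filter_upwards [ae_restrict_mem measurableSet_Icc] with t ht using (hs1 t ht k).hasSum
  · refine aestronglyMeasurable_of_tendsto_ae Filter.atTop
      (f := fun (s : Finset ℕ) t => ∑ n ∈ s, (e n t).2 k)
      (fun s => Finset.aestronglyMeasurable_fun_sum s fun n _ => (he n).meas₂ k) ?_
    filter_upwards [ae_restrict_mem measurableSet_Icc] with t ht using (hs2 t ht k).hasSum
  · refine (nrm_le_of_en_le (B := 2 * (2 * (16⁻¹ ^ 0 * D))) fun t ht => ?_).trans_lt (by finiteness)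
    refine (en_sumState_le σ e t).trans ?_
    gcongr
    exact tsum_geometric_bound 0 (fun n => en σ (e n t)) fun n => h n t ht

/-- The remainders of a series. -/
def remainder (e : ℕ → ℝ → State d) (N : ℕ) : ℝ → State d :=
  sumState e - ∑ n ∈ Finset.range N, e n

lemma remainder_succ (e : ℕ → ℝ → State d) (N : ℕ) :
    remainder e N = e N + remainder e (N + 1) := by
  rw [remainder, remainder, Finset.sum_range_succ]
  abel

lemma en_remainder_le {e : ℕ → ℝ → State d} {D : ℝ≥0∞} (hD : D < ⊤) {t : ℝ}
    (h : ∀ n, en σ (e n t) ≤ 16⁻¹ ^ n * D) (N : ℕ) :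
    en σ (remainder e N t) ≤ 16⁻¹ ^ N * (4 * D) := by
  have hs : ∑' n, 4 ^ n * en σ (e n t) < ⊤ := by
    refine (tsum_geometric_bound 0 (fun n => en σ (e n t)) h).trans_lt ?_
    finiteness
  have hs1 : ∀ k, Summable fun n => (e n t).1 k := fun k =>
    summable_coeff (σ := σ + 1) (c := fun n => (e n t).1)
      ((ENNReal.tsum_le_tsum fun n => by gcongr; exact le_self_add).trans_lt hs) k
  have hs2 : ∀ k, Summable fun n => (e n t).2 k := fun k =>
    summable_coeff (σ := σ) (c := fun n => (e n t).2)
      ((ENNReal.tsum_le_tsum fun n => by gcongr; exact le_add_self).trans_lt hs) k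
  have hr : remainder e N t = sumState (fun n => e (n + N)) t := by
    refine Prod.ext (funext fun k => ?_) (funext fun k => ?_)
    · simp only [remainder, sumState, Pi.sub_apply, Finset.sum_apply, Prod.fst_sub, Prod.fst_sum]
      rw [← (hs1 k).sum_add_tsum_nat_add N, add_sub_cancel_left]
    · simp only [remainder, sumState, Pi.sub_apply, Finset.sum_apply, Prod.snd_sub, Prod.snd_sum]
      rw [← (hs2 k).sum_add_tsum_nat_add N, add_sub_cancel_left]
  rw [hr]
  refine (en_sumState_le σ _ t).trans ?_
  calc _ ≤ 2 * (2 * (16⁻¹ ^ N * D)) := by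
        gcongr
        exact tsum_geometric_bound N (fun n => en σ (e n t)) h
    _ = _ := by ring

lemma adm_zero (σ t₀ T : ℝ) : Adm σ t₀ T (0 : ℝ → State d) where
  real₁ _ _ k := by simp
  real₂ _ _ k := by simp
  meas₁ k := aestronglyMeasurable_const
  meas₂ k := aestronglyMeasurable_const
  fin := by simp [nrm, en, sobSq_zero]

lemma Adm.sum {e : ℕ → ℝ → State d} (he : ∀ n, Adm σ t₀ T (e n)) (s : Finset ℕ) :
    Adm σ t₀ T (∑ n ∈ s, e n) := by
  induction s using Finset.induction with
  | empty => exact adm_zero σ t₀ T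
  | insert a s ha ih => rw [Finset.sum_insert ha]; exact (he a).add ih

lemma Adm.remainder {e : ℕ → ℝ → State d} (he : ∀ n, Adm σ t₀ T (e n))
    (hs : Adm σ t₀ T (sumState e)) (N : ℕ) : Adm σ t₀ T (remainder e N) := hs.sub (Adm.sum he _)

/-- Fixed points of contractions. -/
theorem IsContraction.exists_fixed (hL : IsContraction σ t₀ T K L) {x : ℝ → State d}
    (hx : Adm σ t₀ T x) : ∃ y, Adm σ t₀ T y ∧
      (∀ t ∈ Icc t₀ T, en σ (y t) ≤ 4 * (K * nrm σ t₀ T x)) ∧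
      ∀ t ∈ Icc t₀ T, y t = L (x + y) t := by
  set D := K * nrm σ t₀ T x with hD
  have hDt : D < ⊤ := ENNReal.mul_lt_top hL.lt_top hx.fin
  -- The Neumann series without its zeroth term `x`. Already `L x` is bounded in `en` at every time,
  -- while `x` need only be square integrable.
  set e : ℕ → ℝ → State d := fun n => L^[n + 1] x with he
  have he0 : e 0 = L x := rfl
  have hes : ∀ n, e (n + 1) = L (e n) := fun n => Function.iterate_succ_apply' L (n + 1) x
  have hadm : ∀ n, Adm σ t₀ T (e n) := by
    intro n
    induction n with
    | zero => exact hL.adm x hx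
    | succ n ih => rw [hes]; exact hL.adm _ ih
  have hnL : ∀ Z B, Adm σ t₀ T Z → (∀ t ∈ Icc t₀ T, en σ (Z t) ≤ B) → ∀ t ∈ Icc t₀ T,
      en σ (L Z t) ≤ 16⁻¹ * B := by
    intro Z B hZ hB t ht
    calc _ ≤ K * nrm σ t₀ T Z := hL.en_le Z hZ t ht
      _ ≤ K * (ENNReal.ofReal (T - t₀) * B) := by gcongr; exact nrm_le_of_en_le hB
      _ = ENNReal.ofReal (T - t₀) * K * B := by ring
      _ ≤ _ := by gcongr; exact hL.small
  have hen : ∀ n, ∀ t ∈ Icc t₀ T, en σ (e n t) ≤ 16⁻¹ ^ n * D := by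
    intro n
    induction n with
    | zero =>
      intro t ht
      rw [pow_zero, one_mul]
      exact hL.en_le x hx t ht
    | succ n ih =>
      intro t ht
      rw [hes, pow_succ', mul_assoc]
      exact hnL _ _ (hadm n) ih t ht
  have hS := adm_sumState hDt hadm hen
  have hr : ∀ N, Adm σ t₀ T (remainder e N) := fun N => Adm.remainder hadm hS N
  have hrb : ∀ N, ∀ t ∈ Icc t₀ T, en σ (remainder e N t) ≤ 16⁻¹ ^ N * (4 * D) := fun N t ht =>
    en_remainder_le hDt (fun n => hen n t ht) N
  have hr0 : remainder e 0 = sumState e := by simp [remainder]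
  refine ⟨sumState e, hS, fun t ht => ?_, fun t ht => ?_⟩
  · have := hrb 0 t ht
    rwa [hr0, pow_zero, one_mul] at this
  -- `L` is additive for finite sums only and cannot be applied to the series term by term. The
  -- defect of the fixed point equation is therefore expressed through the remainder after `N`
  -- terms, for every `N`, and tends to zero.
  · have hrec : ∀ N, sumState e t - L (x + sumState e) t =
        remainder e (N + 1) t - L (remainder e N) t := by
      intro N
      induction N with
      | zero =>
        rw [hL.add _ _ hx hS t ht, hr0]
        have := congrFun (remainder_succ e 0) t
        rw [hr0, Pi.add_apply, he0] at this
        rw [← hr0, hr0]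
        conv_lhs => rw [this]
        abel
      | succ N ih =>
        rw [ih]
        have h1 : L (remainder e N) t = e (N + 1) t + L (remainder e (N + 1)) t := by
          rw [remainder_succ e N, hL.add _ _ (hadm N) (hr (N + 1)) t ht, hes]
        have h2 := congrFun (remainder_succ e (N + 1)) t
        rw [Pi.add_apply] at h2
        rw [h1, h2]
        abel
    have hb : ∀ N : ℕ, en σ (sumState e t - L (x + sumState e) t) ≤ 16⁻¹ ^ N * (16 * D) := by
      intro N
      rw [hrec N, sub_eq_add_neg]
      refine (en_add_le σ _ _).trans ?_
      rw [en_neg]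
      have h16 : (16 : ℝ≥0∞)⁻¹ ≤ 1 := ENNReal.inv_le_one.2 (by norm_num)
      calc _ ≤ 2 * (16⁻¹ ^ (N + 1) * (4 * D)) + 2 * (16⁻¹ * (16⁻¹ ^ N * (4 * D))) := by
            gcongr
            · exact hrb (N + 1) t ht
            · exact hnL _ _ (hr N) (hrb N) t ht
        _ = 16⁻¹ * (16⁻¹ ^ N * (16 * D)) := by rw [pow_succ']; ring
        _ ≤ _ := mul_le_of_le_one_left bot_le h16
    have hlim : Filter.Tendsto (fun N : ℕ => (16 : ℝ≥0∞)⁻¹ ^ N * (16 * D)) Filter.atTop (nhds 0) := by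
      have h1 := ENNReal.tendsto_pow_atTop_nhds_zero_of_lt_one (r := (16 : ℝ≥0∞)⁻¹)
        (ENNReal.inv_lt_one.2 (by norm_num))
      have := ENNReal.Tendsto.mul_const (b := 16 * D) h1 (Or.inr (by finiteness))
      simpa using this
    have h0 : en σ (sumState e t - L (x + sumState e) t) = 0 :=
      le_antisymm (ge_of_tendsto' hlim hb) bot_le
    exact sub_eq_zero.1 (eq_zero_of_en_eq_zero h0)

end

/-! ## Mild solutions -/

/-- Additive operators from `H^σ` to `H^{σ+1}`. -/
structure TerminalOp (σ : ℝ) (κ : ℝ≥0∞) (Θ : Coeffs d → Coeffs d) : Prop where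
  bound : ∀ c, sobSq σ c < ⊤ → sobSq (σ + 1) (Θ c) ≤ κ * sobSq σ c
  add : ∀ a b, sobSq σ a < ⊤ → sobSq σ b < ⊤ → Θ (a + b) = Θ a + Θ b
  real : ∀ c, sobSq σ c < ⊤ → IsRealDist c → IsRealDist (Θ c)

lemma isRealDist_zero : IsRealDist (0 : Coeffs d) := fun k => by simp

lemma terminalOp_zero (σ : ℝ) : TerminalOp σ 0 fun _ : Coeffs d => 0 :=
  ⟨fun c _ => by simp [sobSq_zero], fun _ _ _ _ => by simp, fun _ _ _ => isRealDist_zero⟩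

lemma TerminalOp.map_zero {σ : ℝ} {κ : ℝ≥0∞} {Θ : Coeffs d → Coeffs d} (h : TerminalOp σ κ Θ) :
    Θ 0 = 0 :=
  eq_zero_of_sobSq_eq_zero (σ := σ + 1)
    (le_antisymm ((h.bound 0 (by simp [sobSq_zero])).trans (by simp [sobSq_zero])) bot_le)

lemma TerminalOp.map_sub {σ : ℝ} {κ : ℝ≥0∞} {Θ : Coeffs d → Coeffs d} (h : TerminalOp σ κ Θ)
    {a b : Coeffs d} (ha : sobSq σ a < ⊤) (hb : sobSq σ b < ⊤) : Θ (a - b) = Θ a - Θ b := by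
  have hs : sobSq σ (a - b) < ⊤ := (sobSq_sub_le σ a b).trans_lt (by finiteness)
  have := h.add (a - b) b hs hb
  rw [sub_add_cancel] at this
  rw [this, add_sub_cancel_right]

/-- The pair of the backward and the forward heat flow. -/
def freeState (t₀ T : ℝ) (w μ₀ : Coeffs d) (t : ℝ) : State d :=
  (heatFlow (T - t) w, heatFlow (t - t₀) μ₀)

/-- Mild solutions of the linear system with coefficients `A`, terminal value `w` and initial value
`μ₀`. -/
def IsMild (A : Option (Fin d) → Option (Fin d) → ℝ → Coeffs d) (t₀ T : ℝ) (w μ₀ : Coeffs d)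
    (Z : ℝ → State d) : Prop :=
  ∀ t ∈ Icc t₀ T, Z t = freeState t₀ T w μ₀ t + duhamel A t₀ T Z t

lemma heatFlow_zero_time (c : Coeffs d) : heatFlow 0 c = c := by
  funext k; simp [heatFlow, heatR]

lemma heatFlow_neg (t : ℝ) (c : Coeffs d) : heatFlow t (-c) = -heatFlow t c := by
  funext k; simp [heatFlow]

lemma heatFlow_sub (t : ℝ) (a b : Coeffs d) : heatFlow t (a - b) = heatFlow t a - heatFlow t b := by
  rw [sub_eq_add_neg, heatFlow_add, heatFlow_neg, sub_eq_add_neg]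

lemma lintegral_sobSq_backward_le (σ t₀ T : ℝ) (c : Coeffs d) :
    ∫⁻ t in Icc t₀ T, sobSq (σ + 1) (heatFlow (T - t) c) ≤
      (ENNReal.ofReal (T - t₀) + 1) * sobSq σ c := by
  refine le_trans (le_of_eq ?_) (lintegral_sobSq_heatFlow_le σ t₀ T T c)
  exact setLIntegral_congr_fun measurableSet_Icc fun t ht => by
    rw [abs_of_nonneg (sub_nonneg.2 ht.2)]

lemma lintegral_sobSq_forward_le (σ t₀ T : ℝ) (c : Coeffs d) :
    ∫⁻ t in Icc t₀ T, sobSq (σ + 1) (heatFlow (t - t₀) c) ≤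
      (ENNReal.ofReal (T - t₀) + 1) * sobSq σ c := by
  refine le_trans (le_of_eq ?_) (lintegral_sobSq_heatFlow_le σ t₀ T t₀ c)
  exact setLIntegral_congr_fun measurableSet_Icc fun t ht => by
    rw [abs_sub_comm, abs_of_nonneg (sub_nonneg.2 ht.1)]

lemma measTime_backward (t₀ T : ℝ) (c : Coeffs d) :
    MeasTime t₀ T fun t => heatFlow (T - t) c := by
  have := measTime_heatFlow t₀ T (-1) T c
  simpa only [neg_one_mul, neg_add_eq_sub] using this

lemma measTime_forward (t₀ T : ℝ) (c : Coeffs d) :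
    MeasTime t₀ T fun t => heatFlow (t - t₀) c := by
  have := measTime_heatFlow t₀ T 1 (-t₀) c
  simpa only [one_mul, ← sub_eq_add_neg] using this

/-- The heat flow gains one derivative in `L²` of time, so the data may be one order rougher than
the solution: `w` in `H^σ` and `μ₀` in `H^{σ-1}`. -/
lemma adm_freeState {σ t₀ T : ℝ} {w μ₀ : Coeffs d} (hw : IsRealDist w) (hw' : sobSq σ w < ⊤)
    (hμ : IsRealDist μ₀) (hμ' : sobSq (σ - 1) μ₀ < ⊤) : Adm σ t₀ T (freeState t₀ T w μ₀) where
  real₁ _ _ := hw.heatFlow _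
  real₂ _ _ := hμ.heatFlow _
  meas₁ := measTime_backward t₀ T w
  meas₂ := measTime_forward t₀ T μ₀
  fin := by
    have h1 := lintegral_sobSq_backward_le σ t₀ T w
    have h2 := lintegral_sobSq_forward_le (σ - 1) t₀ T μ₀
    rw [sub_add_cancel] at h2
    have e : nrm σ t₀ T (freeState t₀ T w μ₀) =
        ∫⁻ t in Icc t₀ T, (sobSq (σ + 1) (heatFlow (T - t) w) + sobSq σ (heatFlow (t - t₀) μ₀)) := rfl
    rw [e, lintegral_add_left' (aemeasurable_sobSq (measTime_backward t₀ T w) _)]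
    exact (add_le_add h1 h2).trans_lt (by finiteness)

section

variable {σ ρ t₀ T : ℝ} {K κ : ℝ≥0∞} {A : Option (Fin d) → Option (Fin d) → ℝ → Coeffs d}
  {Z Y : ℝ → State d} {Θ : Coeffs d → Coeffs d} {w w' μ₀ μ₀' : Coeffs d}

/-- The solution operator with terminal condition `v(T) = Θ μ(T)`. -/
def solOp (A : Option (Fin d) → Option (Fin d) → ℝ → Coeffs d) (Θ : Coeffs d → Coeffs d)
    (t₀ T : ℝ) (Z : ℝ → State d) (t : ℝ) : State d :=
  freeState t₀ T (Θ (duhF t₀ (flux A Z) T)) 0 t + duhamel A t₀ T Z t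

lemma CoefBound.sobSq_duhF_le_nrm (hA : CoefBound t₀ T σ ρ K A) (h : Adm σ t₀ T Z) {t : ℝ}
    (ht : t ∈ Icc t₀ T) : sobSq σ (duhF t₀ (flux A Z) t) ≤ duhamelC d K * nrm σ t₀ T Z :=
  le_trans le_add_self (hA.en_duhamel_le h ht)

/-- `Θ` gains one derivative, so `Θ` of the Duhamel part of `μ(T)` is in `H^{σ+1}` and its heat flow
is bounded there at every time, like the Duhamel terms. The constant `2κ + 2` adds the two
contributions in squared norms. -/
lemma CoefBound.isContraction_solOp (hA : CoefBound t₀ T σ ρ K A) (hK : K ≠ ⊤) (hT : t₀ ≤ T)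
    (hΘ : TerminalOp σ κ Θ) (hκ : κ ≠ ⊤)
    (hsmall : ENNReal.ofReal (T - t₀) * ((2 * κ + 2) * duhamelC d K) ≤ 16⁻¹) :
    IsContraction σ t₀ T ((2 * κ + 2) * duhamelC d K) (solOp A Θ t₀ T) := by
  have hTT : T ∈ Icc t₀ T := right_mem_Icc.2 hT
  have hC := duhamelC_lt_top (d := d) hK
  have hF : ∀ Z, Adm σ t₀ T Z → sobSq σ (duhF t₀ (flux A Z) T) < ⊤ := fun Z hZ =>
    (hA.sobSq_duhF_le_nrm hZ hTT).trans_lt (by have := hZ.fin; finiteness)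
  have hw : ∀ Z, Adm σ t₀ T Z → sobSq (σ + 1) (Θ (duhF t₀ (flux A Z) T)) ≤
      κ * (duhamelC d K * nrm σ t₀ T Z) := fun Z hZ =>
    (hΘ.bound _ (hF Z hZ)).trans (by gcongr; exact hA.sobSq_duhF_le_nrm hZ hTT)
  refine ⟨fun Z hZ => ?_, fun Z hZ t ht => ?_, fun Z Y hZ hY t ht => ?_, by finiteness, hsmall⟩
  · refine Adm.add (adm_freeState ?_ ?_ isRealDist_zero (by simp [sobSq_zero]))
      (hA.adm_duhamel hK hT hZ)
    · exact hΘ.real _ (hF Z hZ) (isRealDist_duhF (fun t ht => hA.real_flux hZ ht) hTT)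
    · exact (sobSq_mono (by linarith) _).trans_lt
        ((hw Z hZ).trans_lt (by have := hZ.fin; finiteness))
  · refine (en_add_le _ _ _).trans ?_
    have h1 : en σ (freeState t₀ T (Θ (duhF t₀ (flux A Z) T)) 0 t) ≤
        κ * (duhamelC d K * nrm σ t₀ T Z) := by
      rw [en, freeState, heatFlow_zero, sobSq_zero, add_zero]
      exact (sobSq_heatFlow_le _ (sub_nonneg.2 ht.2) _).trans (hw Z hZ)
    calc _ ≤ 2 * (κ * (duhamelC d K * nrm σ t₀ T Z)) + 2 * (duhamelC d K * nrm σ t₀ T Z) := by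
          gcongr
          exact hA.en_duhamel_le hZ ht
      _ = _ := by ring
  · have hFT := duhF_add hTT (hA.integrable_flux hK hZ) (hA.integrable_flux hK hY)
      (hA.flux_add hZ hY)
    rw [solOp, solOp, solOp, hA.duhamel_add hK hZ hY ht, hFT, hΘ.add _ _ (hF Z hZ) (hF Y hY)]
    simp only [freeState, heatFlow_add, heatFlow_zero]
    refine Prod.ext ?_ ?_
    · simp only [Prod.fst_add]; abel
    · simp only [Prod.snd_add, zero_add]

/-- Existence of mild solutions for short times. -/
theorem CoefBound.exists_mild (hA : CoefBound t₀ T σ ρ K A) (hK : K ≠ ⊤) (hT : t₀ ≤ T)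
    (hΘ : TerminalOp σ κ Θ) (hκ : κ ≠ ⊤)
    (hsmall : ENNReal.ofReal (T - t₀) * ((2 * κ + 2) * duhamelC d K) ≤ 16⁻¹)
    (hw : IsRealDist w) (hw' : sobSq σ w < ⊤) (hμ : IsRealDist μ₀) (hμ' : sobSq (σ - 1) μ₀ < ⊤) :
    ∃ Z, Adm σ t₀ T Z ∧ (∃ C < ⊤, ∀ t ∈ Icc t₀ T, en σ (Z t - freeState t₀ T w μ₀ t) ≤ C) ∧
      sobSq σ (duhF t₀ (flux A Z) T) < ⊤ ∧
      IsMild A t₀ T (w + Θ (duhF t₀ (flux A Z) T)) μ₀ Z := by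
  have hx := adm_freeState (t₀ := t₀) (T := T) hw hw' hμ hμ'
  obtain ⟨y, hy, hyb, hyL⟩ := (hA.isContraction_solOp hK hT hΘ hκ hsmall).exists_fixed hx
  have hC := duhamelC_lt_top (d := d) hK
  -- The fixed point is only the correction `y`. The free part carries the rough data and need not
  -- be bounded in `en σ` at each time.
  refine ⟨freeState t₀ T w μ₀ + y, hx.add hy,
    ⟨4 * ((2 * κ + 2) * duhamelC d K * nrm σ t₀ T (freeState t₀ T w μ₀)), ?_, fun t ht => ?_⟩,
    ?_, fun t ht => ?_⟩
  · have := hx.fin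
    finiteness
  · rw [Pi.add_apply, add_sub_cancel_left]
    exact hyb t ht
  · exact (hA.sobSq_duhF_le_nrm (hx.add hy) (right_mem_Icc.2 hT)).trans_lt
      (by have := (hx.add hy).fin; finiteness)
  · rw [Pi.add_apply]
    conv_lhs => rw [hyL t ht]
    rw [solOp]
    simp only [freeState, heatFlow_add, heatFlow_zero]
    refine Prod.ext ?_ ?_
    · simp only [Prod.fst_add]; abel
    · simp only [Prod.snd_add, zero_add]

lemma CoefBound.duhamel_sub (hA : CoefBound t₀ T σ ρ K A) (hK : K ≠ ⊤) (h : Adm σ t₀ T Z)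
    (h' : Adm σ t₀ T Y) {t : ℝ} (ht : t ∈ Icc t₀ T) :
    duhamel A t₀ T (Z - Y) t = duhamel A t₀ T Z t - duhamel A t₀ T Y t := by
  have := hA.duhamel_add hK (h.sub h') h' ht
  rw [sub_add_cancel] at this
  rw [this, add_sub_cancel_right]

lemma IsMild.add (hA : CoefBound t₀ T σ ρ K A) (hK : K ≠ ⊤) (h : Adm σ t₀ T Z)
    (h' : Adm σ t₀ T Y) (hZ : IsMild A t₀ T w μ₀ Z) (hY : IsMild A t₀ T w' μ₀' Y) :
    IsMild A t₀ T (w + w') (μ₀ + μ₀') (Z + Y) := fun t ht => by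
  rw [Pi.add_apply, hZ t ht, hY t ht, hA.duhamel_add hK h h' ht]
  simp only [freeState, heatFlow_add]
  refine Prod.ext ?_ ?_
  · simp only [Prod.fst_add]; abel
  · simp only [Prod.snd_add]; abel

lemma IsMild.sub (hA : CoefBound t₀ T σ ρ K A) (hK : K ≠ ⊤) (h : Adm σ t₀ T Z)
    (h' : Adm σ t₀ T Y) (hZ : IsMild A t₀ T w μ₀ Z) (hY : IsMild A t₀ T w' μ₀' Y) :
    IsMild A t₀ T (w - w') (μ₀ - μ₀') (Z - Y) := fun t ht => by
  rw [Pi.sub_apply, hZ t ht, hY t ht, hA.duhamel_sub hK h h' ht]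
  simp only [freeState, heatFlow_sub]
  refine Prod.ext ?_ ?_
  · simp only [Prod.fst_sub, Prod.fst_add]; abel
  · simp only [Prod.snd_sub, Prod.snd_add]; abel

/-- Uniqueness of mild solutions for short times. -/
theorem IsMild.eq_freeState (hA : CoefBound t₀ T σ ρ K A) (hT : t₀ ≤ T)
    (h : Adm σ t₀ T Z) (hZ : IsMild A t₀ T w 0 Z) {ε : ℝ≥0∞}
    (hw : ∫⁻ t in Icc t₀ T, sobSq (σ + 1) (heatFlow (T - t) w) ≤ ε * sobSq σ (Z T).2)
    (hsmall : (2 * ε + 2 * ENNReal.ofReal (T - t₀)) * duhamelC d K ≤ 2⁻¹) :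
    ∀ t ∈ Icc t₀ T, Z t = freeState t₀ T w 0 t := by
  have hTT : T ∈ Icc t₀ T := right_mem_Icc.2 hT
  have hZT : (Z T).2 = duhF t₀ (flux A Z) T := by
    rw [hZ T hTT, freeState, heatFlow_zero, Prod.snd_add, zero_add, duhamel]
  -- The norm of `Z` is bounded by at most half of itself and is finite, so it vanishes; then the
  -- Duhamel part vanishes at every time.
  have h1 : nrm σ t₀ T Z ≤ 2 * (ε * (duhamelC d K * nrm σ t₀ T Z)) +
      2 * (ENNReal.ofReal (T - t₀) * (duhamelC d K * nrm σ t₀ T Z)) := by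
    calc nrm σ t₀ T Z ≤ ∫⁻ t in Icc t₀ T, (2 * sobSq (σ + 1) (heatFlow (T - t) w)
          + 2 * (duhamelC d K * nrm σ t₀ T Z)) := by
          refine setLIntegral_mono' measurableSet_Icc fun t ht => ?_
          rw [hZ t ht]
          refine (en_add_le _ _ _).trans ?_
          gcongr
          · rw [en, freeState, heatFlow_zero, sobSq_zero, add_zero]
          · exact hA.en_duhamel_le h ht
      _ = 2 * (∫⁻ t in Icc t₀ T, sobSq (σ + 1) (heatFlow (T - t) w)) +
          2 * (ENNReal.ofReal (T - t₀) * (duhamelC d K * nrm σ t₀ T Z)) := by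
          rw [lintegral_add_right _ measurable_const, lintegral_const_mul' _ _ (by norm_num),
            setLIntegral_const, Real.volume_Icc]
          ring
      _ ≤ _ := by
          gcongr
          refine hw.trans ?_
          gcongr
          rw [hZT]
          exact hA.sobSq_duhF_le_nrm h hTT
  have h2 : nrm σ t₀ T Z ≤ 2⁻¹ * nrm σ t₀ T Z := by
    refine h1.trans ?_
    calc _ = (2 * ε + 2 * ENNReal.ofReal (T - t₀)) * duhamelC d K * nrm σ t₀ T Z := by ring
      _ ≤ _ := by gcongr
  have h3 : nrm σ t₀ T Z = 0 := by
    by_contra hne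
    have h4 : 2⁻¹ * nrm σ t₀ T Z < nrm σ t₀ T Z := by
      rw [mul_comm, ← div_eq_mul_inv]
      exact ENNReal.half_lt_self hne h.fin.ne
    exact absurd h2 h4.not_ge
  intro t ht
  have h5 : duhamel A t₀ T Z t = 0 := eq_zero_of_en_eq_zero (σ := σ)
    (le_antisymm ((hA.en_duhamel_le h ht).trans (by rw [h3, mul_zero])) bot_le)
  rw [hZ t ht, h5, add_zero]

/-- Uniqueness for a given terminal value. -/
lemma IsMild.eq (hA : CoefBound t₀ T σ ρ K A) (hK : K ≠ ⊤) (hT : t₀ ≤ T)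
    (hsmall : ENNReal.ofReal (T - t₀) * (2 * duhamelC d K) ≤ 16⁻¹)
    (h : Adm σ t₀ T Z) (h' : Adm σ t₀ T Y) (hZ : IsMild A t₀ T w μ₀ Z)
    (hY : IsMild A t₀ T w μ₀ Y) : ∀ t ∈ Icc t₀ T, Z t = Y t := by
  have h1 := IsMild.sub hA hK h h' hZ hY
  rw [sub_self, sub_self] at h1
  intro t ht
  have h2 := IsMild.eq_freeState hA hT (h.sub h') h1 (ε := 0)
    (by simp [heatFlow_zero, sobSq_zero]) (by
      refine le_trans (le_of_eq (by ring)) (hsmall.trans ?_)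
      exact ENNReal.inv_le_inv.2 (by norm_num)) t ht
  rw [freeState, heatFlow_zero, heatFlow_zero, Pi.sub_apply] at h2
  exact sub_eq_zero.1 h2

/-! ### Restarting and smoothing -/

lemma heatFlow_duhF {S : ℝ → Coeffs d} {τ t : ℝ} (hS : ∀ k, IntegrableOn (fun r => S r k) (Icc t₀ T))
    (hτ : τ ∈ Icc t₀ T) (ht : t ∈ Icc τ T) :
    duhF t₀ S t = heatFlow (t - τ) (duhF t₀ S τ) + duhF τ S t := by
  funext k
  have ht' : t ∈ Icc t₀ T := ⟨hτ.1.trans ht.1, ht.2⟩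
  have h0 : t₀ ∈ Icc t₀ T := ⟨le_rfl, hτ.1.trans hτ.2⟩
  rw [Pi.add_apply, heatFlow, duhF, duhF, duhF, ← intervalIntegral.integral_const_mul,
    ← intervalIntegral.integral_add_adjacent_intervals (intervalIntegrable_heatR_mul t (hS k) h0 hτ).1
      (intervalIntegrable_heatR_mul t (hS k) hτ ht').1]
  congr 1
  refine intervalIntegral.integral_congr fun r _ => ?_
  simp only [heatR]
  rw [← mul_assoc, ← Complex.ofReal_mul, ← Real.exp_add]
  congr 3
  ring

lemma heatFlow_heatFlow (a b : ℝ) (c : Coeffs d) : heatFlow a (heatFlow b c) = heatFlow (a + b) c := by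
  funext k
  simp only [heatFlow, heatR]
  rw [← mul_assoc, ← Complex.ofReal_mul, ← Real.exp_add]
  congr 3
  ring

/-- Mild solutions can be restarted. -/
lemma IsMild.restart (hA : CoefBound t₀ T σ ρ K A) (hK : K ≠ ⊤) (h : Adm σ t₀ T Z)
    (hZ : IsMild A t₀ T w μ₀ Z) {τ : ℝ} (hτ : τ ∈ Icc t₀ T) : IsMild A τ T w (Z τ).2 Z := by
  intro t ht
  have ht' : t ∈ Icc t₀ T := ⟨hτ.1.trans ht.1, ht.2⟩
  rw [hZ t ht']
  refine Prod.ext (by simp only [freeState, duhamel, Prod.fst_add]) ?_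
  have h1 := hZ τ hτ
  simp only [freeState, duhamel, Prod.mk_add_mk] at h1 ⊢
  rw [h1, heatFlow_duhF (hA.integrable_flux hK h) hτ ht]
  simp only [heatFlow_add, heatFlow_heatFlow]
  rw [show t - τ + (τ - t₀) = t - t₀ by ring]
  abel

lemma Adm.restrict (h : Adm σ t₀ T Z) {τ : ℝ} (hτ : t₀ ≤ τ) : Adm σ τ T Z := by
  have hs : Icc τ T ⊆ Icc t₀ T := Icc_subset_Icc_left hτ
  exact ⟨fun t ht => h.real₁ t (hs ht), fun t ht => h.real₂ t (hs ht),
    fun k => (h.meas₁ k).mono_measure (Measure.restrict_mono hs le_rfl),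
    fun k => (h.meas₂ k).mono_measure (Measure.restrict_mono hs le_rfl),
    (lintegral_mono_set hs).trans_lt h.fin⟩

/-- Extension of the distribution by zero to the larger interval leaves both integrals unchanged. -/
lemma SmoothingBound.restrict {f : ℝ → Coeffs d} (h : SmoothingBound t₀ T σ K f) {τ : ℝ}
    (hτ : t₀ ≤ τ) : SmoothingBound τ T σ K f := by
  classical
  intro c hc hfin t
  have hs : Icc τ T ⊆ Icc t₀ T := Icc_subset_Icc_left hτ
  set e : ℝ → Coeffs d := fun r => if r ∈ Icc τ T then c r else 0 with he
  have he1 : ∀ F : ℝ → Coeffs d → ℝ≥0∞, (∀ r, F r 0 = 0) →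
      ∫⁻ r in Icc t₀ T, F r (e r) = ∫⁻ r in Icc τ T, F r (c r) := by
    intro F hF
    have : ∀ r, F r (e r) = (Icc τ T).indicator (fun r => F r (c r)) r := by
      intro r
      by_cases hr : r ∈ Icc τ T
      · simp only [he, if_pos hr, indicator_of_mem hr]
      · simp only [he, if_neg hr, hF, indicator_of_notMem hr]
    simp only [this]
    rw [setLIntegral_indicator measurableSet_Icc, inter_eq_self_of_subset_left hs]
  have hem : MeasTime t₀ T e := by
    intro k
    have : (fun r => e r k) = (Icc τ T).indicator fun r => c r k := by
      funext r
      by_cases hr : r ∈ Icc τ T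
      · simp only [he, if_pos hr, indicator_of_mem hr]
      · simp only [he, if_neg hr, indicator_of_notMem hr, Pi.zero_apply]
    rw [this, aestronglyMeasurable_indicator_iff measurableSet_Icc,
      Measure.restrict_restrict measurableSet_Icc, inter_eq_self_of_subset_left hs]
    exact hc k
  have hs0 := he1 (fun _ c => sobSq σ c) fun _ => sobSq_zero σ
  have := h e hem (by rw [hs0]; exact hfin) t
  rw [hs0] at this
  refine le_trans (le_of_eq ?_) this
  refine tsum_congr fun k => ?_
  rw [he1 (fun r c => heat k t r * ‖conv (f r) c k‖ₑ) fun r => by simp [conv]]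

lemma CoefBound.restrict (hA : CoefBound t₀ T σ ρ K A) {τ : ℝ} (hτ : t₀ ≤ τ) :
    CoefBound τ T σ ρ K A := by
  have hs : Icc τ T ⊆ Icc t₀ T := Icc_subset_Icc_left hτ
  exact ⟨hA.nonneg, hA.neg_le, hA.real,
    fun o b k => (hA.meas o b k).mono_measure (Measure.restrict_mono hs le_rfl),
    fun o b => ae_restrict_of_ae_restrict_of_subset hs (hA.fin o b),
    fun o b => (hA.smoothing o b).restrict hτ⟩

/-- Square integrability makes the norm finite at almost every time, hence at some time before `T`
from which to restart. -/
lemma Adm.exists_en_lt_top (h : Adm σ t₀ T Z) (hT : t₀ < T) : ∃ τ ∈ Ico t₀ T, en σ (Z τ) < ⊤ := by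
  by_contra hne
  push Not at hne
  have h1 : ∀ᵐ t ∂(volume.restrict (Ico t₀ T)), False := by
    filter_upwards [ae_restrict_of_ae_restrict_of_subset Ico_subset_Icc_self h.ae_en_lt_top,
      ae_restrict_mem measurableSet_Ico] with t h2 h3
    exact absurd (hne t h3) (not_le.2 h2)
  have h2 : volume (Ico t₀ T) = 0 := by
    have h3 := ae_iff.1 h1
    simpa only [not_false_eq_true, ofPred_true, Measure.restrict_apply_univ] using h3
  rw [Real.volume_Ico, ENNReal.ofReal_eq_zero] at h2
  linarith

/-- Smoothing: mild solutions are as regular at the final time as the coefficients permit. -/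
theorem IsMild.sobSq_terminal_lt_top {σ₀ σ₁ : ℝ} (hK : K ≠ ⊤)
    (hA : ∀ σ ∈ Icc σ₀ σ₁, ∃ ρ, CoefBound t₀ T σ ρ K A)
    (hsmall : ENNReal.ofReal (T - t₀) * (2 * duhamelC d K) ≤ 16⁻¹) (n : ℕ) :
    ∀ σ ∈ Icc σ₀ σ₁, σ₁ - σ ≤ n → ∀ t₁ ∈ Ico t₀ T, ∀ Z μ₀, Adm σ t₁ T Z →
      IsMild A t₁ T 0 μ₀ Z → sobSq σ₁ (Z T).2 < ⊤ := by
  have hC := duhamelC_lt_top (d := d) hK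
  have hsmall' : ∀ t₁ ∈ Ico t₀ T, ENNReal.ofReal (T - t₁) * (2 * duhamelC d K) ≤ 16⁻¹ :=
    fun t₁ ht₁ => le_trans (by gcongr; exact ht₁.1) hsmall
  induction n with
  | zero =>
    intro σ hσ hn t₁ ht₁ Z μ₀ hZ hm
    have hσ1 : σ = σ₁ := le_antisymm hσ.2 (by simpa using hn)
    subst hσ1
    obtain ⟨ρ, hAσ⟩ := hA σ hσ
    have hA1 := hAσ.restrict ht₁.1
    -- Even at the top order a restart is needed, because the initial value at `t₁` need not belong
    -- to `H^{σ₁}`.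
    obtain ⟨τ, hτ, hfin⟩ := hZ.exists_en_lt_top ht₁.2
    have hTT : T ∈ Icc τ T := right_mem_Icc.2 hτ.2.le
    have h1 := hm.restart hA1 hK hZ ⟨hτ.1, hτ.2.le⟩ T hTT
    rw [h1, freeState, duhamel, Prod.snd_add]
    refine (sobSq_add_le _ _ _).trans_lt ?_
    have h2 := sobSq_heatFlow_le σ (sub_nonneg.2 hτ.2.le) (Z τ).2
    have h3 : sobSq σ (Z τ).2 < ⊤ := lt_of_le_of_lt le_add_self hfin
    have h4 := (hA1.restrict hτ.1).sobSq_duhF_le_nrm (hZ.restrict hτ.1) hTT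
    have h5 := (hZ.restrict hτ.1).fin
    have h6 := h2.trans_lt h3
    have h7 := h4.trans_lt (by finiteness)
    simp only
    finiteness
  -- At some time `μ` is in `H^σ`, which is admissible initial data for a solution of order `σ + 1`
  -- (cut off at `σ₁`), the terminal value being zero. The more regular solution started there
  -- agrees with `Z` by uniqueness at order `σ`.
  | succ n ih =>
    intro σ hσ hn t₁ ht₁ Z μ₀ hZ hm
    obtain ⟨ρ, hAσ⟩ := hA σ hσ
    have hA1 := hAσ.restrict ht₁.1
    obtain ⟨τ, hτ, hfin⟩ := hZ.exists_en_lt_top ht₁.2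
    have hτ0 : τ ∈ Ico t₀ T := ⟨ht₁.1.trans hτ.1, hτ.2⟩
    have h1 := hm.restart hA1 hK hZ ⟨hτ.1, hτ.2.le⟩
    have h3 : sobSq σ (Z τ).2 < ⊤ := lt_of_le_of_lt le_add_self hfin
    set σ' := min (σ + 1) σ₁ with hσ'
    have hσ'1 : σ ≤ σ' := le_min (by linarith) hσ.2
    have hσ'm : σ' ∈ Icc σ₀ σ₁ := ⟨hσ.1.trans hσ'1, min_le_right _ _⟩
    obtain ⟨ρ', hAσ'⟩ := hA σ' hσ'm
    have hA' := hAσ'.restrict hτ0.1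
    obtain ⟨Z', hZ', -, -, hm'⟩ := hA'.exists_mild hK hτ.2.le (terminalOp_zero σ') (by norm_num)
      (by simpa using hsmall' τ hτ0) isRealDist_zero (by simp [sobSq_zero])
      (hZ.real₂ τ ⟨hτ.1, hτ.2.le⟩)
      ((sobSq_mono (by linarith [min_le_left (σ + 1) σ₁]) _).trans_lt h3)
    rw [zero_add] at hm'
    have he := IsMild.eq (hAσ.restrict hτ0.1) hK hτ.2.le (hsmall' τ hτ0) (hZ.restrict hτ.1)
      (hZ'.mono hσ'1) h1 hm' T (right_mem_Icc.2 hτ.2.le)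
    rw [he]
    refine ih σ' hσ'm ?_ τ hτ0 Z' _ hZ' hm'
    push_cast at hn
    rcases min_choice (σ + 1) σ₁ with h | h
    · rw [hσ', h]; linarith
    · rw [hσ', h, sub_self]; positivity

end

/-! ## Scalar evolution equations -/

/-- The product rule for a smooth function and a primitive of an integrable function. -/
lemma mul_primitive {g g' : ℝ → ℂ} (hg : ∀ x, HasDerivAt g (g' x) x) (hg' : Continuous g')
    {G : ℝ → ℂ} {a t : ℝ} (hat : a ≤ t) (hG : IntegrableOn G (Ioc a t)) :
    g t * ∫ τ in a..t, G τ = ∫ τ in a..t, (g' τ * (∫ r in a..τ, G r) + g τ * G τ) := by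
  have hgc : Continuous g := continuous_iff_continuousAt.2 fun x => (hg x).continuousAt
  have hGi : IntervalIntegrable G volume a t := (intervalIntegrable_iff_integrableOn_Ioc_of_le hat).2 hG
  set μ := (volume : Measure ℝ).restrict (Ioc a t) with hμ
  have hg'i : Integrable g' μ := (hg'.intervalIntegrable a t).1
  have hs : MeasurableSet {p : ℝ × ℝ | p.2 ≤ p.1} := measurableSet_le measurable_snd measurable_fst
  -- Fubini on the triangle `r ≤ τ` takes the place of integration by parts, since a primitive of an
  -- integrable function need not be differentiable at every point.
  have hint : Integrable ({p : ℝ × ℝ | p.2 ≤ p.1}.indicator fun p => g' p.1 * G p.2) (μ.prod μ) :=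
    (hg'i.mul_prod hG).indicator hs
  have hsw := integral_integral_swap (f := fun τ r =>
    {p : ℝ × ℝ | p.2 ≤ p.1}.indicator (fun p => g' p.1 * G p.2) (τ, r)) hint
  have hL : ∀ τ ∈ Ioc a t, ∫ r, {p : ℝ × ℝ | p.2 ≤ p.1}.indicator
      (fun p => g' p.1 * G p.2) (τ, r) ∂μ = g' τ * ∫ r in a..τ, G r := by
    intro τ hτ
    have e : ∀ r, {p : ℝ × ℝ | p.2 ≤ p.1}.indicator (fun p => g' p.1 * G p.2) (τ, r) =
        (Iic τ).indicator (fun r => g' τ * G r) r := fun r => by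
      by_cases h : r ≤ τ <;> simp [h, indicator]
    simp only [e]
    rw [integral_indicator measurableSet_Iic, hμ, Measure.restrict_restrict measurableSet_Iic,
      integral_const_mul, intervalIntegral.integral_of_le hτ.1.le]
    congr 3
    ext r
    exact ⟨fun h => ⟨h.2.1, h.1⟩, fun h => ⟨h.2, h.1, h.2.trans hτ.2⟩⟩
  have hR : ∀ r ∈ Ioc a t, ∫ τ, {p : ℝ × ℝ | p.2 ≤ p.1}.indicator
      (fun p => g' p.1 * G p.2) (τ, r) ∂μ = (g t - g r) * G r := by
    intro r hr
    have e : ∀ τ, {p : ℝ × ℝ | p.2 ≤ p.1}.indicator (fun p => g' p.1 * G p.2) (τ, r) =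
        (Ici r).indicator (fun τ => g' τ * G r) τ := fun τ => by
      by_cases h : r ≤ τ <;> simp [h, indicator]
    simp only [e]
    rw [integral_indicator measurableSet_Ici, hμ, Measure.restrict_restrict measurableSet_Ici,
      integral_mul_const, ← intervalIntegral.integral_eq_sub_of_hasDerivAt (fun x _ => hg x)
        (hg'.intervalIntegrable r t), intervalIntegral.integral_of_le hr.2]
    congr 1
    refine setIntegral_congr_set ?_
    rw [show Ici r ∩ Ioc a t = Icc r t from by
      ext x; exact ⟨fun h => ⟨h.1, h.2.2⟩, fun h => ⟨h.1, hr.1.trans_le h.1, h.2⟩⟩]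
    exact Ioc_ae_eq_Icc.symm
  have hprim : ContinuousOn (fun τ => ∫ r in a..τ, G r) (uIcc a t) :=
    intervalIntegral.continuousOn_primitive_interval' hGi left_mem_uIcc
  have h1 : IntervalIntegrable (fun τ => g' τ * ∫ r in a..τ, G r) volume a t :=
    (hg'.continuousOn.mul hprim).intervalIntegrable
  have h2 : IntervalIntegrable (fun τ => g τ * G τ) volume a t :=
    hGi.continuousOn_mul hgc.continuousOn
  rw [intervalIntegral.integral_add h1 h2, intervalIntegral.integral_of_le hat,
    intervalIntegral.integral_of_le hat, intervalIntegral.integral_of_le hat,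
    ← setIntegral_congr_fun measurableSet_Ioc hL, hsw, setIntegral_congr_fun measurableSet_Ioc hR]
  have h3 : IntegrableOn (fun r => (g t - g r) * G r) (Ioc a t) :=
    (hGi.continuousOn_mul ((continuous_const.sub hgc).continuousOn)).1
  rw [← integral_add h3 h2.1, ← integral_const_mul]
  refine setIntegral_congr_fun measurableSet_Ioc fun r _ => ?_
  ring

/-- `f` is a primitive of the integrable function `h`. -/
def IsPrim (a b : ℝ) (f h : ℝ → ℂ) : Prop :=
  IntegrableOn h (Icc a b) ∧ ∀ t ∈ Icc a b, f t = f a + ∫ τ in a..t, h τ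

section

variable {a b c : ℝ} {f h F Z : ℝ → ℂ}

lemma intervalIntegrable_of_Icc (h : IntegrableOn F (Icc a b)) {x y : ℝ} (hx : x ∈ Icc a b)
    (hy : y ∈ Icc a b) : IntervalIntegrable F volume x y :=
  (h.mono_set ((convex_Icc a b).ordConnected.uIcc_subset hx hy)).intervalIntegrable

lemma IsPrim.sub_eq (hf : IsPrim a b f h) {x y : ℝ} (hx : x ∈ Icc a b) (hy : y ∈ Icc a b) :
    f y = f x + ∫ τ in x..y, h τ := by
  have ha : a ∈ Icc a b := ⟨le_rfl, hx.1.trans hx.2⟩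
  rw [hf.2 x hx, hf.2 y hy, add_assoc, intervalIntegral.integral_add_adjacent_intervals
    (intervalIntegrable_of_Icc hf.1 ha hx) (intervalIntegrable_of_Icc hf.1 hx hy)]

lemma isPrim_of_eq (hh : IntegrableOn h (Icc a b)) (hc : c ∈ Icc a b) {z : ℂ}
    (hf : ∀ t ∈ Icc a b, f t = z + ∫ τ in c..t, h τ) : IsPrim a b f h := by
  have ha : a ∈ Icc a b := ⟨le_rfl, hc.1.trans hc.2⟩
  refine ⟨hh, fun t ht => ?_⟩
  rw [hf t ht, hf a ha, add_assoc, intervalIntegral.integral_add_adjacent_intervals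
    (intervalIntegrable_of_Icc hh hc ha) (intervalIntegrable_of_Icc hh ha ht)]

lemma IsPrim.continuousOn (hf : IsPrim a b f h) (hab : a ≤ b) : ContinuousOn f (Icc a b) := by
  have ha : a ∈ Icc a b := ⟨le_rfl, hab⟩
  have h1 := intervalIntegral.continuousOn_primitive_interval'
    (intervalIntegrable_of_Icc hf.1 ha ⟨hab, le_rfl⟩) left_mem_uIcc
  rw [uIcc_of_le hab] at h1
  exact (continuousOn_const.add h1).congr fun t ht => hf.2 t ht

lemma IsPrim.mul (hf : IsPrim a b f h) (hab : a ≤ b) {g g' : ℝ → ℂ}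
    (hg : ∀ x, HasDerivAt g (g' x) x) (hg' : Continuous g') :
    IsPrim a b (fun t => g t * f t) fun t => g' t * f t + g t * h t := by
  have hgc : Continuous g := continuous_iff_continuousAt.2 fun x => (hg x).continuousAt
  have ha : a ∈ Icc a b := ⟨le_rfl, hab⟩
  have hb : b ∈ Icc a b := ⟨hab, le_rfl⟩
  refine ⟨?_, fun t ht => ?_⟩
  · refine IntegrableOn.add ?_ ?_
    · exact (hg'.continuousOn.mul (hf.continuousOn hab)).integrableOn_Icc
    · exact hf.1.continuousOn_mul hgc.continuousOn isCompact_Icc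
  · have h1 := mul_primitive hg hg' ht.1
      (hf.1.mono_set (Ioc_subset_Icc_self.trans (Icc_subset_Icc_right ht.2)))
    have e : ∀ τ ∈ uIcc a t, g' τ * f τ + g τ * h τ =
        (g' τ * (∫ r in a..τ, h r) + g τ * h τ) + g' τ * f a := by
      intro τ hτ
      rw [uIcc_of_le ht.1] at hτ
      rw [hf.2 τ ⟨hτ.1, hτ.2.trans ht.2⟩]
      ring
    have hi := intervalIntegrable_of_Icc hf.1 ha ht
    have hprim : ContinuousOn (fun τ => ∫ r in a..τ, h r) (uIcc a t) :=
      intervalIntegral.continuousOn_primitive_interval' hi left_mem_uIcc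
    have hA : IntervalIntegrable (fun τ => g' τ * (∫ r in a..τ, h r) + g τ * h τ) volume a t :=
      (hg'.continuousOn.mul hprim).intervalIntegrable.add (hi.continuousOn_mul hgc.continuousOn)
    rw [intervalIntegral.integral_congr e, intervalIntegral.integral_add hA ((hg'.intervalIntegrable _ _).mul_const _), ← h1, intervalIntegral.integral_mul_const,
      intervalIntegral.integral_eq_sub_of_hasDerivAt (fun x _ => hg x) (hg'.intervalIntegrable a t)]
    simp only
    rw [hf.2 t ht]
    ring

lemma hasDerivAt_cexp_mul (c : ℂ) (x : ℝ) :
    HasDerivAt (fun t : ℝ => Complex.exp (c * t)) (c * Complex.exp (c * x)) x := by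
  have h1 : HasDerivAt (fun t : ℝ => c * (t : ℂ)) c x := by
    simpa using (Complex.ofRealCLM.hasDerivAt (x := x)).const_mul c
  simpa [mul_comm] using h1.cexp

/-- Solutions of a linear equation are given by the Duhamel formula. -/
lemma IsPrim.duhamel {l : ℂ} (hf : IsPrim a b Z fun t => l * Z t + F t) (hab : a ≤ b) {t : ℝ}
    (hc : c ∈ Icc a b) (ht : t ∈ Icc a b) :
    Z t = Complex.exp (l * (t - c)) * Z c + ∫ τ in c..t, Complex.exp (l * (t - τ)) * F τ := by
  have h1 := hf.mul hab (hasDerivAt_cexp_mul (-l)) (by fun_prop)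
  have h2 := h1.sub_eq hc ht
  have e : ∀ τ : ℝ, -l * Complex.exp (-l * τ) * Z τ + Complex.exp (-l * τ) * (l * Z τ + F τ) =
      Complex.exp (-l * τ) * F τ := fun τ => by ring
  simp only [e] at h2
  have h3 : ∀ r : ℝ, Complex.exp (l * (t - r)) = Complex.exp (l * t) * Complex.exp (-l * r) :=
    fun r => by rw [← Complex.exp_add]; congr 1; ring
  have h4 : Complex.exp (l * t) * Complex.exp (-l * t) = 1 := by
    rw [← Complex.exp_add]; simp
  simp only [h3, mul_assoc]
  rw [intervalIntegral.integral_const_mul, ← mul_add, ← h2, ← mul_assoc, h4, one_mul]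

/-- Functions given by the Duhamel formula solve the equation. -/
lemma isPrim_of_duhamel {l z : ℂ} (hF : IntegrableOn F (Icc a b)) (hc : c ∈ Icc a b)
    (hZ : ∀ t ∈ Icc a b,
      Z t = Complex.exp (l * (t - c)) * z + ∫ τ in c..t, Complex.exp (l * (t - τ)) * F τ) :
    IsPrim a b Z fun t => l * Z t + F t := by
  have hab := hc.1.trans hc.2
  have hex : Continuous fun t : ℝ => Complex.exp (-l * t) := by fun_prop
  have h3 : ∀ t r : ℝ, Complex.exp (l * (t - r)) = Complex.exp (l * t) * Complex.exp (-l * r) :=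
    fun t r => by rw [← Complex.exp_add]; congr 1; ring
  have h4 : ∀ t : ℝ, Complex.exp (l * t) * Complex.exp (-l * t) = 1 := fun t => by
    rw [← Complex.exp_add]; simp
  have hY : IsPrim a b (fun t => Complex.exp (-l * t) * Z t) fun t => Complex.exp (-l * t) * F t := by
    refine isPrim_of_eq (c := c) (z := Complex.exp (-l * c) * z)
      (hF.continuousOn_mul hex.continuousOn isCompact_Icc) hc fun t ht => ?_
    rw [hZ t ht]
    simp only [h3, mul_assoc]
    rw [intervalIntegral.integral_const_mul, ← mul_add, ← mul_assoc, mul_comm (Complex.exp (-l * t)),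
      h4, one_mul]
  have h1 := hY.mul hab (hasDerivAt_cexp_mul l) (by fun_prop)
  have e1 : (fun t : ℝ => Complex.exp (l * t) * (Complex.exp (-l * t) * Z t)) = Z := by
    funext t; rw [← mul_assoc, h4, one_mul]
  have e2 : (fun t : ℝ => l * Complex.exp (l * t) * (Complex.exp (-l * t) * Z t) +
      Complex.exp (l * t) * (Complex.exp (-l * t) * F t)) = fun t => l * Z t + F t := by
    funext t
    rw [show l * Complex.exp (l * t) * (Complex.exp (-l * t) * Z t) +
      Complex.exp (l * t) * (Complex.exp (-l * t) * F t) =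
      (Complex.exp (l * t) * Complex.exp (-l * t)) * (l * Z t + F t) by ring, h4, one_mul]
  rwa [e1, e2] at h1

end

/-! ## Distributions tested with smooth functions -/

/-- Distributions of finite order. -/
def Tame (c : Coeffs d) : Prop := ∃ p, wien p c < ⊤

lemma wien_smul (p : ℝ) (z : ℂ) (c : Coeffs d) : wien p (z • c) = ‖z‖ₑ * wien p c := by
  rw [wien, wien, ← ENNReal.tsum_mul_left]
  exact tsum_congr fun k => by rw [Pi.smul_apply, smul_eq_mul, enorm_mul, mul_left_comm]

lemma enorm_freqSq_le (k : Freq d) : ‖(freqSq k : ℂ)‖ₑ ≤ wt 1 k := by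
  rw [← ofReal_norm, Complex.norm_real, Real.norm_of_nonneg (freqSq_nonneg k), wt, Real.rpow_one]
  exact ENNReal.ofReal_le_ofReal (by linarith)

lemma wien_distLaplacian_le (p : ℝ) (c : Coeffs d) :
    wien p (distLaplacian c) ≤ wien (p + 2) c := by
  refine ENNReal.tsum_le_tsum fun k => ?_
  rw [add_div, wt_add, mul_assoc, distLaplacian, enorm_mul, enorm_neg, div_self two_ne_zero]
  gcongr
  exact enorm_freqSq_le k

lemma Tame.add {a b : Coeffs d} (ha : Tame a) (hb : Tame b) : Tame (a + b) := by
  obtain ⟨p, hp⟩ := ha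
  obtain ⟨q, hq⟩ := hb
  refine ⟨min p q, (wien_add_le _ _ _).trans_lt (ENNReal.add_lt_top.2 ⟨?_, ?_⟩)⟩
  · exact (wien_mono (min_le_left _ _) _).trans_lt hp
  · exact (wien_mono (min_le_right _ _) _).trans_lt hq

lemma Tame.smul {a : Coeffs d} (ha : Tame a) (z : ℂ) : Tame (z • a) := by
  obtain ⟨p, hp⟩ := ha
  exact ⟨p, by rw [wien_smul]; finiteness⟩

lemma Tame.distPartial {a : Coeffs d} (ha : Tame a) (i : Fin d) : Tame (distPartial i a) := by
  obtain ⟨p, hp⟩ := ha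
  exact ⟨p - 1, (wien_distPartial_le _ _ _).trans_lt (by rwa [sub_add_cancel])⟩

lemma Tame.distLaplacian {a : Coeffs d} (ha : Tame a) : Tame (distLaplacian a) := by
  obtain ⟨p, hp⟩ := ha
  exact ⟨p - 2, (wien_distLaplacian_le _ _).trans_lt (by rwa [sub_add_cancel])⟩

lemma tame_zero : Tame (0 : Coeffs d) := ⟨0, by simp [wien]⟩

lemma Tame.sum {ι : Type*} {s : Finset ι} {a : ι → Coeffs d} (h : ∀ i ∈ s, Tame (a i)) :
    Tame (∑ i ∈ s, a i) := by
  classical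
  induction s using Finset.induction with
  | empty => exact tame_zero
  | insert i s hi ih =>
    rw [Finset.sum_insert hi]
    exact (h i (Finset.mem_insert_self _ _)).add (ih fun j hj => h j (Finset.mem_insert_of_mem hj))

lemma tame_of_sobSq {σ : ℝ} {c : Coeffs d} (h : sobSq σ c < ⊤) : Tame c :=
  ⟨σ - (d / 2 + 1), wien_lt_top_of_sobSq (r := d / 2 + 1) (by linarith) (by rwa [sub_add_cancel])⟩

/-- The crude bound of a product. -/
lemma wien_conv_le {ρ : ℝ} (hρ : 0 ≤ ρ) (r : ℝ) (f c : Coeffs d) :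
    wien (-ρ - 2 * r) (conv f c) ≤ splitC ρ * wtSum d r * (sobSq ρ f + sobSq (-ρ) c) := by
  rw [wtSum, mul_comm (splitC ρ), mul_assoc, ← ENNReal.tsum_mul_right]
  refine ENNReal.tsum_le_tsum fun k => ?_
  have h1 : ‖conv f c k‖ₑ ≤ splitC ρ * wt (ρ / 2) k * (sobSq ρ f + sobSq (-ρ) c) := by
    refine (enorm_conv_le f c k).trans ((ENNReal.pow_le_pow_left_iff two_ne_zero).1 ?_)
    refine (econv_sq_le_wt hρ f c k).trans ?_
    rw [mul_pow, mul_pow, wt_half_sq]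
    gcongr
    rw [sq]
    gcongr
    · exact le_self_add
    · exact le_add_self
  calc _ ≤ wt ((-ρ - 2 * r) / 2) k * (splitC ρ * wt (ρ / 2) k * (sobSq ρ f + sobSq (-ρ) c)) := by
        gcongr
    _ = (wt ((-ρ - 2 * r) / 2) k * wt (ρ / 2) k) * (splitC ρ * (sobSq ρ f + sobSq (-ρ) c)) := by ring
    _ = _ := by rw [← wt_add]; congr 3; ring

lemma tame_conv {ρ : ℝ} (hρ : 0 ≤ ρ) {f c : Coeffs d} (hf : sobSq ρ f < ⊤)
    (hc : sobSq (-ρ) c < ⊤) : Tame (conv f c) :=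
  ⟨_, (wien_conv_le hρ (d / 2 + 1) f c).trans_lt (by
    have := splitC_lt_top ρ
    have := wtSum_lt_top (d := d) (r := d / 2 + 1) (by linarith)
    finiteness)⟩

/-- The opposite weights cancel, and the product of the two sums dominates the sum over matching
frequencies. -/
lemma tsum_enorm_mul_fourier_le (p : ℝ) (c : Coeffs d) (φ : Pt d → ℂ) :
    ∑' k, ‖c k * fourier φ (-k)‖ₑ ≤ wien p c * wien (-p) (fourier φ) := by
  rw [wien, ← ENNReal.tsum_mul_right]
  refine ENNReal.tsum_le_tsum fun k => ?_
  rw [enorm_mul]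
  calc ‖c k‖ₑ * ‖fourier φ (-k)‖ₑ
      = (wt (p / 2) k * ‖c k‖ₑ) * (wt (-p / 2) (-k) * ‖fourier φ (-k)‖ₑ) := by
        rw [wt_neg_freq]
        have h := wt_neg_mul (p / 2) k
        rw [← neg_div] at h
        calc _ = (wt (-p / 2) k * wt (p / 2) k) * (‖c k‖ₑ * ‖fourier φ (-k)‖ₑ) := by rw [h, one_mul]
          _ = _ := by ring
    _ ≤ _ := by
        gcongr
        exact ENNReal.le_tsum (f := fun k => wt (-p / 2) k * ‖fourier φ k‖ₑ) (-k)

lemma Tame.summable {c : Coeffs d} (hc : Tame c) {φ : Pt d → ℂ} (hφ : IsTest φ) :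
    Summable fun k => c k * fourier φ (-k) := by
  obtain ⟨p, hp⟩ := hc
  have := wien_fourier_test (-p) hφ
  exact summable_of_tsum_enorm_lt_top
    ((tsum_enorm_mul_fourier_le p c φ).trans_lt (by finiteness))

lemma pair_add {a b : Coeffs d} (ha : Tame a) (hb : Tame b) {φ : Pt d → ℂ} (hφ : IsTest φ) :
    pair (a + b) φ = pair a φ + pair b φ := by
  rw [pair, pair, pair, ← mul_add, ← (ha.summable hφ).tsum_add (hb.summable hφ)]
  simp only [Pi.add_apply, add_mul]

lemma pair_smul (z : ℂ) (a : Coeffs d) (φ : Pt d → ℂ) : pair (z • a) φ = z * pair a φ := by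
  rw [pair, pair, mul_left_comm, ← tsum_mul_left (a := z)]
  simp only [Pi.smul_apply, smul_eq_mul, mul_assoc]

lemma pair_sum {ι : Type*} {s : Finset ι} {a : ι → Coeffs d} (h : ∀ i ∈ s, Tame (a i))
    {φ : Pt d → ℂ} (hφ : IsTest φ) : pair (∑ i ∈ s, a i) φ = ∑ i ∈ s, pair (a i) φ := by
  classical
  induction s using Finset.induction with
  | empty => simp [pair]
  | insert i s hi ih =>
    have h' := fun j hj => h j (Finset.mem_insert_of_mem hj)
    rw [Finset.sum_insert hi, Finset.sum_insert hi,
      pair_add (h i (Finset.mem_insert_self _ _)) (Tame.sum h') hφ, ih h']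

lemma pair_distPartial (i : Fin d) (c : Coeffs d) {φ : Pt d → ℂ} (hφ : IsTest φ) :
    pair (distPartial i c) φ = -pair c (pderiv i φ) := by
  rw [pair, pair, fourier_pderiv (hφ.1.of_le (by simp)) hφ.2, ← mul_neg, ← tsum_neg]
  congr 1
  refine tsum_congr fun k => ?_
  simp only [distPartial, Pi.neg_apply]
  push_cast
  ring

/-- The pairing of a product. -/
lemma pair_mul {ρ : ℝ} (hρ : 0 ≤ ρ) {f : Pt d → ℂ} (hf : IntegrableOn f (cell d))
    (hf' : sobSq ρ (fourier f) < ⊤) {c : Coeffs d} (hc : sobSq (-ρ) c < ⊤) {φ : Pt d → ℂ}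
    (hφ : IsTest φ) : pair c (fun x => f x * φ x) = pair (conv (fourier f) c) φ := by
  have hw : ∑' k, ‖fourier φ k‖ₑ < ⊤ := by
    rw [← wien_zero]; exact wien_fourier_test 0 hφ
  have h1 : fourier (fun x => f x * φ x) = conv (fourier f) (fourier φ) :=
    fourier_mul hf hφ.1.continuous hφ.2 hw
  rw [pair, pair, h1]
  congr 1
  have e : ∀ l, c l * conv (fourier f) (fourier φ) (-l) =
      ∑' k, fourier f (k - l) * c l * fourier φ (-k) := by
    intro l
    rw [conv, ← tsum_mul_left, ← (Equiv.neg (Freq d)).tsum_eq]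
    refine tsum_congr fun k => ?_
    rw [Equiv.neg_apply, show -l - -k = k - l by abel]
    ring
  simp only [e]
  -- The double sum converges absolutely: the sum over `l` grows at most like the weight `wt (ρ / 2)
  -- k`, against the rapid decay of the test function. The two sums may then be exchanged.
  have hs : Summable (Function.uncurry fun (l k : Freq d) =>
      fourier f (k - l) * c l * fourier φ (-k)) := by
    refine summable_of_tsum_enorm_lt_top ?_
    rw [ENNReal.tsum_prod', ENNReal.tsum_comm]
    simp only [Function.uncurry, enorm_mul, ENNReal.tsum_mul_right]
    have h2 : ∀ k, ∑' l, ‖fourier f (k - l)‖ₑ * ‖c l‖ₑ ≤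
        splitC ρ * wt (ρ / 2) k * (sobSq ρ (fourier f) + sobSq (-ρ) c) := by
      intro k
      refine (ENNReal.pow_le_pow_left_iff two_ne_zero).1 ?_
      refine (econv_sq_le_wt hρ (fourier f) c k).trans ?_
      rw [mul_pow, mul_pow, wt_half_sq]
      gcongr
      rw [sq]
      gcongr
      · exact le_self_add
      · exact le_add_self
    calc _ ≤ ∑' k, splitC ρ * wt (ρ / 2) k * (sobSq ρ (fourier f) + sobSq (-ρ) c) *
          ‖fourier φ (-k)‖ₑ := by gcongr with k; exact h2 k
      _ = splitC ρ * (sobSq ρ (fourier f) + sobSq (-ρ) c) *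
          ∑' k, wt (ρ / 2) (-k) * ‖fourier φ (-k)‖ₑ := by
          rw [← ENNReal.tsum_mul_left]
          refine tsum_congr fun k => ?_
          rw [wt_neg_freq]
          ring
      _ = splitC ρ * (sobSq ρ (fourier f) + sobSq (-ρ) c) * wien ρ (fourier φ) := by
          have h3 := (Equiv.neg (Freq d)).tsum_eq fun k => wt (ρ / 2) k * ‖fourier φ k‖ₑ
          simp only [Equiv.neg_apply] at h3
          rw [h3, wien]
      _ < ⊤ := by
          have := splitC_lt_top ρ
          have := wien_fourier_test ρ hφ
          finiteness
  refine hs.tsum_comm.symm.trans (tsum_congr fun k => ?_)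
  rw [tsum_mul_right, conv]

/-- Time-dependent distributions which are integrable in time. -/
def TimeIntegrable (t₀ T : ℝ) (h : ℝ → Coeffs d) : Prop :=
  MeasTime t₀ T h ∧ ∃ p, ∫⁻ t in Icc t₀ T, wien p (h t) < ⊤

section

variable {t₀ T : ℝ} {h g : ℝ → Coeffs d}

lemma aemeasurable_wien (hm : MeasTime t₀ T h) (p : ℝ) :
    AEMeasurable (fun t => wien p (h t)) (volume.restrict (Icc t₀ T)) :=
  AEMeasurable.tsum fun k => (hm k).enorm.const_mul _

lemma TimeIntegrable.ae_tame (hh : TimeIntegrable t₀ T h) :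
    ∀ᵐ t ∂(volume.restrict (Icc t₀ T)), Tame (h t) := by
  obtain ⟨hm, p, hp⟩ := hh
  filter_upwards [ae_lt_top' (aemeasurable_wien hm p) hp.ne] with t ht using ⟨p, ht⟩

lemma TimeIntegrable.add (hh : TimeIntegrable t₀ T h) (hg : TimeIntegrable t₀ T g) :
    TimeIntegrable t₀ T fun t => h t + g t := by
  obtain ⟨hm, p, hp⟩ := hh
  obtain ⟨gm, q, hq⟩ := hg
  refine ⟨hm.add gm, min p q, ?_⟩
  calc _ ≤ ∫⁻ t in Icc t₀ T, (wien p (h t) + wien q (g t)) := by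
        refine lintegral_mono fun t => (wien_add_le _ _ _).trans (add_le_add ?_ ?_)
        · exact wien_mono (min_le_left _ _) _
        · exact wien_mono (min_le_right _ _) _
    _ = _ := lintegral_add_left' (aemeasurable_wien hm p) _
    _ < ⊤ := by finiteness

lemma TimeIntegrable.smul (hh : TimeIntegrable t₀ T h) (z : ℂ) :
    TimeIntegrable t₀ T fun t => z • h t := by
  obtain ⟨hm, p, hp⟩ := hh
  refine ⟨fun k => (hm k).const_mul z, p, ?_⟩
  simp only [wien_smul]
  rw [lintegral_const_mul' _ _ enorm_ne_top]
  finiteness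

lemma TimeIntegrable.distPartial (hh : TimeIntegrable t₀ T h) (i : Fin d) :
    TimeIntegrable t₀ T fun t => distPartial i (h t) := by
  obtain ⟨hm, p, hp⟩ := hh
  refine ⟨hm.distPartial i, p - 1, (lintegral_mono fun t => wien_distPartial_le _ _ i).trans_lt ?_⟩
  simpa only [sub_add_cancel] using hp

lemma TimeIntegrable.distLaplacian (hh : TimeIntegrable t₀ T h) :
    TimeIntegrable t₀ T fun t => distLaplacian (h t) := by
  obtain ⟨hm, p, hp⟩ := hh
  refine ⟨fun k => (hm k).const_mul _, p - 2,
    (lintegral_mono fun t => wien_distLaplacian_le _ _).trans_lt ?_⟩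
  simpa only [sub_add_cancel] using hp

lemma timeIntegrable_zero : TimeIntegrable t₀ T (0 : ℝ → Coeffs d) :=
  ⟨fun k => aestronglyMeasurable_const, 0, by simp [wien]⟩

lemma TimeIntegrable.sum {ι : Type*} {s : Finset ι} {h : ι → ℝ → Coeffs d}
    (hh : ∀ i ∈ s, TimeIntegrable t₀ T (h i)) : TimeIntegrable t₀ T fun t => ∑ i ∈ s, h i t := by
  classical
  induction s using Finset.induction with
  | empty => exact timeIntegrable_zero
  | insert i s hi ih =>
    simp only [Finset.sum_insert hi]
    exact (hh i (Finset.mem_insert_self _ _)).add (ih fun j hj => hh j (Finset.mem_insert_of_mem hj))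

/-- By `x ≤ 1 + x²` on an interval of finite length. -/
lemma timeIntegrable_of_sobSq {σ : ℝ} (hm : MeasTime t₀ T h)
    (hs : ∫⁻ t in Icc t₀ T, sobSq σ (h t) < ⊤) : TimeIntegrable t₀ T h := by
  refine ⟨hm, σ - (d / 2 + 1), ?_⟩
  have hW := wtSum_lt_top (d := d) (r := d / 2 + 1) (by linarith)
  have hle : ∀ x : ℝ≥0∞, x ≤ 1 + x ^ 2 := fun x => by
    rcases le_total x 1 with h | h
    · exact h.trans le_self_add
    · refine le_trans ?_ le_add_self
      rw [sq]
      exact le_mul_of_one_le_left bot_le h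
  calc _ ≤ ∫⁻ t in Icc t₀ T, (1 + wtSum d (d / 2 + 1) * sobSq σ (h t)) := by
        refine lintegral_mono fun t => (hle _).trans ?_
        gcongr
        refine (wien_sq_le _ (d / 2 + 1) (h t)).trans (le_of_eq ?_)
        rw [sub_add_cancel]
    _ = volume (Icc t₀ T) + wtSum d (d / 2 + 1) * ∫⁻ t in Icc t₀ T, sobSq σ (h t) := by
        rw [lintegral_add_left measurable_const, lintegral_const_mul' _ _ hW.ne, setLIntegral_one]
    _ < ⊤ := by
        rw [Real.volume_Icc]
        finiteness

lemma timeIntegrable_conv {ρ : ℝ} (hρ : 0 ≤ ρ) (hm : MeasTime t₀ T h) (gm : MeasTime t₀ T g)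
    (hh : ∫⁻ t in Icc t₀ T, sobSq ρ (h t) < ⊤) (hg : ∫⁻ t in Icc t₀ T, sobSq (-ρ) (g t) < ⊤) :
    TimeIntegrable t₀ T fun t => conv (h t) (g t) := by
  have hhm := aemeasurable_sobSq hm ρ
  have hgm := aemeasurable_sobSq gm (-ρ)
  refine ⟨hm.conv hρ gm (ae_lt_top' hhm hh.ne) (ae_lt_top' hgm hg.ne), -ρ - 2 * (d / 2 + 1), ?_⟩
  have hW := wtSum_lt_top (d := d) (r := d / 2 + 1) (by linarith)
  have hS := splitC_lt_top ρ
  calc _ ≤ ∫⁻ t in Icc t₀ T, splitC ρ * wtSum d (d / 2 + 1) * (sobSq ρ (h t) + sobSq (-ρ) (g t)) :=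
        lintegral_mono fun t => wien_conv_le hρ _ _ _
    _ = splitC ρ * wtSum d (d / 2 + 1) *
        ((∫⁻ t in Icc t₀ T, sobSq ρ (h t)) + ∫⁻ t in Icc t₀ T, sobSq (-ρ) (g t)) := by
        rw [lintegral_const_mul' _ _ (by finiteness), lintegral_add_left' hhm]
    _ < ⊤ := by finiteness

lemma TimeIntegrable.integrableOn (hh : TimeIntegrable t₀ T h) (k : Freq d) :
    IntegrableOn (fun t => h t k) (Icc t₀ T) := by
  obtain ⟨hm, p, hp⟩ := hh
  refine ⟨hm k, ?_⟩
  have h1 : wt (p / 2) k * ∫⁻ t in Icc t₀ T, ‖h t k‖ₑ < ⊤ := by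
    rw [← lintegral_const_mul' _ _ (wt_ne_top _ _)]
    exact (lintegral_mono fun t =>
      ENNReal.le_tsum (f := fun k => wt (p / 2) k * ‖h t k‖ₑ) k).trans_lt hp
  exact (ENNReal.mul_lt_top_iff.1 h1).elim (fun h => h.2)
    (fun h => h.elim (fun h => absurd h (wt_ne_zero _ _)) fun h => by
      rw [HasFiniteIntegral, h]; exact ENNReal.zero_lt_top)

lemma TimeIntegrable.tsum_lintegral_lt_top (hh : TimeIntegrable t₀ T h) {φ : Pt d → ℂ}
    (hφ : IsTest φ) : ∑' k, ∫⁻ t in Icc t₀ T, ‖h t k * fourier φ (-k)‖ₑ < ⊤ := by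
  obtain ⟨hm, p, hp⟩ := hh
  have h2 := wien_fourier_test (-p) hφ
  rw [← lintegral_tsum fun k => ((hm k).mul_const _).enorm]
  calc _ ≤ ∫⁻ t in Icc t₀ T, wien p (h t) * wien (-p) (fourier φ) :=
        lintegral_mono fun t => tsum_enorm_mul_fourier_le p _ φ
    _ = _ := lintegral_mul_const' _ _ h2.ne
    _ < ⊤ := by finiteness

lemma TimeIntegrable.integrableOn_pair (hh : TimeIntegrable t₀ T h) {φ : Pt d → ℂ}
    (hφ : IsTest φ) : IntegrableOn (fun t => pair (h t) φ) (Icc t₀ T) := by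
  have h1 := hh.tsum_lintegral_lt_top hφ
  have hm : ∀ k, AEStronglyMeasurable (fun t => h t k * fourier φ (-k))
      (volume.restrict (Icc t₀ T)) := fun k => (hh.1 k).mul_const _
  rw [← lintegral_tsum fun k => (hm k).enorm] at h1
  refine Integrable.const_mul ⟨?_, ?_⟩ _
  · refine aestronglyMeasurable_of_tendsto_ae Filter.atTop
      (f := fun (s : Finset (Freq d)) t => ∑ k ∈ s, h t k * fourier φ (-k))
      (fun s => Finset.aestronglyMeasurable_fun_sum s fun k _ => hm k) ?_
    filter_upwards [hh.ae_tame] with t ht using (ht.summable hφ).hasSum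
  · exact (lintegral_mono fun t => enorm_tsum_le_tsum_enorm).trans_lt h1

/-- The pairing commutes with integration in time. -/
lemma TimeIntegrable.pair_integral (hh : TimeIntegrable t₀ T h) {φ : Pt d → ℂ} (hφ : IsTest φ)
    {a b : ℝ} (ha : a ∈ Icc t₀ T) (hb : b ∈ Icc t₀ T) :
    Tame (fun k => ∫ t in a..b, h t k) ∧
    pair (fun k => ∫ t in a..b, h t k) φ = ∫ t in a..b, pair (h t) φ := by
  wlog hab : a ≤ b generalizing a b with H
  · obtain ⟨h1, h2⟩ := H hb ha (le_of_not_ge hab)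
    have e : (fun k => ∫ t in a..b, h t k) = (-1 : ℂ) • fun k => ∫ t in b..a, h t k := by
      funext k
      rw [intervalIntegral.integral_symm]
      simp
    rw [e, intervalIntegral.integral_symm, pair_smul, h2]
    exact ⟨h1.smul _, by ring⟩
  have hs : Ioc a b ⊆ Icc t₀ T := fun x hx => ⟨ha.1.trans hx.1.le, hx.2.trans hb.2⟩
  constructor
  · obtain ⟨hm, p, hp⟩ := hh
    refine ⟨p, lt_of_le_of_lt ?_ hp⟩
    unfold wien
    rw [lintegral_tsum fun k => (hm k).enorm.const_mul _]
    refine ENNReal.tsum_le_tsum fun k => ?_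
    rw [lintegral_const_mul' _ _ (wt_ne_top _ _)]
    refine mul_le_mul_right ?_ _
    simp only [intervalIntegral.integral_of_le hab]
    exact (enorm_integral_le_lintegral_enorm _).trans (lintegral_mono_set hs)
  · have h1 : ∑' k, ∫⁻ t in Ioc a b, ‖h t k * fourier φ (-k)‖ₑ ≠ ⊤ :=
      ((ENNReal.tsum_le_tsum fun k => lintegral_mono_set hs).trans_lt
        (hh.tsum_lintegral_lt_top hφ)).ne
    have h2 := integral_tsum (μ := volume.restrict (Ioc a b))
      (f := fun k t => h t k * fourier φ (-k))
      (fun k => ((hh.1 k).mono_measure (Measure.restrict_mono hs le_rfl)).mul_const _) h1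
    rw [intervalIntegral.integral_of_le hab]
    simp only [pair]
    rw [integral_const_mul, h2]
    congr 1
    refine tsum_congr fun k => ?_
    rw [intervalIntegral.integral_of_le hab, integral_mul_const]

end

/-! ## Weak solutions and mild solutions -/

section

variable {t₀ T : ℝ} {S v : ℝ → Coeffs d} {w : Coeffs d}

lemma exp_eq_heatR (k : Freq d) (x y : ℝ) :
    Complex.exp (-(freqSq k : ℂ) * (x - y)) = heatR k x y := by
  rw [heatR]
  push_cast
  congr 1
  ring

lemma exp_eq_heatR' (k : Freq d) (x y : ℝ) :
    Complex.exp ((freqSq k : ℂ) * (x - y)) = heatR k y x := by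
  rw [heatR]
  push_cast
  congr 1
  ring

lemma heatR_sub (k : Freq d) (x y : ℝ) : heatR k (x - y) 0 = heatR k x y := by
  rw [heatR, heatR, sub_zero]

/-- For each frequency this is variation of constants for a scalar equation with rate `+|k|²`,
solved backward from `T`. This lemma and its forward counterpart are used together with their
converses, so the integrated and the mild forms are equivalent. -/
lemma backward_duhamel_of_integral (hT : t₀ ≤ T)
    (hi : ∀ k, IntegrableOn (fun τ => -(freqSq k : ℂ) * v τ k - S τ k) (Icc t₀ T))
    (hv : ∀ t ∈ Icc t₀ T, ∀ k, v t k = w k + ∫ τ in t..T, (-(freqSq k : ℂ) * v τ k - S τ k)) :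
    ∀ t ∈ Icc t₀ T, v t = heatFlow (T - t) w + duhB T S t := by
  intro t ht
  have hTT : T ∈ Icc t₀ T := right_mem_Icc.2 hT
  funext k
  have e : ∀ τ, -(-(freqSq k : ℂ) * v τ k - S τ k) = (freqSq k : ℂ) * v τ k + S τ k := fun τ => by ring
  have hp : IsPrim t₀ T (fun t => v t k) fun t => (freqSq k : ℂ) * v t k + S t k := by
    refine isPrim_of_eq (c := T) (z := w k) ((hi k).fun_neg.congr_fun (fun τ _ => e τ) measurableSet_Icc) hTT
      fun t ht => ?_
    rw [hv t ht k, intervalIntegral.integral_symm t T, ← intervalIntegral.integral_neg]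
    simp only [← e, neg_neg]
  have hwT : v T k = w k := by simpa using hv T hTT k
  have := hp.duhamel hT hTT ht
  simp only [exp_eq_heatR', hwT] at this
  rw [this, Pi.add_apply, heatFlow, duhB, heatR_sub, intervalIntegral.integral_symm t T]

lemma backward_integral_of_duhamel (hT : t₀ ≤ T) (hS : ∀ k, IntegrableOn (fun τ => S τ k) (Icc t₀ T))
    (hv : ∀ t ∈ Icc t₀ T, v t = heatFlow (T - t) w + duhB T S t) :
    ∀ t ∈ Icc t₀ T, ∀ k, v t k = w k + ∫ τ in t..T, (-(freqSq k : ℂ) * v τ k - S τ k) := by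
  intro t ht k
  have hTT : T ∈ Icc t₀ T := right_mem_Icc.2 hT
  have e : ∀ τ, -(freqSq k : ℂ) * v τ k - S τ k = -((freqSq k : ℂ) * v τ k + S τ k) := fun τ => by ring
  have hp : IsPrim t₀ T (fun t => v t k) fun t => (freqSq k : ℂ) * v t k + S t k := by
    refine isPrim_of_duhamel (z := w k) (hS k) hTT fun t ht => ?_
    simp only [exp_eq_heatR']
    rw [hv t ht, Pi.add_apply, heatFlow, duhB, heatR_sub, intervalIntegral.integral_symm t T]
  have hwT : v T k = w k := by
    rw [hv T hTT]
    simp [heatFlow_zero_time, duhB]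
  have := hp.sub_eq hTT ht
  rw [this, hwT, intervalIntegral.integral_symm]
  simp only [e, intervalIntegral.integral_neg]

lemma forward_duhamel_of_integral (hT : t₀ ≤ T)
    (hi : ∀ k, IntegrableOn (fun τ => -(freqSq k : ℂ) * v τ k + S τ k) (Icc t₀ T))
    (hv : ∀ t ∈ Icc t₀ T, ∀ k, v t k = w k + ∫ τ in t₀..t, (-(freqSq k : ℂ) * v τ k + S τ k)) :
    ∀ t ∈ Icc t₀ T, v t = heatFlow (t - t₀) w + duhF t₀ S t := by
  intro t ht
  have h0 : t₀ ∈ Icc t₀ T := left_mem_Icc.2 hT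
  funext k
  have hp : IsPrim t₀ T (fun t => v t k) fun t => -(freqSq k : ℂ) * v t k + S t k :=
    isPrim_of_eq (c := t₀) (z := w k) (hi k) h0 fun t ht => hv t ht k
  have hw0 : v t₀ k = w k := by simpa using hv t₀ h0 k
  have := hp.duhamel hT h0 ht
  simp only [exp_eq_heatR, hw0] at this
  rw [this, Pi.add_apply, heatFlow, duhF, heatR_sub]

lemma forward_integral_of_duhamel (hT : t₀ ≤ T) (hS : ∀ k, IntegrableOn (fun τ => S τ k) (Icc t₀ T))
    (hv : ∀ t ∈ Icc t₀ T, v t = heatFlow (t - t₀) w + duhF t₀ S t) :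
    ∀ t ∈ Icc t₀ T, ∀ k, v t k = w k + ∫ τ in t₀..t, (-(freqSq k : ℂ) * v τ k + S τ k) := by
  intro t ht k
  have h0 : t₀ ∈ Icc t₀ T := left_mem_Icc.2 hT
  have hp : IsPrim t₀ T (fun t => v t k) fun t => -(freqSq k : ℂ) * v t k + S t k := by
    refine isPrim_of_duhamel (z := w k) (hS k) h0 fun t ht => ?_
    simp only [exp_eq_heatR]
    rw [hv t ht, Pi.add_apply, heatFlow, duhF, heatR_sub]
  have hw0 : v t₀ k = w k := by
    rw [hv t₀ h0]
    simp [heatFlow_zero_time, duhF]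
  rw [hp.sub_eq h0 ht, hw0]

end

/-! ### The products tested with smooth functions -/

lemma conv_add_left {ρ : ℝ} (hρ : 0 ≤ ρ) {f g c : Coeffs d} (hf : sobSq ρ f < ⊤)
    (hg : sobSq ρ g < ⊤) (hc : sobSq (-ρ) c < ⊤) : conv (f + g) c = conv f c + conv g c := by
  funext k
  rw [Pi.add_apply, conv, conv, conv, ← (summable_conv hρ hf hc k).tsum_add (summable_conv hρ hg hc k)]
  simp only [Pi.add_apply, add_mul]

lemma conv_smul_left (z : ℂ) (f c : Coeffs d) : conv (z • f) c = z • conv f c := by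
  funext k
  rw [Pi.smul_apply, conv, conv, smul_eq_mul, ← tsum_mul_left]
  simp only [Pi.smul_apply, smul_eq_mul, mul_assoc]

/-- Continuous functions in `H^ρ`. -/
def RegFun (ρ : ℝ) (f : Pt d → ℝ) : Prop := Continuous f ∧ sobSq ρ (fourierR f) < ⊤

/-- The regularity of the coefficients of the linearized system at a fixed time. -/
structure RegCoef (H : Hamiltonian d) (u m : ℝ → Pt d → ℝ) (ρ t : ℝ) : Prop where
  p : ∀ i, RegFun ρ (coefP H u m i t)
  q : RegFun ρ (coefQ H u m t)
  pp : ∀ i j, RegFun ρ (coefPP H u m i j t)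
  pq : ∀ i, RegFun ρ (coefPQ H u m i t)

lemma RegFun.pair_mul {ρ : ℝ} (hρ : 0 ≤ ρ) {f : Pt d → ℝ} (hf : RegFun ρ f) {c : Coeffs d}
    (hc : sobSq (-ρ) c < ⊤) {φ : Pt d → ℂ} (hφ : IsTest φ) :
    pair c (fun x => (f x : ℂ) * φ x) = pair (conv (fourierR f) c) φ :=
  MFG.pair_mul hρ (integrableOn_cell_of_continuous (Complex.continuous_ofReal.comp hf.1)) hf.2 hc hφ

lemma RegFun.tame_conv {ρ : ℝ} (hρ : 0 ≤ ρ) {f : Pt d → ℝ} (hf : RegFun ρ f) {c : Coeffs d}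
    (hc : sobSq (-ρ) c < ⊤) : Tame (conv (fourierR f) c) := MFG.tame_conv hρ hf.2 hc

/-- The time derivative of the first component. -/
def rateB (A : Option (Fin d) → Option (Fin d) → ℝ → Coeffs d) (Z : ℝ → State d) (t : ℝ) :
    Coeffs d := distLaplacian (Z t).1 + (-1 : ℂ) • source A Z none t

/-- The time derivative of the second component. -/
def rateF (A : Option (Fin d) → Option (Fin d) → ℝ → Coeffs d) (Z : ℝ → State d) (t : ℝ) :
    Coeffs d := distLaplacian (Z t).2 + flux A Z t

section

variable {H : Hamiltonian d} {u m : ℝ → Pt d → ℝ} {ρ t ϑ : ℝ} {Z : ℝ → State d}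

lemma RegCoef.source_none (H : Hamiltonian d) (u m : ℝ → Pt d → ℝ) (ϑ t : ℝ) (Z : ℝ → State d) :
    source (linCoef H u m ϑ) Z none t = conv (fourierR (coefQ H u m t)) (Z t).2 +
      ∑ i, conv (fourierR (coefP H u m i t)) (distPartial i (Z t).1) := by
  rw [source, Fintype.sum_option]
  rfl

/-- `linCoef` merges the two coefficients of `μ` in the flux. They are separated here because the
right side of the forward equation tests them one by one. -/
lemma RegCoef.source_some (h : RegCoef H u m ρ t) (hρ : 0 ≤ ρ)
    (hZ : ∀ b, sobSq (-ρ) (stateComp (Z t) b) < ⊤) (i : Fin d) :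
    source (linCoef H u m ϑ) Z (some i) t = (conv (fourierR (coefP H u m i t)) (Z t).2 +
      (-(ϑ : ℂ)) • conv (fourierR (coefPQ H u m i t)) (Z t).2) +
      ∑ j, conv (fourierR (coefPP H u m i j t)) (distPartial j (Z t).1) := by
  have hN : sobSq (-ρ) (Z t).2 < ⊤ := hZ none
  have hpq : sobSq ρ ((-(ϑ : ℂ)) • fourierR (coefPQ H u m i t)) < ⊤ := by
    rw [sobSq_smul]
    have := (h.pq i).2
    finiteness
  rw [← conv_smul_left, ← conv_add_left hρ (h.p i).2 hpq hN, source, Fintype.sum_option,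
    ← Complex.ofReal_neg]
  rfl

lemma RegCoef.tame_source_none (h : RegCoef H u m ρ t) (hρ : 0 ≤ ρ)
    (hZ : ∀ b, sobSq (-ρ) (stateComp (Z t) b) < ⊤) : Tame (source (linCoef H u m ϑ) Z none t) := by
  have hN : sobSq (-ρ) (Z t).2 < ⊤ := hZ none
  have hS : ∀ j, sobSq (-ρ) (distPartial j (Z t).1) < ⊤ := fun j => hZ (some j)
  rw [RegCoef.source_none]
  exact (h.q.tame_conv hρ hN).add (Tame.sum fun i _ => (h.p i).tame_conv hρ (hS i))

lemma RegCoef.tame_source_some (h : RegCoef H u m ρ t) (hρ : 0 ≤ ρ)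
    (hZ : ∀ b, sobSq (-ρ) (stateComp (Z t) b) < ⊤) (i : Fin d) :
    Tame (source (linCoef H u m ϑ) Z (some i) t) := by
  have hN : sobSq (-ρ) (Z t).2 < ⊤ := hZ none
  have hS : ∀ j, sobSq (-ρ) (distPartial j (Z t).1) < ⊤ := fun j => hZ (some j)
  rw [h.source_some hρ hZ]
  exact (((h.p i).tame_conv hρ hN).add (((h.pq i).tame_conv hρ hN).smul _)).add
    (Tame.sum fun j _ => (h.pp i j).tame_conv hρ (hS j))

lemma RegCoef.backwardRHS_eq (h : RegCoef H u m ρ t) (hρ : 0 ≤ ρ)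
    (hZ : ∀ b, sobSq (-ρ) (stateComp (Z t) b) < ⊤) (hv : Tame (Z t).1) {φ : Pt d → ℂ}
    (hφ : IsTest φ) : backwardRHS H u m (fun t => (Z t).1) (fun t => (Z t).2) φ t =
      pair (rateB (linCoef H u m ϑ) Z t) φ := by
  have hN : sobSq (-ρ) (Z t).2 < ⊤ := hZ none
  have hS : ∀ j, sobSq (-ρ) (distPartial j (Z t).1) < ⊤ := fun j => hZ (some j)
  have h1 : ∀ i, pair (distPartial i (Z t).1) (fun x => (coefP H u m i t x : ℂ) * φ x) =
      pair (conv (fourierR (coefP H u m i t)) (distPartial i (Z t).1)) φ := fun i =>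
    (h.p i).pair_mul hρ (hS i) hφ
  rw [backwardRHS, rateB, pair_add hv.distLaplacian ((h.tame_source_none hρ hZ).smul _) hφ,
    pair_smul, RegCoef.source_none, pair_add (h.q.tame_conv hρ hN)
      (Tame.sum fun i _ => (h.p i).tame_conv hρ (hS i)) hφ,
    pair_sum (fun i _ => (h.p i).tame_conv hρ (hS i)) hφ,
    h.q.pair_mul hρ hN hφ]
  simp only [h1]
  ring

lemma RegCoef.forwardRHS_eq (h : RegCoef H u m ρ t) (hρ : 0 ≤ ρ)
    (hZ : ∀ b, sobSq (-ρ) (stateComp (Z t) b) < ⊤) (hμ : Tame (Z t).2) {φ : Pt d → ℂ}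
    (hφ : IsTest φ) : forwardRHS H u m ϑ (fun t => (Z t).1) (fun t => (Z t).2) φ t =
      pair (rateF (linCoef H u m ϑ) Z t) φ := by
  have hN : sobSq (-ρ) (Z t).2 < ⊤ := hZ none
  have hS : ∀ j, sobSq (-ρ) (distPartial j (Z t).1) < ⊤ := fun j => hZ (some j)
  have h1 : ∀ i, pair (Z t).2 (fun x => (coefP H u m i t x : ℂ) * pderiv i φ x) =
      pair (conv (fourierR (coefP H u m i t)) (Z t).2) (pderiv i φ) := fun i =>
    (h.p i).pair_mul hρ hN (hφ.pderiv i)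
  have h2 : ∀ i j, pair (distPartial j (Z t).1)
      (fun x => (coefPP H u m i j t x : ℂ) * pderiv i φ x) =
      pair (conv (fourierR (coefPP H u m i j t)) (distPartial j (Z t).1)) (pderiv i φ) := fun i j =>
    (h.pp i j).pair_mul hρ (hS j) (hφ.pderiv i)
  have h3 : ∀ i, pair (Z t).2 (fun x => (coefPQ H u m i t x : ℂ) * pderiv i φ x) =
      pair (conv (fourierR (coefPQ H u m i t)) (Z t).2) (pderiv i φ) := fun i =>
    (h.pq i).pair_mul hρ hN (hφ.pderiv i)
  have h4 : ∀ i, pair (distPartial i (source (linCoef H u m ϑ) Z (some i) t)) φ =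
      -(pair (conv (fourierR (coefP H u m i t)) (Z t).2) (pderiv i φ) +
        ∑ j, pair (conv (fourierR (coefPP H u m i j t)) (distPartial j (Z t).1)) (pderiv i φ)) +
      (ϑ : ℂ) * pair (conv (fourierR (coefPQ H u m i t)) (Z t).2) (pderiv i φ) := by
    intro i
    have hi := hφ.pderiv i
    rw [pair_distPartial _ _ hφ, h.source_some hρ hZ,
      pair_add (((h.p i).tame_conv hρ hN).add (((h.pq i).tame_conv hρ hN).smul _))
        (Tame.sum fun j _ => (h.pp i j).tame_conv hρ (hS j)) hi,
      pair_add ((h.p i).tame_conv hρ hN) (((h.pq i).tame_conv hρ hN).smul _) hi,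
      pair_smul, pair_sum (fun j _ => (h.pp i j).tame_conv hρ (hS j)) hi]
    ring
  have ht : ∀ i ∈ Finset.univ, Tame (distPartial i (source (linCoef H u m ϑ) Z (some i) t)) :=
    fun i _ => (h.tame_source_some hρ hZ i).distPartial i
  rw [forwardRHS, rateF, flux, pair_add hμ.distLaplacian (Tame.sum ht) hφ, pair_sum ht hφ]
  simp only [h1, h2, h3, h4]
  simp only [Finset.sum_add_distrib, Finset.sum_neg_distrib, Finset.mul_sum]
  ring

end

section

variable {σ ρ t₀ T : ℝ} {K : ℝ≥0∞} {A : Option (Fin d) → Option (Fin d) → ℝ → Coeffs d}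
  {Z : ℝ → State d} {w μ₀ : Coeffs d}

lemma CoefBound.timeIntegrable_source (hA : CoefBound t₀ T σ ρ K A)
    (hL : ∀ o b, ∫⁻ t in Icc t₀ T, sobSq ρ (A o b t) < ⊤) (h : Adm σ t₀ T Z) (o : Option (Fin d)) :
    TimeIntegrable t₀ T (source A Z o) :=
  TimeIntegrable.sum fun b _ => timeIntegrable_conv hA.nonneg (hA.meas o b) (h.meas_stateComp b)
    (hL o b) ((lintegral_mono fun t =>
      (sobSq_mono hA.neg_le _).trans (sobSq_stateComp_le σ (Z t) b)).trans_lt h.fin)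

lemma Adm.timeIntegrable₁ (h : Adm σ t₀ T Z) : TimeIntegrable t₀ T fun t => (Z t).1 :=
  timeIntegrable_of_sobSq h.meas₁ ((lintegral_mono fun _ => le_self_add).trans_lt h.fin)

lemma Adm.timeIntegrable₂ (h : Adm σ t₀ T Z) : TimeIntegrable t₀ T fun t => (Z t).2 :=
  timeIntegrable_of_sobSq h.meas₂ ((lintegral_mono fun _ => le_add_self).trans_lt h.fin)

lemma CoefBound.timeIntegrable_rateB (hA : CoefBound t₀ T σ ρ K A)
    (hL : ∀ o b, ∫⁻ t in Icc t₀ T, sobSq ρ (A o b t) < ⊤) (h : Adm σ t₀ T Z) :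
    TimeIntegrable t₀ T (rateB A Z) :=
  h.timeIntegrable₁.distLaplacian.add ((hA.timeIntegrable_source hL h none).smul _)

lemma CoefBound.timeIntegrable_rateF (hA : CoefBound t₀ T σ ρ K A)
    (hL : ∀ o b, ∫⁻ t in Icc t₀ T, sobSq ρ (A o b t) < ⊤) (h : Adm σ t₀ T Z) :
    TimeIntegrable t₀ T (rateF A Z) :=
  h.timeIntegrable₂.distLaplacian.add
    (TimeIntegrable.sum fun i _ => (hA.timeIntegrable_source hL h (some i)).distPartial i)

lemma rateB_apply (A : Option (Fin d) → Option (Fin d) → ℝ → Coeffs d) (Z : ℝ → State d) (t : ℝ)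
    (k : Freq d) : rateB A Z t k = -(freqSq k : ℂ) * (Z t).1 k - source A Z none t k := by
  simp only [rateB, Pi.add_apply, Pi.smul_apply, smul_eq_mul, distLaplacian]
  ring

lemma rateF_apply (A : Option (Fin d) → Option (Fin d) → ℝ → Coeffs d) (Z : ℝ → State d) (t : ℝ)
    (k : Freq d) : rateF A Z t k = -(freqSq k : ℂ) * (Z t).2 k + flux A Z t k := rfl

/-- Integrated form of the linear system. -/
lemma CoefBound.isMild_iff (hA : CoefBound t₀ T σ ρ K A) (hK : K ≠ ⊤) (hT : t₀ ≤ T)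
    (hL : ∀ o b, ∫⁻ t in Icc t₀ T, sobSq ρ (A o b t) < ⊤) (h : Adm σ t₀ T Z) :
    IsMild A t₀ T w μ₀ Z ↔ ∀ t ∈ Icc t₀ T,
      (Z t).1 = w + (fun k => ∫ τ in t..T, rateB A Z τ k) ∧
      (Z t).2 = μ₀ + (fun k => ∫ τ in t₀..t, rateF A Z τ k) := by
  constructor
  · intro hZ t ht
    constructor <;> funext k
    · have := backward_integral_of_duhamel (v := fun t => (Z t).1) (w := w) hT
        (hA.integrable_source hK h none) (fun t ht => congrArg Prod.fst (hZ t ht)) t ht k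
      simpa only [rateB_apply, Pi.add_apply] using this
    · have := forward_integral_of_duhamel (v := fun t => (Z t).2) (w := μ₀) hT
        (hA.integrable_flux hK h) (fun t ht => congrArg Prod.snd (hZ t ht)) t ht k
      simpa only [rateF_apply, Pi.add_apply] using this
  · intro hZ t ht
    refine Prod.ext ?_ ?_
    · refine backward_duhamel_of_integral (v := fun t => (Z t).1) hT (fun k => ?_)
        (fun t ht k => ?_) t ht
      · simpa only [rateB_apply, Pi.add_apply] using (hA.timeIntegrable_rateB hL h).integrableOn k
      · simpa only [rateB_apply, Pi.add_apply] using congrFun (hZ t ht).1 k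
    · refine forward_duhamel_of_integral (v := fun t => (Z t).2) hT (fun k => ?_)
        (fun t ht k => ?_) t ht
      · simpa only [rateF_apply, Pi.add_apply] using (hA.timeIntegrable_rateF hL h).integrableOn k
      · simpa only [rateF_apply, Pi.add_apply] using congrFun (hZ t ht).2 k

variable {H : Hamiltonian d} {u m : ℝ → Pt d → ℝ} {ϑ : ℝ} {dG : CostKernel d}

lemma CoefBound.ae_rhs_eq (hA : CoefBound t₀ T σ ρ K (linCoef H u m ϑ))
    (hR : ∀ᵐ t ∂(volume.restrict (Icc t₀ T)), RegCoef H u m ρ t) (h : Adm σ t₀ T Z) :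
    ∀ᵐ t ∂(volume.restrict (Icc t₀ T)), ∀ φ : Pt d → ℂ, IsTest φ →
      backwardRHS H u m (fun t => (Z t).1) (fun t => (Z t).2) φ t =
        pair (rateB (linCoef H u m ϑ) Z t) φ ∧
      forwardRHS H u m ϑ (fun t => (Z t).1) (fun t => (Z t).2) φ t =
        pair (rateF (linCoef H u m ϑ) Z t) φ := by
  filter_upwards [hR, hA.ae_fin h, h.timeIntegrable₁.ae_tame, h.timeIntegrable₂.ae_tame]
    with t h1 h2 h3 h4 φ hφ
  exact ⟨h1.backwardRHS_eq hA.nonneg h2 h3 hφ, h1.forwardRHS_eq hA.nonneg h2 h4 hφ⟩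

/-- Weak solutions are mild solutions. -/
theorem SolvesLinearized.isMild (hA : CoefBound t₀ T σ ρ K (linCoef H u m ϑ)) (hK : K ≠ ⊤)
    (hT : t₀ ≤ T) (hL : ∀ o b, ∫⁻ t in Icc t₀ T, sobSq ρ (linCoef H u m ϑ o b t) < ⊤)
    (hR : ∀ᵐ t ∂(volume.restrict (Icc t₀ T)), RegCoef H u m ρ t) (h : Adm σ t₀ T Z)
    (hs : SolvesLinearized H u m dG ϑ t₀ T μ₀ (fun t => (Z t).1) fun t => (Z t).2) :
    IsMild (linCoef H u m ϑ) t₀ T (kernelAction (fun x y => dG x (m T) y) (Z T).2) μ₀ Z := by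
  rw [hA.isMild_iff hK hT hL h]
  have hae := hA.ae_rhs_eq hR h
  intro t ht
  have hTT : T ∈ Icc t₀ T := right_mem_Icc.2 hT
  have h0 : t₀ ∈ Icc t₀ T := left_mem_Icc.2 hT
  constructor <;> funext k
  -- Characters are test functions, and testing with `e^{-ik·x}` isolates the coefficient at `k`.
  · have h1 := (hs.backward _ (isTest_character (-k))).2 t ht
    rw [integral_congr_Icc (hae.mono fun _ h => (h _ (isTest_character (-k))).1) ht hTT] at h1
    simp only [pair_character] at h1
    rw [intervalIntegral.integral_const_mul, ← mul_add] at h1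
    exact mul_left_cancel₀ (two_pi_pow_ne_zero d) h1
  · have h1 := (hs.forward _ (isTest_character (-k))).2 t ht
    rw [integral_congr_Icc (hae.mono fun _ h => (h _ (isTest_character (-k))).2) h0 ht] at h1
    simp only [pair_character] at h1
    rw [intervalIntegral.integral_const_mul, ← mul_add] at h1
    exact mul_left_cancel₀ (two_pi_pow_ne_zero d) h1

/-- Mild solutions are weak solutions. -/
theorem IsMild.solvesLinearized (hA : CoefBound t₀ T σ ρ K (linCoef H u m ϑ)) (hK : K ≠ ⊤)
    (hT : t₀ ≤ T) (hL : ∀ o b, ∫⁻ t in Icc t₀ T, sobSq ρ (linCoef H u m ϑ o b t) < ⊤)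
    (hR : ∀ᵐ t ∂(volume.restrict (Icc t₀ T)), RegCoef H u m ρ t) (h : Adm σ t₀ T Z)
    (hμ₀ : Tame μ₀) (hw : Tame (kernelAction (fun x y => dG x (m T) y) (Z T).2))
    (hZ : IsMild (linCoef H u m ϑ) t₀ T (kernelAction (fun x y => dG x (m T) y) (Z T).2) μ₀ Z) :
    SolvesLinearized H u m dG ϑ t₀ T μ₀ (fun t => (Z t).1) fun t => (Z t).2 := by
  rw [hA.isMild_iff hK hT hL h] at hZ
  have hae := hA.ae_rhs_eq hR h
  have hTT : T ∈ Icc t₀ T := right_mem_Icc.2 hT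
  have h0 : t₀ ∈ Icc t₀ T := left_mem_Icc.2 hT
  refine ⟨fun φ hφ => ⟨?_, fun t ht => ?_⟩, fun φ hφ => ⟨?_, fun t ht => ?_⟩⟩
  · refine intervalIntegrable_of_Icc (Integrable.congr
      ((hA.timeIntegrable_rateB hL h).integrableOn_pair hφ) ?_) h0 hTT
    exact hae.mono fun _ h => (h φ hφ).1.symm
  · obtain ⟨h1, h2⟩ := (hA.timeIntegrable_rateB hL h).pair_integral hφ ht hTT
    rw [(hZ t ht).1, pair_add hw h1 hφ, h2]
    congr 1
    exact (integral_congr_Icc (hae.mono fun _ h => (h φ hφ).1) ht hTT).symm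
  · refine intervalIntegrable_of_Icc (Integrable.congr
      ((hA.timeIntegrable_rateF hL h).integrableOn_pair hφ) ?_) h0 hTT
    exact hae.mono fun _ h => (h φ hφ).2.symm
  · obtain ⟨h1, h2⟩ := (hA.timeIntegrable_rateF hL h).pair_integral hφ h0 ht
    rw [(hZ t ht).2, pair_add hμ₀ h1 hφ, h2]
    congr 1
    exact (integral_congr_Icc (hae.mono fun _ h => (h φ hφ).2) h0 ht).symm

end

/-! ## Kernel operators -/

/-- The `j`-th column of the matrix of a kernel operator. -/
def kernelCoef (k : Pt d → Pt d → ℝ) (j : Freq d) : Coeffs d :=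
  fourier fun x => ∫ y in cell d, (k x y : ℂ) * character j y

/-- The reflection `c ↦ conj (c (-·))`. -/
def reflect (c : Coeffs d) : Coeffs d := fun k => (starRingEnd ℂ) (c (-k))

lemma sobSq_reflect (σ : ℝ) (c : Coeffs d) : sobSq σ (reflect c) = sobSq σ c := by
  rw [sobSq_eq, sobSq_eq, ← (Equiv.neg (Freq d)).tsum_eq]
  refine tsum_congr fun k => ?_
  rw [Equiv.neg_apply, wt_neg_freq, reflect, neg_neg, ← ofReal_norm, ← ofReal_norm,
    RCLike.norm_conj]

lemma fourier_conj (f : Pt d → ℂ) :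
    fourier (fun x => (starRingEnd ℂ) (f x)) = reflect (fourier f) := by
  funext k
  rw [reflect, fourier, fourier, map_mul, Complex.conj_ofReal, ← integral_conj]
  congr 2
  funext x
  rw [map_mul, ← character_neg, neg_neg]

/-- The kernel bound is assumed for real functions, while the action on distributions is defined
through characters. Real and imaginary parts are therefore separated in `H^σ`, by means of the
reflection of Fourier coefficients. -/
lemma sobSq_fourierR_re_le (σ : ℝ) {f : Pt d → ℂ} (hf : Continuous f) :
    sobSq σ (fourierR fun x => (f x).re) ≤ 4 * sobSq σ (fourier f) := by
  have hc : Continuous fun x => (starRingEnd ℂ) (f x) := Complex.continuous_conj.comp hf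
  have e : fourierR (fun x => (f x).re) = (2⁻¹ : ℂ) • (fourier f + reflect (fourier f)) := by
    rw [fourierR, ← fourier_conj, ← fourier_add (integrableOn_cell_of_continuous hf)
      (integrableOn_cell_of_continuous hc), ← fourier_const_mul]
    congr 1
    funext x
    rw [Complex.re_eq_add_conj, div_eq_inv_mul]
  rw [e, sobSq_smul]
  have h1 : ‖(2⁻¹ : ℂ)‖ₑ ^ 2 ≤ 1 := by
    refine pow_le_one₀ bot_le ?_
    rw [← ofReal_norm, ENNReal.ofReal_le_one]
    norm_num
  calc _ ≤ 1 * (2 * sobSq σ (fourier f) + 2 * sobSq σ (reflect (fourier f))) := by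
        gcongr; exact sobSq_add_le _ _ _
    _ = _ := by rw [sobSq_reflect]; ring

lemma sobSq_fourierR_im_le (σ : ℝ) {f : Pt d → ℂ} (hf : Continuous f) :
    sobSq σ (fourierR fun x => (f x).im) ≤ 4 * sobSq σ (fourier f) := by
  have h := sobSq_fourierR_re_le σ (f := fun x => -Complex.I * f x) (continuous_const.mul hf)
  have e : ∀ x, (-Complex.I * f x).re = (f x).im := fun x => by simp
  simp only [e] at h
  rw [fourier_const_mul, sobSq_smul] at h
  simpa [← ofReal_norm] using h

/-- The bound `‖∫ k(·, y) μ(y) dy‖²_{H^σ} ≤ κ ‖μ‖²_{H^{σ-1}}` for smooth `μ`. -/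
structure KernelBound (σ : ℝ) (κ : ℝ≥0∞) (k : Pt d → Pt d → ℝ) : Prop where
  continuous : ∀ x, Continuous (k x)
  bound : ∀ μ : Pt d → ℝ, ContDiff ℝ ∞ μ → TorusPeriodic μ →
    MemSobFun σ (fun x => ∫ y in cell d, k x y * μ y) ∧
    sobSq σ (fourierR fun x => ∫ y in cell d, k x y * μ y) ≤ κ * sobSq (σ - 1) (fourierR μ)

section

variable {σ : ℝ} {κ : ℝ≥0∞} {k : Pt d → Pt d → ℝ}

lemma KernelBound.integrable (h : KernelBound σ κ k) (x : Pt d) {P : Pt d → ℂ} (hP : Continuous P) :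
    IntegrableOn (fun y => (k x y : ℂ) * P y) (cell d) :=
  integrableOn_cell_of_continuous ((Complex.continuous_ofReal.comp (h.continuous x)).mul hP)

/-- Real and imaginary parts are treated separately, at the cost of the factor `16 = 2 · 4 + 2 · 4`.
-/
lemma KernelBound.complex (h : KernelBound σ κ k) {P : Pt d → ℂ} (hP : IsTest P) :
    IntegrableOn (fun x => ∫ y in cell d, (k x y : ℂ) * P y) (cell d) ∧
    sobSq σ (fourier fun x => ∫ y in cell d, (k x y : ℂ) * P y) ≤
      16 * κ * sobSq (σ - 1) (fourier P) := by
  have hPc := hP.1.continuous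
  obtain ⟨⟨-, hr1, -⟩, hr2⟩ := h.bound (fun y => (P y).re) (Complex.reCLM.contDiff.comp hP.1)
    fun x l => by simp only [hP.2 x l]
  obtain ⟨⟨-, hi1, -⟩, hi2⟩ := h.bound (fun y => (P y).im) (Complex.imCLM.contDiff.comp hP.1)
    fun x l => by simp only [hP.2 x l]
  have hrc : ∀ x, Integrable (fun y => ((k x y * (P y).re : ℝ) : ℂ)) (volume.restrict (cell d)) :=
    fun x => (integrableOn_cell_of_continuous
      ((h.continuous x).mul (Complex.continuous_re.comp hPc))).ofReal
  have hic : ∀ x, Integrable (fun y => ((k x y * (P y).im : ℝ) : ℂ)) (volume.restrict (cell d)) :=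
    fun x => (integrableOn_cell_of_continuous
      ((h.continuous x).mul (Complex.continuous_im.comp hPc))).ofReal
  have e : (fun x => ∫ y in cell d, (k x y : ℂ) * P y) = fun x =>
      ((∫ y in cell d, k x y * (P y).re : ℝ) : ℂ) +
        Complex.I * ((∫ y in cell d, k x y * (P y).im : ℝ) : ℂ) := by
    funext x
    rw [← integral_complex_ofReal, ← integral_complex_ofReal, ← integral_const_mul,
      ← integral_add (hrc x) ((hic x).const_mul _)]
    refine integral_congr_ae (Filter.Eventually.of_forall fun y => ?_)
    simp only
    conv_lhs => rw [← Complex.re_add_im (P y)]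
    push_cast
    ring
  rw [e]
  refine ⟨hr1.ofReal.add (hi1.ofReal.const_mul _), ?_⟩
  have hR : IntegrableOn (fun x => ((∫ y in cell d, k x y * (P y).re : ℝ) : ℂ)) (cell d) :=
    hr1.ofReal
  have hI : IntegrableOn (fun x => Complex.I * ((∫ y in cell d, k x y * (P y).im : ℝ) : ℂ))
    (cell d) := hi1.ofReal.const_mul _
  rw [fourier_add hR hI, fourier_const_mul]
  refine (sobSq_add_le _ _ _).trans ?_
  rw [sobSq_smul, show ‖Complex.I‖ₑ = 1 by simp [← ofReal_norm], one_pow, one_mul]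
  calc _ ≤ 2 * (κ * (4 * sobSq (σ - 1) (fourier P))) + 2 * (κ * (4 * sobSq (σ - 1) (fourier P))) := by
        gcongr
        · refine hr2.trans ?_
          gcongr
          exact sobSq_fourierR_re_le _ hPc
        · refine hi2.trans ?_
          gcongr
          exact sobSq_fourierR_im_le _ hPc
    _ = _ := by ring

/-- A finite sum is the image of a trigonometric polynomial, which is smooth and so covered by the
kernel bound; restricting `c` to `s` does not increase its norm. -/
lemma KernelBound.sum_le (h : KernelBound σ κ k) (s : Finset (Freq d)) (c : Coeffs d) :
    sobSq σ (fun n => ∑ j ∈ s, c j * kernelCoef k j n) ≤ 16 * κ * sobSq (σ - 1) c := by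
  classical
  set P : Pt d → ℂ := fun y => ∑ j ∈ s, c j * character j y with hP
  have hPt : IsTest P := by
    refine ⟨ContDiff.sum fun j _ => contDiff_const.mul (contDiff_character j), fun x l => ?_⟩
    simp only [hP, character_periodic _ x l]
  have h1 : fourier (fun x => ∫ y in cell d, (k x y : ℂ) * P y) =
      fun n => ∑ j ∈ s, c j * kernelCoef k j n := by
    have e : ∀ x, ∫ y in cell d, (k x y : ℂ) * P y =
        ∑ j ∈ s, c j * ∫ y in cell d, (k x y : ℂ) * character j y := by
      intro x
      simp only [← integral_const_mul]
      rw [← integral_finsetSum _ fun j _ => (h.integrable x (continuous_character j)).const_mul _]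
      congr 1
      funext y
      simp only [hP, Finset.mul_sum]
      exact Finset.sum_congr rfl fun j _ => mul_left_comm _ _ _
    simp only [e]
    rw [fourier_sum s fun j _ => (h.complex (isTest_character j)).1.const_mul _]
    funext n
    simp only [fourier_const_mul, Finset.sum_apply, Pi.smul_apply, smul_eq_mul, kernelCoef]
  have h2 : fourier P = fun n => if n ∈ s then c n else 0 := by
    have hj : ∀ j ∈ s, IntegrableOn (fun y => c j * character j y) (cell d) := fun j _ =>
      integrableOn_cell_of_continuous (continuous_const.mul (continuous_character j))
    rw [hP, fourier_sum s hj]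
    funext n
    simp only [fourier_const_mul, fourier_character, Finset.sum_apply, Pi.smul_apply, smul_eq_mul,
      Pi.single_apply, mul_ite, mul_one, mul_zero, Finset.sum_ite_eq]
  rw [← h1]
  refine (h.complex hPt).2.trans ?_
  gcongr
  refine sobSq_le_of_enorm_le fun n => ?_
  rw [h2]
  by_cases hn : n ∈ s <;> simp [hn]

/-- The bound for finite sums holds for all phases of `c`. Rotating each `c j` so that every term at
the fixed frequency `n` becomes nonnegative does not increase the norm of `c`, and turns the bound
for the sum into one for the sum of absolute values. -/
lemma KernelBound.summable (h : KernelBound σ κ k) (hκ : κ ≠ ⊤) {c : Coeffs d}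
    (hc : sobSq (σ - 1) c < ⊤) (n : Freq d) : Summable fun j => c j * kernelCoef k j n := by
  refine summable_of_tsum_enorm_lt_top ?_
  set B := 16 * κ * sobSq (σ - 1) c with hB
  have hBt : B < ⊤ := by finiteness
  have hs : ∀ s : Finset (Freq d), ∑ j ∈ s, ‖c j * kernelCoef k j n‖ₑ ≤ 1 + wt (-σ) n * B := by
    intro s
    set e : Coeffs d := fun j => (‖c j‖ : ℂ) *
      ((starRingEnd ℂ) (kernelCoef k j n) / (‖kernelCoef k j n‖ : ℂ)) with he
    have he1 : ∀ j, ‖e j‖ₑ ≤ ‖c j‖ₑ := by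
      intro j
      rw [← ofReal_norm, ← ofReal_norm]
      refine ENNReal.ofReal_le_ofReal ?_
      simp only [he, norm_mul, norm_div, Complex.norm_real, norm_norm, RCLike.norm_conj]
      exact mul_le_of_le_one_right (norm_nonneg _) (div_self_le_one _)
    have he2 : ∀ j, e j * kernelCoef k j n = ((‖c j * kernelCoef k j n‖ : ℝ) : ℂ) := by
      intro j
      simp only [he, norm_mul]
      rcases eq_or_ne (kernelCoef k j n) 0 with h0 | h0
      · simp [h0]
      · have h0' : ((‖kernelCoef k j n‖ : ℝ) : ℂ) ≠ 0 := by
          exact_mod_cast norm_ne_zero_iff.2 h0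
        rw [mul_assoc, div_mul_eq_mul_div, mul_comm ((starRingEnd ℂ) _), Complex.mul_conj,
          Complex.normSq_eq_norm_sq]
        push_cast
        field_simp
    have h1 := (wt_mul_enorm_sq_le σ _ n).trans ((h.sum_le s e).trans
      (mul_le_mul_right (sobSq_le_of_enorm_le he1) _))
    simp only [he2] at h1
    rw [← Complex.ofReal_sum, ← ofReal_norm, Complex.norm_real, Real.norm_of_nonneg
      (Finset.sum_nonneg fun _ _ => norm_nonneg _), ENNReal.ofReal_sum_of_nonneg
      fun _ _ => norm_nonneg _] at h1
    simp only [ofReal_norm] at h1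
    have hle : ∀ x : ℝ≥0∞, x ≤ 1 + x ^ 2 := fun x => by
      rcases le_total x 1 with h | h
      · exact h.trans le_self_add
      · refine le_trans ?_ le_add_self
        rw [sq]
        exact le_mul_of_one_le_left bot_le h
    refine (hle _).trans ?_
    gcongr
    calc _ = wt (-σ) n * (wt σ n * (∑ j ∈ s, ‖c j * kernelCoef k j n‖ₑ) ^ 2) := by
          rw [← mul_assoc, wt_neg_mul, one_mul]
      _ ≤ _ := by gcongr
  have hW := wt_ne_top (-σ) n
  refine lt_of_le_of_lt ?_ (show 1 + wt (-σ) n * B < ⊤ by finiteness)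
  rw [ENNReal.tsum_eq_iSup_sum]
  exact iSup_le hs

/-- Kernel operators gain one derivative on Sobolev spaces. -/
theorem KernelBound.terminalOp (h : KernelBound σ κ k) (hκ : κ ≠ ⊤) :
    TerminalOp (σ - 1) (16 * κ) (kernelAction k) where
  bound c hc := by
    rw [sub_add_cancel]
    refine sobSq_le_of_tendsto (l := Filter.atTop) (fun n => (h.summable hκ hc n).hasSum) ?_
    exact Filter.Eventually.of_forall fun s => h.sum_le s c
  add a b ha hb := by
    funext n
    change ∑' j, (a + b) j * kernelCoef k j n =
      ∑' j, a j * kernelCoef k j n + ∑' j, b j * kernelCoef k j n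
    rw [← (h.summable hκ ha n).tsum_add (h.summable hκ hb n)]
    simp only [Pi.add_apply, add_mul]
  real c hc hr n := by
    have hk : ∀ j, kernelCoef k (-j) (-n) = (starRingEnd ℂ) (kernelCoef k j n) := by
      intro j
      have e : (fun x => ∫ y in cell d, (k x y : ℂ) * character (-j) y) =
          fun x => (starRingEnd ℂ) (∫ y in cell d, (k x y : ℂ) * character j y) := by
        funext x
        rw [← integral_conj]
        congr 1
        funext y
        rw [map_mul, Complex.conj_ofReal, character_neg]
      rw [kernelCoef, e, fourier_conj, reflect, neg_neg, kernelCoef]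
    change ∑' j, c j * kernelCoef k j (-n) = (starRingEnd ℂ) (∑' j, c j * kernelCoef k j n)
    rw [Complex.conj_tsum, ← (Equiv.neg (Freq d)).tsum_eq]
    refine tsum_congr fun j => ?_
    rw [Equiv.neg_apply, map_mul, ← hk, hr]

end

/-! ### Low and high frequencies at the terminal time -/

/-- Frequencies at most `Λ` of a distribution. -/
def lowPart (Λ : ℝ) (c : Coeffs d) : Coeffs d := fun k => if 1 + freqSq k ≤ Λ then c k else 0

lemma sobSq_lowPart_le (Λ : ℝ) {σ τ : ℝ} (h : τ ≤ σ) (c : Coeffs d) :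
    sobSq σ (lowPart Λ c) ≤ ENNReal.ofReal (Λ ^ (σ - τ)) * sobSq τ c := by
  rw [sobSq_eq, sobSq_eq, ← ENNReal.tsum_mul_left]
  refine ENNReal.tsum_le_tsum fun k => ?_
  by_cases hk : 1 + freqSq k ≤ Λ
  · rw [lowPart, if_pos hk, ← mul_assoc, show σ = (σ - τ) + τ by ring, wt_add,
      show (σ - τ) + τ - τ = σ - τ by ring]
    gcongr
    exact ENNReal.ofReal_le_ofReal
      (Real.rpow_le_rpow (one_add_freqSq_pos k).le hk (by linarith))
  · simp [lowPart, hk]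

lemma sobSq_sub_lowPart_le (Λ : ℝ) (hΛ : 0 < Λ) {σ τ : ℝ} (h : σ ≤ τ) (c : Coeffs d) :
    sobSq σ (c - lowPart Λ c) ≤ ENNReal.ofReal (Λ ^ (σ - τ)) * sobSq τ c := by
  rw [sobSq_eq, sobSq_eq, ← ENNReal.tsum_mul_left]
  refine ENNReal.tsum_le_tsum fun k => ?_
  by_cases hk : 1 + freqSq k ≤ Λ
  · simp [lowPart, hk]
  · rw [Pi.sub_apply, lowPart, if_neg hk, sub_zero, ← mul_assoc, show σ = (σ - τ) + τ by ring, wt_add,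
      show (σ - τ) + τ - τ = σ - τ by ring]
    gcongr
    exact ENNReal.ofReal_le_ofReal
      (Real.rpow_le_rpow_of_nonpos hΛ (not_le.1 hk).le (by linarith))

/-- Smallness of the terminal operator in `L²` of time, for short times. -/
lemma TerminalOp.lintegral_heatFlow_le {σ σ' t₀ T : ℝ} {κ κ' : ℝ≥0∞} {Θ : Coeffs d → Coeffs d}
    (h : TerminalOp (σ - 1) κ Θ) (h' : TerminalOp σ' κ' Θ) (hσ : σ ≤ σ') {Λ : ℝ} (hΛ : 0 < Λ)
    {c : Coeffs d} (hc : sobSq σ c < ⊤) :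
    ∫⁻ t in Icc t₀ T, sobSq (σ + 1) (heatFlow (T - t) (Θ c)) ≤
      (2 * ((ENNReal.ofReal (T - t₀) + 1) * (κ * ENNReal.ofReal (Λ ^ (-1 : ℝ)))) +
        2 * (ENNReal.ofReal (T - t₀) * (κ' * ENNReal.ofReal (Λ ^ (σ' - σ))))) * sobSq σ c := by
  -- The first bound alone puts `Θ c` in `H^σ`, and its heat flow in `L² H^{σ+1}` without a small
  -- factor. For the high frequencies `a`, measuring an element of `H^σ` in `H^{σ-1}` gains
  -- `Λ^{-1}`. The low frequencies `b` are regular, and for them the second bound, at order `σ'`,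
  -- lets the length of the interval give the smallness once `Λ` is fixed.
  set a := c - lowPart Λ c with ha
  set b := lowPart Λ c with hb
  have ha1 : sobSq (σ - 1) a ≤ ENNReal.ofReal (Λ ^ (-1 : ℝ)) * sobSq σ c := by
    have := sobSq_sub_lowPart_le Λ hΛ (σ := σ - 1) (τ := σ) (by linarith) c
    rwa [show σ - 1 - σ = -1 by ring] at this
  have hb1 : sobSq σ' b ≤ ENNReal.ofReal (Λ ^ (σ' - σ)) * sobSq σ c :=
    sobSq_lowPart_le Λ hσ c
  have ha2 : sobSq (σ - 1) a < ⊤ := ha1.trans_lt (by finiteness)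
  have hb2 : sobSq σ' b < ⊤ := hb1.trans_lt (by finiteness)
  have hΘ : Θ c = Θ a + Θ b := by
    rw [← h.add a b ha2 ((sobSq_mono (by linarith) _).trans_lt hb2), ha, hb, sub_add_cancel]
  have h1 : ∫⁻ t in Icc t₀ T, sobSq (σ + 1) (heatFlow (T - t) (Θ a)) ≤
      (ENNReal.ofReal (T - t₀) + 1) * (κ * (ENNReal.ofReal (Λ ^ (-1 : ℝ)) * sobSq σ c)) := by
    refine (lintegral_sobSq_backward_le σ t₀ T (Θ a)).trans ?_
    gcongr
    have := h.bound a ha2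
    rw [sub_add_cancel] at this
    exact this.trans (by gcongr)
  have h2 : ∫⁻ t in Icc t₀ T, sobSq (σ + 1) (heatFlow (T - t) (Θ b)) ≤
      ENNReal.ofReal (T - t₀) * (κ' * (ENNReal.ofReal (Λ ^ (σ' - σ)) * sobSq σ c)) := by
    calc _ ≤ ∫⁻ _t in Icc t₀ T, κ' * (ENNReal.ofReal (Λ ^ (σ' - σ)) * sobSq σ c) := by
          refine setLIntegral_mono' measurableSet_Icc fun t ht => ?_
          refine (sobSq_heatFlow_le _ (sub_nonneg.2 ht.2) _).trans ?_
          exact (sobSq_mono (by linarith) _).trans ((h'.bound b hb2).trans (by gcongr))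
      _ = _ := by rw [setLIntegral_const, Real.volume_Icc, mul_comm]
  calc _ ≤ ∫⁻ t in Icc t₀ T, (2 * sobSq (σ + 1) (heatFlow (T - t) (Θ a)) +
        2 * sobSq (σ + 1) (heatFlow (T - t) (Θ b))) := by
        refine lintegral_mono fun t => ?_
        rw [hΘ, heatFlow_add]
        exact sobSq_add_le _ _ _
    _ = 2 * (∫⁻ t in Icc t₀ T, sobSq (σ + 1) (heatFlow (T - t) (Θ a))) +
        2 * ∫⁻ t in Icc t₀ T, sobSq (σ + 1) (heatFlow (T - t) (Θ b)) := by
        rw [lintegral_add_left' ((aemeasurable_sobSq (measTime_backward t₀ T _) _).const_mul _),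
          lintegral_const_mul' _ _ (by norm_num), lintegral_const_mul' _ _ (by norm_num)]
    _ ≤ _ := by
        refine (add_le_add (mul_le_mul_right h1 2) (mul_le_mul_right h2 2)).trans (le_of_eq ?_)
        ring

/-! ## The terminal density -/

lemma distLaplacian_eq_sum (c : Coeffs d) :
    distLaplacian c = ∑ i, distPartial i (distPartial i c) := by
  funext k
  simp only [distLaplacian, Finset.sum_apply, distPartial, freqSq]
  push_cast
  rw [← Finset.sum_neg_distrib, Finset.sum_mul]
  refine Finset.sum_congr rfl fun i _ => ?_
  linear_combination (-(k i : ℂ) ^ 2 * c k) * Complex.I_sq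

lemma sobSq_sum_distPartial_le (σ : ℝ) (a : Fin d → Coeffs d) :
    sobSq σ (∑ i, distPartial i (a i)) ≤ d * ∑ i, sobSq (σ + 1) (a i) := by
  refine (sobSq_sum_le _ _ _).trans ?_
  rw [Finset.card_univ, Fintype.card_fin]
  gcongr
  exact sobSq_distPartial_le _ _ _

lemma continuousOn_fourierR {t₀ T : ℝ} (hT : t₀ ≤ T) {f : ℝ → Pt d → ℝ}
    (hf : ContinuousOn (fun z : ℝ × Pt d => f z.1 z.2) (Icc t₀ T ×ˢ univ)) (k : Freq d) :
    ContinuousOn (fun t => fourierR (f t) k) (Icc t₀ T) := by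
  have h : Continuous fun t => fourierR (f (projIcc t₀ T hT t)) k := by
    unfold fourierR fourier
    refine continuous_const.mul (continuous_parametric_integral_of_continuous ?_ (isCompact_cell d))
    exact ((continuous_character (-k)).comp continuous_snd).mul
      (Complex.continuous_ofReal.comp (continuous_projIcc_comp hT hf))
  refine h.continuousOn.congr fun t ht => ?_
  simp only [projIcc_of_mem hT ht]

/-- The good times are dense, and Sobolev norms are lower semicontinuous under convergence of the
coefficients; so the bound holds at every interior time. -/
lemma sobSq_le_of_ae {σ t₀ T : ℝ} {c : ℝ → Coeffs d} {B : ℝ≥0∞}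
    (hc : ∀ k, ContinuousOn (fun t => c t k) (Icc t₀ T))
    (hB : ∀ᵐ t ∂(volume.restrict (Icc t₀ T)), sobSq σ (c t) ≤ B) :
    ∀ t ∈ Ioo t₀ T, sobSq σ (c t) ≤ B := by
  intro t ht
  rw [ae_restrict_iff' measurableSet_Icc] at hB
  have hd := Measure.dense_of_ae hB
  have hne : (nhdsWithin t {x | x ∈ Icc t₀ T → sobSq σ (c x) ≤ B}).NeBot :=
    mem_closure_iff_nhdsWithin_neBot.1 (hd t)
  refine sobSq_le_of_tendsto (l := nhdsWithin t {x | x ∈ Icc t₀ T → sobSq σ (c x) ≤ B}) (c := c)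
    (fun k => ((hc k).continuousAt (Icc_mem_nhds ht.1 ht.2)).tendsto.mono_left
      nhdsWithin_le_nhds) ?_
  filter_upwards [self_mem_nhdsWithin, nhdsWithin_le_nhds (Ioo_mem_nhds ht.1 ht.2)] with x hx hx'
  exact hx (Ioo_subset_Icc_self hx')

lemma IsMFGSolution.slice {s t₀ T M : ℝ} {H : Hamiltonian d} {G : FinalCost d} {m₀ : Pt d → ℝ}
    {u m : ℝ → Pt d → ℝ} (hsol : IsMFGSolution s H G t₀ T m₀ u m) (hb : MFGBound s t₀ T M u m)
    (hT : t₀ ≤ T) {t : ℝ} (ht : t ∈ Ioo t₀ T) : Slice s M (u t) (m t) :=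
  have ht' := Ioo_subset_Icc_self ht
  ⟨hsol.contDiff_u t ht, hsol.contDiff_m t ht, hsol.periodic_u t ht', hsol.periodic_m t ht',
    hsol.nonneg_m t ht', sobSq_le_of_ae (continuousOn_fourierR hT hsol.continuous_u) hb.linf_u t ht,
    sobSq_le_of_ae (continuousOn_fourierR hT hsol.continuous_m) hb.linf_m t ht⟩

/-- The density flux `m D_pH(t, x, ∇u, m)`. -/
def drift (H : Hamiltonian d) (t : ℝ) (u m : Pt d → ℝ) (i : Fin d) (x : Pt d) : ℝ :=
  m x * along (Hp H i) t u m x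

/-- The time derivative of the density. -/
def densityRate (H : Hamiltonian d) (t : ℝ) (u m : Pt d → ℝ) (x : Pt d) : ℝ :=
  laplacian m x + ∑ i, pderiv i (drift H t u m i) x

section

variable {s M T₀ : ℝ} {H : Hamiltonian d} {t : ℝ} {u m : Pt d → ℝ}

lemma Slice.contDiff_drift (h : Slice s M u m) {n : ℕ} (hH : HamiltonianRegular T₀ (n + 1 + 1) H)
    (ht : t ∈ Icc 0 T₀) (i : Fin d) : ContDiff ℝ 1 (drift H t u m i) := by
  have hw : ∀ b, ContDiff ℝ 1 (stateCurve u m b) := by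
    intro b
    cases b with
    | none => exact h.contDiff_m.of_le (by norm_num)
    | some j => exact h.contDiff_u.pderiv (by norm_num) j
  refine (h.contDiff_m.of_le (by norm_num)).mul ?_
  rw [along_eq]
  exact (((hH.Hp i).contDiff t ht).of_le (by norm_cast; omega)).comp_contDiff (contDiff_curve hw)
    h.nonneg

lemma Slice.periodic_drift (h : Slice s M u m) {n : ℕ} (hH : HamiltonianRegular T₀ (n + 1 + 1) H)
    (ht : t ∈ Icc 0 T₀) (i : Fin d) : TorusPeriodic (drift H t u m i) := fun x k => by
  rw [drift, h.periodic_m x k, h.periodic_along (hH.Hp i) ht x k, drift]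

lemma Slice.continuous_laplacian (h : Slice s M u m) : Continuous (laplacian m) :=
  continuous_finsetSum _ fun i _ =>
    ((h.contDiff_m.pderiv (m := 1) (by norm_num) i).pderiv (m := 0) (by norm_num) i).continuous

lemma Slice.continuous_densityRate (h : Slice s M u m) {n : ℕ}
    (hH : HamiltonianRegular T₀ (n + 1 + 1) H) (ht : t ∈ Icc 0 T₀) :
    Continuous (densityRate H t u m) :=
  h.continuous_laplacian.add (continuous_finsetSum _ fun i _ =>
    ((h.contDiff_drift hH ht i).pderiv (m := 0) (by norm_num) i).continuous)

lemma Slice.periodic_densityRate (h : Slice s M u m) {n : ℕ}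
    (hH : HamiltonianRegular T₀ (n + 1 + 1) H) (ht : t ∈ Icc 0 T₀) :
    TorusPeriodic (densityRate H t u m) := fun x k => by
  have h1 := fun i => (h.periodic_m.pderiv i).pderiv i x k
  have h2 := fun i => (h.periodic_drift hH ht i).pderiv i x k
  simp only [densityRate, laplacian, h2]
  congr 1
  exact Finset.sum_congr rfl fun i _ => h1 i

lemma Slice.fourierR_densityRate (h : Slice s M u m) {n : ℕ}
    (hH : HamiltonianRegular T₀ (n + 1 + 1) H) (ht : t ∈ Icc 0 T₀) :
    fourierR (densityRate H t u m) =
      distLaplacian (fourierR m) + ∑ i, distPartial i (fourierR (drift H t u m i)) := by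
  have h1 : ∀ i, fourierR (pderiv i (drift H t u m i)) =
      distPartial i (fourierR (drift H t u m i)) := fun i =>
    fourierR_pderiv (h.contDiff_drift hH ht i) (h.periodic_drift hH ht i) i
  have h2 : ∀ i, fourierR (pderiv i (pderiv i m)) = distPartial i (distPartial i (fourierR m)) :=
    fun i => by
      rw [fourierR_pderiv (h.contDiff_m.pderiv (by norm_num) i) (h.periodic_m.pderiv i),
        fourierR_pderiv (h.contDiff_m.of_le (by norm_num)) h.periodic_m]
  have hc1 : ∀ i ∈ Finset.univ, IntegrableOn (pderiv i (drift H t u m i)) (cell d) := fun i _ =>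
    integrableOn_cell_of_continuous
      ((h.contDiff_drift hH ht i).pderiv (m := 0) (by norm_num) i).continuous
  have hc2 : ∀ i ∈ Finset.univ, IntegrableOn (pderiv i (pderiv i m)) (cell d) := fun i _ =>
    integrableOn_cell_of_continuous
      ((h.contDiff_m.pderiv (m := 1) (by norm_num) i).pderiv (m := 0) (by norm_num) i).continuous
  have e1 : fourierR (fun x => ∑ i, pderiv i (drift H t u m i) x) =
      ∑ i, distPartial i (fourierR (drift H t u m i)) := by
    rw [fourierR_sum _ hc1]
    exact Finset.sum_congr rfl fun i _ => h1 i
  have e2 : fourierR (laplacian m) = distLaplacian (fourierR m) := by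
    rw [distLaplacian_eq_sum]
    refine (fourierR_sum _ hc2).trans ?_
    exact Finset.sum_congr rfl fun i _ => h2 i
  have hi1 : IntegrableOn (fun x => ∑ i, pderiv i (drift H t u m i) x) (cell d) :=
    integrable_finsetSum _ hc1
  have := fourierR_add (integrableOn_cell_of_continuous h.continuous_laplacian) hi1
  rw [e1, e2] at this
  exact this

end

/-- The rate of change of the density is bounded. -/
lemma exists_abs_densityRate_le {s : ℝ} (hs : Admissible d s) (M : ℝ) {T₀ : ℝ} {n : ℕ}
    {H : Hamiltonian d} (hH : HamiltonianRegular T₀ (n + 1 + 1) H) (hn : s ≤ n + 1) :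
    ∃ B : ℝ, ∀ t ∈ Icc 0 T₀, ∀ u m : Pt d → ℝ, Slice s M u m → ∀ x,
      |densityRate H t u m x| ≤ B := by
  have h1 := fun i => exists_sobSq_mul_along_le hs M (hH.Hp i) (σ := s - 1) le_rfl (by linarith)
  choose C hC using h1
  set D : ℝ≥0∞ := 1 + (ENNReal.ofReal (M ^ 2) + ENNReal.ofReal (M ^ 2)) with hD
  have hw : wtSum d (s - 3) < ⊤ := wtSum_lt_top hs.half_lt
  set E : ℝ≥0∞ := wtSum d (s - 3) * (2 * (d * ∑ _i : Fin d, ENNReal.ofReal (M ^ 2)) +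
    2 * (d * ∑ i, C i * D)) with hE
  have hEt : E < ⊤ := by
    have hS : ∑ i, (C i : ℝ≥0∞) * D < ⊤ := ENNReal.sum_lt_top.2 fun i _ => by finiteness
    have hS' : ∑ _i : Fin d, ENNReal.ofReal (M ^ 2) < ⊤ :=
      ENNReal.sum_lt_top.2 fun i _ => by finiteness
    finiteness
  refine ⟨(1 + E).toReal, fun t ht u m h x => ?_⟩
  -- The Laplacian takes `m` from order `s - 1` to `s - 3`, which is still above `d / 2`.
  have h2 : sobSq (s - 3) (fourierR (densityRate H t u m)) ≤
      2 * (d * ∑ _i : Fin d, ENNReal.ofReal (M ^ 2)) + 2 * (d * ∑ i, C i * D) := by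
    rw [h.fourierR_densityRate hH ht, distLaplacian_eq_sum]
    refine (sobSq_add_le _ _ _).trans ?_
    gcongr
    · refine (sobSq_sum_distPartial_le _ _).trans ?_
      gcongr with i
      refine (sobSq_distPartial_le _ _ _).trans ?_
      rw [show s - 3 + 1 + 1 = s - 1 by ring]
      exact h.bound_m
    · refine (sobSq_sum_distPartial_le _ _).trans ?_
      gcongr with i
      refine (sobSq_mono (by linarith) _).trans ((hC i t ht u m h).trans ?_)
      gcongr
      exact h.bound_sum le_rfl
  have h3 : wien 0 (fourierR (densityRate H t u m)) ≤ 1 + E := by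
    have h4 := wien_sq_le 0 (s - 3) (fourierR (densityRate H t u m))
    rw [zero_add] at h4
    replace h4 := h4.trans (mul_le_mul_right h2 _)
    rcases le_total (wien 0 (fourierR (densityRate H t u m))) 1 with h5 | h5
    · exact h5.trans le_self_add
    · refine le_trans ?_ (h4.trans le_add_self)
      rw [sq]
      exact le_mul_of_one_le_left bot_le h5
  have h5 := (norm_le_wien (h.continuous_densityRate hH ht) (h.periodic_densityRate hH ht) x).trans
    h3
  have hEt' : 1 + E ≠ ⊤ := by finiteness
  exact (ENNReal.ofReal_le_iff_le_toReal hEt').1 h5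

/-! ### The Fokker–Planck equation for Fourier coefficients -/

section

variable {s t₀ T M T₀ : ℝ} {H : Hamiltonian d} {G : FinalCost d} {m₀ : Pt d → ℝ}
  {u m : ℝ → Pt d → ℝ}

/-- Differentiation under the integral. A classical solution satisfies the equation pointwise, with
no bound on its time derivative; the domination comes from the Sobolev bounds, through
`exists_abs_densityRate_le`. -/
lemma IsMFGSolution.hasDerivAt_fourierR (hs : Admissible d s) (h₀ : 0 ≤ t₀) (hT : t₀ ≤ T)
    (hTT : T ≤ T₀) {n : ℕ} (hH : HamiltonianRegular T₀ (n + 1 + 1) H) (hn : s ≤ n + 1)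
    (hsol : IsMFGSolution s H G t₀ T m₀ u m) (hb : MFGBound s t₀ T M u m) (k : Freq d) {t : ℝ}
    (ht : t ∈ Ioo t₀ T) :
    HasDerivAt (fun τ => fourierR (m τ) k) (fourierR (densityRate H t (u t) (m t)) k) t := by
  obtain ⟨B, hB⟩ := exists_abs_densityRate_le hs M hH hn
  have hI : ∀ τ ∈ Ioo t₀ T, τ ∈ Icc 0 T₀ := fun τ hτ =>
    ⟨h₀.trans hτ.1.le, hτ.2.le.trans hTT⟩
  have hsl : ∀ τ ∈ Ioo t₀ T, Slice s M (u τ) (m τ) := fun τ hτ => hsol.slice hb hT hτ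
  have hc : ∀ τ ∈ Ioo t₀ T, Continuous fun x => character (-k) x * ((m τ x : ℝ) : ℂ) := fun τ hτ =>
    (continuous_character _).mul (Complex.continuous_ofReal.comp (hsl τ hτ).contDiff_m.continuous)
  have hc' : Continuous fun x =>
      character (-k) x * ((densityRate H t (u t) (m t) x : ℝ) : ℂ) :=
    (continuous_character _).mul
      (Complex.continuous_ofReal.comp ((hsl t ht).continuous_densityRate hH (hI t ht)))
  refine HasDerivAt.const_mul _ (hasDerivAt_integral_of_dominated_loc_of_deriv_le
    (F := fun τ x => character (-k) x * ((m τ x : ℝ) : ℂ))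
    (F' := fun τ x => character (-k) x * ((densityRate H τ (u τ) (m τ) x : ℝ) : ℂ))
    (bound := fun _ => B) (Ioo_mem_nhds ht.1 ht.2) ?_ (integrableOn_cell_of_continuous (hc t ht))
    hc'.aestronglyMeasurable ?_ (integrableOn_cell_of_continuous continuous_const) ?_).2
  · filter_upwards [Ioo_mem_nhds ht.1 ht.2] with τ hτ using (hc τ hτ).aestronglyMeasurable
  · refine Filter.Eventually.of_forall fun x τ hτ => ?_
    rw [norm_mul, norm_character, one_mul, Complex.norm_real]
    exact hB τ (hI τ hτ) _ _ (hsl τ hτ) x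
  · refine Filter.Eventually.of_forall fun x τ hτ => ?_
    exact ((hsol.fokkerPlanck τ hτ x).ofReal_comp).const_mul _

/-- The source of the Fokker–Planck equation. -/
def driftSource (H : Hamiltonian d) (u m : ℝ → Pt d → ℝ) (t : ℝ) : Coeffs d :=
  ∑ i, distPartial i (fourierR (drift H t (u t) (m t) i))

lemma IsMFGSolution.measTime_drift (h₀ : 0 ≤ t₀) (hT : t₀ ≤ T) (hTT : T ≤ T₀) {n : ℕ}
    (hH : HamiltonianRegular T₀ (n + 1) H) (hsol : IsMFGSolution s H G t₀ T m₀ u m) (i : Fin d) :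
    MeasTime t₀ T fun t => fourierR (drift H t (u t) (m t) i) := fun k =>
  ((hsol.jointMeas_m hT).mul (hsol.jointMeas_along h₀ hT hTT (hH.Hp i))).fourierR k

/-- Duhamel's formula for the density. -/
lemma IsMFGSolution.density_duhamel (hs : Admissible d s) (h₀ : 0 ≤ t₀) (hT : t₀ ≤ T)
    (hTT : T ≤ T₀) {n : ℕ} (hH : HamiltonianRegular T₀ (n + 1 + 1) H) (hn : s ≤ n + 1)
    (hsol : IsMFGSolution s H G t₀ T m₀ u m) (hb : MFGBound s t₀ T M u m) :
    fourierR (m T) = heatFlow (T - t₀) (fourierR m₀) + duhF t₀ (driftSource H u m) T := by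
  obtain ⟨B, hB⟩ := exists_abs_densityRate_le hs M hH hn
  have hI : ∀ τ ∈ Ioo t₀ T, τ ∈ Icc 0 T₀ := fun τ hτ =>
    ⟨h₀.trans hτ.1.le, hτ.2.le.trans hTT⟩
  have hcont := continuousOn_fourierR hT hsol.continuous_m
  have hrate : ∀ k, ∀ τ ∈ Ioo t₀ T, fourierR (densityRate H τ (u τ) (m τ)) k =
      -(freqSq k : ℂ) * fourierR (m τ) k + driftSource H u m τ k := fun k τ hτ => by
    rw [(hsol.slice hb hT hτ).fourierR_densityRate hH (hI τ hτ)]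
    rfl
  have hmeas : MeasTime t₀ T (driftSource H u m) :=
    MeasTime.sum fun i _ => (hsol.measTime_drift h₀ hT hTT hH i).distPartial i
  have hint : ∀ k, IntegrableOn
      (fun τ => -(freqSq k : ℂ) * fourierR (m τ) k + driftSource H u m τ k) (Icc t₀ T) := by
    intro k
    refine Integrable.of_bound (C := B) ?_ ?_
    · exact (((hcont k).aestronglyMeasurable measurableSet_Icc).const_mul _).add (hmeas k)
    · rw [← restrict_Ioo_eq_restrict_Icc]
      filter_upwards [ae_restrict_mem measurableSet_Ioo] with τ hτ
      rw [← hrate k τ hτ]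
      refine norm_fourier_le_of_bound (fun x _ => ?_) k
      rw [Complex.norm_real]
      exact hB τ (hI τ hτ) _ _ (hsol.slice hb hT hτ) x
  refine forward_duhamel_of_integral (v := fun t => fourierR (m t)) hT hint (fun t ht k => ?_) T
    (right_mem_Icc.2 hT)
  have hsub : Icc t₀ t ⊆ Icc t₀ T := Icc_subset_Icc_right ht.2
  rw [intervalIntegral.integral_eq_sub_of_hasDerivAt_of_le ht.1 ((hcont k).mono hsub)
    (fun τ hτ => ?_) ?_, hsol.initial]
  · ring
  · rw [intervalIntegrable_iff_integrableOn_Icc_of_le ht.1]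
    exact (hint k).mono_set hsub
  · have hτ' : τ ∈ Ioo t₀ T := ⟨hτ.1, hτ.2.trans_le ht.2⟩
    rw [← hrate k τ hτ']
    exact hsol.hasDerivAt_fourierR hs h₀ hT hTT hH hn hb k hτ'

end

lemma sobSq_duhF_le_lintegral {σ t₀ T : ℝ} {S : ℝ → Coeffs d} (hS : MeasTime t₀ T S) {t : ℝ}
    (ht : t ∈ Icc t₀ T) :
    sobSq (σ + 1) (duhF t₀ S t) ≤
      (ENNReal.ofReal (T - t₀) + 1) * ∫⁻ τ in Icc t₀ T, sobSq σ (S τ) := by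
  have h := duhamel_sq_le (g := fun k τ => wt (σ / 2) k * ‖S τ k‖ₑ)
    (fun k => (hS k).enorm.const_mul _) t
  simp only [← sobSq_eq_sq] at h
  refine le_trans ?_ h
  rw [sobSq_eq]
  refine ENNReal.tsum_le_tsum fun k => ?_
  simp only [mul_left_comm (heat k t _) (wt (σ / 2) k)]
  rw [lintegral_const_mul' _ _ (wt_ne_top _ _), mul_pow, wt_half_sq, ← mul_assoc, ← wt_add,
    add_comm 1 σ]
  gcongr
  exact enorm_duhF_le ht k

/-- The terminal density belongs to a ball of `H^s` that depends only on the bounds. -/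
theorem exists_terminal_mem_densityBall {s : ℝ} (hs : Admissible d s) {T₀ : ℝ} {n : ℕ}
    {H : Hamiltonian d} (hH : HamiltonianRegular T₀ (n + 1 + 1) H) (hn : s ≤ n + 1) (R M : ℝ)
    (G : FinalCost d) :
    ∃ R' > 0, ∀ t₀ T : ℝ, 0 ≤ t₀ → t₀ ≤ T → T ≤ T₀ → ∀ m₀ ∈ densityBall d s R,
      ∀ u m : ℝ → Pt d → ℝ, IsMFGSolution s H G t₀ T m₀ u m → MFGBound s t₀ T M u m →
        m T ∈ densityBall d s R' := by
  have h1 := fun i => exists_sobSq_mul_along_le hs M (hH.Hp i) (σ := s) (by linarith) hn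
  choose C hC using h1
  set a : ℝ := ((2 * Real.pi) ^ d)⁻¹ with ha
  set b := ENNReal.ofReal (M ^ 2) with hb
  -- A bound for the source of the density in `L² H^{s-1}`, from which the heat semigroup gains the
  -- order `s`. The bound on `m` in `L^∞ H^{s-1}` alone would not control `m(T)` in `H^s`.
  set J : ℝ≥0∞ := d * ∑ i, C i * (ENNReal.ofReal T₀ + (b + b)) with hJ
  have hJt : J < ⊤ := by
    have : ∑ i, (C i : ℝ≥0∞) * (ENNReal.ofReal T₀ + (b + b)) < ⊤ :=
      ENNReal.sum_lt_top.2 fun i _ => by finiteness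
    finiteness
  set X : ℝ≥0∞ := 2 * (2 * (2 * ENNReal.ofReal (R ^ 2) + 2 * ENNReal.ofReal (a ^ 2)) +
    2 * ((ENNReal.ofReal T₀ + 1) * J)) + 2 * ENNReal.ofReal (a ^ 2) with hX
  have hXt : X < ⊤ := by finiteness
  refine ⟨1 + X.toReal, by positivity, fun t₀ T h₀ hT hTT m₀ hm₀ u m hsol hbd =>
    ⟨hsol.terminal_mem, ?_⟩⟩
  have hXR : X ≤ ENNReal.ofReal ((1 + X.toReal) ^ 2) := by
    rw [ENNReal.le_ofReal_iff_toReal_le hXt.ne (by positivity)]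
    have := X.toReal_nonneg
    nlinarith
  refine le_trans ?_ hXR
  have hca : ∀ f : Pt d → ℝ, Continuous f → IntegrableOn f (cell d) := fun f hf =>
    integrableOn_cell_of_continuous hf
  have hm0 : sobSq s (fourierR m₀) ≤ 2 * ENNReal.ofReal (R ^ 2) + 2 * ENNReal.ofReal (a ^ 2) := by
    have h2 : fourierR m₀ = fourierR (fun x => m₀ x - a) + fourierR fun _ => a := by
      rw [fourierR_sub (hca _ hm₀.1.2.1) (hca _ continuous_const), sub_add_cancel]
    rw [h2]
    refine (sobSq_add_le _ _ _).trans ?_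
    rw [sobSq_fourierR_const]
    gcongr
    exact hm₀.2
  have hF : ∫⁻ τ in Icc t₀ T, sobSq (s - 1) (driftSource H u m τ) ≤ J := by
    have hm := fun i => hsol.measTime_drift h₀ hT hTT hH i
    calc _ ≤ ∫⁻ τ in Icc t₀ T, d * ∑ i, sobSq s (fourierR (drift H τ (u τ) (m τ) i)) := by
          refine lintegral_mono fun τ => ?_
          have := sobSq_sum_distPartial_le (s - 1) fun i => fourierR (drift H τ (u τ) (m τ) i)
          rwa [sub_add_cancel] at this
      _ = d * ∑ i, ∫⁻ τ in Icc t₀ T, sobSq s (fourierR (drift H τ (u τ) (m τ) i)) := by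
          rw [lintegral_const_mul' _ _ (by finiteness),
            lintegral_finsetSum' _ fun i _ => aemeasurable_sobSq (hm i) s]
      _ ≤ J := by
          rw [hJ]
          gcongr with i
          calc _ ≤ ∫⁻ τ in Icc t₀ T,
                C i * (1 + (sobSq (s + 1) (fourierR (u τ)) + sobSq s (fourierR (m τ)))) := by
                refine lintegral_mono_ae ?_
                filter_upwards [hbd.ae_slice hsol] with τ hτ
                exact hC i τ ⟨h₀.trans hτ.1.1.le, hτ.1.2.le.trans hTT⟩ _ _ hτ.2
            _ ≤ _ := by
                have hmu : MeasTime t₀ T fun t => fourierR (u t) := fun k =>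
                  (JointMeas.of_continuousOn hT hsol.continuous_u).fourierR k
                rw [lintegral_const_mul' _ _ ENNReal.coe_ne_top,
                  lintegral_add_left' aemeasurable_const,
                  lintegral_add_left' (aemeasurable_sobSq hmu _), setLIntegral_const,
                  Real.volume_Icc, one_mul]
                gcongr
                · linarith
                · exact hbd.l2_u
                · exact hbd.l2_m
  have hD := sobSq_duhF_le_lintegral (σ := s - 1)
    (MeasTime.sum fun i _ => (hsol.measTime_drift h₀ hT hTT hH i).distPartial i :
      MeasTime t₀ T (driftSource H u m)) (right_mem_Icc.2 hT)
  rw [sub_add_cancel] at hD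
  rw [fourierR_sub (hca _ hsol.terminal_mem.2.1) (hca _ continuous_const),
    hsol.density_duhamel hs h₀ hT hTT hH hn hbd]
  refine (sobSq_sub_le _ _ _).trans ?_
  rw [sobSq_fourierR_const, hX]
  gcongr
  refine (sobSq_add_le _ _ _).trans ?_
  gcongr
  · exact (sobSq_heatFlow_le _ (by linarith) _).trans hm0
  · refine hD.trans ?_
    gcongr
    · linarith
    · exact hF

/-! ## The coefficients of the linearized system -/

/-- Two derivatives of `H` are spent on the coefficients; the remaining `n + 1` are those of the
composition theorem. -/
lemma Slice.regCoef {s : ℝ} (hs : Admissible d s) {M T₀ : ℝ} {n : ℕ} {H : Hamiltonian d}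
    (hH : HamiltonianRegular T₀ (n + 1 + 2) H) {ρ : ℝ} (hρ0 : s - 1 ≤ ρ) (hρ : ρ ≤ n + 1) {t : ℝ}
    (ht : t ∈ Icc 0 T₀) {u m : ℝ → Pt d → ℝ} (h : Slice s M (u t) (m t))
    (hu : sobSq (ρ + 1) (fourierR (u t)) < ⊤) (hm : sobSq ρ (fourierR (m t)) < ⊤) :
    RegCoef H u m ρ t := by
  have h3 := hs.three_lt
  have h1 : ∀ {Φ : Hamiltonian d}, HamiltonianRegular T₀ (n + 1) Φ →
      RegFun ρ (along Φ t (u t) (m t)) := fun hΦ => by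
    obtain ⟨C, hC⟩ := exists_sobSq_along_le hs M hΦ (σ := ρ) (by linarith) hρ
    exact ⟨h.continuous_along hΦ ht, (hC t ht _ _ h).trans_lt (by finiteness)⟩
  have h2 : ∀ {Φ : Hamiltonian d}, HamiltonianRegular T₀ (n + 1) Φ →
      RegFun ρ (fun x => m t x * along Φ t (u t) (m t) x) := fun hΦ => by
    obtain ⟨C, hC⟩ := exists_sobSq_mul_along_le hs M hΦ hρ0 hρ
    exact ⟨h.contDiff_m.continuous.mul (h.continuous_along hΦ ht),
      (hC t ht _ _ h).trans_lt (by finiteness)⟩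
  exact ⟨fun i => h1 ((hH.Hp i).mono (Nat.le_succ (n + 1))),
    h1 (hH.Hq.mono (Nat.le_succ (n + 1))), fun i j => h2 ((hH.Hp j).Hp i), fun i => h2 (hH.Hq.Hp i)⟩

/-- Integrability and regularity of the coefficients of the linearized system. -/
structure LinReg (H : Hamiltonian d) (u m : ℝ → Pt d → ℝ) (ϑ t₀ T ρ : ℝ) : Prop where
  fin : ∀ o b, ∫⁻ t in Icc t₀ T, sobSq ρ (linCoef H u m ϑ o b t) < ⊤
  reg : ∀ᵐ t ∂(volume.restrict (Icc t₀ T)), RegCoef H u m ρ t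

lemma SmoothingBound.mono {t₀ T σ : ℝ} {K K' : ℝ≥0∞} {f : ℝ → Coeffs d}
    (h : SmoothingBound t₀ T σ K f) (hK : K ≤ K') : SmoothingBound t₀ T σ K' f :=
  fun c hc hf t => (h c hc hf t).trans (mul_le_mul_left hK _)

lemma CoefBound.mono {t₀ T σ ρ : ℝ} {K K' : ℝ≥0∞}
    {A : Option (Fin d) → Option (Fin d) → ℝ → Coeffs d} (h : CoefBound t₀ T σ ρ K A)
    (hK : K ≤ K') : CoefBound t₀ T σ ρ K' A :=
  ⟨h.nonneg, h.neg_le, h.real, h.meas, h.fin, fun o b => (h.smoothing o b).mono hK⟩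

section

variable {s T₀ : ℝ} {n : ℕ} {H : Hamiltonian d}

/-- Order `s - 1` is where the state is bounded uniformly in time. It asks for `s - 1` derivatives
of the coefficients, so that `⌊s⌋ + 2` derivatives of `H` suffice. -/
lemma exists_sup_linCoef_le (hs : Admissible d s) (hH : HamiltonianRegular T₀ (n + 1 + 2) H)
    (hn : s - 1 ≤ n + 1) (M : ℝ) (G : FinalCost d) :
    ∃ Λ : ℝ≥0, ∀ t₀ T : ℝ, 0 ≤ t₀ → T ≤ T₀ → ∀ m₀, ∀ u m : ℝ → Pt d → ℝ,
      IsMFGSolution s H G t₀ T m₀ u m → MFGBound s t₀ T M u m → ∀ ϑ : ℝ, ϑ = 1 ∨ ϑ = -1 →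
        (∀ o b, ∀ᵐ t ∂(volume.restrict (Icc t₀ T)), sobSq (s - 1) (linCoef H u m ϑ o b t) ≤ Λ) ∧
        ∀ᵐ t ∂(volume.restrict (Icc t₀ T)), RegCoef H u m (s - 1) t := by
  obtain ⟨C, hC⟩ := exists_sobSq_linCoef_le hs M hH le_rfl hn
  obtain ⟨Λ, hΛ⟩ := exists_nnreal_of_lt_top
    (show C * (1 + (ENNReal.ofReal (M ^ 2) + ENNReal.ofReal (M ^ 2))) < ⊤ by finiteness)
  refine ⟨Λ, fun t₀ T h₀ hTT m₀ u m hsol hb ϑ hϑ => ⟨fun o b => ?_, ?_⟩⟩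
  · filter_upwards [hb.ae_slice hsol] with t ht
    refine (hC t ⟨h₀.trans ht.1.1.le, ht.1.2.le.trans hTT⟩ u m ht.2 ϑ hϑ o b).trans ?_
    rw [← hΛ]
    exact mul_le_mul_right (ht.2.bound_sum le_rfl) _
  · filter_upwards [hb.ae_slice hsol] with t ht
    refine ht.2.regCoef hs hH le_rfl hn ⟨h₀.trans ht.1.1.le, ht.1.2.le.trans hTT⟩ ?_ ?_
    · rw [sub_add_cancel]
      exact ht.2.bound_u.trans_lt ENNReal.ofReal_lt_top
    · exact ht.2.bound_m.trans_lt ENNReal.ofReal_lt_top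

/-- Order `s` is reached only in `L²` of time, and asks for `s` derivatives of the coefficients;
this is the origin of the hypothesis with `⌈s⌉ + 2` for distributional data. -/
lemma exists_lintegral_linCoef_le (hs : Admissible d s) (hH : HamiltonianRegular T₀ (n + 1 + 2) H)
    (hn : s ≤ n + 1) (M : ℝ) (G : FinalCost d) :
    ∃ Λ : ℝ≥0, ∀ t₀ T : ℝ, 0 ≤ t₀ → t₀ ≤ T → T ≤ T₀ → ∀ m₀, ∀ u m : ℝ → Pt d → ℝ,
      IsMFGSolution s H G t₀ T m₀ u m → MFGBound s t₀ T M u m → ∀ ϑ : ℝ, ϑ = 1 ∨ ϑ = -1 →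
        (∀ o b, ∫⁻ t in Icc t₀ T, sobSq s (linCoef H u m ϑ o b t) ≤ Λ) ∧
        ∀ᵐ t ∂(volume.restrict (Icc t₀ T)), RegCoef H u m s t := by
  obtain ⟨C, hC⟩ := exists_sobSq_linCoef_le hs M hH (by linarith) hn
  obtain ⟨Λ, hΛ⟩ := exists_nnreal_of_lt_top
    (show C * (ENNReal.ofReal T₀ + (ENNReal.ofReal (M ^ 2) + ENNReal.ofReal (M ^ 2))) < ⊤ by
      finiteness)
  refine ⟨Λ, fun t₀ T h₀ hT hTT m₀ u m hsol hb ϑ hϑ => ?_⟩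
  have hmu : MeasTime t₀ T fun t => fourierR (u t) := fun k =>
    (JointMeas.of_continuousOn hT hsol.continuous_u).fourierR k
  have hmm : MeasTime t₀ T fun t => fourierR (m t) := fun k => (hsol.jointMeas_m hT).fourierR k
  refine ⟨fun o b => ?_, ?_⟩
  · calc _ ≤ ∫⁻ t in Icc t₀ T,
          C * (1 + (sobSq (s + 1) (fourierR (u t)) + sobSq s (fourierR (m t)))) := by
          refine lintegral_mono_ae ?_
          filter_upwards [hb.ae_slice hsol] with t ht
          exact hC t ⟨h₀.trans ht.1.1.le, ht.1.2.le.trans hTT⟩ u m ht.2 ϑ hϑ o b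
      _ ≤ _ := by
          rw [← hΛ, lintegral_const_mul' _ _ ENNReal.coe_ne_top,
            lintegral_add_left' aemeasurable_const,
            lintegral_add_left' (aemeasurable_sobSq hmu _), setLIntegral_const,
            Real.volume_Icc, one_mul]
          gcongr
          · linarith
          · exact hb.l2_u
          · exact hb.l2_m
  · filter_upwards [hb.ae_slice hsol,
      ae_lt_top' (aemeasurable_sobSq hmu _) (hb.l2_u.trans_lt ENNReal.ofReal_lt_top).ne,
      ae_lt_top' (aemeasurable_sobSq hmm _) (hb.l2_m.trans_lt ENNReal.ofReal_lt_top).ne]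
      with t ht hu hm
    exact ht.2.regCoef hs hH (by linarith) hn ⟨h₀.trans ht.1.1.le, ht.1.2.le.trans hTT⟩ hu hm

/-- Bounds of the coefficients on Sobolev spaces of nonnegative order. -/
lemma exists_coefBound_nonneg (hs : Admissible d s) (hH : HamiltonianRegular T₀ (n + 1 + 2) H)
    (hn : s - 1 ≤ n + 1) (M : ℝ) (G : FinalCost d) :
    ∃ K : ℝ≥0, ∀ t₀ T : ℝ, 0 ≤ t₀ → t₀ ≤ T → T ≤ T₀ → ∀ m₀, ∀ u m : ℝ → Pt d → ℝ,
      IsMFGSolution s H G t₀ T m₀ u m → MFGBound s t₀ T M u m → ∀ ϑ : ℝ, ϑ = 1 ∨ ϑ = -1 →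
        LinReg H u m ϑ t₀ T (s - 1) ∧
        ∀ σ ∈ Icc 0 (s - 1), CoefBound t₀ T σ (s - 1) K (linCoef H u m ϑ) := by
  have h3 := hs.three_lt
  obtain ⟨Λ, hΛ⟩ := exists_sup_linCoef_le hs hH hn M G
  have hw : wtSum d (s - 1) < ⊤ := wtSum_lt_top (by linarith [hs.half_lt])
  have hc := splitC_lt_top (s - 1)
  obtain ⟨K, hK⟩ := exists_nnreal_of_lt_top (show (ENNReal.ofReal T₀ + 1) *
    (2 * splitC (s - 1) ^ 2 * (wtSum d (s - 1) * Λ + wtSum d (s - 1) * Λ)) < ⊤ by finiteness)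
  refine ⟨K, fun t₀ T h₀ hT hTT m₀ u m hsol hb ϑ hϑ => ?_⟩
  obtain ⟨h1, h2⟩ := hΛ t₀ T h₀ hTT m₀ u m hsol hb ϑ hϑ
  have hm : ∀ o b, MeasTime t₀ T (linCoef H u m ϑ o b) := fun o b =>
    hsol.aestronglyMeasurable_linCoef h₀ hT hTT hH ϑ o b
  refine ⟨⟨fun o b => ?_, h2⟩, fun σ hσ => ⟨by linarith, by linarith [hσ.1],
    isRealDist_linCoef H u m ϑ, hm, fun o b => ?_, fun o b => ?_⟩⟩
  · refine (lintegral_mono_ae (h1 o b)).trans_lt ?_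
    rw [setLIntegral_const, Real.volume_Icc]
    finiteness
  · filter_upwards [h1 o b] with t ht using ht.trans_lt ENNReal.coe_lt_top
  · refine (smoothingBound_of_nonneg hσ.1 hσ.2 (hm o b) ENNReal.coe_ne_top (h1 o b)).mono ?_
    rw [← hK]
    gcongr
    linarith

/-- Bounds of the coefficients on Sobolev spaces of nonpositive order. -/
lemma exists_coefBound_nonpos (hs : Admissible d s) (hH : HamiltonianRegular T₀ (n + 1 + 2) H)
    (hn : s ≤ n + 1) (M : ℝ) (G : FinalCost d) :
    ∃ K : ℝ≥0, ∀ t₀ T : ℝ, 0 ≤ t₀ → t₀ ≤ T → T ≤ T₀ → ∀ m₀, ∀ u m : ℝ → Pt d → ℝ,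
      IsMFGSolution s H G t₀ T m₀ u m → MFGBound s t₀ T M u m → ∀ ϑ : ℝ, ϑ = 1 ∨ ϑ = -1 →
        LinReg H u m ϑ t₀ T s ∧
        ∀ σ ∈ Icc (-s) 0, CoefBound t₀ T σ s K (linCoef H u m ϑ) := by
  have h3 := hs.three_lt
  obtain ⟨Λ₁, hΛ₁⟩ := exists_sup_linCoef_le hs hH (by linarith) M G
  obtain ⟨Λ₂, hΛ₂⟩ := exists_lintegral_linCoef_le hs hH hn M G
  have hw : wtSum d (s - 1) < ⊤ := wtSum_lt_top (by linarith [hs.half_lt])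
  have hc := splitC_lt_top s
  obtain ⟨K, hK⟩ := exists_nnreal_of_lt_top (show splitC s ^ 2 * (2 * (ENNReal.ofReal T₀ + 1) *
    (wtSum d (s - 1) * Λ₁) + 2 * (wtSum d (s - 1) * Λ₂)) < ⊤ by finiteness)
  refine ⟨K, fun t₀ T h₀ hT hTT m₀ u m hsol hb ϑ hϑ => ?_⟩
  obtain ⟨h1, -⟩ := hΛ₁ t₀ T h₀ hTT m₀ u m hsol hb ϑ hϑ
  obtain ⟨h2, h4⟩ := hΛ₂ t₀ T h₀ hT hTT m₀ u m hsol hb ϑ hϑ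
  have hm : ∀ o b, MeasTime t₀ T (linCoef H u m ϑ o b) := fun o b =>
    hsol.aestronglyMeasurable_linCoef h₀ hT hTT hH ϑ o b
  refine ⟨⟨fun o b => (h2 o b).trans_lt ENNReal.coe_lt_top, h4⟩, fun σ hσ => ⟨by linarith, hσ.1,
    isRealDist_linCoef H u m ϑ, hm, fun o b => ?_, fun o b => ?_⟩⟩
  · exact ae_lt_top' (aemeasurable_sobSq (hm o b) _) ((h2 o b).trans_lt ENNReal.coe_lt_top).ne
  · refine (smoothingBound_of_nonpos (W := wtSum d (s - 1) * Λ₁) hσ.2 hσ.1 (hm o b) ?_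
      (h2 o b)).mono ?_
    · filter_upwards [h1 o b] with t ht
      refine (wien_sq_le 0 (s - 1) _).trans ?_
      rw [zero_add]
      gcongr
    · rw [← hK]
      gcongr
      linarith

end

/-! ## Existence and uniqueness for the linearized system -/

section

variable {σ ρ ρ' s t₀ T : ℝ} {K κ : ℝ≥0∞} {A : Option (Fin d) → Option (Fin d) → ℝ → Coeffs d}
  {Θ : Coeffs d → Coeffs d} {Z : ℝ → State d} {w μ₀ : Coeffs d}

lemma IsMild.terminal_eq (hT : t₀ ≤ T) (hZ : IsMild A t₀ T w μ₀ Z) :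
    (Z T).2 = heatFlow (T - t₀) μ₀ + duhF t₀ (flux A Z) T :=
  congrArg Prod.snd (hZ T (right_mem_Icc.2 hT))

/-- The Duhamel part of `μ(T)` has the full order `σ`; the other part is the heat flow of `μ₀`,
which keeps the order of `μ₀`. -/
lemma CoefBound.sobSq_terminal_lt_top (hA : CoefBound t₀ T σ ρ K A) (hK : K ≠ ⊤) (hT : t₀ ≤ T)
    (h : Adm σ t₀ T Z) (hZ : IsMild A t₀ T w μ₀ Z) {τ : ℝ} (hτ : τ ≤ σ) (hμ : sobSq τ μ₀ < ⊤) :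
    sobSq τ (Z T).2 < ⊤ := by
  have h1 := hA.sobSq_duhF_le_nrm h (right_mem_Icc.2 hT)
  have h2 := h.fin
  have h3 := duhamelC_lt_top (d := d) hK
  rw [hZ.terminal_eq hT]
  refine (sobSq_add_le _ _ _).trans_lt ?_
  have h4 := (sobSq_heatFlow_le τ (sub_nonneg.2 hT) μ₀).trans_lt hμ
  have h5 := ((sobSq_mono hτ _).trans h1).trans_lt (ENNReal.mul_lt_top h3 h2)
  finiteness

lemma freeState_zero (t₀ T t : ℝ) : freeState t₀ T (0 : Coeffs d) 0 t = 0 := by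
  rw [freeState, heatFlow_zero, heatFlow_zero]
  rfl

lemma en_freeState_le {τ : ℝ} (w μ₀ : Coeffs d) {t : ℝ} (ht : t ∈ Icc t₀ T) :
    en τ (freeState t₀ T w μ₀ t) ≤ sobSq (τ + 1) w + sobSq τ μ₀ :=
  add_le_add (sobSq_heatFlow_le _ (sub_nonneg.2 ht.2) _) (sobSq_heatFlow_le _ (sub_nonneg.2 ht.1) _)

lemma exists_en_le_of_sub_freeState {τ : ℝ} (hτ : τ ≤ σ) (hw : sobSq (τ + 1) w < ⊤)
    (hμ : sobSq τ μ₀ < ⊤)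
    (h : ∃ C < ⊤, ∀ t ∈ Icc t₀ T, en σ (Z t - freeState t₀ T w μ₀ t) ≤ C) :
    ∃ C < ⊤, ∀ t ∈ Icc t₀ T, en τ (Z t) ≤ C := by
  obtain ⟨C, hC, h⟩ := h
  refine ⟨2 * C + 2 * (sobSq (τ + 1) w + sobSq τ μ₀), by finiteness, fun t ht => ?_⟩
  calc en τ (Z t) = en τ ((Z t - freeState t₀ T w μ₀ t) + freeState t₀ T w μ₀ t) := by
        rw [sub_add_cancel]
    _ ≤ _ := (en_add_le _ _ _).trans (add_le_add
        (mul_le_mul_right ((en_mono hτ _).trans (h t ht)) _)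
        (mul_le_mul_right (en_freeState_le w μ₀ ht) _))

/-- Uniqueness for a coupled terminal condition. -/
lemma IsMild.eq_zero (hA : CoefBound t₀ T σ ρ K A) (hT : t₀ ≤ T) (h : Adm σ t₀ T Z)
    (hΘ0 : Θ 0 = 0) (hZ : IsMild A t₀ T (Θ (Z T).2) 0 Z) {ε : ℝ≥0∞}
    (hw : ∫⁻ t in Icc t₀ T, sobSq (σ + 1) (heatFlow (T - t) (Θ (Z T).2)) ≤ ε * sobSq σ (Z T).2)
    (hsmall : (2 * ε + 2 * ENNReal.ofReal (T - t₀)) * duhamelC d K ≤ 2⁻¹) :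
    ∀ t ∈ Icc t₀ T, Z t = 0 := by
  have h1 := hZ.eq_freeState hA hT h hw hsmall
  have h2 : (Z T).2 = 0 := by
    rw [h1 T (right_mem_Icc.2 hT), freeState, heatFlow_zero]
  intro t ht
  rw [h1 t ht, h2, hΘ0, freeState_zero]

/-- `Θ` gains a full derivative on `H^σ`, so the flow is bounded in `H^{σ+1}` at each time and the
length of the interval provides the small factor `ε` of the uniqueness theorem. -/
lemma TerminalOp.lintegral_heatFlow_le_of_short (hΘ : TerminalOp σ κ Θ) {c : Coeffs d}
    (hc : sobSq σ c < ⊤) :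
    ∫⁻ t in Icc t₀ T, sobSq (σ + 1) (heatFlow (T - t) (Θ c)) ≤
      ENNReal.ofReal (T - t₀) * κ * sobSq σ c := by
  calc _ ≤ ∫⁻ _t in Icc t₀ T, κ * sobSq σ c := by
        refine setLIntegral_mono' measurableSet_Icc fun t ht => ?_
        exact (sobSq_heatFlow_le _ (sub_nonneg.2 ht.2) _).trans (hΘ.bound c hc)
    _ = _ := by
        rw [setLIntegral_const, Real.volume_Icc]
        ring

/-- The smallness condition for the time interval. -/
def ShortTime (d : ℕ) (κ K : ℝ≥0∞) (τ : ℝ) : Prop :=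
  ENNReal.ofReal τ * ((2 * κ + 2) * duhamelC d K) ≤ 16⁻¹

lemma ShortTime.two_mul {τ : ℝ} (h : ShortTime d κ K τ) :
    ENNReal.ofReal τ * (2 * duhamelC d K) ≤ 16⁻¹ := by
  refine le_trans ?_ h
  gcongr
  exact le_add_self

lemma ShortTime.zero {τ : ℝ} (h : ShortTime d κ K τ) : ShortTime d 0 K τ := by
  refine le_trans ?_ h.two_mul
  rw [mul_zero, zero_add]

lemma ShortTime.half {τ : ℝ} (h : ShortTime d κ K τ) :
    (2 * (ENNReal.ofReal τ * κ) + 2 * ENNReal.ofReal τ) * duhamelC d K ≤ 2⁻¹ := by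
  calc _ = ENNReal.ofReal τ * ((2 * κ + 2) * duhamelC d K) := by ring
    _ ≤ 16⁻¹ := h
    _ ≤ 2⁻¹ := ENNReal.inv_le_inv.2 (by norm_num)

lemma IsMild.eq_zero_of_short (hA : CoefBound t₀ T σ ρ K A) (hK : K ≠ ⊤) (hT : t₀ ≤ T)
    (hΘ : TerminalOp σ κ Θ) (hsmall : ShortTime d κ K (T - t₀)) (h : Adm σ t₀ T Z)
    (hZ : IsMild A t₀ T (Θ (Z T).2) 0 Z) : ∀ t ∈ Icc t₀ T, Z t = 0 := by
  refine hZ.eq_zero hA hT h hΘ.map_zero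
    (hΘ.lintegral_heatFlow_le_of_short ?_) hsmall.half
  exact hA.sobSq_terminal_lt_top hK hT h hZ le_rfl (by simp [sobSq_zero])

/-- Solutions with regular data. -/
theorem CoefBound.exists_coupled (hA : CoefBound t₀ T σ ρ K A) (hK : K ≠ ⊤) (hT : t₀ ≤ T)
    (hΘ : TerminalOp σ κ Θ) (hκ : κ ≠ ⊤) (hsmall : ShortTime d κ K (T - t₀)) {c : Coeffs d}
    (hc : IsRealDist c) (hc' : sobSq σ c < ⊤) (hμ : IsRealDist μ₀) (hμ' : sobSq σ μ₀ < ⊤) :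
    ∃ Z, Adm σ t₀ T Z ∧ (∃ C < ⊤, ∀ t ∈ Icc t₀ T, en σ (Z t) ≤ C) ∧
      IsMild A t₀ T (Θ (c + (Z T).2)) μ₀ Z := by
  -- The part of `c + μ(T)` that is known in advance. The rest of `μ(T)` is the Duhamel part, which
  -- `solOp` feeds back through `Θ`.
  set a := c + heatFlow (T - t₀) μ₀ with ha
  have ha1 : sobSq σ (heatFlow (T - t₀) μ₀) < ⊤ :=
    (sobSq_heatFlow_le _ (sub_nonneg.2 hT) _).trans_lt hμ'
  have ha2 : sobSq σ a < ⊤ := (sobSq_add_le _ _ _).trans_lt (by finiteness)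
  have hw : sobSq (σ + 1) (Θ a) < ⊤ := (hΘ.bound a ha2).trans_lt (by finiteness)
  obtain ⟨Z, h1, h2, h3, h4⟩ := hA.exists_mild hK hT hΘ hκ hsmall
    (hΘ.real a ha2 (hc.add (hμ.heatFlow _))) ((sobSq_mono (by linarith) _).trans_lt hw) hμ
    ((sobSq_mono (by linarith) _).trans_lt hμ')
  refine ⟨Z, h1, exists_en_le_of_sub_freeState le_rfl hw hμ' h2, ?_⟩
  rwa [h4.terminal_eq hT, ← add_assoc, ← ha, hΘ.add _ _ ha2 h3]

/-- Solutions with distributional data. The coefficients are bounded on the spaces of order between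
`σ₀` and `σ₁`. -/
theorem exists_coupled_of_distribution {σ₀ σ₁ : ℝ} (hσ : σ₀ ≤ σ₁) (hK : K ≠ ⊤)
    (hA : ∀ σ ∈ Icc σ₀ σ₁, ∃ ρ, CoefBound t₀ T σ ρ K A) (hT : t₀ < T) (hΘ : TerminalOp σ₁ κ Θ)
    (hκ : κ ≠ ⊤) (hsmall : ShortTime d κ K (T - t₀)) (hμ : IsRealDist μ₀)
    (hμ' : sobSq (σ₀ - 1) μ₀ < ⊤) :
    ∃ Z, Adm σ₀ t₀ T Z ∧ (∃ C < ⊤, ∀ t ∈ Icc t₀ T, en (σ₀ - 1) (Z t) ≤ C) ∧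
      sobSq σ₁ (Z T).2 < ⊤ ∧ IsMild A t₀ T (Θ (Z T).2) μ₀ Z := by
  have hTT : T ∈ Icc t₀ T := right_mem_Icc.2 hT.le
  obtain ⟨ρ₀, hA₀⟩ := hA σ₀ (left_mem_Icc.2 hσ)
  obtain ⟨ρ₁, hA₁⟩ := hA σ₁ (right_mem_Icc.2 hσ)
  have h0 : ∀ σ, sobSq σ (0 : Coeffs d) < ⊤ := fun σ => by simp [sobSq_zero]
  -- `X` carries the distributional datum with terminal value zero, so `Θ` is never applied to a
  -- rough distribution. By smoothing `X(T)` has a regular density, and `Y` corrects the terminal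
  -- condition at the regular order, with initial value zero.
  obtain ⟨X, hX1, hX2, -, hX4⟩ := hA₀.exists_mild hK hT.le (terminalOp_zero σ₀) ENNReal.zero_ne_top
    hsmall.zero isRealDist_zero (h0 _) hμ hμ'
  rw [add_zero] at hX4
  have hX3 := exists_en_le_of_sub_freeState (by linarith) (h0 _) hμ' hX2
  obtain ⟨n, hn⟩ := exists_nat_ge (σ₁ - σ₀)
  have hX5 : sobSq σ₁ (X T).2 < ⊤ := IsMild.sobSq_terminal_lt_top hK hA hsmall.two_mul n σ₀
    (left_mem_Icc.2 hσ) hn t₀ (left_mem_Ico.2 hT) X μ₀ hX1 hX4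
  obtain ⟨Y, hY1, ⟨C, hC, hY2⟩, hY3⟩ := hA₁.exists_coupled hK hT.le hΘ hκ hsmall
    (hX1.real₂ T hTT) hX5 isRealDist_zero (h0 _)
  obtain ⟨C', hC', hX3⟩ := hX3
  refine ⟨X + Y, hX1.add (hY1.mono hσ), ⟨2 * C' + 2 * C, by finiteness, fun t ht => ?_⟩, ?_, ?_⟩
  · refine (en_add_le _ _ _).trans (add_le_add (mul_le_mul_right (hX3 t ht) _)
      (mul_le_mul_right ?_ _))
    exact (en_mono (by linarith) _).trans (hY2 t ht)
  · have h1 : sobSq σ₁ (Y T).2 < ⊤ := (le_add_self.trans (hY2 T hTT)).trans_lt hC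
    exact (sobSq_add_le _ _ _).trans_lt (by finiteness)
  · have := hX4.add hA₀ hK hX1 (hY1.mono hσ) hY3
    rwa [zero_add, add_zero] at this

/-- Uniqueness of solutions with distributional data and regular terminal values. -/
theorem IsMild.eq_zero_of_distribution {σ₀ σ₁ : ℝ} (hσ : σ₀ ≤ σ₁) (hK : K ≠ ⊤)
    (hA₀ : CoefBound t₀ T σ₀ ρ K A) (hA₁ : CoefBound t₀ T σ₁ ρ' K A) (hT : t₀ ≤ T)
    (hΘ : TerminalOp σ₁ κ Θ) (hκ : κ ≠ ⊤) (hsmall : ShortTime d κ K (T - t₀))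
    (h : Adm σ₀ t₀ T Z) (hZT : sobSq σ₁ (Z T).2 < ⊤) (hZ : IsMild A t₀ T (Θ (Z T).2) 0 Z) :
    ∀ t ∈ Icc t₀ T, Z t = 0 := by
  have hTT : T ∈ Icc t₀ T := right_mem_Icc.2 hT
  have h0 : ∀ σ, sobSq σ (0 : Coeffs d) < ⊤ := fun σ => by simp [sobSq_zero]
  have hw : sobSq (σ₁ + 1) (Θ (Z T).2) < ⊤ := (hΘ.bound _ hZT).trans_lt (by finiteness)
  -- `Y` is the regular solution with the terminal value of `Z` and initial value zero. Uniqueness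
  -- at the low order identifies it with `Z`, and then uniqueness at the high order applies.
  obtain ⟨Y, hY1, -, -, hY4⟩ := hA₁.exists_mild hK hT (terminalOp_zero σ₁) ENNReal.zero_ne_top
    hsmall.zero (hΘ.real _ hZT (h.real₂ T hTT)) ((sobSq_mono (by linarith) _).trans_lt hw)
    isRealDist_zero (h0 _)
  rw [add_zero] at hY4
  have he := IsMild.eq hA₀ hK hT hsmall.two_mul h (hY1.mono hσ) hZ hY4
  rw [he T hTT] at hY4
  intro t ht
  rw [he t ht]
  exact hY4.eq_zero_of_short hA₁ hK hT hΘ hsmall hY1 t ht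

end

/-! ## Well-posedness of the linearized system -/

lemma Adm.memLinfSob {σ τ t₀ T : ℝ} {Z : ℝ → State d} (h : Adm σ t₀ T Z)
    (hb : ∃ C < ⊤, ∀ t ∈ Icc t₀ T, en τ (Z t) ≤ C) :
    MemLinfSob (τ + 1) t₀ T (fun t => (Z t).1) ∧ MemLinfSob τ t₀ T fun t => (Z t).2 := by
  obtain ⟨C, hC, hb⟩ := hb
  obtain ⟨c, rfl⟩ := exists_nnreal_of_lt_top hC
  refine ⟨⟨h.real₁, h.meas₁, c, ?_⟩, h.real₂, h.meas₂, c, ?_⟩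
  · filter_upwards [ae_restrict_mem measurableSet_Icc] with t ht using le_self_add.trans (hb t ht)
  · filter_upwards [ae_restrict_mem measurableSet_Icc] with t ht using le_add_self.trans (hb t ht)

lemma Adm.memL2Sob {σ t₀ T : ℝ} {Z : ℝ → State d} (h : Adm σ t₀ T Z) :
    MemL2Sob (σ + 1) t₀ T (fun t => (Z t).1) ∧ MemL2Sob σ t₀ T fun t => (Z t).2 :=
  ⟨⟨h.real₁, h.meas₁, (lintegral_mono fun _ => le_self_add).trans_lt h.fin⟩,
    h.real₂, h.meas₂, (lintegral_mono fun _ => le_add_self).trans_lt h.fin⟩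

lemma MemL2Sob.adm {σ t₀ T : ℝ} {v μ : ℝ → Coeffs d} (hv : MemL2Sob (σ + 1) t₀ T v)
    (hμ : MemL2Sob σ t₀ T μ) : Adm σ t₀ T fun t => (v t, μ t) where
  real₁ := hv.1
  real₂ := hμ.1
  meas₁ := hv.2.1
  meas₂ := hμ.2.1
  fin := by
    have h1 := hv.2.2
    have h2 := hμ.2.2
    have : nrm σ t₀ T (fun t => (v t, μ t)) =
        (∫⁻ t in Icc t₀ T, sobSq (σ + 1) (v t)) + ∫⁻ t in Icc t₀ T, sobSq σ (μ t) :=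
      lintegral_add_left' (aemeasurable_sobSq hv.2.1 _) _
    rw [this]
    finiteness

lemma MemLinfSob.memL2Sob {σ t₀ T : ℝ} {c : ℝ → Coeffs d} (h : MemLinfSob σ t₀ T c) :
    MemL2Sob σ t₀ T c := by
  obtain ⟨h1, h2, C, h3⟩ := h
  refine ⟨h1, h2, (lintegral_mono_ae h3).trans_lt ?_⟩
  rw [setLIntegral_const, Real.volume_Icc]
  finiteness

/-- The difference of two solutions solves the homogeneous system. -/
lemma IsMild.sub_coupled {σ ρ τ t₀ T : ℝ} {K κ : ℝ≥0∞}
    {A : Option (Fin d) → Option (Fin d) → ℝ → Coeffs d} {Θ : Coeffs d → Coeffs d}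
    {Z Y : ℝ → State d} {μ₀ : Coeffs d} (hA : CoefBound t₀ T σ ρ K A) (hK : K ≠ ⊤)
    (hΘ : TerminalOp τ κ Θ) (h : Adm σ t₀ T Z) (h' : Adm σ t₀ T Y)
    (hZT : sobSq τ (Z T).2 < ⊤) (hYT : sobSq τ (Y T).2 < ⊤)
    (hZ : IsMild A t₀ T (Θ (Z T).2) μ₀ Z) (hY : IsMild A t₀ T (Θ (Y T).2) μ₀ Y) :
    IsMild A t₀ T (Θ ((Z - Y) T).2) 0 (Z - Y) := by
  have := hZ.sub hA hK h h' hY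
  rwa [sub_self, ← hΘ.map_sub hZT hYT] at this

section

variable {H : Hamiltonian d} {u m : ℝ → Pt d → ℝ} {dG : CostKernel d} {s ϑ t₀ T : ℝ} {K κ : ℝ≥0∞}

/-- Well-posedness in spaces of functions. -/
theorem exists_unique_regularSolution {ρ : ℝ} (hT : t₀ ≤ T) (hK : K ≠ ⊤) (hκ : κ ≠ ⊤)
    (hA : CoefBound t₀ T (s - 1) ρ K (linCoef H u m ϑ)) (hL : LinReg H u m ϑ t₀ T ρ)
    (hΘ : TerminalOp (s - 1) κ (kernelAction fun x y => dG x (m T) y))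
    (hsmall : ShortTime d κ K (T - t₀)) {μ₀ : Coeffs d} (hμ₀ : MemSob (s - 1) μ₀) :
    ∃ v μ : ℝ → Coeffs d, IsRegularSolution H u m dG s ϑ t₀ T μ₀ v μ ∧
      ∀ v' μ' : ℝ → Coeffs d, IsRegularSolution H u m dG s ϑ t₀ T μ₀ v' μ' →
        ∀ t ∈ Icc t₀ T, v' t = v t ∧ μ' t = μ t := by
  obtain ⟨Z, hZ1, hZ2, hZ3⟩ := hA.exists_coupled hK hT hΘ hκ hsmall isRealDist_zero
    (by simp [sobSq_zero]) hμ₀.1 hμ₀.2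
  rw [zero_add] at hZ3
  have hZT := hA.sobSq_terminal_lt_top hK hT hZ1 hZ3 le_rfl hμ₀.2
  have hmem := hZ1.memLinfSob hZ2
  rw [sub_add_cancel] at hmem
  refine ⟨_, _, ⟨hmem.1, hmem.2, hZ3.solvesLinearized hA hK hT hL.fin hL.reg hZ1
    (tame_of_sobSq hμ₀.2) (tame_of_sobSq ((hΘ.bound _ hZT).trans_lt (by finiteness)))⟩,
    fun v' μ' h t ht => ?_⟩
  have hY1 : Adm (s - 1) t₀ T fun t => (v' t, μ' t) :=
    MemL2Sob.adm (by rw [sub_add_cancel]; exact h.1.memL2Sob) h.2.1.memL2Sob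
  have hY3 := SolvesLinearized.isMild hA hK hT hL.fin hL.reg hY1 h.2.2
  have hYT := hA.sobSq_terminal_lt_top hK hT hY1 hY3 le_rfl hμ₀.2
  have h0 := (hY3.sub_coupled hA hK hΘ hY1 hZ1 hYT hZT hZ3).eq_zero_of_short hA hK hT hΘ hsmall
    (hY1.sub hZ1) t ht
  rw [Pi.sub_apply, sub_eq_zero] at h0
  exact ⟨congrArg Prod.fst h0, congrArg Prod.snd h0⟩

/-- Well-posedness in spaces of distributions. -/
theorem exists_unique_distSolution (hs : 1 ≤ s) (hT : t₀ < T) (hK : K ≠ ⊤) (hκ : κ ≠ ⊤)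
    (hA₀ : ∀ σ ∈ Icc (-s) 0, CoefBound t₀ T σ s K (linCoef H u m ϑ))
    (hA₁ : ∀ σ ∈ Icc 0 (s - 1), CoefBound t₀ T σ (s - 1) K (linCoef H u m ϑ))
    (hL : LinReg H u m ϑ t₀ T s)
    (hΘ : TerminalOp (s - 1) κ (kernelAction fun x y => dG x (m T) y))
    (hsmall : ShortTime d κ K (T - t₀)) {μ₀ : Coeffs d} (hμ₀ : MemSob (-s - 1) μ₀) :
    ∃ v μ : ℝ → Coeffs d,
      (IsDistSolution H u m dG s ϑ t₀ T μ₀ v μ ∧ MemSob (s - 1) (μ T)) ∧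
      (∀ v' μ' : ℝ → Coeffs d,
        IsDistSolution H u m dG s ϑ t₀ T μ₀ v' μ' → MemSob (s - 1) (μ' T) →
        ∀ t ∈ Icc t₀ T, v' t = v t ∧ μ' t = μ t) ∧
      ∀ κ' Λ, TerminalOp (-s - 1) κ' (kernelAction fun x y => dG x (m T) y) → κ' ≠ ⊤ → 0 < Λ →
        (2 * (2 * ((ENNReal.ofReal (T - t₀) + 1) * (κ' * ENNReal.ofReal (Λ ^ (-1 : ℝ)))) +
          2 * (ENNReal.ofReal (T - t₀) * (κ * ENNReal.ofReal (Λ ^ (s - 1 - -s))))) +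
            2 * ENNReal.ofReal (T - t₀)) * duhamelC d K ≤ 2⁻¹ →
        ∀ v' μ' : ℝ → Coeffs d, IsDistSolution H u m dG s ϑ t₀ T μ₀ v' μ' →
          ∀ t ∈ Icc t₀ T, v' t = v t ∧ μ' t = μ t := by
  have hAs := hA₀ (-s) (left_mem_Icc.2 (by linarith))
  -- The two families of bounds meet at `σ = 0`, with different orders of the coefficients but the
  -- same `K`, so the bootstrap can climb from `-s` to `s - 1`.
  have hA : ∀ σ ∈ Icc (-s) (s - 1), ∃ ρ, CoefBound t₀ T σ ρ K (linCoef H u m ϑ) := by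
    intro σ hσ
    rcases le_total σ 0 with h | h
    · exact ⟨s, hA₀ σ ⟨hσ.1, h⟩⟩
    · exact ⟨s - 1, hA₁ σ ⟨h, hσ.2⟩⟩
  obtain ⟨Z, hZ1, hZ2, hZT, hZ3⟩ := exists_coupled_of_distribution (by linarith) hK hA hT hΘ hκ
    hsmall hμ₀.1 hμ₀.2
  have hmem := hZ1.memLinfSob hZ2
  have hmem2 := hZ1.memL2Sob
  rw [sub_add_cancel] at hmem
  rw [show -s + 1 = 1 - s by ring] at hmem2
  have hY : ∀ {v' μ' : ℝ → Coeffs d}, IsDistSolution H u m dG s ϑ t₀ T μ₀ v' μ' →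
      Adm (-s) t₀ T (fun t => (v' t, μ' t)) ∧ IsMild (linCoef H u m ϑ) t₀ T
        (kernelAction (fun x y => dG x (m T) y) (μ' T)) μ₀ fun t => (v' t, μ' t) := by
    intro v' μ' h
    have hY1 : Adm (-s) t₀ T fun t => (v' t, μ' t) :=
      MemL2Sob.adm (by rw [show -s + 1 = 1 - s by ring]; exact h.1.2) h.2.1.2
    exact ⟨hY1, SolvesLinearized.isMild hAs hK hT.le hL.fin hL.reg hY1 h.2.2⟩
  refine ⟨_, _, ⟨⟨⟨hmem.1, hmem2.1⟩, ⟨hmem.2, hmem2.2⟩,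
    hZ3.solvesLinearized hAs hK hT.le hL.fin hL.reg hZ1 (tame_of_sobSq hμ₀.2)
      (tame_of_sobSq ((hΘ.bound _ hZT).trans_lt (by finiteness)))⟩,
    hZ1.real₂ T (right_mem_Icc.2 hT.le), hZT⟩, fun v' μ' h hT' t ht => ?_,
    fun κ' Λ hΘ' hκ' hΛ hε v' μ' h t ht => ?_⟩
  · obtain ⟨hY1, hY3⟩ := hY h
    have hD : sobSq (s - 1) (((fun t => (v' t, μ' t)) - Z) T).2 < ⊤ :=
      (sobSq_sub_le _ _ _).trans_lt (by have := hT'.2; finiteness)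
    have h0 := (hY3.sub_coupled hAs hK hΘ hY1 hZ1 hT'.2 hZT hZ3).eq_zero_of_distribution
      (by linarith) hK hAs (hA₁ (s - 1) (right_mem_Icc.2 (by linarith))) hT.le hΘ hκ hsmall
      (hY1.sub hZ1) hD t ht
    rw [Pi.sub_apply, sub_eq_zero] at h0
    exact ⟨congrArg Prod.fst h0, congrArg Prod.snd h0⟩
  -- Without regularity of `μ'(T)` the difference is estimated at order `-s` itself, with the
  -- terminal operator split at the frequency `Λ`.
  · obtain ⟨hY1, hY3⟩ := hY h
    have hYT := hAs.sobSq_terminal_lt_top hK hT.le hY1 hY3 (by linarith) hμ₀.2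
    have hD := hY3.sub_coupled hAs hK hΘ' hY1 hZ1 hYT ((sobSq_mono (by linarith) _).trans_lt hZT)
      hZ3
    have h0 := hD.eq_zero hAs hT.le (hY1.sub hZ1) hΘ.map_zero
      (hΘ'.lintegral_heatFlow_le hΘ (by linarith) hΛ
        (hAs.sobSq_terminal_lt_top hK hT.le (hY1.sub hZ1) hD le_rfl (by simp [sobSq_zero])))
      hε t ht
    rw [Pi.sub_apply, sub_eq_zero] at h0
    exact ⟨congrArg Prod.fst h0, congrArg Prod.snd h0⟩

end

/-! ## The choice of the time -/

lemma exists_forall_ofReal_mul_le {X ε : ℝ≥0∞} (hX : X ≠ ⊤) (hε : ε ≠ 0) :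
    ∃ δ > 0, ∀ τ ≤ δ, ENNReal.ofReal τ * X ≤ ε := by
  obtain ⟨n, hn, h⟩ := ENNReal.exists_nnreal_pos_mul_lt hX hε
  refine ⟨n, by exact_mod_cast hn, fun τ hτ => le_trans ?_ h.le⟩
  gcongr
  exact (ENNReal.ofReal_le_ofReal hτ).trans (ENNReal.ofReal_coe_nnreal).le

lemma exists_shortTime {K κ : ℝ≥0∞} (hK : K ≠ ⊤) (hκ : κ ≠ ⊤) :
    ∃ δ > 0, ∀ τ ≤ δ, ShortTime d κ K τ := by
  have := duhamelC_lt_top (d := d) hK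
  exact exists_forall_ofReal_mul_le (by finiteness) (by norm_num)

/-- The order of the choices matters. First `Λ` makes the high frequency term at most `1 / 4` for
all lengths up to `1`; only then is the time chosen, so short that it outweighs the factor `Λ^p` of
the low frequencies and leaves another `1 / 4`. -/
lemma exists_shortTime_split {κ κ' C : ℝ≥0∞} (hκ : κ ≠ ⊤) (hκ' : κ' ≠ ⊤) (hC : C ≠ ⊤) (p : ℝ) :
    ∃ Λ > (0 : ℝ), ∃ δ > (0 : ℝ), ∀ τ ≤ δ,
      (2 * (2 * ((ENNReal.ofReal τ + 1) * (κ' * ENNReal.ofReal (Λ ^ (-1 : ℝ)))) +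
        2 * (ENNReal.ofReal τ * (κ * ENNReal.ofReal (Λ ^ p)))) + 2 * ENNReal.ofReal τ) * C ≤ 2⁻¹ := by
  obtain ⟨n, hn, h⟩ := ENNReal.exists_nnreal_pos_mul_lt (a := 8 * κ' * C) (b := 4⁻¹)
    (by finiteness) (by norm_num)
  have hn' : (0 : ℝ) < n := by exact_mod_cast hn
  obtain ⟨δ, hδ, hδ'⟩ := exists_forall_ofReal_mul_le
    (X := (4 * (κ * ENNReal.ofReal (((n : ℝ)⁻¹) ^ p)) + 2) * C) (ε := 4⁻¹) (by finiteness)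
    (by norm_num)
  refine ⟨(n : ℝ)⁻¹, inv_pos.2 hn', min δ 1, lt_min hδ one_pos, fun τ hτ => ?_⟩
  have h1 : ENNReal.ofReal τ ≤ 1 := ENNReal.ofReal_le_one.2 (hτ.trans (min_le_right _ _))
  have h2 : ENNReal.ofReal (((n : ℝ)⁻¹) ^ (-1 : ℝ)) = n := by
    rw [Real.rpow_neg_one, inv_inv, ENNReal.ofReal_coe_nnreal]
  rw [h2]
  calc _ ≤ (2 * (2 * ((1 + 1) * (κ' * n)) +
        2 * (ENNReal.ofReal τ * (κ * ENNReal.ofReal (((n : ℝ)⁻¹) ^ p)))) +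
          2 * ENNReal.ofReal τ) * C := by gcongr
    _ = n * (8 * κ' * C) +
        ENNReal.ofReal τ * ((4 * (κ * ENNReal.ofReal (((n : ℝ)⁻¹) ^ p)) + 2) * C) := by ring
    _ ≤ 4⁻¹ + 4⁻¹ := add_le_add h.le (hδ' τ (hτ.trans (min_le_left _ _)))
    _ = 2⁻¹ := by
        rw [← two_mul, show (4 : ℝ≥0∞) = 2 * 2 by norm_num,
          ENNReal.mul_inv (by norm_num) (by norm_num), ← mul_assoc,
          ENNReal.mul_inv_cancel (by norm_num) (by norm_num), one_mul]

/-- For `d ≥ 2` the second entry of the maximum is enough, as `2d + 1 ≥ d + 3`. For `d = 1` the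
estimate `⌈d/2⌉ ≥ d/2` is too crude and the first entry is used. -/
lemma admissible_of_lt (hd : 1 ≤ d) {s : ℝ}
    (hs : ((max (⌈((d : ℝ) + 5) / 2⌉ + 1) (4 * ⌈(d : ℝ) / 2⌉ + 1) : ℤ) : ℝ) < s) :
    Admissible d s := by
  have h1 : ((⌈((d : ℝ) + 5) / 2⌉ + 1 : ℤ) : ℝ) < s :=
    lt_of_le_of_lt (by exact_mod_cast le_max_left _ _) hs
  have h2 : ((4 * ⌈(d : ℝ) / 2⌉ + 1 : ℤ) : ℝ) < s :=
    lt_of_le_of_lt (by exact_mod_cast le_max_right _ _) hs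
  push_cast at h1 h2
  have h3 := Int.le_ceil (((d : ℝ) + 5) / 2)
  have h4 := Int.le_ceil ((d : ℝ) / 2)
  rw [Admissible, wienerOrder]
  rcases hd.eq_or_lt with h | h
  · subst h
    norm_num at h1 h3 ⊢
    linarith
  · have h5 : ((d / 2 : ℕ) : ℝ) ≤ (d : ℝ) / 2 := Nat.cast_div_le
    have h6 : (2 : ℝ) ≤ d := by exact_mod_cast h
    push_cast
    linarith

lemma PayoffBound.exists_terminalOp {s σ : ℝ} {G : FinalCost d} {dG : CostKernel d}
    (hG : FinalCostRegular s G dG) (h : PayoffBound s σ dG) {R : ℝ} (hR : 0 < R) :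
    ∃ κ : ℝ≥0∞, κ ≠ ⊤ ∧ ∀ m ∈ densityBall d s R,
      TerminalOp (σ - 1) κ (kernelAction fun x y => dG x m y) := by
  obtain ⟨κ, hκ⟩ := h R hR
  refine ⟨16 * κ, by finiteness, fun m hm => ?_⟩
  exact KernelBound.terminalOp (σ := σ) (κ := κ)
    ⟨fun x => (hG.gateaux m hm.1 x).continuous, hκ m hm⟩ ENNReal.coe_ne_top

end MFG

end

open MFG

theorem mainTheorem4 (d : ℕ) (hd : 1 ≤ d) (s : ℝ)
    (hs : ((max (⌈((d : ℝ) + 5) / 2⌉ + 1) (4 * ⌈(d : ℝ) / 2⌉ + 1) : ℤ) : ℝ) < s)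
    (T₀ : ℝ) (hT₀ : 0 < T₀)
    (H : Hamiltonian d) (hH : HamiltonianRegular T₀ (⌊s⌋₊ + 2) H)
    (G : FinalCost d) (dG : CostKernel d) (hG : FinalCostRegular s G dG)
    (R : ℝ) (hR : 0 < R) (M : ℝ) (hM : 0 < M) :
    ∃ Tstar : ℝ, 0 < Tstar ∧ Tstar ≤ T₀ ∧
      ∀ (t₀ T : ℝ), 0 ≤ t₀ → t₀ < T → T < Tstar →
      ∀ m₀ ∈ densityBall d s R, ∀ u m : ℝ → Pt d → ℝ,
        IsMFGSolution s H G t₀ T m₀ u m → MFGBound s t₀ T M u m →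
      ∀ ϑ : ℝ, ϑ = 1 ∨ ϑ = -1 →
        (∀ μ₀ : Coeffs d, MemSob (s - 1) μ₀ →
          ∃ v μ : ℝ → Coeffs d, IsRegularSolution H u m dG s ϑ t₀ T μ₀ v μ ∧
            ∀ v' μ' : ℝ → Coeffs d, IsRegularSolution H u m dG s ϑ t₀ T μ₀ v' μ' →
              ∀ t ∈ Set.Icc t₀ T, v' t = v t ∧ μ' t = μ t) ∧
        (HamiltonianRegular T₀ (⌈s⌉₊ + 2) H →
          ∀ μ₀ : Coeffs d, MemSob (-s - 1) μ₀ →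
          ∃ v μ : ℝ → Coeffs d,
            (IsDistSolution H u m dG s ϑ t₀ T μ₀ v μ ∧ MemSob (s - 1) (μ T)) ∧
            (∀ v' μ' : ℝ → Coeffs d,
              IsDistSolution H u m dG s ϑ t₀ T μ₀ v' μ' → MemSob (s - 1) (μ' T) →
              ∀ t ∈ Set.Icc t₀ T, v' t = v t ∧ μ' t = μ t) ∧
            (PayoffBound s (-s) dG → ∀ v' μ' : ℝ → Coeffs d,
              IsDistSolution H u m dG s ϑ t₀ T μ₀ v' μ' →
              ∀ t ∈ Set.Icc t₀ T, v' t = v t ∧ μ' t = μ t)) := by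
  have hadm := admissible_of_lt hd hs
  have h3 := hadm.three_lt
  have hfl : 1 ≤ ⌊s⌋₊ := Nat.le_floor (by push_cast; linarith)
  have hce : 1 ≤ ⌈s⌉₊ := hfl.trans (Nat.floor_le_ceil s)
  have hfl' : ((⌊s⌋₊ - 1 : ℕ) : ℝ) + 1 = ⌊s⌋₊ := by exact_mod_cast Nat.sub_add_cancel hfl
  have hce' : ((⌈s⌉₊ - 1 : ℕ) : ℝ) + 1 = ⌈s⌉₊ := by exact_mod_cast Nat.sub_add_cancel hce
  have hlt := Nat.lt_floor_add_one s
  -- The terminal densities of all solutions in question lie in one ball, so the constants `κ` and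
  -- `κ'` of the terminal operator are uniform.
  obtain ⟨R', hR', hball⟩ := exists_terminal_mem_densityBall hadm (n := ⌊s⌋₊) hH hlt.le R M G
  obtain ⟨κ, hκ, hΘ⟩ := hG.payoff.exists_terminalOp hG hR'
  -- The time must be chosen before `(P_{-s})` is assumed, so its validity is decided now; if it
  -- fails, any value of `κ'` will do. The same device is used for `K₂`.
  obtain ⟨κ', hκ', hΘ'⟩ : ∃ κ' : ENNReal, κ' ≠ ⊤ ∧ (PayoffBound s (-s) dG →
      ∀ m ∈ densityBall d s R', TerminalOp (-s - 1) κ' (kernelAction fun x y => dG x m y)) := by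
    by_cases h : PayoffBound s (-s) dG
    · obtain ⟨κ', hκ', hΘ'⟩ := h.exists_terminalOp hG hR'
      exact ⟨κ', hκ', fun _ => hΘ'⟩
    · exact ⟨0, ENNReal.zero_ne_top, fun h' => absurd h' h⟩
  -- With `n + 1 = ⌊s⌋` the composition theorem reaches order `s - 1`; with `n + 1 = ⌈s⌉`, as for
  -- `K₂`, it reaches order `s`.
  obtain ⟨K₁, hK₁⟩ := exists_coefBound_nonneg hadm (n := ⌊s⌋₊ - 1)
    (by rwa [Nat.sub_add_cancel hfl]) (by rw [hfl']; linarith) M G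
  obtain ⟨K₂, hK₂⟩ : ∃ K₂ : NNReal, HamiltonianRegular T₀ (⌈s⌉₊ + 2) H →
      ∀ t₀ T : ℝ, 0 ≤ t₀ → t₀ ≤ T → T ≤ T₀ → ∀ m₀, ∀ u m : ℝ → Pt d → ℝ,
      IsMFGSolution s H G t₀ T m₀ u m → MFGBound s t₀ T M u m → ∀ ϑ : ℝ, ϑ = 1 ∨ ϑ = -1 →
        LinReg H u m ϑ t₀ T s ∧
        ∀ σ ∈ Set.Icc (-s) 0, CoefBound t₀ T σ s K₂ (linCoef H u m ϑ) := by
    by_cases h : HamiltonianRegular T₀ (⌈s⌉₊ + 2) H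
    · obtain ⟨K₂, hK₂⟩ := exists_coefBound_nonpos hadm (n := ⌈s⌉₊ - 1)
        (by rwa [Nat.sub_add_cancel hce]) (by rw [hce']; exact Nat.le_ceil s) M G
      exact ⟨K₂, fun _ => hK₂⟩
    · exact ⟨0, fun h' => absurd h' h⟩
  set K : ENNReal := K₁ + K₂ with hKdef
  have hK : K ≠ ⊤ := by finiteness
  obtain ⟨δ₁, hδ₁, hs₁⟩ := exists_shortTime (d := d) hK hκ
  obtain ⟨Λ, hΛ, δ₂, hδ₂, hs₂⟩ := exists_shortTime_split hκ hκ' (duhamelC_lt_top (d := d) hK).ne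
    (s - 1 - -s)
  refine ⟨min T₀ (min δ₁ δ₂), lt_min hT₀ (lt_min hδ₁ hδ₂), min_le_left _ _,
    fun t₀ T h₀ hT hTs m₀ hm₀ u m hsol hb ϑ hϑ => ?_⟩
  have hTT : T ≤ T₀ := hTs.le.trans (min_le_left _ _)
  have hT₁ : T - t₀ ≤ δ₁ := by linarith [hTs.le.trans ((min_le_right _ _).trans (min_le_left _ _))]
  have hT₂ : T - t₀ ≤ δ₂ := by
    linarith [hTs.le.trans ((min_le_right _ _).trans (min_le_right _ _))]
  have hmT := hball t₀ T h₀ hT.le hTT m₀ hm₀ u m hsol hb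
  obtain ⟨hL₁, hA₁⟩ := hK₁ t₀ T h₀ hT.le hTT m₀ u m hsol hb ϑ hϑ
  replace hA₁ := fun σ hσ => (hA₁ σ hσ).mono (K' := K) le_self_add
  refine ⟨fun μ₀ hμ₀ => exists_unique_regularSolution hT.le hK hκ
    (hA₁ (s - 1) (Set.right_mem_Icc.2 (by linarith))) hL₁ (hΘ _ hmT) (hs₁ _ hT₁) hμ₀,
    fun hH' μ₀ hμ₀ => ?_⟩
  obtain ⟨hL₂, hA₂⟩ := hK₂ hH' t₀ T h₀ hT.le hTT m₀ u m hsol hb ϑ hϑ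
  replace hA₂ := fun σ hσ => (hA₂ σ hσ).mono (K' := K) le_add_self
  obtain ⟨v, μ, h1, h2, h4⟩ := exists_unique_distSolution (by linarith) hT hK hκ hA₂ hA₁ hL₂
    (hΘ _ hmT) (hs₁ _ hT₁) hμ₀
  exact ⟨v, μ, h1, h2, fun hP => h4 κ' Λ (hΘ' hP _ hmT) hκ' hΛ (hs₂ _ hT₂)⟩
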